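/- Weighted Optimal Linear Arrangement: the input is a simple undirected graph $G=(V,E)$ with $n$ vertices and edge weights $w\colon E\to\mathbb N$. For an ordering $\pi$ (a bijection $\pi\colon V\to\{1,\dots,n\}$) and $1\le i\le n-1$, let $\mathrm{cut}^i_\pi$ be the set of edges with one end at a position greater than $i$ and the other end at a position at most $i$. The cost of $\pi$ is $\sum_{i=1}^{n-1}\sum_{e\in \mathrm{cut}^i_\pi} w(e)$, and it is to be minimized. A $\rho$-approximation is an algorithm that outputs an ordering whose cost is at most $\rho$ times the minimum cost. Let $\omega$ be the exponent of matrix multiplication, that is, the infimum of all real $\tau$ such that the product of two $n\times n$ matrices (over $\mathbb Q$) has bilinear complexity (tensor rank) $O(n^{\tau})$. Running times are deterministic worst-case times on a random access machine with bit (logarithmic) cost, and $O^*$ hides factors polynomial in the input size $n+\sum_{e\in E}(1+\mathrm{bits}(w(e)))$, where $\mathrm{bits}(m)$ is the number of binary digits of $m$. **Proposition.** For each constant $0<\alpha<1$ there is a $\left(1+\frac{1}{2(1-\alpha)}\right)$-approximation for weighted (undirected) Optimal Linear Arrangement that runs in $O^*\!\left(2^{\omega n/3}+2^{(1-\alpha/4)n}\right)$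 time. The algorithm and the hidden constants and polynomial may depend on $\alpha$. -/

import Mathlib

namespace OLA

/-! ### The exponent of matrix multiplication -/

/-- `n × n` matrices over `ℚ` can be multiplied by a bilinear algorithm with `r` multiplications,
i.e. the tensor `⟨n, n, n⟩` has rank at most `r`. -/
def HasBilinearAlgorithm (n r : ℕ) : Prop :=
  ∃ a b c : Fin r → Matrix (Fin n) (Fin n) ℚ, ∀ A B : Matrix (Fin n) (Fin n) ℚ,
    A * B = ∑ t, ((∑ i, ∑ j, a t i j * A i j) * (∑ i, ∑ j, b t i j * B i j)) • c t

/-- The exponent `ω` of matrix multiplication: the infimum of all real `τ` such that the rank of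
`n × n` matrix multiplication is `O(n ^ τ)`. -/
noncomputable def matMulExponent : ℝ :=
  sInf {τ : ℝ | ∃ C : ℝ, ∀ n : ℕ, 1 ≤ n →
    ∃ r : ℕ, (r : ℝ) ≤ C * (n : ℝ) ^ τ ∧ HasBilinearAlgorithm n r}

/-! ### Random access machines with logarithmic (bit) cost

A machine has integer variables and integer arrays, both named by natural numbers (a program
mentions only finitely many of them). Programs are structured programs. Every operation is charged
according to the number of bits of the integers, and array indices, that it handles. -/

/-- Number of bits of the absolute value of an integer. -/
def bits (z : ℤ) : ℕ := Nat.size z.natAbs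

/-- A memory configuration: contents of the variables and of the arrays. -/
@[ext] structure State where
  var : ℕ → ℤ
  arr : ℕ → ℤ → ℤ

/-- Arithmetic expressions; `read a e` is the entry of array `a` at index `e`, and `le` is the
comparison `≤` with value `1` or `0`. -/
inductive Expr where
  | const (z : ℤ)
  | var (x : ℕ)
  | read (a : ℕ) (e : Expr)
  | add (e₁ e₂ : Expr)
  | sub (e₁ e₂ : Expr)
  | mul (e₁ e₂ : Expr)
  | div (e₁ e₂ : Expr)
  | mod (e₁ e₂ : Expr)
  | le (e₁ e₂ : Expr)

/-- The value of an expression. -/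
def Expr.eval (s : State) : Expr → ℤ
  | .const z => z
  | .var x => s.var x
  | .read a e => s.arr a (e.eval s)
  | .add e₁ e₂ => e₁.eval s + e₂.eval s
  | .sub e₁ e₂ => e₁.eval s - e₂.eval s
  | .mul e₁ e₂ => e₁.eval s * e₂.eval s
  | .div e₁ e₂ => e₁.eval s / e₂.eval s
  | .mod e₁ e₂ => e₁.eval s % e₂.eval s
  | .le e₁ e₂ => if e₁.eval s ≤ e₂.eval s then 1 else 0

/-- The cost of evaluating an expression: linear in the number of bits for an access, an addition,
a subtraction or a comparison, and the product of the bit lengths for `mul`, `div` and `mod`. -/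
def Expr.cost (s : State) : Expr → ℕ
  | .const z => 1 + bits z
  | .var x => 1 + bits (s.var x)
  | .read a e => e.cost s + 1 + bits (e.eval s) + bits (s.arr a (e.eval s))
  | .add e₁ e₂ => e₁.cost s + e₂.cost s + 1 + bits (e₁.eval s) + bits (e₂.eval s)
  | .sub e₁ e₂ => e₁.cost s + e₂.cost s + 1 + bits (e₁.eval s) + bits (e₂.eval s)
  | .mul e₁ e₂ => e₁.cost s + e₂.cost s + 1 + bits (e₁.eval s) * bits (e₂.eval s)
  | .div e₁ e₂ => e₁.cost s + e₂.cost s + 1 + bits (e₁.eval s) * bits (e₂.eval s)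
  | .mod e₁ e₂ => e₁.cost s + e₂.cost s + 1 + bits (e₁.eval s) * bits (e₂.eval s)
  | .le e₁ e₂ => e₁.cost s + e₂.cost s + 1 + bits (e₁.eval s) + bits (e₂.eval s)

/-- Programs: `write a e₁ e₂` stores the value of `e₂` in array `a` at index `e₁`; a test `e`
succeeds when its value is not `0`. -/
inductive Program where
  | skip
  | assign (x : ℕ) (e : Expr)
  | write (a : ℕ) (e₁ e₂ : Expr)
  | seq (p q : Program)
  | branch (e : Expr) (p q : Program)
  | loop (e : Expr) (p : Program)

/-- The state after setting variable `x` to `z`. -/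
def State.setVar (s : State) (x : ℕ) (z : ℤ) : State :=
  ⟨Function.update s.var x z, s.arr⟩

/-- The state after setting entry `i` of array `a` to `z`. -/
def State.setArr (s : State) (a : ℕ) (i z : ℤ) : State :=
  ⟨s.var, Function.update s.arr a (Function.update (s.arr a) i z)⟩

/-- `Run p s t s'`: started in `s`, the program `p` halts in `s'` after exactly `t` steps
(a step being one unit of bit cost). -/
inductive Run : Program → State → ℕ → State → Prop where
  | skip (s : State) : Run .skip s 1 s
  | assign (x : ℕ) (e : Expr) (s : State) :
      Run (.assign x e) s (e.cost s + 1 + bits (e.eval s)) (s.setVar x (e.eval s))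
  | write (a : ℕ) (e₁ e₂ : Expr) (s : State) :
      Run (.write a e₁ e₂) s
        (e₁.cost s + e₂.cost s + 1 + bits (e₁.eval s) + bits (e₂.eval s))
        (s.setArr a (e₁.eval s) (e₂.eval s))
  | seq {p q : Program} {s s' s'' : State} {t t' : ℕ} :
      Run p s t s' → Run q s' t' s'' → Run (.seq p q) s (t + t') s''
  | branchTrue {e : Expr} {p q : Program} {s s' : State} {t : ℕ} :
      e.eval s ≠ 0 → Run p s t s' → Run (.branch e p q) s (e.cost s + 1 + t) s'
  | branchFalse {e : Expr} {p q : Program} {s s' : State} {t : ℕ} :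
      e.eval s = 0 → Run q s t s' → Run (.branch e p q) s (e.cost s + 1 + t) s'
  | loopTrue {e : Expr} {p : Program} {s s' s'' : State} {t t' : ℕ} :
      e.eval s ≠ 0 → Run p s t s' → Run (.loop e p) s' t' s'' →
        Run (.loop e p) s (e.cost s + 1 + t + t') s''
  | loopFalse {e : Expr} {p : Program} {s : State} :
      e.eval s = 0 → Run (.loop e p) s (e.cost s + 1) s

/-! ### Weighted Optimal Linear Arrangement -/

/-- A simple undirected graph on `n` vertices with natural numbers as edge weights. -/
structure WeightedGraph (n : ℕ) where
  graph : SimpleGraph (Fin n)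
  weight : graph.edgeSet → ℕ

/-- An ordering of the vertices: a bijection onto the `n` positions. -/
abbrev VertexOrdering (n : ℕ) := Fin n ≃ Fin n

/-- The position of a vertex, in `{1, …, n}`. -/
def VertexOrdering.pos {n : ℕ} (π : VertexOrdering n) (v : Fin n) : ℕ := (π v : ℕ) + 1

/-- The edges with one end after position `i` and one end at position at most `i`. -/
def WeightedGraph.cut {n : ℕ} (I : WeightedGraph n) (π : VertexOrdering n) (i : ℕ) :
    Set I.graph.edgeSet :=
  {e | ∃ u v : Fin n, (e : Sym2 (Fin n)) = s(u, v) ∧ i < π.pos u ∧ π.pos v ≤ i}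

open Classical in
/-- The objective value: the sum over the positions `1, …, n - 1` of the weights of the cuts. -/
noncomputable def WeightedGraph.cost {n : ℕ} (I : WeightedGraph n) (π : VertexOrdering n) : ℕ :=
  ∑ i ∈ Finset.Icc 1 (n - 1), ∑ e : I.graph.edgeSet with e ∈ I.cut π i, I.weight e

/-- `π` is within the factor `ρ` of every ordering, that is, of the optimum. -/
def WeightedGraph.IsApproxOptimal {n : ℕ} (I : WeightedGraph n) (ρ : ℝ)
    (π : VertexOrdering n) : Prop :=
  ∀ σ : VertexOrdering n, (I.cost π : ℝ) ≤ ρ * (I.cost σ : ℝ)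

open Classical in
/-- The size of an instance: the vertices, the edges and the bits of the edge weights. -/
noncomputable def WeightedGraph.inputSize {n : ℕ} (I : WeightedGraph n) : ℕ :=
  n + ∑ e : I.graph.edgeSet, (1 + Nat.size (I.weight e))

/-- An `n × n` matrix stored row by row in an array that is `0` elsewhere. -/
def matrixArray {n : ℕ} (M : Fin n → Fin n → ℤ) (z : ℤ) : ℤ :=
  ∑ u : Fin n, ∑ v : Fin n, if z = (n : ℤ) * (u : ℤ) + (v : ℤ) then M u v else 0

open Classical in
/-- The initial memory for an instance: variable `0` holds `n`, array `0` the adjacency matrix,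
array `1` the matrix of edge weights (`0` where there is no edge), and all else is `0`. -/
noncomputable def WeightedGraph.initState {n : ℕ} (I : WeightedGraph n) : State where
  var x := if x = 0 then (n : ℤ) else 0
  arr a :=
    if a = 0 then matrixArray fun u v => if I.graph.Adj u v then 1 else 0
    else if a = 1 then
      matrixArray fun u v =>
        if h : I.graph.Adj u v then
          (I.weight ⟨s(u, v), (SimpleGraph.mem_edgeSet I.graph).mpr h⟩ : ℤ)
        else 0
    else fun _ => 0

/-- The final memory `s` holds the ordering `π`: entry `v` of array `2` is the position of `v`. -/
def State.Outputs {n : ℕ} (s : State) (π : VertexOrdering n) : Prop :=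
  ∀ v : Fin n, s.arr 2 (v : ℤ) = (π.pos v : ℤ)

end OLA

/-! For a vertex set S let cut(S) be the weight of the edges that leave S. The algorithm finds one
set S of moderate size with small cut and then computes the best ordering that begins with S.

Such an ordering is good enough. Take any ordering and bring S to the front, once keeping the
relative orders inside S and inside its complement, and once reversing both. Edges inside either
part do not get longer, and the two lengths of an edge that leaves S add up to at most n. The
cheaper variant therefore costs at most (n/2)·cut(S) more than the given ordering
(`exists_rearrangement`). The best ordering that begins with S is found by dynamic programming over
the subsets of S and the supersets of S, which is a table with about 2^|S| + 2^(n-|S|) entries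
(`PrefixTable`, `arrangeCmd_spec`). If |S| lies between αn/4 and (1-α/4)n, this is within the second
term of the time bound (`Acceptable.rpow_le`).

The cut is small compared with the optimum. The cost of an ordering is the sum of the cuts of its
prefixes. About (1-α/2)n of these prefixes or the complementary suffixes have a size between αn/4
and n/2. If cut(S) is at most 1+1/q times the cut of every set of such a size, then the optimum is
at least (1-α)·n·cut(S). The gap between 1-α/2 and 1-α pays for the factor 1+1/q and for all
rounding (`mul_le_ordCost`, `Fits.window`, `Fits.approx`). The extra cost (n/2)·cut(S) is thus at
most 1/(2(1-α)) times the optimum.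

The set S is found by matrix multiplication. Split the vertices into three blocks. The cut of a set
is a sum of three terms, each depending on the traces of the set on two of the blocks
(`cutVal_mask3`), so sets of small cut are triangles in a tripartite graph on the traces. The edge
weights of that graph may be huge, but up to a factor 1+1/K polynomially many thresholds are enough:
multiples of weights of edges of the instance (`exists_threshold`). For each guess of three
thresholds one 0/1 matrix product detects a triangle (`findCmd_spec`, `bodyCmd_spec`).

The infimum ω need not be attained, and the stated time has no ε in the exponent. The slack comes
from the sizes: only sets with at most (1/2-1/q)n vertices are sought, and one of polynomially many
partitions distributes such a set evenly over the blocks (`exists_balanced`). Each block of m digits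
then has at most 2^(θm) relevant traces for some θ < 1 (`exists_entropy_bound`). A single fixed
bilinear scheme of exponent ω/θ > ω (`exists_scheme`), applied recursively, multiplies matrices of
that size in time about 2^(ωm), where m is about n/3 (`BilinearScheme.pow_le`).

To obtain a machine program with its cost, the algorithm is written in a small language of commands
whose terms include polynomially long sums. One theorem, `Cmd.run_compile`, turns a bound on the
number of commands and on the stored values into a run of the machine with a bound on its bit cost.
-/

namespace OLA

/-! ### A small imperative language with bounded sums -/

/-- Binary operations of the machine. -/
inductive BinOp where
  | add | sub | mul | div | mod | le

/-- The value of a binary operation. -/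
def BinOp.eval : BinOp → ℤ → ℤ → ℤ
  | .add, a, b => a + b
  | .sub, a, b => a - b
  | .mul, a, b => a * b
  | .div, a, b => a / b
  | .mod, a, b => a % b
  | .le, a, b => if a ≤ b then 1 else 0

/-- The machine expression applying a binary operation. -/
def BinOp.toExpr : BinOp → Expr → Expr → Expr
  | .add => .add
  | .sub => .sub
  | .mul => .mul
  | .div => .div
  | .mod => .mod
  | .le => .le

/-- Terms: machine expressions extended by bounded sums. `sum b e` sums `e` over the values of a
bound variable below the contents of variable `b`; `bvar` is a de Bruijn index. -/
inductive Term where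
  | const (z : ℤ)
  | var (x : ℕ)
  | bvar (i : ℕ)
  | read (a : ℕ) (e : Term)
  | bin (o : BinOp) (e₁ e₂ : Term)
  | sum (b : Fin 4) (e : Term)

/-- The value of a term in a memory and an environment for the bound variables. -/
def Term.eval (s : State) : Term → List ℤ → ℤ
  | .const z, _ => z
  | .var x, _ => s.var x
  | .bvar i, ρ => ρ.getD i 0
  | .read a e, ρ => s.arr a (e.eval s ρ)
  | .bin o e₁ e₂, ρ => o.eval (e₁.eval s ρ) (e₂.eval s ρ)
  | .sum b e, ρ => ∑ i ∈ Finset.range (s.var b).toNat, e.eval s ((i : ℤ) :: ρ)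

/-- Commands: programs with `for` loops. -/
inductive Cmd where
  | skip
  | assign (x : ℕ) (e : Term)
  | write (a : ℕ) (e₁ e₂ : Term)
  | seq (c₁ c₂ : Cmd)
  | ite (e : Term) (c₁ c₂ : Cmd)
  | loop (x : ℕ) (e : Term) (c : Cmd)

/-- Iterates a map that depends on the index of the iteration. -/
def iter {α : Type*} (f : ℕ → α → α) : ℕ → α → α
  | 0, s => s
  | n + 1, s => f n (iter f n s)

/-- The memory after a command. -/
def Cmd.exec : Cmd → State → State
  | .skip, s => s
  | .assign x e, s => s.setVar x (e.eval s [])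
  | .write a e₁ e₂, s => s.setArr a (e₁.eval s []) (e₂.eval s [])
  | .seq c₁ c₂, s => c₂.exec (c₁.exec s)
  | .ite e c₁ c₂, s => if e.eval s [] ≠ 0 then c₁.exec s else c₂.exec s
  | .loop x e c, s => iter (fun i s => c.exec (s.setVar x i)) (e.eval s []).toNat s

/-- The number of elementary commands executed. -/
def Cmd.steps : Cmd → State → ℕ
  | .skip, _ => 1
  | .assign _ _, _ => 1
  | .write _ _ _, _ => 1
  | .seq c₁ c₂, s => c₁.steps s + c₂.steps (c₁.exec s)
  | .ite e c₁ c₂, s => 1 + if e.eval s [] ≠ 0 then c₁.steps s else c₂.steps s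
  | .loop x e c, s => 1 + ∑ i ∈ Finset.range (e.eval s []).toNat,
      (1 + c.steps ((iter (fun i s => c.exec (s.setVar x i)) i s).setVar x i))

/-- The bound on a variable: `L` for the ranges of sums and `M` otherwise. -/
def limit (M L x : ℕ) : ℕ := if x < 4 then L else M

/-- All values stored during the execution obey the bounds. -/
def Cmd.ok (M L : ℕ) : Cmd → State → Prop
  | .skip, _ => True
  | .assign x e, s => |e.eval s []| ≤ limit M L x
  | .write _ _ e₂, s => |e₂.eval s []| ≤ M
  | .seq c₁ c₂, s => c₁.ok M L s ∧ c₂.ok M L (c₁.exec s)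
  | .ite e c₁ c₂, s => if e.eval s [] ≠ 0 then c₁.ok M L s else c₂.ok M L s
  | .loop x e c, s => ∀ i < (e.eval s []).toNat, i ≤ limit M L x ∧
      c.ok M L ((iter (fun i s => c.exec (s.setVar x i)) i s).setVar x i)

/-- A memory within the bounds. -/
def State.Bounded (M L : ℕ) (s : State) : Prop :=
  (∀ x, |s.var x| ≤ limit M L x) ∧ ∀ a i, |s.arr a i| ≤ M

/-! ### Compilation -/

/-- The program that leaves the value of a term in variable `d`, using only variables from `d` on;
`lv` lists the variables that hold the bound variables. -/
def Term.compile : Term → List ℕ → ℕ → Program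
  | .const z, _, d => .assign d (.const z)
  | .var x, _, d => .assign d (.var x)
  | .bvar i, lv, d => .assign d (match lv[i]? with | some x => .var x | none => .const 0)
  | .read a e, lv, d => .seq (e.compile lv d) (.assign d (.read a (.var d)))
  | .bin o e₁ e₂, lv, d => .seq (e₁.compile lv d)
      (.seq (e₂.compile lv (d + 1)) (.assign d (o.toExpr (.var d) (.var (d + 1)))))
  | .sum b e, lv, d => .seq (.assign d (.const 0)) (.seq (.assign (d + 1) (.const 0))
      (.loop (.le (.add (.var (d + 1)) (.const 1)) (.var b))
        (.seq (e.compile ((d + 1) :: lv) (d + 2))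
          (.seq (.assign d (.add (.var d) (.var (d + 2))))
            (.assign (d + 1) (.add (.var (d + 1)) (.const 1)))))))

/-- The program of a command, with auxiliary variables from `d` on. -/
def Cmd.compile : Cmd → ℕ → Program
  | .skip, _ => .skip
  | .assign x e, d => .seq (e.compile [] d) (.assign x (.var d))
  | .write a e₁ e₂, d => .seq (e₁.compile [] d)
      (.seq (e₂.compile [] (d + 1)) (.write a (.var d) (.var (d + 1))))
  | .seq c₁ c₂, d => .seq (c₁.compile d) (c₂.compile d)
  | .ite e c₁ c₂, d => .seq (e.compile [] d) (.branch (.var d) (c₁.compile d) (c₂.compile d))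
  | .loop x e c, d => .seq (e.compile [] d) (.seq (.assign (d + 1) (.const 0))
      (.loop (.le (.add (.var (d + 1)) (.const 1)) (.var d))
        (.seq (.assign x (.var (d + 1))) (.seq (c.compile (d + 2))
          (.assign (d + 1) (.add (.var (d + 1)) (.const 1)))))))

/-- A strict bound on the variables in a term. -/
def Term.varBound : Term → ℕ
  | .const _ => 0
  | .var x => x + 1
  | .bvar _ => 0
  | .read _ e => e.varBound
  | .bin _ e₁ e₂ => max e₁.varBound e₂.varBound
  | .sum _ e => max 4 e.varBound

/-- A strict bound on the variables in a command. -/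
def Cmd.varBound : Cmd → ℕ
  | .skip => 0
  | .assign x e => max (x + 1) e.varBound
  | .write _ e₁ e₂ => max e₁.varBound e₂.varBound
  | .seq c₁ c₂ => max c₁.varBound c₂.varBound
  | .ite e c₁ c₂ => max e.varBound (max c₁.varBound c₂.varBound)
  | .loop x e c => max (x + 1) (max e.varBound c.varBound)

/-- The factor by which a term can increase the number of bits. -/
def Term.growth : Term → ℕ
  | .const z => z.natAbs
  | .var _ => 1
  | .bvar _ => 1
  | .read _ e => e.growth + 1
  | .bin _ e₁ e₂ => e₁.growth + e₂.growth + 1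
  | .sum _ e => e.growth + 1

/-- The nesting depth of sums. -/
def Term.depth : Term → ℕ
  | .const _ => 0
  | .var _ => 0
  | .bvar _ => 0
  | .read _ e => e.depth
  | .bin _ e₁ e₂ => max e₁.depth e₂.depth
  | .sum _ e => e.depth + 1

/-- The constant in the cost of a term. -/
def Term.costConst : Term → ℕ
  | .const z => 20 * (z.natAbs + 2) ^ 2
  | .var _ => 20 * (1 + 2) ^ 2
  | .bvar _ => 20 * (1 + 2) ^ 2
  | .read _ e => e.costConst + 20 * (e.growth + 1 + 2) ^ 2
  | .bin _ e₁ e₂ => e₁.costConst + e₂.costConst + 20 * (e₁.growth + e₂.growth + 1 + 2) ^ 2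
  | .sum _ e => e.costConst + 80 * (e.growth + 1 + 2) ^ 2

/-- The nesting depth of sums in a command. -/
def Cmd.depth : Cmd → ℕ
  | .skip => 0
  | .assign _ e => e.depth
  | .write _ e₁ e₂ => max e₁.depth e₂.depth
  | .seq c₁ c₂ => max c₁.depth c₂.depth
  | .ite e c₁ c₂ => max e.depth (max c₁.depth c₂.depth)
  | .loop _ e c => max e.depth c.depth

/-- The constant in the cost of a command. -/
def Cmd.costConst : Cmd → ℕ
  | .skip => 1
  | .assign _ e => e.costConst + 20 * (e.growth + 2) ^ 2
  | .write _ e₁ e₂ => e₁.costConst + e₂.costConst + 20 * (e₁.growth + e₂.growth + 2) ^ 2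
  | .seq c₁ c₂ => c₁.costConst + c₂.costConst
  | .ite e c₁ c₂ => e.costConst + c₁.costConst + c₂.costConst + 20 * (e.growth + 2) ^ 2
  | .loop _ e c => e.costConst + c.costConst + 80 * (e.growth + 2) ^ 2

/-! ### Bit lengths of the values of terms -/

lemma bits_le {z : ℤ} {x : ℕ} (h : |z| ≤ 2 ^ x) : bits z ≤ x + 1 := by
  rw [bits, Nat.size_le]
  have : (z.natAbs : ℤ) ≤ ((2 ^ x : ℕ) : ℤ) := by simpa using h
  have h2 : z.natAbs ≤ 2 ^ x := by exact_mod_cast this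
  exact lt_of_le_of_lt h2 (Nat.pow_lt_pow_right (by norm_num) (Nat.lt_succ_self x))

lemma limit_le {M L : ℕ} (h : L ≤ M) (x : ℕ) : limit M L x ≤ M := by
  unfold limit; split_ifs <;> omega

/-- Exponents add under multiplication. The extra β ≥ 1 pays for the factor 2 in X + Y ≤ 2XY, and
quotients and remainders are no longer than an operand, also for divisor 0, where the remainder is
the dividend. -/
lemma BinOp.abs_eval_le (o : BinOp) {a b : ℤ} {x y β : ℕ} (hβ : 1 ≤ β)
    (ha : |a| ≤ 2 ^ (x * β)) (hb : |b| ≤ 2 ^ (y * β)) :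
    |o.eval a b| ≤ 2 ^ ((x + y + 1) * β) := by
  have hx : (1 : ℤ) ≤ 2 ^ (x * β) := one_le_pow₀ (by norm_num)
  have hy : (1 : ℤ) ≤ 2 ^ (y * β) := one_le_pow₀ (by norm_num)
  have hz : (2 : ℤ) ≤ 2 ^ β := by
    calc (2 : ℤ) = 2 ^ 1 := by norm_num
      _ ≤ 2 ^ β := pow_le_pow_right₀ (by norm_num) hβ
  have key : (2 : ℤ) ^ ((x + y + 1) * β) = 2 ^ (x * β) * 2 ^ (y * β) * 2 ^ β := by
    rw [← pow_add, ← pow_add]; ring_nf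
  rw [key]
  set X : ℤ := 2 ^ (x * β)
  set Y : ℤ := 2 ^ (y * β)
  have hXY : 1 ≤ X * Y := by nlinarith
  have h2 : X * Y * 2 ≤ X * Y * 2 ^ β := by nlinarith
  have h3 : X + Y ≤ X * Y * 2 := by nlinarith
  cases o with
  | add => exact (abs_add_le a b).trans (by linarith)
  | sub => exact (abs_sub a b).trans (by linarith)
  | mul =>
    simp only [BinOp.eval, abs_mul]
    have := mul_le_mul ha hb (abs_nonneg b) (by linarith)
    linarith
  | div =>
    have : |a / b| ≤ |a| := Int.abs_ediv_le_abs a b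
    exact this.trans (by nlinarith)
  | mod =>
    simp only [BinOp.eval]
    by_cases hb0 : b = 0
    · subst hb0; simp only [Int.emod_zero]; linarith
    · have h4 := Int.emod_nonneg a hb0
      have h5 := Int.emod_lt_abs a hb0
      rw [abs_of_nonneg h4]; linarith
  | le =>
    simp only [BinOp.eval]
    split_ifs <;> simp <;> linarith

lemma BinOp.eval_toExpr (o : BinOp) (s : State) (e₁ e₂ : Expr) :
    (o.toExpr e₁ e₂).eval s = o.eval (e₁.eval s) (e₂.eval s) := by
  cases o <;> rfl

lemma BinOp.cost_toExpr_le (o : BinOp) (s : State) (x y X : ℕ)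
    (hx : bits (s.var x) ≤ X) (hy : bits (s.var y) ≤ X) :
    (o.toExpr (.var x) (.var y)).cost s ≤ 3 + 4 * X + X * X := by
  have := Nat.mul_le_mul hx hy
  cases o <;> simp only [BinOp.toExpr, Expr.cost, Expr.eval] <;> nlinarith

/-- Bounds that relate the parameters of the cost estimates. -/
structure Params (M L β : ℕ) : Prop where
  one_le : 1 ≤ β
  L_le : L ≤ M
  M_le : M ≤ 2 ^ β

/-- Everything stored is at most 2^β, so a term built from a fixed number of operations has a number
of bits that is a constant times β. A sum has at most L ≤ 2^β summands and costs one further factor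
2^β. -/
lemma Term.abs_eval_le {M L β : ℕ} (hp : Params M L β) {s : State} (hs : s.Bounded M L) (e : Term) :
    ∀ ρ : List ℤ, (∀ z ∈ ρ, |z| ≤ L) → |e.eval s ρ| ≤ 2 ^ (e.growth * β) := by
  have hM : (M : ℤ) ≤ 2 ^ β := by exact_mod_cast hp.M_le
  have hL : (L : ℤ) ≤ 2 ^ β := by exact_mod_cast hp.L_le.trans hp.M_le
  induction e with
  | const z =>
    intro ρ _
    have h1 : z.natAbs ≤ 2 ^ (z.natAbs * β) :=
      (Nat.lt_two_pow_self).le.trans (Nat.pow_le_pow_right (by norm_num)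
        (Nat.le_mul_of_pos_right _ hp.one_le))
    simp only [Term.eval, Term.growth]
    rw [Int.abs_eq_natAbs]; exact_mod_cast h1
  | var x =>
    intro ρ _
    have := hs.1 x
    have h2 : (limit M L x : ℤ) ≤ M := by exact_mod_cast limit_le hp.L_le x
    simp only [Term.eval, Term.growth, one_mul]; linarith
  | bvar i =>
    intro ρ hρ
    simp only [Term.eval, Term.growth, one_mul]
    by_cases hi : i < ρ.length
    · rw [List.getD_eq_getElem _ _ hi]
      exact (hρ _ (List.getElem_mem hi)).trans hL
    · rw [List.getD_eq_default _ _ (by omega)]; simp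
  | read a e ih =>
    intro ρ hρ
    have h1 := hs.2 a (e.eval s ρ)
    simp only [Term.eval, Term.growth]
    refine (h1.trans hM).trans (pow_le_pow_right₀ (by norm_num) ?_)
    nlinarith
  | bin o e₁ e₂ ih₁ ih₂ =>
    intro ρ hρ
    exact o.abs_eval_le hp.one_le (ih₁ ρ hρ) (ih₂ ρ hρ)
  | sum b e ih =>
    intro ρ hρ
    have hb := hs.1 b
    have hlim : limit M L b = L := by simp [limit, b.2]
    rw [hlim] at hb
    simp only [Term.eval, Term.growth]
    refine (Finset.abs_sum_le_sum_abs _ _).trans ?_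
    have hn : ((s.var b).toNat : ℤ) ≤ L := by
      have := le_abs_self (s.var b); omega
    calc ∑ i ∈ Finset.range (s.var b).toNat, |e.eval s ((i : ℤ) :: ρ)|
        ≤ ∑ i ∈ Finset.range (s.var b).toNat, (2 : ℤ) ^ (e.growth * β) := by
          refine Finset.sum_le_sum fun i hi => ih _ ?_
          intro z hz
          rcases List.mem_cons.1 hz with rfl | hz
          · have := Finset.mem_range.1 hi
            rw [abs_of_nonneg (by positivity)]; omega
          · exact hρ z hz
      _ = (s.var b).toNat * (2 : ℤ) ^ (e.growth * β) := by simp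
      _ ≤ 2 ^ β * 2 ^ (e.growth * β) := by gcongr; exact hn.trans hL
      _ = 2 ^ ((e.growth + 1) * β) := by rw [← pow_add]; ring_nf

/-- Two memories agree on the arrays and on the variables below `d`. -/
def State.Agree (d : ℕ) (s σ : State) : Prop := (∀ x < d, s.var x = σ.var x) ∧ s.arr = σ.arr

lemma State.Agree.trans {d : ℕ} {s σ τ : State} (h : s.Agree d σ) (h' : σ.Agree d τ) :
    s.Agree d τ :=
  ⟨fun x hx => (h.1 x hx).trans (h'.1 x hx), h.2.trans h'.2⟩

lemma State.Agree.mono {d d' : ℕ} {s σ : State} (h : s.Agree d σ) (hd : d' ≤ d) : s.Agree d' σ :=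
  ⟨fun x hx => h.1 x (hx.trans_le hd), h.2⟩

lemma State.agree_setVar {d x : ℕ} (s : State) (z : ℤ) (hx : d ≤ x) : (s.setVar x z).Agree d s :=
  ⟨fun y hy => by simp [State.setVar, Function.update_of_ne (show y ≠ x by omega)], rfl⟩

lemma State.setVar_var_self (s : State) (x : ℕ) (z : ℤ) : (s.setVar x z).var x = z := by
  simp [State.setVar]

lemma State.setVar_var_of_ne (s : State) {x y : ℕ} (z : ℤ) (h : y ≠ x) :
    (s.setVar x z).var y = s.var y := by
  simp [State.setVar, Function.update_of_ne h]

/-- The unit of cost: the square of the number of bits. -/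
lemma atomic_le {g β X c : ℕ} (hX : X ≤ g * β + 1) (hc : c ≤ 8 + 8 * X + X * X) :
    c ≤ 20 * (g + 2) ^ 2 * (β + 1) ^ 2 := by
  have h1 : X + 1 ≤ (g + 2) * (β + 1) := by nlinarith
  have h2 : (X + 1) ^ 2 ≤ ((g + 2) * (β + 1)) ^ 2 := Nat.pow_le_pow_left h1 2
  rw [mul_pow] at h2
  nlinarith

end OLA

/-! ### Correctness and cost of compiled terms -/

namespace OLA

lemma pow_growth_mono {g g' β : ℕ} (h : g ≤ g') : (2 : ℤ) ^ (g * β) ≤ 2 ^ (g' * β) :=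
  pow_le_pow_right₀ (by norm_num) (Nat.mul_le_mul_right _ h)

-- The memory σ is the one in which the term is meant to be evaluated. The machine memory s may
-- differ from it in auxiliary variables, and the code for a term only overwrites variables from d
-- on, so the values of the enclosing bound variables, which lie below d, survive. Each sum repeats
-- its body at most L times, which explains the power of L + 1.
set_option maxHeartbeats 1000000 in
theorem Term.run_compile {M L β d₀ : ℕ} (hp : Params M L β) {σ : State} (hσ : σ.Bounded M L)
    (e : Term) : e.varBound ≤ d₀ → ∀ (lv : List ℕ) (ρ : List ℤ) (d : ℕ) (s : State), d₀ ≤ d →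
      s.Agree d₀ σ → List.Forall₂ (fun x z => x < d ∧ s.var x = z) lv ρ → (∀ z ∈ ρ, |z| ≤ L) →
      ∃ t s', Run (e.compile lv d) s t s' ∧ s'.var d = e.eval σ ρ ∧ s'.Agree d s ∧
        t ≤ e.costConst * (β + 1) ^ 2 * (L + 1) ^ e.depth := by
  induction e with
  | const z =>
    intro _ lv ρ d s hd hs hlv hρ
    refine ⟨_, _, Run.assign _ _ _, s.setVar_var_self _ _, s.agree_setVar _ le_rfl, ?_⟩
    have h1 := Term.abs_eval_le hp hσ (.const z) ρ hρ
    have := bits_le h1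
    simp only [Term.eval, Term.growth] at this
    simp only [Expr.cost, Expr.eval, Term.costConst, Term.depth, pow_zero, mul_one]
    exact atomic_le this (by omega)
  | var x =>
    intro hx lv ρ d s hd hs hlv hρ
    have he : s.var x = σ.var x := hs.1 x hx
    refine ⟨_, _, Run.assign _ _ _, by rw [s.setVar_var_self]; exact he,
      s.agree_setVar _ le_rfl, ?_⟩
    have h1 := Term.abs_eval_le hp hσ (.var x) ρ hρ
    have := bits_le h1
    simp only [Term.eval, Term.growth] at this
    simp only [Expr.cost, Expr.eval, Term.costConst, Term.depth, pow_zero, mul_one, he]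
    exact atomic_le this (by omega)
  | bvar i =>
    intro _ lv ρ d s hd hs hlv hρ
    have hlen := hlv.length_eq
    have h1 := Term.abs_eval_le hp hσ (.bvar i) ρ hρ
    have hb := bits_le h1
    simp only [Term.growth] at hb
    by_cases hi : i < lv.length
    · have hval : s.var lv[i] = (Term.bvar i).eval σ ρ := by
        have := (List.forall₂_iff_get.1 hlv).2 i hi (by omega)
        simp only [Term.eval]
        rw [List.getD_eq_getElem _ _ (by omega)]
        exact this.2
      simp only [Term.compile, List.getElem?_eq_getElem hi]
      refine ⟨_, _, Run.assign _ _ _, by rw [s.setVar_var_self]; exact hval,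
        s.agree_setVar _ le_rfl, ?_⟩
      simp only [Expr.cost, Expr.eval, Term.costConst, Term.depth, pow_zero, mul_one, hval]
      exact atomic_le hb (by omega)
    · have hval : (Term.bvar i).eval σ ρ = 0 := by
        simp only [Term.eval]
        rw [List.getD_eq_default _ _ (by omega)]
      simp only [Term.compile, List.getElem?_eq_none (show lv.length ≤ i by omega)]
      refine ⟨_, _, Run.assign _ _ _, by rw [s.setVar_var_self, hval]; rfl,
        s.agree_setVar _ le_rfl, ?_⟩
      simp only [Expr.cost, Expr.eval, Term.costConst, Term.depth, pow_zero, mul_one]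
      exact atomic_le (X := 1) (g := 1) (by omega) (by simp [bits])
  | read a e ih =>
    intro hv lv ρ d s hd hs hlv hρ
    obtain ⟨t, s', hr, he, ha, ht⟩ := ih hv lv ρ d s hd hs hlv hρ
    have harr : s'.arr = σ.arr := ha.2.trans hs.2
    refine ⟨_, _, Run.seq hr (Run.assign _ _ _), ?_, (s'.agree_setVar _ le_rfl).trans ha, ?_⟩
    · rw [State.setVar_var_self]; simp only [Expr.eval, Term.eval]; rw [he, harr]
    · have h1 := Term.abs_eval_le hp hσ e ρ hρ
      have h2 := Term.abs_eval_le hp hσ (.read a e) ρ hρ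
      have b1 := bits_le (h1.trans (pow_growth_mono (Nat.le_succ _)))
      have b2 := bits_le h2
      simp only [Term.eval, Term.growth] at b2
      simp only [Expr.cost, Expr.eval, Term.costConst, Term.depth, he, harr]
      have h3 := atomic_le (g := e.growth + 1) (β := β) le_rfl
        (c := (1 + bits (e.eval σ ρ) + 1 + bits (e.eval σ ρ) + bits (σ.arr a (e.eval σ ρ)) + 1 +
          bits (σ.arr a (e.eval σ ρ)))) (by nlinarith)
      have h4 : 1 ≤ (L + 1) ^ e.depth := Nat.one_le_pow _ _ (by omega)
      have h5 := Nat.le_mul_of_pos_right (20 * (e.growth + 1 + 2) ^ 2 * (β + 1) ^ 2) h4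
      nlinarith
  | bin o e₁ e₂ ih₁ ih₂ =>
    intro hv lv ρ d s hd hs hlv hρ
    simp only [Term.varBound, max_le_iff] at hv
    obtain ⟨t₁, s₁, hr₁, he₁, ha₁, ht₁⟩ := ih₁ hv.1 lv ρ d s hd hs hlv hρ
    have hlv₁ : List.Forall₂ (fun x z => x < d + 1 ∧ s₁.var x = z) lv ρ :=
      hlv.imp fun x z h => ⟨by omega, (ha₁.1 x h.1).trans h.2⟩
    -- The second operand is computed one variable higher, so that the value of the first one in d
    -- is kept.
    obtain ⟨t₂, s₂, hr₂, he₂, ha₂, ht₂⟩ := ih₂ hv.2 lv ρ (d + 1) s₁ (by omega)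
      ((ha₁.mono hd).trans hs) hlv₁ hρ
    have he₁' : s₂.var d = e₁.eval σ ρ := (ha₂.1 d (by omega)).trans he₁
    refine ⟨_, _, Run.seq hr₁ (Run.seq hr₂ (Run.assign _ _ _)), ?_,
      (s₂.agree_setVar _ le_rfl).trans ((ha₂.mono (by omega)).trans ha₁), ?_⟩
    · rw [State.setVar_var_self, BinOp.eval_toExpr]; simp only [Expr.eval, Term.eval]
      rw [he₂, he₁']
    · have h1 := Term.abs_eval_le hp hσ e₁ ρ hρ
      have h2 := Term.abs_eval_le hp hσ e₂ ρ hρ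
      have h3 := Term.abs_eval_le hp hσ (.bin o e₁ e₂) ρ hρ
      have b1 := bits_le (h1.trans (pow_growth_mono (g' := e₁.growth + e₂.growth + 1) (by omega)))
      have b2 := bits_le (h2.trans (pow_growth_mono (g' := e₁.growth + e₂.growth + 1) (by omega)))
      have b3 := bits_le h3
      simp only [Term.growth, Term.eval] at b3
      rw [← he₁'] at b1
      rw [← he₂] at b2
      have hc := o.cost_toExpr_le s₂ d (d + 1) _ b1 b2
      rw [BinOp.eval_toExpr]
      simp only [Expr.eval, he₁', he₂]
      have h3 := atomic_le (g := e₁.growth + e₂.growth + 1) (β := β) le_rfl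
        (c := (o.toExpr (.var d) (.var (d + 1))).cost s₂ + 1 +
          bits (o.eval (e₁.eval σ ρ) (e₂.eval σ ρ))) (by omega)
      simp only [Term.costConst, Term.depth]
      have h4 : 1 ≤ (L + 1) ^ max e₁.depth e₂.depth := Nat.one_le_pow _ _ (by omega)
      have h5 := Nat.le_mul_of_pos_right
        (20 * (e₁.growth + e₂.growth + 1 + 2) ^ 2 * (β + 1) ^ 2) h4
      have h6 : (L + 1) ^ e₁.depth ≤ (L + 1) ^ max e₁.depth e₂.depth :=
        Nat.pow_le_pow_right (by omega) (le_max_left _ _)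
      have h7 : (L + 1) ^ e₂.depth ≤ (L + 1) ^ max e₁.depth e₂.depth :=
        Nat.pow_le_pow_right (by omega) (le_max_right _ _)
      have h8 := ht₁.trans (Nat.mul_le_mul_left _ h6)
      have h9 := ht₂.trans (Nat.mul_le_mul_left _ h7)
      simp only [add_mul]
      omega
  | sum b e ih =>
    intro hv lv ρ d s hd hs hlv hρ
    simp only [Term.varBound, max_le_iff] at hv
    have hlim : limit M L b = L := by simp [limit, b.2]
    have hb := hσ.1 b
    rw [hlim] at hb
    set m := (σ.var b).toNat with hm
    have hmL : m ≤ L := by have := le_abs_self (σ.var b); omega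
    have hβL : (L : ℤ) ≤ 2 ^ β := by exact_mod_cast hp.L_le.trans hp.M_le
    set G := e.growth + 1 with hG
    have hgrow : (2 : ℤ) ^ β ≤ 2 ^ (G * β) := by
      calc (2 : ℤ) ^ β = 2 ^ (1 * β) := by rw [one_mul]
        _ ≤ _ := pow_growth_mono (by omega)
    set A := 20 * (G + 2) ^ 2 * (β + 1) ^ 2 with hA
    have hat : 8 + 8 * (G * β + 1) + (G * β + 1) * (G * β + 1) ≤ A := atomic_le le_rfl le_rfl
    -- partial sums are bounded
    have hterm : ∀ i < m, |e.eval σ ((i : ℤ) :: ρ)| ≤ 2 ^ (e.growth * β) := by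
      intro i hi
      refine Term.abs_eval_le hp hσ e _ ?_
      intro z hz
      rcases List.mem_cons.1 hz with rfl | hz
      · rw [abs_of_nonneg (by positivity)]; omega
      · exact hρ z hz
    have hpart : ∀ i ≤ m, |∑ j ∈ Finset.range i, e.eval σ ((j : ℤ) :: ρ)| ≤ 2 ^ (G * β) := by
      intro i hi
      refine (Finset.abs_sum_le_sum_abs _ _).trans ?_
      calc ∑ j ∈ Finset.range i, |e.eval σ ((j : ℤ) :: ρ)|
          ≤ ∑ j ∈ Finset.range i, (2 : ℤ) ^ (e.growth * β) :=
            Finset.sum_le_sum fun j hj => hterm j ((Finset.mem_range.1 hj).trans_le hi)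
        _ = i * (2 : ℤ) ^ (e.growth * β) := by simp
        _ ≤ 2 ^ β * 2 ^ (e.growth * β) := by
            gcongr; exact (show (i : ℤ) ≤ L by omega).trans hβL
        _ = 2 ^ (G * β) := by rw [← pow_add, hG]; ring_nf
    have hidx : ∀ i : ℕ, i ≤ m → bits (i : ℤ) ≤ G * β + 1 := by
      intro i hi
      refine bits_le (le_trans ?_ hgrow)
      rw [abs_of_nonneg (by positivity)]; omega
    have hbb : bits (σ.var b) ≤ G * β + 1 := bits_le ((hb.trans hβL).trans hgrow)
    have hone : bits 1 = 1 := by decide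
    have hzero : bits 0 = 0 := by decide
    have hbit1 : ∀ i : ℕ, i ≤ m → bits ((i : ℤ) + 1) ≤ G * β + 2 := by
      intro i hi
      refine bits_le ?_
      rw [abs_of_nonneg (by positivity)]
      have h1 : (i : ℤ) ≤ 2 ^ (G * β) := ((show (i : ℤ) ≤ L by omega).trans hβL).trans hgrow
      have h2 : (1 : ℤ) ≤ 2 ^ (G * β) := one_le_pow₀ (by norm_num)
      rw [pow_succ]; linarith
    -- the loop, by induction on the number of remaining rounds
    have hloop : ∀ k i : ℕ, i + k = m → ∀ s₁ : State, s₁.Agree d s → s₁.var (d + 1) = i →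
        s₁.var d = ∑ j ∈ Finset.range i, e.eval σ ((j : ℤ) :: ρ) →
        ∃ t s', Run (.loop (.le (.add (.var (d + 1)) (.const 1)) (.var b))
          (.seq (e.compile ((d + 1) :: lv) (d + 2))
          (.seq (.assign d (.add (.var d) (.var (d + 2))))
            (.assign (d + 1) (.add (.var (d + 1)) (.const 1)))))) s₁ t s' ∧
          s'.var d = ∑ j ∈ Finset.range m, e.eval σ ((j : ℤ) :: ρ) ∧ s'.Agree d s ∧
          t ≤ k * (e.costConst * (β + 1) ^ 2 * (L + 1) ^ e.depth + 3 * A) + A := by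
      intro k
      induction k with
      | zero =>
        intro i hi s₁ ha h1 h0
        obtain rfl : i = m := by omega
        have hvb : s₁.var b = σ.var b :=
          (ha.1 b (by omega)).trans (hs.1 b (by omega))
        refine ⟨_, _, Run.loopFalse ?_, h0, ha, ?_⟩
        · simp only [Expr.eval, h1, hvb]
          rw [if_neg]; omega
        · simp only [Expr.cost, Expr.eval, h1, hvb, hone]
          have := hidx m le_rfl
          have := hbit1 m le_rfl
          nlinarith
      | succ k ihk =>
        intro i hi s₁ ha h1 h0
        have hvb : s₁.var b = σ.var b :=
          (ha.1 b (by omega)).trans (hs.1 b (by omega))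
        have hlv₁ : List.Forall₂ (fun x z => x < d + 2 ∧ s₁.var x = z) ((d + 1) :: lv)
            ((i : ℤ) :: ρ) := by
          refine List.Forall₂.cons ⟨by omega, h1⟩ ?_
          exact hlv.imp fun x z h => ⟨by omega, (ha.1 x h.1).trans h.2⟩
        obtain ⟨t₂, s₂, hr₂, he₂, ha₂, ht₂⟩ := ih hv.2 ((d + 1) :: lv) ((i : ℤ) :: ρ) (d + 2) s₁
          (by omega) ((ha.mono hd).trans hs) hlv₁ (by
            intro z hz
            rcases List.mem_cons.1 hz with rfl | hz
            · rw [abs_of_nonneg (by positivity)]; omega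
            · exact hρ z hz)
        have hd₂ : s₂.var d = s₁.var d := ha₂.1 d (by omega)
        have hd₂' : s₂.var (d + 1) = i := (ha₂.1 (d + 1) (by omega)).trans h1
        set s₃ := s₂.setVar d (s₂.var d + s₂.var (d + 2)) with hs₃
        have hd₃ : s₃.var (d + 1) = i := by
          rw [hs₃, State.setVar_var_of_ne _ _ (by omega)]; exact hd₂'
        set s₄ := s₃.setVar (d + 1) (s₃.var (d + 1) + 1) with hs₄
        have hsum : s₃.var d = ∑ j ∈ Finset.range (i + 1), e.eval σ ((j : ℤ) :: ρ) := by
          rw [hs₃, State.setVar_var_self, hd₂, h0, he₂, Finset.sum_range_succ]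
        obtain ⟨t₅, s₅, hr₅, he₅, ha₅, ht₅⟩ := ihk (i + 1) (by omega) s₄
          ((s₃.agree_setVar _ (by omega)).trans ((s₂.agree_setVar _ le_rfl).trans
            ((ha₂.mono (by omega)).trans ha)))
          (by rw [hs₄, State.setVar_var_self, hd₃]; push_cast; ring)
          (by rw [hs₄, State.setVar_var_of_ne _ _ (by omega)]; exact hsum)
        refine ⟨_, s₅, Run.loopTrue ?_ (Run.seq hr₂ (Run.seq (Run.assign _ _ _)
          (Run.assign _ _ _))) hr₅, he₅, ha₅, ?_⟩
        · simp only [Expr.eval, h1, hvb]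
          rw [if_pos (by omega)]; norm_num
        · have c1 := hidx i (by omega)
          have c2 := hbit1 i (by omega)
          have c3 := bits_le (hpart i (by omega))
          have c4 := bits_le ((hterm i (by omega)).trans
            (pow_growth_mono (g' := G) (by omega)))
          have c5 := bits_le (hpart (i + 1) (by omega))
          have e1 : (Expr.le (.add (.var (d + 1)) (.const 1)) (.var b)).cost s₁
              = 1 + bits i + (1 + bits 1) + 1 + bits i + bits 1 + (1 + bits (σ.var b)) + 1
                + bits ((i : ℤ) + 1) + bits (σ.var b) := by
            simp only [Expr.cost, Expr.eval, h1, hvb]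
          have e2 : (Expr.add (.var d) (.var (d + 2))).cost s₂ + 1 +
              bits ((Expr.add (.var d) (.var (d + 2))).eval s₂) =
              1 + bits (∑ j ∈ Finset.range i, e.eval σ ((j : ℤ) :: ρ)) +
              (1 + bits (e.eval σ ((i : ℤ) :: ρ))) + 1 +
              bits (∑ j ∈ Finset.range i, e.eval σ ((j : ℤ) :: ρ)) +
              bits (e.eval σ ((i : ℤ) :: ρ)) + 1 +
              bits (∑ j ∈ Finset.range (i + 1), e.eval σ ((j : ℤ) :: ρ)) := by
            rw [Finset.sum_range_succ]
            simp only [Expr.cost, Expr.eval, hd₂, h0, he₂]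
          have e3 : (Expr.add (.var (d + 1)) (.const 1)).cost s₃ + 1 +
              bits ((Expr.add (.var (d + 1)) (.const 1)).eval s₃) =
              1 + bits i + (1 + bits 1) + 1 + bits i + bits 1 + 1 + bits ((i : ℤ) + 1) := by
            simp only [Expr.cost, Expr.eval, hd₃]
          have e4 : s₂.setVar d ((Expr.add (.var d) (.var (d + 2))).eval s₂) = s₃ := rfl
          rw [e1, e2, e4, e3, hone, Nat.add_mul]
          clear_value A G m s₃ s₄
          clear e1 e2 e3 e4 ihk ih hpart hterm hgrow hβL
          have hsq : 0 ≤ (G * β + 1) * (G * β + 1) := Nat.zero_le _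
          generalize (G * β + 1) * (G * β + 1) = Y at *
          generalize k * (e.costConst * (β + 1) ^ 2 * (L + 1) ^ e.depth + 3 * A) = Z at *
          generalize e.costConst * (β + 1) ^ 2 * (L + 1) ^ e.depth = Z' at *
          omega
    set s₁ := (s.setVar d 0).setVar (d + 1) 0 with hs₁
    obtain ⟨t, s', hr, he, ha, ht⟩ := hloop m 0 (by omega) s₁
      ((State.agree_setVar _ _ (by omega)).trans (s.agree_setVar _ le_rfl))
      (by rw [hs₁, State.setVar_var_self]; rfl)
      (by rw [hs₁, State.setVar_var_of_ne _ _ (by omega), State.setVar_var_self]; simp)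
    refine ⟨_, s', Run.seq (Run.assign _ _ _) (Run.seq (Run.assign _ _ _) hr), he, ha, ?_⟩
    simp only [Expr.cost, Expr.eval, Term.costConst, Term.depth, hzero]
    have h1 : 1 ≤ (L + 1) ^ e.depth := Nat.one_le_pow _ _ (by omega)
    set B := e.costConst * (β + 1) ^ 2 * (L + 1) ^ e.depth with hB
    have h2 : m * (B + 3 * A) ≤ L * (B + 3 * A) := Nat.mul_le_mul_right _ hmL
    -- The constant 80 is four times the unit 20: three units per round for the test and the two
    -- assignments, and one more for the failing test at the end and the initialization.
    have h3 : (e.costConst + 80 * (G + 2) ^ 2) * (β + 1) ^ 2 * (L + 1) ^ (e.depth + 1)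
        = (L + 1) * B + 4 * A * (L + 1) ^ e.depth * (L + 1) := by
      rw [hB, hA]; ring
    rw [h3]
    have h4 : 4 * A * (L + 1) ≤ 4 * A * (L + 1) ^ e.depth * (L + 1) := by
      refine Nat.mul_le_mul_right _ (Nat.le_mul_of_pos_right _ h1)
    nlinarith

end OLA

/-! ### Correctness and cost of compiled commands -/

namespace OLA

lemma State.Bounded.setVar {M L : ℕ} {s : State} (h : s.Bounded M L) {x : ℕ} {z : ℤ}
    (hz : |z| ≤ limit M L x) : (s.setVar x z).Bounded M L := by
  refine ⟨fun y => ?_, h.2⟩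
  by_cases hy : y = x
  · subst hy; rw [State.setVar_var_self]; exact hz
  · rw [State.setVar_var_of_ne _ _ hy]; exact h.1 y

lemma State.Bounded.setArr {M L : ℕ} {s : State} (h : s.Bounded M L) {a : ℕ} {i z : ℤ}
    (hz : |z| ≤ M) : (s.setArr a i z).Bounded M L := by
  refine ⟨h.1, fun a' i' => ?_⟩
  change |Function.update s.arr a _ a' i'| ≤ _
  rw [Function.update_apply]
  split_ifs with h1
  · rw [Function.update_apply]
    split_ifs
    · exact hz
    · exact h.2 _ _
  · exact h.2 _ _

lemma State.Agree.setVar {d x : ℕ} {s σ : State} (h : s.Agree d σ) (z : ℤ) :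
    (s.setVar x z).Agree d (σ.setVar x z) := by
  refine ⟨fun y hy => ?_, h.2⟩
  simp only [State.setVar, Function.update_apply]
  rw [h.1 y hy]

lemma State.Agree.setArr {d a : ℕ} {s σ : State} (h : s.Agree d σ) (i z : ℤ) :
    (s.setArr a i z).Agree d (σ.setArr a i z) :=
  ⟨h.1, by simp only [State.setArr, h.2]⟩

lemma cost_mono {K K' D D' β L : ℕ} (hK : K ≤ K') (hD : D ≤ D') :
    K * (β + 1) ^ 2 * (L + 1) ^ D ≤ K' * (β + 1) ^ 2 * (L + 1) ^ D' :=
  Nat.mul_le_mul (Nat.mul_le_mul_right _ hK) (Nat.pow_le_pow_right (by omega) hD)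

-- The cost splits into the number of elementary commands, which may be exponential, and a price per
-- command that is polynomial in β and L. Only the former has to be estimated for the algorithm. The
-- clause on variables between d₀ and d protects the counters of the surrounding loops, which the
-- compiled program keeps there.
set_option maxHeartbeats 1000000 in
theorem Cmd.run_compile {M L β d₀ : ℕ} (hp : Params M L β) (c : Cmd) :
    c.varBound ≤ d₀ → ∀ (d : ℕ) (σ s : State), d₀ ≤ d → σ.Bounded M L → c.ok M L σ →
      s.Agree d₀ σ → ∃ t s', Run (c.compile d) s t s' ∧ s'.Agree d₀ (c.exec σ) ∧
        (∀ x, d₀ ≤ x → x < d → s'.var x = s.var x) ∧ (c.exec σ).Bounded M L ∧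
        t ≤ c.steps σ * (c.costConst * (β + 1) ^ 2 * (L + 1) ^ c.depth) := by
  have hP : ∀ D, 1 ≤ (L + 1) ^ D := fun D => Nat.one_le_pow _ _ (by omega)
  induction c with
  | skip =>
    intro _ d σ s hd hσ _ hs
    refine ⟨1, s, Run.skip s, hs, fun _ _ _ => rfl, hσ, ?_⟩
    simp only [Cmd.steps, Cmd.costConst, Cmd.depth, pow_zero]
    have : 1 ≤ (β + 1) ^ 2 := Nat.one_le_pow _ _ (by omega)
    omega
  | assign x e =>
    intro hv d σ s hd hσ hok hs
    simp only [Cmd.varBound, max_le_iff] at hv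
    obtain ⟨t, s', hr, he, ha, ht⟩ := e.run_compile hp hσ hv.2 [] [] d s hd hs .nil (by simp)
    have h1 := Term.abs_eval_le hp hσ e [] (by simp)
    refine ⟨_, _, Run.seq hr (Run.assign _ _ _), ?_, ?_, hσ.setVar hok, ?_⟩
    · simp only [Expr.eval, he]
      exact ((ha.mono hd).trans hs).setVar _
    · intro y hy hyd
      rw [State.setVar_var_of_ne _ _ (by omega)]; exact ha.1 y hyd
    · simp only [Expr.cost, Expr.eval, he, Cmd.steps, Cmd.costConst, Cmd.depth, one_mul]
      have b1 := bits_le h1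
      have h2 := atomic_le (g := e.growth) (β := β) (X := bits (e.eval σ [])) b1
        (c := 1 + bits (e.eval σ []) + 1 + bits (e.eval σ [])) (by nlinarith)
      have h3 := Nat.le_mul_of_pos_right (20 * (e.growth + 2) ^ 2 * (β + 1) ^ 2) (hP e.depth)
      simp only [add_mul]
      omega
  | write a e₁ e₂ =>
    intro hv d σ s hd hσ hok hs
    simp only [Cmd.varBound, max_le_iff] at hv
    obtain ⟨t₁, s₁, hr₁, he₁, ha₁, ht₁⟩ := e₁.run_compile hp hσ hv.1 [] [] d s hd hs .nil (by simp)
    obtain ⟨t₂, s₂, hr₂, he₂, ha₂, ht₂⟩ := e₂.run_compile hp hσ hv.2 [] [] (d + 1) s₁ (by omega)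
      ((ha₁.mono hd).trans hs) .nil (by simp)
    have he₁' : s₂.var d = e₁.eval σ [] := (ha₂.1 d (by omega)).trans he₁
    have h1 := Term.abs_eval_le hp hσ e₁ [] (by simp)
    have h2 := Term.abs_eval_le hp hσ e₂ [] (by simp)
    refine ⟨_, _, Run.seq hr₁ (Run.seq hr₂ (Run.write _ _ _ _)), ?_, ?_, hσ.setArr hok, ?_⟩
    · simp only [Expr.eval, he₁', he₂]
      exact ((ha₂.mono (by omega)).trans ((ha₁.mono hd).trans hs)).setArr _ _
    · intro y hy hyd
      exact (ha₂.1 y (by omega)).trans (ha₁.1 y hyd)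
    · simp only [Expr.cost, Expr.eval, he₁', he₂, Cmd.steps, Cmd.costConst, Cmd.depth, one_mul]
      have b1 := bits_le (h1.trans (pow_growth_mono (g' := e₁.growth + e₂.growth) (by omega)))
      have b2 := bits_le (h2.trans (pow_growth_mono (g' := e₁.growth + e₂.growth) (by omega)))
      have h3 := atomic_le (g := e₁.growth + e₂.growth) (β := β) le_rfl
        (c := 1 + bits (e₁.eval σ []) + (1 + bits (e₂.eval σ [])) + 1 + bits (e₁.eval σ []) +
          bits (e₂.eval σ [])) (by omega)
      have h4 := Nat.le_mul_of_pos_right (20 * (e₁.growth + e₂.growth + 2) ^ 2 * (β + 1) ^ 2)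
        (hP (max e₁.depth e₂.depth))
      have h5 := ht₁.trans (cost_mono le_rfl (le_max_left e₁.depth e₂.depth))
      have h6 := ht₂.trans (cost_mono le_rfl (le_max_right e₁.depth e₂.depth))
      simp only [add_mul]
      omega
  | seq c₁ c₂ ih₁ ih₂ =>
    intro hv d σ s hd hσ hok hs
    simp only [Cmd.varBound, max_le_iff] at hv
    obtain ⟨t₁, s₁, hr₁, ha₁, hk₁, hb₁, ht₁⟩ := ih₁ hv.1 d σ s hd hσ hok.1 hs
    obtain ⟨t₂, s₂, hr₂, ha₂, hk₂, hb₂, ht₂⟩ := ih₂ hv.2 d _ s₁ hd hb₁ hok.2 ha₁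
    refine ⟨_, s₂, Run.seq hr₁ hr₂, ha₂, fun x h h' => (hk₂ x h h').trans (hk₁ x h h'), hb₂, ?_⟩
    simp only [Cmd.steps, Cmd.costConst, Cmd.depth]
    have h5 := ht₁.trans (Nat.mul_le_mul_left _ (cost_mono (K' := c₁.costConst + c₂.costConst)
      (by omega) (le_max_left c₁.depth c₂.depth)))
    have h6 := ht₂.trans (Nat.mul_le_mul_left _ (cost_mono (K' := c₁.costConst + c₂.costConst)
      (by omega) (le_max_right c₁.depth c₂.depth)))
    rw [add_mul (c₁.steps σ)]
    omega
  | ite e c₁ c₂ ih₁ ih₂ =>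
    intro hv d σ s hd hσ hok hs
    simp only [Cmd.varBound, max_le_iff] at hv
    obtain ⟨t, s', hr, he, ha, ht⟩ := e.run_compile hp hσ hv.1 [] [] d s hd hs .nil (by simp)
    have h1 := Term.abs_eval_le hp hσ e [] (by simp)
    have b1 := bits_le h1
    have h2 := atomic_le (g := e.growth) (β := β) (X := bits (e.eval σ [])) b1
        (c := 1 + bits (e.eval σ []) + 1) (by nlinarith)
    have hcost : (Expr.var d).cost s' + 1 = 1 + bits (e.eval σ []) + 1 := by
      simp only [Expr.cost, he]
    have h3 := ht.trans (cost_mono (K' := e.costConst) le_rfl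
      (le_max_left e.depth (max c₁.depth c₂.depth)))
    have h4 := Nat.le_mul_of_pos_right (20 * (e.growth + 2) ^ 2 * (β + 1) ^ 2)
        (hP (max e.depth (max c₁.depth c₂.depth)))
    simp only [Cmd.ok] at hok
    by_cases hz : e.eval σ [] ≠ 0
    · rw [if_pos hz] at hok
      obtain ⟨t₁, s₁, hr₁, ha₁, hk₁, hb₁, ht₁⟩ := ih₁ hv.2.1 d σ s' hd hσ hok
        ((ha.mono hd).trans hs)
      refine ⟨_, s₁, Run.seq hr (Run.branchTrue (by simpa [Expr.eval, he] using hz) hr₁), ?_,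
        fun x h h' => (hk₁ x h h').trans (ha.1 x h'), ?_, ?_⟩
      · simpa only [Cmd.exec, if_pos hz] using ha₁
      · simpa only [Cmd.exec, if_pos hz] using hb₁
      · simp only [Cmd.steps, Cmd.costConst, Cmd.depth, if_pos hz]
        have h5 := ht₁.trans (Nat.mul_le_mul_left _ (cost_mono
          (K' := e.costConst + c₁.costConst + c₂.costConst + 20 * (e.growth + 2) ^ 2)
          (by omega) ((le_max_left c₁.depth c₂.depth).trans (le_max_right e.depth _))))
        rw [hcost, add_mul 1 (c₁.steps σ), one_mul]
        simp only [add_mul] at h5 ⊢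
        omega
    · rw [if_neg hz] at hok
      obtain ⟨t₁, s₁, hr₁, ha₁, hk₁, hb₁, ht₁⟩ := ih₂ hv.2.2 d σ s' hd hσ hok
        ((ha.mono hd).trans hs)
      refine ⟨_, s₁, Run.seq hr (Run.branchFalse (by simpa [Expr.eval, he] using hz) hr₁), ?_,
        fun x h h' => (hk₁ x h h').trans (ha.1 x h'), ?_, ?_⟩
      · simpa only [Cmd.exec, if_neg hz] using ha₁
      · simpa only [Cmd.exec, if_neg hz] using hb₁
      · simp only [Cmd.steps, Cmd.costConst, Cmd.depth, if_neg hz]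
        have h5 := ht₁.trans (Nat.mul_le_mul_left _ (cost_mono
          (K' := e.costConst + c₁.costConst + c₂.costConst + 20 * (e.growth + 2) ^ 2)
          (by omega) ((le_max_right c₁.depth c₂.depth).trans (le_max_right e.depth _))))
        rw [hcost, add_mul 1 (c₂.steps σ), one_mul]
        simp only [add_mul] at h5 ⊢
        omega
  | loop x e c ih =>
    intro hv d σ s hd hσ hok hs
    simp only [Cmd.varBound, max_le_iff] at hv
    obtain ⟨t, s', hr, he, ha, ht⟩ := e.run_compile hp hσ hv.2.1 [] [] d s hd hs .nil (by simp)
    have h1 := Term.abs_eval_le hp hσ e [] (by simp)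
    have b1 := bits_le h1
    simp only [Cmd.ok] at hok
    set m := (e.eval σ []).toNat with hm
    set f : ℕ → State → State := fun i s => c.exec (s.setVar x i) with hf
    set D := max e.depth c.depth with hD
    set A := 20 * (e.growth + 2) ^ 2 * (β + 1) ^ 2 with hA
    set U := (e.costConst + c.costConst + 80 * (e.growth + 2) ^ 2) * (β + 1) ^ 2 * (L + 1) ^ D
      with hU
    have hat : 8 + 8 * (e.growth * β + 1) + (e.growth * β + 1) * (e.growth * β + 1) ≤ A :=
      atomic_le le_rfl le_rfl
    have hidx : ∀ i : ℕ, i ≤ m → bits (i : ℤ) ≤ e.growth * β + 1 := by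
      intro i hi
      refine bits_le (le_trans ?_ h1)
      rw [abs_of_nonneg (by positivity)]
      have := le_abs_self (e.eval σ [])
      have := abs_nonneg (e.eval σ [])
      omega
    have hidx1 : ∀ i : ℕ, i ≤ m → bits ((i : ℤ) + 1) ≤ e.growth * β + 2 := by
      intro i hi
      refine bits_le ?_
      rw [abs_of_nonneg (by positivity), pow_succ]
      have := le_abs_self (e.eval σ [])
      have := abs_nonneg (e.eval σ [])
      have h2 : (1 : ℤ) ≤ 2 ^ (e.growth * β) := one_le_pow₀ (by norm_num)
      have : (i : ℤ) ≤ |e.eval σ []| := by omega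
      linarith
    have hone : bits 1 = 1 := by decide
    have hzero : bits 0 = 0 := by decide
    -- The overhead of a round is charged to the summand 1 that `Cmd.steps` adds in every round.
    have hUc : ∀ k, k * (c.costConst * (β + 1) ^ 2 * (L + 1) ^ c.depth) + 4 * A ≤ (1 + k) * U := by
      intro k
      have h5 : c.costConst * (β + 1) ^ 2 * (L + 1) ^ c.depth ≤ U :=
        cost_mono (by omega) (le_max_right _ _)
      have h6 : 4 * A ≤ U := by
        have : 4 * A = 80 * (e.growth + 2) ^ 2 * (β + 1) ^ 2 * (L + 1) ^ 0 := by rw [hA]; ring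
        rw [this]; exact cost_mono (by omega) (by omega)
      have := Nat.mul_le_mul_left k h5
      rw [add_mul, one_mul]; omega
    -- Induction on the number k of remaining rounds, for all i, since a run of a loop is built from
    -- its first round.
    have hloop : ∀ k i : ℕ, i + k = m → ∀ s₁ : State, s₁.Agree d₀ (iter f i σ) →
        (iter f i σ).Bounded M L → s₁.var (d + 1) = i → s₁.var d = e.eval σ [] →
        ∃ t s', Run (.loop (.le (.add (.var (d + 1)) (.const 1)) (.var d))
          (.seq (.assign x (.var (d + 1))) (.seq (c.compile (d + 2))
          (.assign (d + 1) (.add (.var (d + 1)) (.const 1)))))) s₁ t s' ∧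
          s'.Agree d₀ (iter f m σ) ∧ (iter f m σ).Bounded M L ∧
          (∀ x, d₀ ≤ x → x < d → s'.var x = s₁.var x) ∧
          t ≤ (∑ j ∈ Finset.range k, (1 + c.steps ((iter f (i + j) σ).setVar x ((i + j : ℕ) : ℤ))))
            * U + A := by
      intro k
      induction k with
      | zero =>
        intro i hi s₁ ha hb h1 h0
        obtain rfl : i = m := by omega
        refine ⟨_, _, Run.loopFalse ?_, ha, hb, fun _ _ _ => rfl, ?_⟩
        · simp only [Expr.eval, h1, h0]
          rw [if_neg]; omega
        · simp only [Expr.cost, Expr.eval, h1, h0, hone]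
          have := hidx m le_rfl
          have := hidx1 m le_rfl
          simp only [Finset.range_zero, Finset.sum_empty, zero_mul]
          nlinarith
      | succ k ihk =>
        intro i hi s₁ ha hb h1 h0
        obtain ⟨hi1, hi2⟩ := hok i (by omega)
        obtain ⟨t₂, s₂, hr₂, ha₂, hk₂, hb₂, ht₂⟩ := ih hv.2.2 (d + 2)
          ((iter f i σ).setVar x i) (s₁.setVar x i) (by omega)
          (hb.setVar (by rw [abs_of_nonneg (by positivity)]; exact_mod_cast hi1)) hi2 (ha.setVar _)
        have hx1 : x ≠ d + 1 := by omega
        have hx0 : x ≠ d := by omega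
        have hv1 : s₂.var (d + 1) = i := by
          rw [hk₂ _ (by omega) (by omega), State.setVar_var_of_ne _ _ hx1.symm, h1]
        have hv0 : s₂.var d = e.eval σ [] := by
          rw [hk₂ _ (by omega) (by omega), State.setVar_var_of_ne _ _ hx0.symm, h0]
        obtain ⟨t₃, s₃, hr₃, ha₃, hb₃, hk₃, ht₃⟩ := ihk (i + 1) (by omega)
          (s₂.setVar (d + 1) (s₂.var (d + 1) + 1))
          (((State.agree_setVar _ _ (by omega))).trans ha₂) hb₂
          (by rw [State.setVar_var_self, hv1]; push_cast; ring)
          (by rw [State.setVar_var_of_ne _ _ (by omega)]; exact hv0)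
        have hass : (Expr.var (d + 1)).eval s₁ = (i : ℤ) := h1
        refine ⟨_, s₃, Run.loopTrue ?_ (Run.seq (Run.assign _ _ _) (Run.seq (by rw [hass]; exact hr₂)
          (Run.assign _ _ _))) hr₃, ha₃, hb₃, ?_, ?_⟩
        · simp only [Expr.eval, h1, h0]
          rw [if_pos (by omega)]; norm_num
        · intro y hy hyd
          rw [hk₃ y hy hyd, State.setVar_var_of_ne _ _ (by omega), hk₂ y hy (by omega),
            State.setVar_var_of_ne _ _ (by omega)]
        · simp only [Expr.cost, Expr.eval, h1, h0, hv1, hone]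
          rw [Finset.sum_range_succ']
          have hre : ∀ j, i + 1 + j = i + (j + 1) := fun j => by omega
          simp only [hre] at ht₃
          rw [add_mul, add_zero]
          have := hUc (c.steps ((iter f i σ).setVar x (i : ℤ)))
          have := hidx i (by omega)
          have := hidx1 i (by omega)
          clear_value A U
          generalize (e.growth * β + 1) * (e.growth * β + 1) = Y at *
          omega
    obtain ⟨t₁, s₁, hr₁, ha₁, hb₁, hk₁, ht₁⟩ := hloop m 0 (by omega) (s'.setVar (d + 1) 0)
      ((s'.agree_setVar _ (by omega)).trans ((ha.mono hd).trans hs)) hσ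
      (by rw [State.setVar_var_self]; rfl)
      (by rw [State.setVar_var_of_ne _ _ (by omega)]; exact he)
    refine ⟨_, s₁, Run.seq hr (Run.seq (Run.assign _ _ _) hr₁), ha₁, ?_, hb₁, ?_⟩
    · intro y hy hyd
      rw [hk₁ y hy hyd, State.setVar_var_of_ne _ _ (by omega), ha.1 y hyd]
    · simp only [Cmd.steps, Cmd.costConst, Cmd.depth, Expr.cost, Expr.eval, hzero]
      simp only [zero_add] at ht₁
      rw [← hD, ← hU, add_mul 1, one_mul]
      have h5 := ht.trans (cost_mono (K' := e.costConst) le_rfl (le_max_left e.depth c.depth))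
      have h6 : 2 * A + e.costConst * (β + 1) ^ 2 * (L + 1) ^ D ≤ U := by
        have h7 := Nat.le_mul_of_pos_right (80 * (e.growth + 2) ^ 2 * (β + 1) ^ 2) (hP D)
        rw [hU, hA]; simp only [add_mul]; nlinarith
      nlinarith

end OLA

namespace OLA

/-! ### Reasoning about commands -/

/-- The command does not assign to variable `y`. -/
def Cmd.KeepsVar (y : ℕ) : Cmd → Prop
  | .skip => True
  | .assign x _ => y ≠ x
  | .write _ _ _ => True
  | .seq c₁ c₂ => c₁.KeepsVar y ∧ c₂.KeepsVar y
  | .ite _ c₁ c₂ => c₁.KeepsVar y ∧ c₂.KeepsVar y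
  | .loop x _ c => y ≠ x ∧ c.KeepsVar y

/-- The command does not write to array `b`. -/
def Cmd.KeepsArr (b : ℕ) : Cmd → Prop
  | .skip => True
  | .assign _ _ => True
  | .write a _ _ => b ≠ a
  | .seq c₁ c₂ => c₁.KeepsArr b ∧ c₂.KeepsArr b
  | .ite _ c₁ c₂ => c₁.KeepsArr b ∧ c₂.KeepsArr b
  | .loop _ _ c => c.KeepsArr b

lemma Cmd.exec_var {y : ℕ} (c : Cmd) : c.KeepsVar y → ∀ s, (c.exec s).var y = s.var y := by
  induction c with
  | skip => intros; rfl
  | assign x e => intro h s; exact State.setVar_var_of_ne _ _ h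
  | write a e₁ e₂ => intros; rfl
  | seq c₁ c₂ ih₁ ih₂ => intro h s; exact (ih₂ h.2 _).trans (ih₁ h.1 s)
  | ite e c₁ c₂ ih₁ ih₂ =>
    intro h s; simp only [Cmd.exec]; split_ifs
    exacts [ih₁ h.1 s, ih₂ h.2 s]
  | loop x e c ih =>
    intro h s; simp only [Cmd.exec]
    generalize (e.eval s []).toNat = m
    induction m with
    | zero => rfl
    | succ m ihm =>
      simp only [iter]; rw [ih h.2, State.setVar_var_of_ne _ _ h.1]; exact ihm

lemma Cmd.exec_arr {b : ℕ} (c : Cmd) : c.KeepsArr b → ∀ s, (c.exec s).arr b = s.arr b := by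
  induction c with
  | skip => intros; rfl
  | assign x e => intros; rfl
  | write a e₁ e₂ => intro h s; exact Function.update_of_ne h _ _
  | seq c₁ c₂ ih₁ ih₂ => intro h s; exact (ih₂ h.2 _).trans (ih₁ h.1 s)
  | ite e c₁ c₂ ih₁ ih₂ =>
    intro h s; simp only [Cmd.exec]; split_ifs
    exacts [ih₁ h.1 s, ih₂ h.2 s]
  | loop x e c ih =>
    intro h s; simp only [Cmd.exec]
    generalize (e.eval s []).toNat = m
    induction m with
    | zero => rfl
    | succ m ihm => simp only [iter]; rw [ih h]; exact ihm

/-- Started in `s`, the command respects the bounds, takes at most `k` steps, and ends in a memory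
with the property `Q`. -/
def Cmd.Spec (M L : ℕ) (c : Cmd) (s : State) (k : ℕ) (Q : State → Prop) : Prop :=
  c.ok M L s ∧ c.steps s ≤ k ∧ Q (c.exec s)

/-- `s'` differs from `s` only in what the command may change. -/
def Cmd.Frame (c : Cmd) (s s' : State) : Prop :=
  (∀ y, c.KeepsVar y → s'.var y = s.var y) ∧ ∀ b, c.KeepsArr b → s'.arr b = s.arr b

lemma Cmd.frame_exec (c : Cmd) (s : State) : c.Frame s (c.exec s) :=
  ⟨fun _ h => c.exec_var h s, fun _ h => c.exec_arr h s⟩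

namespace Cmd.Spec

variable {M L : ℕ} {c c₁ c₂ : Cmd} {s : State} {k k₁ k₂ : ℕ} {Q Q' : State → Prop}

/-- This consequence rule also supplies the frame of the command, so that postconditions need not
list what stays unchanged. -/
lemma mono (h : c.Spec M L s k Q) (hk : k ≤ k₁) (hQ : ∀ s', c.Frame s s' → Q s' → Q' s') :
    c.Spec M L s k₁ Q' :=
  ⟨h.1, h.2.1.trans hk, hQ _ (c.frame_exec s) h.2.2⟩

lemma skip (h : Q s) : Cmd.skip.Spec M L s 1 Q := ⟨trivial, le_rfl, h⟩

lemma assign {x : ℕ} {e : Term} (hb : |e.eval s []| ≤ limit M L x)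
    (h : Q (s.setVar x (e.eval s []))) : (Cmd.assign x e).Spec M L s 1 Q := ⟨hb, le_rfl, h⟩

lemma write {a : ℕ} {e₁ e₂ : Term} (hb : |e₂.eval s []| ≤ M)
    (h : Q (s.setArr a (e₁.eval s []) (e₂.eval s []))) : (Cmd.write a e₁ e₂).Spec M L s 1 Q :=
  ⟨hb, le_rfl, h⟩

lemma seq (h : c₁.Spec M L s k₁ fun s' => c₂.Spec M L s' k₂ Q) :
    (Cmd.seq c₁ c₂).Spec M L s (k₁ + k₂) Q :=
  ⟨⟨h.1, h.2.2.1⟩, Nat.add_le_add h.2.1 h.2.2.2.1, h.2.2.2.2⟩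

lemma seq' (h : c₁.Spec M L s k₁ Q') (h' : ∀ s', c₁.Frame s s' → Q' s' → c₂.Spec M L s' k₂ Q) :
    (Cmd.seq c₁ c₂).Spec M L s (k₁ + k₂) Q :=
  seq (h.mono le_rfl h')

lemma ite {e : Term} (h₁ : e.eval s [] ≠ 0 → c₁.Spec M L s k Q)
    (h₂ : e.eval s [] = 0 → c₂.Spec M L s k Q) : (Cmd.ite e c₁ c₂).Spec M L s (1 + k) Q := by
  by_cases h : e.eval s [] = 0
  · obtain ⟨a, b, c⟩ := h₂ h
    refine ⟨?_, ?_, ?_⟩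
    · simpa [Cmd.ok, h] using a
    · simpa [Cmd.steps, h] using b
    · simpa [Cmd.exec, h] using c
  · obtain ⟨a, b, c⟩ := h₁ h
    refine ⟨?_, ?_, ?_⟩
    · simpa [Cmd.ok, h] using a
    · simpa [Cmd.steps, h] using b
    · simpa [Cmd.exec, h] using c

/-- The counter only takes the values 0, …, m - 1, hence the bound m ≤ limit + 1. The frame of the
whole loop is available in every round, so the invariant has to mention only what the loop changes.
-/
lemma loop {x m : ℕ} {e : Term} (hm : (e.eval s []).toNat = m) (hx : m ≤ limit M L x + 1)
    (I : ℕ → State → Prop) (h0 : I 0 s)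
    (hstep : ∀ i < m, ∀ s', (Cmd.loop x e c).Frame s s' → I i s' →
      c.Spec M L (s'.setVar x i) k (I (i + 1))) :
    (Cmd.loop x e c).Spec M L s (1 + m * (1 + k)) (I m) := by
  set f : ℕ → State → State := fun i s => c.exec (s.setVar x i) with hf
  have hI : ∀ i ≤ m, I i (iter f i s) ∧ (Cmd.loop x e c).Frame s (iter f i s) := by
    intro i
    induction i with
    | zero => intro _; exact ⟨h0, fun _ _ => rfl, fun _ _ => rfl⟩
    | succ i ih =>
      intro hi
      obtain ⟨h1, h2⟩ := ih (by omega)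
      refine ⟨(hstep i (by omega) _ h2 h1).2.2, ?_, ?_⟩
      · intro y hy
        simp only [iter, hf]
        rw [c.exec_var hy.2, State.setVar_var_of_ne _ _ hy.1]; exact h2.1 y hy
      · intro b hb
        simp only [iter, hf]
        rw [c.exec_arr hb]; exact h2.2 b hb
  refine ⟨?_, ?_, ?_⟩
  · simp only [Cmd.ok, hm]
    intro i hi
    obtain ⟨h1, h2⟩ := hI i hi.le
    exact ⟨by omega, (hstep i hi _ h2 h1).1⟩
  · simp only [Cmd.steps, hm]
    refine Nat.add_le_add_left ?_ _
    calc _ ≤ ∑ _i ∈ Finset.range m, (1 + k) := by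
          refine Finset.sum_le_sum fun i hi => ?_
          have hi := Finset.mem_range.1 hi
          obtain ⟨h1, h2⟩ := hI i hi.le
          exact Nat.add_le_add_left (hstep i hi _ h2 h1).2.1 _
      _ = m * (1 + k) := by simp
  · simp only [Cmd.exec, hm]
    exact (hI m le_rfl).1

/-- A loop that fills an array. -/
lemma fill {x a m : ℕ} {e addr val : Term} (hm : (e.eval s []).toNat = m)
    (hx : m ≤ limit M L x + 1) (A V : ℕ → ℤ) (hA : ∀ i < m, ∀ j < m, A i = A j → i = j)
    (hV : ∀ i < m, |V i| ≤ M)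
    (h : ∀ i < m, ∀ s' : State, (∀ y, y ≠ x → s'.var y = s.var y) →
      (∀ b, b ≠ a → s'.arr b = s.arr b) → s'.var x = i → (∀ j < i, s'.arr a (A j) = V j) →
      (∀ z, (∀ j < i, z ≠ A j) → s'.arr a z = s.arr a z) →
      addr.eval s' [] = A i ∧ val.eval s' [] = V i) :
    (Cmd.loop x e (Cmd.write a addr val)).Spec M L s (1 + m * (1 + 1)) fun s' =>
      (∀ i < m, s'.arr a (A i) = V i) ∧ ∀ z, (∀ i < m, z ≠ A i) → s'.arr a z = s.arr a z := by
  refine loop hm hx (fun i s' => (∀ j < i, s'.arr a (A j) = V j) ∧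
    ∀ z, (∀ j < i, z ≠ A j) → s'.arr a z = s.arr a z) ⟨by simp, by simp⟩ ?_
  rintro i hi s' hfr ⟨h1, h2⟩
  obtain ⟨e1, e2⟩ := h i hi (s'.setVar x i)
    (fun y hy => by
      rw [State.setVar_var_of_ne _ _ hy]; exact hfr.1 y ⟨hy, trivial⟩)
    (fun b hb => hfr.2 b hb) (State.setVar_var_self _ _ _) h1 h2
  refine write (by rw [e2]; exact hV i hi) ?_
  rw [e1, e2]
  have hself : ∀ z, ((s'.setVar x i).setArr a (A i) (V i)).arr a z =
      if z = A i then V i else s'.arr a z := by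
    intro z; simp [State.setArr, State.setVar, Function.update_apply]
  refine ⟨fun j hj => ?_, fun z hz => ?_⟩
  · rw [hself]
    split_ifs with h3
    · rw [hA j (by omega) i hi h3]
    · refine h1 j ?_
      rcases Nat.lt_succ_iff_lt_or_eq.1 hj with h | rfl
      · exact h
      · exact absurd rfl h3
  · rw [hself, if_neg (hz i (by omega))]
    exact h2 z fun j hj => hz j (by omega)

/-- A loop that searches for an index with a property. -/
lemma search {x y m : ℕ} {e cond : Term} (hxy : x ≠ y) (hm : (e.eval s []).toNat = m)
    (hx : m ≤ limit M L x + 1) (hy : m ≤ limit M L y + 1) (G : ℕ → Prop) (hs : s.var y = -1)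
    (h : ∀ i < m, ∀ s' : State, (∀ z, z ≠ x → z ≠ y → s'.var z = s.var z) → s'.arr = s.arr →
      s'.var x = i → (cond.eval s' [] ≠ 0 ↔ G i)) :
    (Cmd.loop x e (Cmd.ite cond (Cmd.assign y (Term.var x)) Cmd.skip)).Spec M L s (1 + m * 3)
      fun s' => (s'.var y = -1 ∧ ∀ i < m, ¬ G i) ∨ ∃ i < m, G i ∧ s'.var y = i := by
  -- The loop does not stop at a hit and later hits overwrite earlier ones, so the invariant claims
  -- only some index with the property.
  refine (loop (k := 1 + 1) hm hx (fun i s' => (s'.var y = -1 ∧ ∀ j < i, ¬ G j) ∨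
    ∃ j < i, G j ∧ s'.var y = j) (Or.inl ⟨hs, by simp⟩) ?_).mono (by omega) (fun _ _ h => h)
  intro i hi s' hfr hI
  have hc := h i hi (s'.setVar x i)
    (fun z hz hz' => by
      rw [State.setVar_var_of_ne _ _ hz]; exact hfr.1 z ⟨hz, hz', trivial⟩)
    (by funext b; exact hfr.2 b ⟨trivial, trivial⟩) (State.setVar_var_self _ _ _)
  have hvx : (Term.var x).eval (s'.setVar x i) [] = i := State.setVar_var_self _ _ _
  refine ite (fun hne => assign ?_ ?_) (fun heq => skip ?_)
  · rw [hvx, abs_of_nonneg (by positivity)]; exact_mod_cast (by omega)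
  · right
    exact ⟨i, by omega, hc.1 hne, by rw [hvx, State.setVar_var_self]⟩
  · have hyv : (s'.setVar x i).var y = s'.var y := State.setVar_var_of_ne _ _ hxy.symm
    rw [hyv]
    rcases hI with ⟨h1, h2⟩ | ⟨j, hj, h1, h2⟩
    · left
      refine ⟨h1, fun j hj => ?_⟩
      rcases Nat.lt_succ_iff_lt_or_eq.1 hj with h' | rfl
      · exact h2 j h'
      · exact fun hG => hc.2 hG heq
    · right; exact ⟨j, by omega, h1, h2⟩

end Cmd.Spec

/-! ### Notation for terms -/

instance : Add Term := ⟨.bin .add⟩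
instance : Sub Term := ⟨.bin .sub⟩
instance : Mul Term := ⟨.bin .mul⟩
instance : Div Term := ⟨.bin .div⟩
instance : Mod Term := ⟨.bin .mod⟩
instance (k : ℕ) : OfNat Term k := ⟨.const k⟩

/-- The indicator of `e₁ ≤ e₂`. -/
def Term.leq (e₁ e₂ : Term) : Term := .bin .le e₁ e₂

/-- The indicator of `e₁ < e₂`. -/
def Term.lt (e₁ e₂ : Term) : Term := .bin .le (e₁ + 1) e₂

/-- The indicator of `e₁ = e₂`. -/
def Term.eq (e₁ e₂ : Term) : Term := e₁.leq e₂ * e₂.leq e₁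

/-- The indicator of `a ≤ b`. -/
def ile (a b : ℤ) : ℤ := if a ≤ b then 1 else 0

/-- The indicator of `a < b`. -/
def ilt (a b : ℤ) : ℤ := if a < b then 1 else 0

/-- The indicator of `a = b`. -/
def ieq (a b : ℤ) : ℤ := if a = b then 1 else 0

lemma ile_ne_zero {a b : ℤ} : ile a b ≠ 0 ↔ a ≤ b := by simp [ile]

lemma ilt_ne_zero {a b : ℤ} : ilt a b ≠ 0 ↔ a < b := by simp [ilt]

lemma ieq_ne_zero {a b : ℤ} : ieq a b ≠ 0 ↔ a = b := by simp [ieq]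

section
variable (s : State) (e₁ e₂ : Term) (ρ : List ℤ)

@[simp] lemma Term.eval_const (z : ℤ) : (Term.const z).eval s ρ = z := rfl
@[simp] lemma Term.eval_zero : (0 : Term).eval s ρ = 0 := rfl
@[simp] lemma Term.eval_one : (1 : Term).eval s ρ = 1 := rfl
@[simp] lemma Term.eval_two : (2 : Term).eval s ρ = 2 := rfl
@[simp] lemma Term.eval_var (x : ℕ) : (Term.var x).eval s ρ = s.var x := rfl
@[simp] lemma Term.eval_bvar (i : ℕ) : (Term.bvar i).eval s ρ = ρ.getD i 0 := rfl
@[simp] lemma Term.eval_read (a : ℕ) : (Term.read a e₁).eval s ρ = s.arr a (e₁.eval s ρ) := rfl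
@[simp] lemma Term.eval_add : (e₁ + e₂).eval s ρ = e₁.eval s ρ + e₂.eval s ρ := rfl
@[simp] lemma Term.eval_sub : (e₁ - e₂).eval s ρ = e₁.eval s ρ - e₂.eval s ρ := rfl
@[simp] lemma Term.eval_mul : (e₁ * e₂).eval s ρ = e₁.eval s ρ * e₂.eval s ρ := rfl
@[simp] lemma Term.eval_div : (e₁ / e₂).eval s ρ = e₁.eval s ρ / e₂.eval s ρ := rfl
@[simp] lemma Term.eval_mod : (e₁ % e₂).eval s ρ = e₁.eval s ρ % e₂.eval s ρ := rfl
@[simp] lemma Term.eval_leq : (e₁.leq e₂).eval s ρ = ile (e₁.eval s ρ) (e₂.eval s ρ) := rfl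
@[simp] lemma Term.eval_lt : (e₁.lt e₂).eval s ρ = ilt (e₁.eval s ρ) (e₂.eval s ρ) := rfl
@[simp] lemma Term.eval_eq : (e₁.eq e₂).eval s ρ = ieq (e₁.eval s ρ) (e₂.eval s ρ) := by
  simp only [Term.eq, Term.eval_mul, Term.eval_leq, ile, ieq]
  split_ifs <;> first | rfl | omega
@[simp] lemma Term.eval_sum (b : Fin 4) : (Term.sum b e₁).eval s ρ =
    ∑ i ∈ Finset.range (s.var b).toNat, e₁.eval s ((i : ℤ) :: ρ) := rfl

end

end OLA

namespace OLA

/-! ### Bilinear schemes for matrix multiplication -/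

/-- A bilinear algorithm for `N × N` matrices with integral coefficients that computes a positive
multiple of the product. Matrix entries are numbered row by row. -/
structure BilinearScheme where
  N : ℕ
  R : ℕ
  a : ℕ → ℕ → ℤ
  b : ℕ → ℕ → ℤ
  c : ℕ → ℕ → ℤ
  scale : ℤ
  coefBound : ℕ
  two_le : 2 ≤ N
  sq_le : N * N ≤ R
  scale_pos : 0 < scale
  abs_a_le : ∀ t x, |a t x| ≤ coefBound
  abs_b_le : ∀ t x, |b t x| ≤ coefBound
  abs_c_le : ∀ t x, |c t x| ≤ coefBound
  identity : ∀ (A B : ℕ → ℕ → ℤ) (p q : ℕ), p < N → q < N →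
    ∑ t ∈ Finset.range R, c t (p * N + q) *
        (∑ x ∈ Finset.range (N * N), a t x * A (x / N) (x % N)) *
        (∑ x ∈ Finset.range (N * N), b t x * B (x / N) (x % N)) =
      scale * ∑ j ∈ Finset.range N, A p j * B j q

lemma sum_range_mul {β : Type*} [AddCommMonoid β] (a b : ℕ) (f : ℕ → ℕ → β) :
    ∑ x ∈ Finset.range (a * b), f (x / b) (x % b) =
      ∑ i ∈ Finset.range a, ∑ j ∈ Finset.range b, f i j := by
  induction a with
  | zero => simp
  | succ a ih =>
    rw [Nat.succ_mul, Finset.sum_range_add, ih, Finset.sum_range_succ]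
    congr 1
    refine Finset.sum_congr rfl fun j hj => ?_
    have hj := Finset.mem_range.1 hj
    rw [mul_comm a b, Nat.mul_add_div (by omega), Nat.div_eq_of_lt hj, Nat.mul_add_mod,
      Nat.mod_eq_of_lt hj, add_zero]

/-- The product of all denominators is a common multiple. -/
lemma exists_integer_multiple {ι : Type*} [Fintype ι] (f : ι → ℚ) :
    ∃ (D : ℤ) (g : ι → ℤ), 0 < D ∧ ∀ i, (g i : ℚ) = D * f i := by
  classical
  refine ⟨∏ i, ((f i).den : ℤ), fun i => (f i).num * ∏ j ∈ Finset.univ.erase i, ((f j).den : ℤ),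
    Finset.prod_pos fun i _ => by exact_mod_cast (f i).pos, fun i => ?_⟩
  rw [← Finset.mul_prod_erase Finset.univ _ (Finset.mem_univ i)]
  push_cast
  have h := Rat.num_div_den (f i)
  have h2 : ((f i).den : ℚ) ≠ 0 := by exact_mod_cast (f i).den_nz
  have h3 : ((f i).num : ℚ) = (f i).den * f i := by
    rw [mul_comm]; exact (Rat.mul_den_eq_num (f i)).symm
  rw [h3]; ring

/-- Multiplying by the identity shows that a matrix is determined by the r values of the left linear
forms. These embed a space of dimension n² into one of dimension r. The inequality makes all levels
of the recursion fit into the same amount of memory. -/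
lemma HasBilinearAlgorithm.sq_le {n r : ℕ} (h : HasBilinearAlgorithm n r) : n * n ≤ r := by
  obtain ⟨a, b, c, h⟩ := h
  let φ : Matrix (Fin n) (Fin n) ℚ →ₗ[ℚ] (Fin r → ℚ) :=
    { toFun := fun A t => ∑ i, ∑ j, a t i j * A i j
      map_add' := fun A B => by
        funext t; simp [mul_add, Finset.sum_add_distrib]
      map_smul' := fun x A => by
        funext t; simp only [Matrix.smul_apply, smul_eq_mul, RingHom.id_apply, Pi.smul_apply,
          Finset.mul_sum]
        refine Finset.sum_congr rfl fun i _ => Finset.sum_congr rfl fun j _ => by ring }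
  have hinj : Function.Injective φ := by
    rw [← LinearMap.ker_eq_bot, LinearMap.ker_eq_bot']
    intro A hA
    have h1 := h A 1
    rw [mul_one] at h1
    rw [h1]
    refine Finset.sum_eq_zero fun t _ => ?_
    have h2 : ∑ i, ∑ j, a t i j * A i j = 0 := congrFun hA t
    rw [h2, zero_mul, zero_smul]
  have h2 := LinearMap.finrank_le_finrank_of_injective hinj
  simpa [Module.finrank_matrix] using h2

/-- The school method. It shows that the set of exponents in the definition of ω is not empty. -/
lemma hasBilinearAlgorithm_cube (n : ℕ) : HasBilinearAlgorithm n (n * n * n) := by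
  let e : Fin (n * n * n) ≃ (Fin n × Fin n) × Fin n :=
    (finProdFinEquiv (m := n * n) (n := n)).symm.trans
      (Equiv.prodCongr finProdFinEquiv.symm (Equiv.refl _))
  refine ⟨fun t => Matrix.single (e t).1.1 (e t).1.2 1, fun t => Matrix.single (e t).1.2 (e t).2 1,
    fun t => Matrix.single (e t).1.1 (e t).2 1, fun A B => ?_⟩
  have key : ∀ (i j : Fin n) (A : Matrix (Fin n) (Fin n) ℚ),
      ∑ i', ∑ j', Matrix.single i j (1 : ℚ) i' j' * A i' j' = A i j := by
    intro i j A
    simp only [Matrix.single_apply, ite_mul, one_mul, zero_mul, ite_and]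
    simp
  simp only [key]
  rw [Equiv.sum_comp e (fun x => (A x.1.1 x.1.2 * B x.1.2 x.2) • Matrix.single x.1.1 x.2 (1 : ℚ))]
  ext p q
  rw [Matrix.mul_apply, Matrix.sum_apply, Fintype.sum_prod_type, Fintype.sum_prod_type]
  simp only [Matrix.smul_apply, Matrix.single_apply, smul_eq_mul, mul_ite, mul_one, mul_zero,
    ite_and]
  rw [Finset.sum_comm]
  simp

/-- Denominators are cleared separately in the three families of coefficients. The result is the
product multiplied by the three common denominators, which is harmless because later only the sign
of an entry is used. -/
lemma exists_scheme_of_hasBilinearAlgorithm {n r : ℕ} (hn : 2 ≤ n)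
    (h : HasBilinearAlgorithm n r) : ∃ S : BilinearScheme, S.N = n ∧ S.R = r := by
  have hsq := h.sq_le
  obtain ⟨a, b, c, h⟩ := h
  have int : ∀ f : Fin r → Matrix (Fin n) (Fin n) ℚ, ∃ (D : ℤ) (g : ℕ → ℕ → ℤ) (Z : ℕ), 0 < D ∧
      (∀ t i j, (g (t : Fin r) ((i : Fin n) * n + (j : Fin n)) : ℚ) = D * f t i j) ∧
      ∀ t x, |g t x| ≤ Z := by
    intro f
    obtain ⟨D, g, hD, hg⟩ := exists_integer_multiple
      (fun x : Fin r × Fin n × Fin n => f x.1 x.2.1 x.2.2)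
    -- The value 0 outside of the ranges gives functions on all natural numbers with one bound, the
    -- sum of all absolute values.
    refine ⟨D, fun t x => if h : t < r ∧ x / n < n then
      g (⟨t, h.1⟩, ⟨x / n, h.2⟩, ⟨x % n, Nat.mod_lt _ (by omega)⟩) else 0,
      ∑ x, (g x).natAbs, hD, fun t i j => ?_, fun t x => ?_⟩
    swap
    · dsimp only
      split_ifs
      · rw [Int.abs_eq_natAbs]
        exact_mod_cast Finset.single_le_sum (f := fun x => (g x).natAbs)
          (fun _ _ => Nat.zero_le _) (Finset.mem_univ _)
      · rw [abs_zero]; positivity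
    have h1 : ((i : ℕ) * n + j) / n = i := by
      rw [mul_comm, Nat.mul_add_div (by omega), Nat.div_eq_of_lt j.2, add_zero]
    have h2 : ((i : ℕ) * n + j) % n = j := by
      rw [mul_comm, Nat.mul_add_mod, Nat.mod_eq_of_lt j.2]
    simp only [h1, h2, t.2, i.2, and_self, dite_true, Fin.eta]
    exact hg (t, i, j)
  obtain ⟨Da, a', Za, hDa, ha, hZa⟩ := int a
  obtain ⟨Db, b', Zb, hDb, hb, hZb⟩ := int b
  obtain ⟨Dc, c', Zc, hDc, hc, hZc⟩ := int c
  refine ⟨⟨n, r, a', b', c', Dc * Da * Db, Za + Zb + Zc, hn, hsq, by positivity,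
    fun t x => (hZa t x).trans (by push_cast; linarith),
    fun t x => (hZb t x).trans (by push_cast; linarith),
    fun t x => (hZc t x).trans (by push_cast; linarith), ?_⟩, rfl, rfl⟩
  intro A B p q hp hq
  have hsum : ∀ (g : ℕ → ℕ → ℤ) (D : ℤ) (f : Fin r → Matrix (Fin n) (Fin n) ℚ) (X : ℕ → ℕ → ℤ)
      (t : Fin r), (∀ t i j, (g (t : Fin r) ((i : Fin n) * n + (j : Fin n)) : ℚ) = D * f t i j) →
      ((∑ x ∈ Finset.range (n * n), g t x * X (x / n) (x % n) : ℤ) : ℚ) =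
        D * ∑ i, ∑ j, f t i j * (Matrix.of fun i j : Fin n => (X i j : ℚ)) i j := by
    intro g D f X t hg
    have h1 : ∑ x ∈ Finset.range (n * n), g t x * X (x / n) (x % n) =
        ∑ x ∈ Finset.range (n * n), g t ((x / n) * n + x % n) * X (x / n) (x % n) := by
      refine Finset.sum_congr rfl fun x _ => ?_
      rw [Nat.div_add_mod']
    rw [h1, sum_range_mul n n (fun i j => g t (i * n + j) * X i j)]
    simp only [Finset.sum_range]
    push_cast
    rw [Finset.mul_sum]
    refine Finset.sum_congr rfl fun i _ => ?_
    rw [Finset.mul_sum]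
    refine Finset.sum_congr rfl fun j _ => ?_
    rw [hg, Matrix.of_apply]; ring
  have hmain := congrFun (congrFun (h (Matrix.of fun i j : Fin n => (A i j : ℚ))
    (Matrix.of fun i j : Fin n => (B i j : ℚ))) ⟨p, hp⟩) ⟨q, hq⟩
  rw [Matrix.mul_apply, Matrix.sum_apply] at hmain
  have : ((∑ t ∈ Finset.range r, c' t (p * n + q) *
        (∑ x ∈ Finset.range (n * n), a' t x * A (x / n) (x % n)) *
        (∑ x ∈ Finset.range (n * n), b' t x * B (x / n) (x % n)) : ℤ) : ℚ) =
      ((Dc * Da * Db * ∑ j ∈ Finset.range n, A p j * B j q : ℤ) : ℚ) := by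
    rw [Finset.sum_range, Finset.sum_range, Int.cast_sum]
    rw [Int.cast_mul, Int.cast_sum]
    have e1 : ∀ j : Fin n, ((A p j * B j q : ℤ) : ℚ) =
        (Matrix.of fun i j : Fin n => (A i j : ℚ)) ⟨p, hp⟩ j *
          (Matrix.of fun i j : Fin n => (B i j : ℚ)) j ⟨q, hq⟩ := by
      intro j; simp
    rw [Finset.sum_congr rfl fun j _ => e1 j, hmain, Finset.mul_sum]
    refine Finset.sum_congr rfl fun t _ => ?_
    rw [Int.cast_mul, Int.cast_mul, hsum a' Da a A t ha, hsum b' Db b B t hb,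
      hc t ⟨p, hp⟩ ⟨q, hq⟩, Matrix.smul_apply, smul_eq_mul]
    push_cast; ring
  exact_mod_cast this

/-- The rank is at least n², which exceeds C·n^τ for large n when τ < 2. -/
lemma two_le_of_mem {τ C : ℝ} (h : ∀ n : ℕ, 1 ≤ n →
    ∃ r : ℕ, (r : ℝ) ≤ C * (n : ℝ) ^ τ ∧ HasBilinearAlgorithm n r) : 2 ≤ τ := by
  by_contra hlt
  push Not at hlt
  have ht := (tendsto_rpow_atTop (show 0 < 2 - τ by linarith)).comp tendsto_natCast_atTop_atTop
  obtain ⟨n, hn1, hn2⟩ := ((ht.eventually_gt_atTop C).and (Filter.eventually_ge_atTop 1)).exists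
  obtain ⟨r, hr, hb⟩ := h n hn2
  have h1 : ((n * n : ℕ) : ℝ) ≤ r := by exact_mod_cast hb.sq_le
  have hn0 : (0 : ℝ) < n := by exact_mod_cast hn2
  have h2 : (n : ℝ) ^ (2 - τ) * (n : ℝ) ^ τ = n * n := by
    rw [← Real.rpow_add hn0]; norm_num [sq]
  have h3 : 0 < (n : ℝ) ^ τ := Real.rpow_pos_of_pos hn0 _
  push_cast at h1
  simp only [Function.comp] at hn1
  nlinarith

/-- Used in two ways: positivity of ω makes ω/θ larger than ω for θ < 1, and ω ≥ 1 puts the time 2^m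
for listing masks below 2^(ωm). -/
lemma two_le_matMulExponent : 2 ≤ matMulExponent := by
  refine le_csInf ⟨3, 1, fun n hn => ⟨n * n * n, ?_, hasBilinearAlgorithm_cube n⟩⟩ ?_
  · push_cast
    rw [one_mul, show (3 : ℝ) = ((3 : ℕ) : ℝ) by norm_num, Real.rpow_natCast]
    exact le_of_eq (by ring)
  · rintro τ ⟨C, hC⟩
    exact two_le_of_mem hC

/-- Choose an exponent τ' < τ with its constant C. For n large the factor n^(τ-τ') absorbs C, and
the algorithm for this single n already satisfies the bound without a constant. Recursion then needs
no constant either. -/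
lemma exists_scheme {τ : ℝ} (hτ : matMulExponent < τ) :
    ∃ S : BilinearScheme, (S.R : ℝ) ≤ (S.N : ℝ) ^ τ := by
  obtain ⟨τ', ⟨C, hC⟩, hlt⟩ := exists_lt_of_csInf_lt (s := {τ : ℝ | ∃ C : ℝ, ∀ n : ℕ, 1 ≤ n →
    ∃ r : ℕ, (r : ℝ) ≤ C * (n : ℝ) ^ τ ∧ HasBilinearAlgorithm n r})
    ⟨3, 1, fun n hn => ⟨n * n * n, by
      push_cast
      rw [one_mul, show (3 : ℝ) = ((3 : ℕ) : ℝ) by norm_num, Real.rpow_natCast]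
      exact le_of_eq (by ring), hasBilinearAlgorithm_cube n⟩⟩ hτ
  have ht := (tendsto_rpow_atTop (show 0 < τ - τ' by linarith)).comp tendsto_natCast_atTop_atTop
  obtain ⟨n, hn1, hn2⟩ := ((ht.eventually_gt_atTop C).and (Filter.eventually_ge_atTop 2)).exists
  obtain ⟨r, hr, hb⟩ := hC n (by omega)
  obtain ⟨S, hN, hR⟩ := exists_scheme_of_hasBilinearAlgorithm hn2 hb
  refine ⟨S, ?_⟩
  rw [hN, hR]
  have hn0 : (0 : ℝ) < n := by exact_mod_cast (by omega : 0 < n)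
  refine hr.trans ?_
  have h2 : (n : ℝ) ^ (τ - τ') * (n : ℝ) ^ τ' = (n : ℝ) ^ τ := by
    rw [← Real.rpow_add hn0]; congr 1; ring
  rw [← h2]
  exact mul_le_mul_of_nonneg_right hn1.le (Real.rpow_nonneg hn0.le _)

/-- Recursive use of a scheme, level by level: `MA l t` is the `t`-th of the `R ^ l` matrices of
size `N ^ (κ - l)` formed from the first factor, and similarly for `MB` and for the products. -/
lemma BilinearScheme.levels (S : BilinearScheme) (κ : ℕ) (MA MB MC : ℕ → ℕ → ℕ → ℕ → ℤ)
    (hA : ∀ l < κ, ∀ t < S.R ^ l, ∀ t' < S.R, ∀ i < S.N ^ (κ - l - 1), ∀ j < S.N ^ (κ - l - 1),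
      MA (l + 1) (t * S.R + t') i j = ∑ x ∈ Finset.range (S.N * S.N), S.a t' x *
        MA l t ((x / S.N) * S.N ^ (κ - l - 1) + i) ((x % S.N) * S.N ^ (κ - l - 1) + j))
    (hB : ∀ l < κ, ∀ t < S.R ^ l, ∀ t' < S.R, ∀ i < S.N ^ (κ - l - 1), ∀ j < S.N ^ (κ - l - 1),
      MB (l + 1) (t * S.R + t') i j = ∑ x ∈ Finset.range (S.N * S.N), S.b t' x *
        MB l t ((x / S.N) * S.N ^ (κ - l - 1) + i) ((x % S.N) * S.N ^ (κ - l - 1) + j))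
    (hκ : ∀ t < S.R ^ κ, MC κ t 0 0 = MA κ t 0 0 * MB κ t 0 0)
    (hC : ∀ l < κ, ∀ t < S.R ^ l, ∀ p < S.N, ∀ q < S.N, ∀ i < S.N ^ (κ - l - 1),
      ∀ j < S.N ^ (κ - l - 1),
      MC l t (p * S.N ^ (κ - l - 1) + i) (q * S.N ^ (κ - l - 1) + j) =
        ∑ t' ∈ Finset.range S.R, S.c t' (p * S.N + q) * MC (l + 1) (t * S.R + t') i j) :
    ∀ d l, l + d = κ → ∀ t < S.R ^ l, ∀ i < S.N ^ d, ∀ k < S.N ^ d,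
      MC l t i k = S.scale ^ d * ∑ j ∈ Finset.range (S.N ^ d), MA l t i j * MB l t j k := by
  have hN := S.two_le
  intro d
  induction d with
  | zero =>
    intro l hl t ht i hi k hk
    obtain rfl : l = κ := by omega
    obtain rfl : i = 0 := by simpa using hi
    obtain rfl : k = 0 := by simpa using hk
    simp [hκ t ht]
  | succ d ih =>
    intro l hl t ht i hi k hk
    have hd : κ - l - 1 = d := by omega
    have hpos : 0 < S.N ^ d := Nat.pow_pos (by omega)
    have hp : i / S.N ^ d < S.N := by
      rw [Nat.div_lt_iff_lt_mul hpos]; rwa [pow_succ, mul_comm] at hi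
    have hq : k / S.N ^ d < S.N := by
      rw [Nat.div_lt_iff_lt_mul hpos]; rwa [pow_succ, mul_comm] at hk
    have hi' : i % S.N ^ d < S.N ^ d := Nat.mod_lt _ hpos
    have hk' : k % S.N ^ d < S.N ^ d := Nat.mod_lt _ hpos
    have h1 := hC l (by omega) t ht (i / S.N ^ d) hp (k / S.N ^ d) hq (i % S.N ^ d)
      (by rwa [hd]) (k % S.N ^ d) (by rwa [hd])
    rw [hd, Nat.div_add_mod', Nat.div_add_mod'] at h1
    have ht' : ∀ t' < S.R, t * S.R + t' < S.R ^ (l + 1) := by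
      intro t' ht'
      rw [pow_succ]
      calc t * S.R + t' < t * S.R + S.R := by omega
        _ = (t + 1) * S.R := by ring
        _ ≤ _ := Nat.mul_le_mul_right _ ht
    rw [h1]
    have h2 : ∀ t' ∈ Finset.range S.R, S.c t' (i / S.N ^ d * S.N + k / S.N ^ d) *
        MC (l + 1) (t * S.R + t') (i % S.N ^ d) (k % S.N ^ d) =
        S.scale ^ d * ∑ j ∈ Finset.range (S.N ^ d), S.c t' (i / S.N ^ d * S.N + k / S.N ^ d) *
          (∑ x ∈ Finset.range (S.N * S.N), S.a t' x *
            MA l t ((x / S.N) * S.N ^ d + i % S.N ^ d) ((x % S.N) * S.N ^ d + j)) *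
          (∑ x ∈ Finset.range (S.N * S.N), S.b t' x *
            MB l t ((x / S.N) * S.N ^ d + j) ((x % S.N) * S.N ^ d + k % S.N ^ d)) := by
      intro t' htr
      have htr := Finset.mem_range.1 htr
      rw [ih (l + 1) (by omega) _ (ht' t' htr) _ hi' _ hk', mul_left_comm, Finset.mul_sum]
      congr 1
      refine Finset.sum_congr rfl fun j hj => ?_
      have hj := Finset.mem_range.1 hj
      rw [hA l (by omega) t ht t' htr _ (by rwa [hd]) j (by rwa [hd]),
        hB l (by omega) t ht t' htr j (by rwa [hd]) _ (by rwa [hd]), hd, mul_assoc]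
    -- With the inner index j fixed outside, the sum over the R products is the scheme applied to
    -- two N × N matrices of numbers, the j-th entries of the blocks. Noncommuting blocks are
    -- thereby avoided.
    rw [Finset.sum_congr rfl h2, ← Finset.mul_sum, Finset.sum_comm]
    have h3 : ∀ j ∈ Finset.range (S.N ^ d), ∑ t' ∈ Finset.range S.R,
        S.c t' (i / S.N ^ d * S.N + k / S.N ^ d) *
          (∑ x ∈ Finset.range (S.N * S.N), S.a t' x *
            MA l t ((x / S.N) * S.N ^ d + i % S.N ^ d) ((x % S.N) * S.N ^ d + j)) *
          (∑ x ∈ Finset.range (S.N * S.N), S.b t' x *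
            MB l t ((x / S.N) * S.N ^ d + j) ((x % S.N) * S.N ^ d + k % S.N ^ d)) =
        S.scale * ∑ p ∈ Finset.range S.N, MA l t i (p * S.N ^ d + j) * MB l t (p * S.N ^ d + j) k := by
      intro j _
      have := S.identity (fun p q => MA l t (p * S.N ^ d + i % S.N ^ d) (q * S.N ^ d + j))
        (fun p q => MB l t (p * S.N ^ d + j) (q * S.N ^ d + k % S.N ^ d)) _ _ hp hq
      simp only [Nat.div_add_mod'] at this
      exact this
    rw [Finset.sum_congr rfl h3, ← Finset.mul_sum, Finset.sum_comm, ← mul_assoc, ← pow_succ]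
    congr 1
    -- The block index p and the index j inside of the block combine to the summation index p·N^d +
    -- j of the full product.
    have h4 := sum_range_mul S.N (S.N ^ d)
      (fun p j => MA l t i (p * S.N ^ d + j) * MB l t (p * S.N ^ d + j) k)
    simp only [Nat.div_add_mod'] at h4
    rw [← h4, pow_succ, mul_comm S.N]

end OLA

namespace OLA

/-! ### Masks -/

/-- The binary digit of `x` at position `i`. -/
def digit (x i : ℕ) : ℤ := if x.testBit i then 1 else 0

/-- The number of nonzero digits among the first `m`. -/
def popcount (m x : ℕ) : ℤ := ∑ i ∈ Finset.range m, digit x i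

lemma digit_eq (x i : ℕ) : ((x : ℤ) / 2 ^ i) % 2 = digit x i := by
  rw [digit, Nat.testBit_eq_decide_div_mod_eq]
  have : ((x : ℤ) / 2 ^ i) % 2 = ((x / 2 ^ i % 2 : ℕ) : ℤ) := by push_cast; rfl
  rw [this]
  rcases Nat.mod_two_eq_zero_or_one (x / 2 ^ i) with h | h <;> simp [h]

lemma digit_nonneg (x i : ℕ) : 0 ≤ digit x i := by unfold digit; split_ifs <;> norm_num

lemma digit_le_one (x i : ℕ) : digit x i ≤ 1 := by unfold digit; split_ifs <;> norm_num

lemma popcount_nonneg (m x : ℕ) : 0 ≤ popcount m x :=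
  Finset.sum_nonneg fun _ _ => digit_nonneg _ _

/-- The mask of a finite set. -/
def mask (A : Finset ℕ) : ℕ := ∑ i ∈ A, 2 ^ i

lemma testBit_mask (A : Finset ℕ) (i : ℕ) : (mask A).testBit i = decide (i ∈ A) := by
  have h := Finset.equivBitIndices.apply_symm_apply A
  have h2 : Finset.equivBitIndices.symm A = mask A := rfl
  rw [h2] at h
  have h3 : i ∈ (mask A).bitIndices.toFinset ↔ i ∈ A := by
    rw [show (mask A).bitIndices.toFinset = A from h]
  rw [List.mem_toFinset, Nat.mem_bitIndices] at h3
  rw [Bool.eq_iff_iff, h3]; simp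

lemma digit_mask (A : Finset ℕ) (i : ℕ) : digit (mask A) i = if i ∈ A then 1 else 0 := by
  rw [digit, testBit_mask]; simp

lemma mask_lt {A : Finset ℕ} {m : ℕ} (h : A ⊆ Finset.range m) : mask A < 2 ^ m := by
  refine Nat.lt_pow_two_of_testBit _ fun i hi => ?_
  rw [testBit_mask, decide_eq_false_iff_not]
  intro h'
  have := Finset.mem_range.1 (h h'); omega

lemma mask_erase {A : Finset ℕ} {i : ℕ} (hi : i ∈ A) : mask (A.erase i) + 2 ^ i = mask A :=
  Finset.sum_erase_add _ _ hi

lemma mask_range (m : ℕ) : mask (Finset.range m) = 2 ^ m - 1 := by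
  refine Nat.eq_of_testBit_eq fun i => ?_
  rw [testBit_mask, Nat.testBit_two_pow_sub_one]; simp

lemma exists_mask_eq (x : ℕ) : ∃ A, mask A = x :=
  ⟨Finset.equivBitIndices x, Finset.equivBitIndices.symm_apply_apply x⟩

lemma digit_add_mul {x m : ℕ} (hx : x < 2 ^ m) (y i : ℕ) :
    digit (x + 2 ^ m * y) i = if i < m then digit x i else digit y (i - m) := by
  unfold digit
  rw [add_comm, Nat.testBit_two_pow_mul_add _ hx]
  split_ifs <;> simp_all

/-- Generating function of the number of digits. -/
lemma sum_pow_popcount (z : ℝ) (m : ℕ) :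
    ∑ x ∈ Finset.range (2 ^ m), z ^ (popcount m x).toNat = (1 + z) ^ m := by
  induction m with
  | zero => simp [popcount]
  | succ m ih =>
    have h1 : ∀ x : ℕ, z ^ (popcount (m + 1) x).toNat =
        z ^ (x % 2) * z ^ (popcount m (x / 2)).toNat := by
      intro x
      rw [← pow_add]
      congr 1
      -- The lowest digit is split off, which gives the factor 1 + z.
      have h2 : popcount (m + 1) x = popcount m (x / 2) + (x % 2 : ℕ) := by
        unfold popcount
        rw [Finset.sum_range_succ']
        congr 1
        · refine Finset.sum_congr rfl fun i _ => ?_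
          unfold digit; rw [Nat.testBit_succ]
        · rw [← digit_eq]; simp
      have := popcount_nonneg m (x / 2)
      rw [h2]; omega
    rw [Finset.sum_congr rfl fun x _ => h1 x, pow_succ,
      sum_range_mul (2 ^ m) 2 fun y a => z ^ a * z ^ (popcount m y).toNat, pow_succ, ← ih,
      Finset.sum_mul]
    refine Finset.sum_congr rfl fun y _ => ?_
    simp [Finset.sum_range_succ]; ring

/-- In the generating function every mask counted here contributes z^k, and all other contributions
are nonnegative. This is the exponential Markov inequality. -/
lemma card_popcount_mul_le {z : ℝ} (hz : 0 ≤ z) (m k : ℕ) :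
    (((Finset.range (2 ^ m)).filter fun x => popcount m x = k).card : ℝ) * z ^ k ≤
      (1 + z) ^ m := by
  rw [← sum_pow_popcount]
  calc _ = ∑ x ∈ (Finset.range (2 ^ m)).filter (fun x => popcount m x = k),
        z ^ (popcount m x).toNat := by
        rw [Finset.sum_congr rfl (g := fun _ => z ^ k)]
        · simp
        · intro x hx
          rw [(Finset.mem_filter.1 hx).2]; simp
    _ ≤ _ := Finset.sum_le_sum_of_subset_of_nonneg (Finset.filter_subset _ _)
        fun x _ _ => pow_nonneg hz _

/-- Few masks have less than half of their digits nonzero. -/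
lemma exists_entropy_bound {δ : ℝ} (hδ : δ < 1 / 2) : ∃ θ : ℝ, 0 < θ ∧ θ < 1 ∧ ∀ m k : ℕ,
    (k : ℝ) ≤ δ * m →
      (((Finset.range (2 ^ m)).filter fun x => popcount m x = k).card : ℝ) ≤ 2 ^ (θ * m) := by
  -- The cap 1/4 keeps θ = 1 - 2η²/log 2 positive even if δ is very small.
  obtain ⟨η, hη, hη'⟩ : ∃ η : ℝ, 0 < η ∧ η ≤ 1 / 2 - δ ∧ η < 1 / 2 :=
    ⟨min (1 / 4) (1 / 2 - δ), by rw [lt_min_iff]; constructor <;> linarith, min_le_right _ _,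
      (min_le_left _ _).trans_lt (by norm_num)⟩
  have hlog : 0 < Real.log 2 := Real.log_pos (by norm_num)
  refine ⟨1 - 2 * η ^ 2 / Real.log 2, ?_, ?_, ?_⟩
  · have : Real.log 2 > 0.69 := by linarith [Real.log_two_gt_d9]
    rw [sub_pos, div_lt_one hlog]; nlinarith
  · have : 0 < 2 * η ^ 2 / Real.log 2 := by positivity
    linarith
  · intro m k hk
    -- This z leads to the exponent log 2 - 2η + 2η² per digit, and to log 2 - 2η² once k ≤ (1/2 -
    -- η)m is inserted.
    set z : ℝ := Real.exp (-(4 * η)) with hz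
    have h1 := card_popcount_mul_le (Real.exp_pos (-(4 * η))).le m k
    set X : ℝ := (((Finset.range (2 ^ m)).filter fun x => popcount m x = k).card : ℝ)
    -- Here 1 + e^(-4η) = 2·e^(-2η)·cosh(2η), and cosh x ≤ e^(x²/2).
    have h2 : 1 + Real.exp (-(4 * η)) ≤ Real.exp (Real.log 2 - 2 * η + 2 * η ^ 2) := by
      have h3 := Real.cosh_le_exp_half_sq (2 * η)
      rw [Real.cosh_eq] at h3
      have h4 : 1 + Real.exp (-(4 * η)) =
          2 * Real.exp (-(2 * η)) * ((Real.exp (2 * η) + Real.exp (-(2 * η))) / 2) := by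
        have e1 : Real.exp (-(2 * η)) * Real.exp (2 * η) = 1 := by rw [← Real.exp_add]; simp
        have e2 : Real.exp (-(2 * η)) * Real.exp (-(2 * η)) = Real.exp (-(4 * η)) := by
          rw [← Real.exp_add]; congr 1; ring
        linear_combination -e1 - e2
      have h5 : Real.exp (Real.log 2 - 2 * η + 2 * η ^ 2) =
          2 * Real.exp (-(2 * η)) * Real.exp ((2 * η) ^ 2 / 2) := by
        rw [show Real.log 2 - 2 * η + 2 * η ^ 2 = Real.log 2 + -(2 * η) + (2 * η) ^ 2 / 2 by ring,
          Real.exp_add, Real.exp_add, Real.exp_log (by norm_num)]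
      rw [h4, h5]
      exact mul_le_mul_of_nonneg_left h3 (by positivity)
    have h6 : X * Real.exp (-(4 * η)) ^ k ≤ Real.exp (Real.log 2 - 2 * η + 2 * η ^ 2) ^ m :=
      h1.trans (pow_le_pow_left₀ (by positivity) h2 m)
    rw [← Real.exp_nat_mul, ← Real.exp_nat_mul] at h6
    have h7 : X ≤ Real.exp (m * (Real.log 2 - 2 * η + 2 * η ^ 2) + k * (4 * η)) := by
      have : X = X * Real.exp (k * -(4 * η)) * Real.exp (k * (4 * η)) := by
        rw [mul_assoc, ← Real.exp_add]; simp
      rw [this, Real.exp_add]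
      exact mul_le_mul_of_nonneg_right h6 (Real.exp_pos _).le
    refine h7.trans ?_
    rw [Real.rpow_def_of_pos (by norm_num : (0 : ℝ) < 2)]
    refine Real.exp_le_exp.2 ?_
    have h8 : Real.log 2 * ((1 - 2 * η ^ 2 / Real.log 2) * m) =
        m * (Real.log 2 - 2 * η ^ 2) := by field_simp
    rw [h8]
    have h9 : (k : ℝ) ≤ (1 / 2 - η) * m :=
      hk.trans (mul_le_mul_of_nonneg_right (by linarith) (Nat.cast_nonneg _))
    nlinarith

/-! ### Balanced partitions -/

/-- A discrete intermediate value theorem: a sequence of integers with steps of at most 1 skips no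
value. -/
lemma exists_eq_of_steps (f : ℕ → ℤ) (hf : ∀ r, |f (r + 1) - f r| ≤ 1) {k : ℤ} {a b : ℕ}
    (hab : a ≤ b) (ha : f a ≤ k) (hb : k ≤ f b) : ∃ r, r ≤ b ∧ f r = k := by
  induction b, hab using Nat.le_induction with
  | base => exact ⟨a, le_rfl, by omega⟩
  | succ b hab ih =>
    by_cases h : k ≤ f b
    · obtain ⟨r, hr, hr'⟩ := ih h; exact ⟨r, by omega, hr'⟩
    · have := abs_le.1 (hf b)
      exact ⟨b + 1, le_rfl, by omega⟩

lemma exists_eq_of_steps' (f : ℕ → ℤ) (hf : ∀ r, |f (r + 1) - f r| ≤ 1) {k : ℤ} {a b c : ℕ}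
    (hac : a ≤ c) (hbc : b ≤ c) (ha : f a ≤ k) (hb : k ≤ f b) : ∃ r, r ≤ c ∧ f r = k := by
  rcases le_total a b with h | h
  · obtain ⟨r, hr, hr'⟩ := exists_eq_of_steps f hf h ha hb
    exact ⟨r, by omega, hr'⟩
  · obtain ⟨r, hr, hr'⟩ := exists_eq_of_steps (fun r => - f r)
      (fun r => by rw [← abs_neg]; convert hf r using 2; ring) (k := -k) h (by omega) (by omega)
    exact ⟨r, by omega, by omega⟩

/-- Some window of length `m` contains the average number of elements. -/
lemma exists_window (χ : ℕ → ℤ) (h0 : ∀ i, 0 ≤ χ i) (h1 : ∀ i, χ i ≤ 1) (b m k j : ℕ)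
    (hsum : ∑ i ∈ Finset.range ((j + 1) * m), χ (b + i) = ((j + 1) * k : ℕ)) :
    ∃ r, r ≤ j * m ∧ ∑ i ∈ Finset.range m, χ (b + r + i) = k := by
  set f : ℕ → ℤ := fun r => ∑ i ∈ Finset.range m, χ (b + r + i) with hf
  -- Moving the window by one loses one element and gains one.
  have hsteps : ∀ r, |f (r + 1) - f r| ≤ 1 := by
    intro r
    have e1 : f (r + 1) + χ (b + r) = f r + χ (b + r + m) := by
      simp only [hf]
      rw [← Finset.sum_range_succ (fun i => χ (b + r + i)), Finset.sum_range_succ']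
      rw [add_zero]
      congr 1
      exact Finset.sum_congr rfl fun i _ => by congr 1; ring
    have := h0 (b + r); have := h1 (b + r); have := h0 (b + r + m); have := h1 (b + r + m)
    rw [abs_le]; constructor <;> omega
  -- The j + 1 disjoint windows that start at multiples of m contain k elements on average. So one
  -- of them has at most k and one at least k, and some window in between has exactly k.
  have hblocks : ∑ a ∈ Finset.range (j + 1), f (a * m) = ∑ _a ∈ Finset.range (j + 1), (k : ℤ) := by
    have h2 := sum_range_mul (j + 1) m fun a i => χ (b + (a * m + i))
    simp only [Nat.div_add_mod'] at h2
    rw [hsum] at h2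
    simp only [hf]
    simp only [add_assoc]
    rw [← h2]; simp
  have hne : (Finset.range (j + 1)).Nonempty := ⟨0, by simp⟩
  obtain ⟨a, ha, hak⟩ := Finset.exists_le_of_sum_le hne hblocks.le
  obtain ⟨a', ha', hak'⟩ := Finset.exists_le_of_sum_le hne hblocks.ge
  have ha := Finset.mem_range.1 ha
  have ha' := Finset.mem_range.1 ha'
  exact exists_eq_of_steps' f hsteps (Nat.mul_le_mul_right m (by omega : a ≤ j))
    (Nat.mul_le_mul_right m (by omega : a' ≤ j)) hak hak'

/-- The permutation that moves the window of length `m` at `b + r` to `b`. -/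
def shift (m b r e : ℕ) : ℕ :=
  if b ≤ e ∧ e < b + r then e + m else if b + r ≤ e ∧ e < b + r + m then e - r else e

/-- The inverse of `shift`. -/
def unshift (m b r e : ℕ) : ℕ :=
  if b ≤ e ∧ e < b + m then e + r else if b + m ≤ e ∧ e < b + m + r then e - m else e

lemma unshift_shift (m b r e : ℕ) : unshift m b r (shift m b r e) = e := by
  unfold unshift shift; split_ifs <;> omega

lemma shift_unshift (m b r e : ℕ) : shift m b r (unshift m b r e) = e := by
  unfold unshift shift; split_ifs <;> omega

lemma shift_lt {m b r e t : ℕ} (ht : b + r + m ≤ t) (he : e < t) : shift m b r e < t := by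
  unfold shift; split_ifs <;> omega

lemma unshift_lt {m b r e t : ℕ} (ht : b + r + m ≤ t) (he : e < t) : unshift m b r e < t := by
  unfold unshift; split_ifs <;> omega

lemma sum_unshift (χ : ℕ → ℤ) {m b r t : ℕ} (ht : b + r + m ≤ t) :
    ∑ e ∈ Finset.range t, χ (unshift m b r e) = ∑ e ∈ Finset.range t, χ e :=
  Finset.sum_nbij' (unshift m b r) (shift m b r)
    (fun _ he => Finset.mem_range.2 (unshift_lt ht (Finset.mem_range.1 he)))
    (fun _ he => Finset.mem_range.2 (shift_lt ht (Finset.mem_range.1 he)))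
    (fun _ _ => shift_unshift m b r _) (fun _ _ => unshift_shift m b r _) (fun _ _ => rfl)

/-- Two shifts distribute a set of `3 * k` out of `3 * m` elements evenly over three blocks. -/
lemma exists_balanced (χ : ℕ → ℤ) (h0 : ∀ i, 0 ≤ χ i) (h1 : ∀ i, χ i ≤ 1) (m k : ℕ)
    (hsum : ∑ i ∈ Finset.range (3 * m), χ i = (3 * k : ℕ)) :
    ∃ r r' : ℕ, r ≤ 2 * m ∧ r' ≤ m ∧ ∃ ψ : ℕ → ℤ, (∀ i, 0 ≤ ψ i) ∧ (∀ i, ψ i ≤ 1) ∧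
      (∀ e, ψ (shift m m r' (shift m 0 r e)) = χ e) ∧
      ∀ j < 3, ∑ i ∈ Finset.range m, ψ (j * m + i) = k := by
  -- A window with k elements is moved to the front. The other 2m positions contain 2k elements, and
  -- the same argument applies to them. The last block is correct by counting.
  obtain ⟨r, hr, hrk⟩ := exists_window χ h0 h1 0 m k 2 (by simpa using hsum)
  set χ₁ : ℕ → ℤ := fun e => χ (unshift m 0 r e) with hχ₁
  have s0 : ∑ i ∈ Finset.range m, χ₁ i = k := by
    rw [← hrk]
    refine Finset.sum_congr rfl fun i hi => ?_
    have := Finset.mem_range.1 hi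
    simp only [hχ₁, unshift]
    rw [if_pos (by omega)]; congr 1; omega
  have s1 : ∑ i ∈ Finset.range (2 * m), χ₁ (m + i) = (2 * k : ℕ) := by
    have h2 := sum_unshift χ (m := m) (b := 0) (r := r) (t := 3 * m) (by omega)
    rw [hsum, show 3 * m = m + 2 * m by ring, Finset.sum_range_add] at h2
    simp only [hχ₁] at s0 ⊢
    push_cast at h2 ⊢
    linarith
  obtain ⟨r', hr', hrk'⟩ := exists_window χ₁ (fun _ => h0 _) (fun _ => h1 _) m m k 1
    (by simpa using s1)
  set ψ : ℕ → ℤ := fun e => χ₁ (unshift m m r' e) with hψ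
  have t0 : ∑ i ∈ Finset.range m, ψ i = k := by
    rw [← s0]
    refine Finset.sum_congr rfl fun i hi => ?_
    have := Finset.mem_range.1 hi
    simp only [hψ, unshift]
    rw [if_neg (by omega), if_neg (by omega)]
  have t1 : ∑ i ∈ Finset.range m, ψ (m + i) = k := by
    rw [← hrk']
    refine Finset.sum_congr rfl fun i hi => ?_
    have := Finset.mem_range.1 hi
    simp only [hψ, unshift]
    rw [if_pos (by omega)]; congr 1; omega
  have t2 : ∑ i ∈ Finset.range m, ψ (2 * m + i) = k := by
    have h2 := sum_unshift χ₁ (m := m) (b := m) (r := r') (t := m + m + m) (by omega)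
    rw [Finset.sum_range_add, Finset.sum_range_add] at h2
    have h3 := sum_unshift χ (m := m) (b := 0) (r := r) (t := 3 * m) (by omega)
    rw [hsum, show 3 * m = m + m + m by ring] at h3
    have h4 : ∑ x ∈ Finset.range m, χ₁ (unshift m m r' (m + m + x)) =
        ∑ i ∈ Finset.range m, ψ (2 * m + i) := by
      refine Finset.sum_congr rfl fun i _ => ?_
      simp only [hψ, two_mul]
    rw [h4] at h2
    simp only [hψ] at t0 t1
    simp only [hχ₁] at h2 t0 t1
    push_cast at h3
    linarith
  refine ⟨r, r', by omega, by omega, ψ, fun _ => h0 _, fun _ => h1 _, fun e => ?_, fun j hj => ?_⟩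
  · simp only [hψ, hχ₁, unshift_shift]
  · interval_cases j
    · simpa using t0
    · simpa using t1
    · exact t2

end OLA

namespace OLA

/-! ### Costs of orderings -/

/-- The weight of the cut between `b = 1` and `b = 0`. -/
def cutVal (n : ℕ) (w : ℕ → ℕ → ℤ) (b : ℕ → ℤ) : ℤ :=
  ∑ u ∈ Finset.range n, ∑ v ∈ Finset.range n, w u v * b u * (1 - b v)

/-- The cost of the ordering that puts `u` at position `f u`, counted from `0`. -/
def ordCost (n : ℕ) (w : ℕ → ℕ → ℤ) (f : ℕ → ℕ) : ℤ :=
  ∑ i ∈ Finset.range n, cutVal n w fun u => if f u ≤ i then 1 else 0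

lemma cutVal_congr {n : ℕ} {w : ℕ → ℕ → ℤ} {b b' : ℕ → ℤ} (h : ∀ u < n, b u = b' u) :
    cutVal n w b = cutVal n w b' :=
  Finset.sum_congr rfl fun u hu => Finset.sum_congr rfl fun v hv => by
    rw [h u (Finset.mem_range.1 hu), h v (Finset.mem_range.1 hv)]

lemma cutVal_nonneg {n : ℕ} {w : ℕ → ℕ → ℤ} (hw : ∀ u v, 0 ≤ w u v) {b : ℕ → ℤ}
    (h0 : ∀ u, 0 ≤ b u) (h1 : ∀ u, b u ≤ 1) : 0 ≤ cutVal n w b :=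
  Finset.sum_nonneg fun u _ => Finset.sum_nonneg fun v _ =>
    mul_nonneg (mul_nonneg (hw u v) (h0 u)) (by linarith [h1 v])

lemma cutVal_le_sum {n : ℕ} {w : ℕ → ℕ → ℤ} (hw : ∀ u v, 0 ≤ w u v) {b : ℕ → ℤ}
    (h0 : ∀ u, 0 ≤ b u) (h1 : ∀ u, b u ≤ 1) :
    cutVal n w b ≤ ∑ u ∈ Finset.range n, ∑ v ∈ Finset.range n, w u v :=
  Finset.sum_le_sum fun u _ => Finset.sum_le_sum fun v _ => by
    have h2 : w u v * b u ≤ w u v := mul_le_of_le_one_right (hw u v) (h1 u)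
    have h3 : 0 ≤ w u v * b u := mul_nonneg (hw u v) (h0 u)
    exact (mul_le_of_le_one_right h3 (by linarith [h0 v])).trans h2

lemma cutVal_compl {n : ℕ} {w : ℕ → ℕ → ℤ} (hsymm : ∀ u v, w u v = w v u) (b : ℕ → ℤ) :
    cutVal n w (fun u => 1 - b u) = cutVal n w b := by
  unfold cutVal
  rw [Finset.sum_comm]
  refine Finset.sum_congr rfl fun u _ => Finset.sum_congr rfl fun v _ => ?_
  rw [hsymm v u]; ring

lemma ordCost_congr {n : ℕ} {w : ℕ → ℕ → ℤ} {f g : ℕ → ℕ} (h : ∀ u < n, f u = g u) :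
    ordCost n w f = ordCost n w g :=
  Finset.sum_congr rfl fun i _ => cutVal_congr fun u hu => by rw [h u hu]

/-- An edge lies in the cuts i with f u ≤ i < f v, so it is counted as often as its length. The
truncated subtraction gives the pair (u, v) a nonzero length only if u comes before v, and each edge
is counted once. -/
lemma ordCost_eq {n : ℕ} (w : ℕ → ℕ → ℤ) {f : ℕ → ℕ} (hf : ∀ u < n, f u < n) :
    ordCost n w f =
      ∑ u ∈ Finset.range n, ∑ v ∈ Finset.range n, w u v * ((f v - f u : ℕ) : ℤ) := by
  unfold ordCost cutVal
  rw [Finset.sum_comm]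
  refine Finset.sum_congr rfl fun u _ => ?_
  rw [Finset.sum_comm]
  refine Finset.sum_congr rfl fun v hv => ?_
  have hv := hf v (Finset.mem_range.1 hv)
  have h1 : ∀ i ∈ Finset.range n, w u v * (if f u ≤ i then 1 else 0) *
      (1 - (if f v ≤ i then 1 else 0)) = w u v * if i ∈ Finset.Ico (f u) (f v) then 1 else 0 := by
    intro i _
    rw [mul_assoc]; congr 1
    simp only [Finset.mem_Ico]
    split_ifs <;> first | rfl | omega
  rw [Finset.sum_congr rfl h1, ← Finset.mul_sum, Finset.sum_ite_mem, Finset.sum_const]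
  have h2 : Finset.range n ∩ Finset.Ico (f u) (f v) = Finset.Ico (f u) (f v) := by
    rw [Finset.inter_eq_right]
    intro i hi; rw [Finset.mem_Ico] at hi; rw [Finset.mem_range]; omega
  rw [h2, Nat.card_Ico]; simp

/-! ### Ranks -/

/-- The number of elements below `n` with a smaller key. -/
def rank (n : ℕ) (key : ℕ → ℕ) (u : ℕ) : ℕ := ((Finset.range n).filter fun x => key x < key u).card

section rank
variable {n : ℕ} {key : ℕ → ℕ}

lemma rank_lt {u : ℕ} (hu : u < n) : rank n key u < n := by
  have h : (Finset.range n).filter (fun x => key x < key u) ⊂ Finset.range n :=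
    (Finset.ssubset_iff_of_subset (Finset.filter_subset _ _)).2
      ⟨u, Finset.mem_range.2 hu, by simp⟩
  have h2 := Finset.card_lt_card h
  rwa [Finset.card_range] at h2

lemma rank_lt_rank {u v : ℕ} (hu : u < n) (h : key u < key v) : rank n key u < rank n key v := by
  refine Finset.card_lt_card ((Finset.ssubset_iff_of_subset fun x hx => ?_).2 ⟨u, ?_, ?_⟩)
  · rw [Finset.mem_filter] at hx ⊢
    exact ⟨hx.1, hx.2.trans h⟩
  · simp [hu, h]
  · simp

lemma rank_injOn (hk : Set.InjOn key (Set.Iio n)) : Set.InjOn (rank n key) (Set.Iio n) := by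
  intro u hu v hv h
  rcases lt_trichotomy (key u) (key v) with h' | h' | h'
  · exact absurd h (rank_lt_rank hu h').ne
  · exact hk hu hv h'
  · exact absurd h (rank_lt_rank hv h').ne'

/-- The elements ranked from u up to v have distinct keys in the interval from `key u` to `key v`.
Passing to ranks can only shorten distances. -/
lemma rank_sub_le (hk : Set.InjOn key (Set.Iio n)) (u v : ℕ) :
    rank n key v - rank n key u ≤ key v - key u := by
  have h1 : (Finset.range n).filter (fun x => key x < key v) ⊆
      (Finset.range n).filter (fun x => key x < key u) ∪
        (Finset.range n).filter (fun x => key u ≤ key x ∧ key x < key v) := by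
    intro x hx
    simp only [Finset.mem_union, Finset.mem_filter] at hx ⊢
    rcases lt_or_ge (key x) (key u) with h | h
    · exact Or.inl ⟨hx.1, h⟩
    · exact Or.inr ⟨hx.1, h, hx.2⟩
  have h2 := (Finset.card_le_card h1).trans (Finset.card_union_le _ _)
  have h3 : ((Finset.range n).filter (fun x => key u ≤ key x ∧ key x < key v)).card ≤
      (Finset.Ico (key u) (key v)).card := by
    refine Finset.card_le_card_of_injOn key (fun x hx => ?_) (fun x hx y hy h => ?_)
    · rw [Finset.mem_coe, Finset.mem_filter] at hx
      rw [Finset.mem_coe, Finset.mem_Ico]; exact hx.2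
    · rw [Finset.mem_coe, Finset.mem_filter, Finset.mem_range] at hx hy
      exact hk hx.1 hy.1 h
  rw [Nat.card_Ico] at h3
  unfold rank
  omega

/-- Ranking by a key that puts a set `S` first. -/
lemma rank_lt_card_iff (S : Finset ℕ) (hS : S ⊆ Finset.range n)
    (h : ∀ u v, u ∈ S → v ∉ S → u < n → v < n → key u < key v) {u : ℕ} (hu : u < n) :
    rank n key u < S.card ↔ u ∈ S := by
  constructor
  · intro hlt
    by_contra hnot
    have : S ⊆ (Finset.range n).filter (fun x => key x < key u) := by
      intro x hx
      rw [Finset.mem_filter]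
      exact ⟨hS hx, h x u hx hnot (Finset.mem_range.1 (hS hx)) hu⟩
    have := Finset.card_le_card this
    unfold rank at hlt; omega
  · intro hmem
    refine Finset.card_lt_card ((Finset.ssubset_iff_of_subset fun x hx => ?_).2 ⟨u, hmem, by simp⟩)
    rw [Finset.mem_filter] at hx
    by_contra hnot
    have := h u x hmem hnot hu (Finset.mem_range.1 hx.1)
    omega

end rank

/-- Every ordering can be rearranged so that a given set `S` comes first, at an extra cost of at
most `n / 2` times the weight of the cut of `S`. -/
lemma exists_rearrangement {n : ℕ} {w : ℕ → ℕ → ℤ} (hw : ∀ u v, 0 ≤ w u v)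
    (hsymm : ∀ u v, w u v = w v u) {f : ℕ → ℕ} (hf : ∀ u < n, f u < n)
    (hinj : Set.InjOn f (Set.Iio n)) (S : Finset ℕ) (hS : S ⊆ Finset.range n) :
    ∃ g : ℕ → ℕ, (∀ u < n, g u < n) ∧ Set.InjOn g (Set.Iio n) ∧
      (∀ u < n, g u < S.card ↔ u ∈ S) ∧
      2 * ordCost n w g ≤ 2 * ordCost n w f + n * cutVal n w (fun u => if u ∈ S then 1 else 0) := by
  -- Both keys put S first; the first keeps the order given by f inside S and inside the complement,
  -- the second reverses it in both.
  set k₁ : ℕ → ℕ := fun u => (if u ∈ S then 0 else n) + f u with hk₁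
  set k₂ : ℕ → ℕ := fun u => (if u ∈ S then 0 else n) + (n - 1 - f u) with hk₂
  have inj₁ : Set.InjOn k₁ (Set.Iio n) := by
    intro u hu v hv h
    have := hf u hu; have := hf v hv
    refine hinj hu hv ?_
    simp only [hk₁] at h
    split_ifs at h <;> omega
  have inj₂ : Set.InjOn k₂ (Set.Iio n) := by
    intro u hu v hv h
    have := hf u hu; have := hf v hv
    refine hinj hu hv ?_
    simp only [hk₂] at h
    split_ifs at h <;> omega
  have first₁ : ∀ u v, u ∈ S → v ∉ S → u < n → v < n → k₁ u < k₁ v := by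
    intro u v hu hv hun hvn
    have := hf u hun; have := hf v hvn
    simp only [hk₁, if_pos hu, if_neg hv]; omega
  have first₂ : ∀ u v, u ∈ S → v ∉ S → u < n → v < n → k₂ u < k₂ v := by
    intro u v hu hv hun hvn
    have := hf u hun; have := hf v hvn
    simp only [hk₂, if_pos hu, if_neg hv]; omega
  set g₁ := rank n k₁ with hg₁
  set g₂ := rank n k₂ with hg₂
  -- Every other element of S precedes u in one of the two orders.
  have hsumS : ∀ u ∈ S, S.card ≤ g₁ u + g₂ u + 1 := by
    intro u hu
    have hsub : S ⊆ (Finset.range n).filter (fun x => k₁ x < k₁ u) ∪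
        (Finset.range n).filter (fun x => k₂ x < k₂ u) ∪ {u} := by
      intro x hx
      have hxn := Finset.mem_range.1 (hS hx)
      have hun := Finset.mem_range.1 (hS hu)
      have := hf x hxn; have := hf u hun
      simp only [Finset.mem_union, Finset.mem_filter, Finset.mem_range, Finset.mem_singleton,
        hk₁, hk₂, if_pos hx, if_pos hu]
      rcases lt_trichotomy (f x) (f u) with h | h | h
      · left; left; omega
      · right; exact hinj hxn hun h
      · left; right; omega
    refine (Finset.card_le_card hsub).trans ((Finset.card_union_le _ _).trans ?_)
    rw [Finset.card_singleton]
    exact Nat.add_le_add_right (Finset.card_union_le _ _) 1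
  -- Outside of S no element precedes v in both orders, so the predecessors of v in both orders lie
  -- in S.
  have hsumC : ∀ v < n, v ∉ S → g₁ v + g₂ v + 1 ≤ n + S.card := by
    intro v hvn hv
    have hunion : (Finset.range n).filter (fun x => k₁ x < k₁ v) ∪
        (Finset.range n).filter (fun x => k₂ x < k₂ v) ⊆ (Finset.range n).erase v := by
      intro x hx
      simp only [Finset.mem_union, Finset.mem_filter] at hx
      rw [Finset.mem_erase]
      rcases hx with h | h
      · exact ⟨fun he => by rw [he] at h; omega, h.1⟩
      · exact ⟨fun he => by rw [he] at h; omega, h.1⟩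
    have hinter : (Finset.range n).filter (fun x => k₁ x < k₁ v) ∩
        (Finset.range n).filter (fun x => k₂ x < k₂ v) ⊆ S := by
      intro x hx
      simp only [Finset.mem_inter, Finset.mem_filter, Finset.mem_range] at hx
      by_contra hnot
      have := hf x hx.1.1; have := hf v hvn
      simp only [hk₁, hk₂, if_neg hnot, if_neg hv] at hx
      omega
    have h1 := Finset.card_le_card hunion
    have h2 := Finset.card_le_card hinter
    have h3 := Finset.card_union_add_card_inter ((Finset.range n).filter (fun x => k₁ x < k₁ v))
      ((Finset.range n).filter (fun x => k₂ x < k₂ v))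
    rw [Finset.card_erase_of_mem (Finset.mem_range.2 hvn), Finset.card_range] at h1
    simp only [hg₁, hg₂, rank]
    omega
  -- For u in S and v outside, subtracting the two sums above bounds the total length by n. Within
  -- S, or within the complement, one of the two orders puts v after u, at a distance no larger than
  -- under f. For u outside and v in S both differences truncate to 0.
  have hpair : ∀ u < n, ∀ v < n, (g₁ v - g₁ u) + (g₂ v - g₂ u) ≤ (f v - f u) + (f u - f v) +
      n * (if u ∈ S ∧ v ∉ S then 1 else 0) := by
    intro u hu v hv
    have h1 := rank_sub_le inj₁ u v
    have h2 := rank_sub_le inj₂ u v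
    have := hf u hu; have := hf v hv
    by_cases hus : u ∈ S <;> by_cases hvs : v ∈ S
    · simp only [hk₁, hk₂, if_pos hus, if_pos hvs] at h1 h2
      simp only [hg₁, hg₂, hk₁, hk₂]
      omega
    · have e1 := hsumS u hus
      have e2 := hsumC v hv hvs
      have e3 := rank_lt_rank hu (first₁ u v hus hvs hu hv)
      have e4 := rank_lt_rank hu (first₂ u v hus hvs hu hv)
      rw [if_pos ⟨hus, hvs⟩]
      simp only [hg₁, hg₂] at *
      omega
    · have e3 := rank_lt_rank hv (first₁ v u hvs hus hv hu)
      have e4 := rank_lt_rank hv (first₂ v u hvs hus hv hu)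
      simp only [hg₁, hg₂] at *
      omega
    · simp only [hk₁, hk₂, if_neg hus, if_neg hvs] at h1 h2
      simp only [hg₁, hg₂, hk₁, hk₂]
      omega
  have lt₁ : ∀ u < n, g₁ u < n := fun u hu => rank_lt hu
  have lt₂ : ∀ u < n, g₂ u < n := fun u hu => rank_lt hu
  have hsum : ordCost n w g₁ + ordCost n w g₂ ≤ 2 * ordCost n w f +
      n * cutVal n w (fun u => if u ∈ S then 1 else 0) := by
    -- The reversed ordering has the same cost by symmetry of the weights, hence the term 2·cost(f).
    have hrev : ∑ u ∈ Finset.range n, ∑ v ∈ Finset.range n, w u v * ((f u - f v : ℕ) : ℤ) =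
        ordCost n w f := by
      rw [ordCost_eq w hf, Finset.sum_comm]
      exact Finset.sum_congr rfl fun u _ => Finset.sum_congr rfl fun v _ => by rw [hsymm v u]
    rw [two_mul]
    nth_rewrite 2 [← hrev]
    rw [ordCost_eq w lt₁, ordCost_eq w lt₂, ordCost_eq w hf]
    unfold cutVal
    rw [← Finset.sum_add_distrib, ← Finset.sum_add_distrib, Finset.mul_sum,
      ← Finset.sum_add_distrib]
    refine Finset.sum_le_sum fun u hu => ?_
    rw [← Finset.sum_add_distrib, ← Finset.sum_add_distrib, Finset.mul_sum,
      ← Finset.sum_add_distrib]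
    refine Finset.sum_le_sum fun v hv => ?_
    have h1 := hpair u (Finset.mem_range.1 hu) v (Finset.mem_range.1 hv)
    have h2 : (((g₁ v - g₁ u) + (g₂ v - g₂ u) : ℕ) : ℤ) ≤ (((f v - f u) + (f u - f v) +
      n * (if u ∈ S ∧ v ∉ S then 1 else 0) : ℕ) : ℤ) := by exact_mod_cast h1
    have h3 := mul_le_mul_of_nonneg_left h2 (hw u v)
    have h4 : ((if u ∈ S ∧ v ∉ S then 1 else 0 : ℕ) : ℤ) =
        (if u ∈ S then 1 else 0) * (1 - if v ∈ S then 1 else 0) := by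
      by_cases hus : u ∈ S <;> by_cases hvs : v ∈ S <;> simp [hus, hvs]
    rw [Nat.cast_add, Nat.cast_add, Nat.cast_add, Nat.cast_mul, h4] at h3
    linarith
  rcases le_total (ordCost n w g₁) (ordCost n w g₂) with h | h
  · exact ⟨g₁, lt₁, rank_injOn inj₁, fun u hu => rank_lt_card_iff S hS first₁ hu, by linarith⟩
  · exact ⟨g₂, lt₂, rank_injOn inj₂, fun u hu => rank_lt_card_iff S hS first₂ hu, by linarith⟩

/-! ### Dynamic programming over masks -/

/-- A table of minimum costs of prefixes, for orderings of `n` coordinates in which the first `s`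
coordinates come first; `last` selects an optimal last element. -/
structure PrefixTable (n s : ℕ) (cut F : ℕ → ℤ) (last : ℕ → ℕ) : Prop where
  le : s ≤ n
  zero : F 0 = 0
  mem : ∀ A : Finset ℕ, A ⊆ Finset.range n → (A ⊆ Finset.range s ∨ Finset.range s ⊆ A) →
    A.Nonempty → last (mask A) ∈ A ∧ (¬ A ⊆ Finset.range s → s ≤ last (mask A)) ∧
      F (mask A) = cut (mask A) + F (mask (A.erase (last (mask A)))) ∧
      ∀ v ∈ A, (¬ A ⊆ Finset.range s → s ≤ v) →
        F (mask (A.erase (last (mask A)))) ≤ F (mask (A.erase v))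

namespace PrefixTable

variable {n s : ℕ} {cut F : ℕ → ℤ} {last : ℕ → ℕ}

/-- The table bounds the cost of every ordering from below. -/
lemma le_chain (h : PrefixTable n s cut F last) (τ : ℕ → ℕ) (hτ : ∀ c < n, τ c < n)
    (hinj : Set.InjOn τ (Set.Iio n)) (hs : ∀ c < n, τ c < s ↔ c < s) :
    F (mask (Finset.range n)) ≤
      ∑ j ∈ Finset.range n, cut (mask ((Finset.range n).filter fun c => τ c ≤ j)) := by
  have hsurj : ∀ i < n, ∃ c < n, τ c = i := by
    have h1 : Finset.image τ (Finset.range n) = Finset.range n := by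
      refine Finset.eq_of_subset_of_card_le ?_ ?_
      · intro x hx
        obtain ⟨c, hc, rfl⟩ := Finset.mem_image.1 hx
        exact Finset.mem_range.2 (hτ c (Finset.mem_range.1 hc))
      · rw [Finset.card_image_of_injOn]
        intro x hx y hy
        exact hinj (by simpa using hx) (by simpa using hy)
    intro i hi
    rw [← Finset.mem_range, ← h1, Finset.mem_image] at hi
    obtain ⟨c, hc, hci⟩ := hi
    exact ⟨c, Finset.mem_range.1 hc, hci⟩
  -- The prefixes of an ordering that puts the first s coordinates first are all in the table, so
  -- its inequalities can be added along the chain.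
  have key : ∀ i ≤ n, F (mask ((Finset.range n).filter fun c => τ c < i)) ≤
      ∑ j ∈ Finset.range i, cut (mask ((Finset.range n).filter fun c => τ c ≤ j)) := by
    intro i
    induction i with
    | zero => intro _; simp [mask, h.zero]
    | succ i ih =>
      intro hi
      obtain ⟨c, hc, hci⟩ := hsurj i (by omega)
      set B := (Finset.range n).filter fun c => τ c < i + 1 with hB
      have hB' : (Finset.range n).filter (fun c => τ c ≤ i) = B := by
        simp only [hB, Nat.lt_succ_iff]
      have hcB : c ∈ B := by
        rw [hB, Finset.mem_filter, Finset.mem_range]; omega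
      have herase : B.erase c = (Finset.range n).filter fun c => τ c < i := by
        ext x
        simp only [hB, Finset.mem_erase, Finset.mem_filter, Finset.mem_range]
        constructor
        · rintro ⟨h1, h2, h3⟩
          refine ⟨h2, lt_of_le_of_ne (by omega) fun h4 => h1 (hinj h2 hc (by omega))⟩
        · rintro ⟨h1, h2⟩
          exact ⟨fun h3 => by subst h3; omega, h1, by omega⟩
      have hvalid : B ⊆ Finset.range s ∨ Finset.range s ⊆ B := by
        rcases le_total (i + 1) s with h1 | h1
        · left
          intro x hx
          rw [hB, Finset.mem_filter, Finset.mem_range] at hx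
          exact Finset.mem_range.2 ((hs x hx.1).1 (by omega))
        · right
          intro x hx
          have hx := Finset.mem_range.1 hx
          have := h.le
          have := (hs x (by omega)).2 hx
          rw [hB, Finset.mem_filter, Finset.mem_range]; omega
      obtain ⟨-, -, h3, h4⟩ := h.mem B (Finset.filter_subset _ _) hvalid ⟨c, hcB⟩
      -- If the last element c of the prefix B were below s, its position i would be below s too,
      -- and B would consist of elements below s only.
      have h5 := h4 c hcB (fun hnot => by
        by_contra hlt
        have h6 := (hs c hc).2 (by omega)
        refine hnot fun x hx => ?_
        rw [hB, Finset.mem_filter, Finset.mem_range] at hx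
        exact Finset.mem_range.2 ((hs x hx.1).1 (by omega)))
      rw [Finset.sum_range_succ, hB', h3]
      rw [herase] at h5
      have := ih (by omega)
      linarith
  have hfull : (Finset.range n).filter (fun c => τ c < n) = Finset.range n :=
    Finset.filter_true_of_mem fun c hc => hτ c (Finset.mem_range.1 hc)
  have := key n le_rfl
  rwa [hfull] at this

/-- The sets that remain when the ordering is read off from the table, from the last element on. -/
def remaining (n : ℕ) (last : ℕ → ℕ) : ℕ → Finset ℕ
  | 0 => Finset.range n
  | i + 1 => (remaining n last i).erase (last (mask (remaining n last i)))

/-- Reading off never leaves the table: as long as the set contains elements outside of the first s,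
`last` selects an element that is at least s, so all of the first s remain. -/
lemma remaining_spec (h : PrefixTable n s cut F last) : ∀ i ≤ n,
    remaining n last i ⊆ Finset.range n ∧
    (remaining n last i ⊆ Finset.range s ∨ Finset.range s ⊆ remaining n last i) ∧
    (remaining n last i).card = n - i := by
  intro i
  induction i with
  | zero =>
    intro _
    exact ⟨subset_rfl, Or.inr (Finset.range_subset_range.2 h.le), by simp [remaining]⟩
  | succ i ih =>
    intro hi
    obtain ⟨h1, h2, h3⟩ := ih (by omega)
    obtain ⟨h4, h5, -⟩ := h.mem _ h1 h2 (Finset.card_pos.1 (by omega))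
    refine ⟨(Finset.erase_subset _ _).trans h1, ?_, ?_⟩
    · by_cases hs : remaining n last i ⊆ Finset.range s
      · exact Or.inl ((Finset.erase_subset _ _).trans hs)
      · right
        intro x hx
        refine Finset.mem_erase.2 ⟨?_, h2.resolve_left hs hx⟩
        have := h5 hs
        have := Finset.mem_range.1 hx
        omega
    · simp only [remaining]
      rw [Finset.card_erase_of_mem h4]; omega

lemma last_mem (h : PrefixTable n s cut F last) {i : ℕ} (hi : i < n) :
    last (mask (remaining n last i)) ∈ remaining n last i := by
  obtain ⟨h1, h2, h3⟩ := h.remaining_spec i hi.le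
  exact (h.mem _ h1 h2 (Finset.card_pos.1 (by omega))).1

/-- The recursion of the table telescopes along the sets that are read off. -/
lemma value_eq (h : PrefixTable n s cut F last) : ∀ i ≤ n,
    F (mask (Finset.range n)) = F (mask (remaining n last i)) +
      ∑ j ∈ Finset.range i, cut (mask (remaining n last j)) := by
  intro i
  induction i with
  | zero => intro _; simp [remaining]
  | succ i ih =>
    intro hi
    obtain ⟨h1, h2, h3⟩ := h.remaining_spec i (by omega)
    obtain ⟨-, -, h4, -⟩ := h.mem _ h1 h2 (Finset.card_pos.1 (by omega))
    rw [ih (by omega), Finset.sum_range_succ, h4]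
    simp only [remaining]; ring

lemma remaining_anti (last : ℕ → ℕ) {i j : ℕ} (hij : i ≤ j) :
    remaining n last j ⊆ remaining n last i := by
  induction j, hij using Nat.le_induction with
  | base => exact subset_rfl
  | succ j _ ih => exact (Finset.erase_subset _ _).trans ih

/-- The ordering read off from the table. -/
lemma exists_ordering (h : PrefixTable n s cut F last) : ∃ g : ℕ → ℕ, (∀ c < n, g c < n) ∧
    Set.InjOn g (Set.Iio n) ∧
    (∀ c < n, last (mask (remaining n last (n - 1 - g c))) = c) ∧
    F (mask (Finset.range n)) =
      ∑ j ∈ Finset.range n, cut (mask ((Finset.range n).filter fun c => g c ≤ j)) := by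
  have hmemlt : ∀ i, ∀ c, c ∈ Finset.range n → c ∉ remaining n last i →
      ∃ j < i, last (mask (remaining n last j)) = c := by
    intro i
    induction i with
    | zero => intro c hc hn; exact absurd hc hn
    | succ i ih =>
      intro c hc hn
      by_cases hci : c ∈ remaining n last i
      · refine ⟨i, by omega, ?_⟩
        by_contra hne
        exact hn (Finset.mem_erase.2 ⟨fun h => hne h.symm, hci⟩)
      · obtain ⟨j, hj, hj'⟩ := ih c hc hci
        exact ⟨j, by omega, hj'⟩
  have hempty : remaining n last n = ∅ := by
    have := (h.remaining_spec n le_rfl).2.2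
    exact Finset.card_eq_zero.1 (by omega)
  -- The number t c chosen from this is the round in which c is removed. Rounds count from the end
  -- of the ordering, so c gets position n - 1 - t c.
  have hex : ∀ c : ℕ, ∃ j, c < n → j < n ∧ last (mask (remaining n last j)) = c := by
    intro c
    by_cases hc : c < n
    · obtain ⟨j, hj, hj'⟩ := hmemlt n c (Finset.mem_range.2 hc) (by rw [hempty]; simp)
      exact ⟨j, fun _ => ⟨hj, hj'⟩⟩
    · exact ⟨0, fun h => absurd h hc⟩
  choose t ht using hex
  have hiff : ∀ c < n, ∀ i ≤ n, c ∈ remaining n last i ↔ i ≤ t c := by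
    intro c hc i hi
    obtain ⟨h1, h2⟩ := ht c hc
    constructor
    · intro hmem
      by_contra hlt
      have h3 := remaining_anti (n := n) last (show t c + 1 ≤ i by omega) hmem
      simp only [remaining, h2] at h3
      exact absurd rfl (Finset.mem_erase.1 h3).1
    · intro hle
      have h3 := h.last_mem h1
      rw [h2] at h3
      exact remaining_anti last hle h3
  refine ⟨fun c => n - 1 - t c, fun c hc => show n - 1 - t c < n by omega, ?_, ?_, ?_⟩
  · intro c hc d hd hcd
    obtain ⟨h1, h2⟩ := ht c hc
    obtain ⟨h3, h4⟩ := ht d hd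
    have : t c = t d := by simp only at hcd; omega
    rw [← h2, ← h4, this]
  · intro c hc
    obtain ⟨h1, h2⟩ := ht c hc
    rw [show n - 1 - (n - 1 - t c) = t c by omega]; exact h2
  · rw [h.value_eq n le_rfl, hempty]
    simp only [mask, Finset.sum_empty, h.zero, zero_add]
    rw [← Finset.sum_range_reflect]
    refine Finset.sum_congr rfl fun j hj => ?_
    have hj := Finset.mem_range.1 hj
    have : remaining n last (n - 1 - j) = (Finset.range n).filter fun c => n - 1 - t c ≤ j := by
      ext c
      rw [Finset.mem_filter, Finset.mem_range]
      constructor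
      · intro hmem
        have hc := Finset.mem_range.1 ((h.remaining_spec _ (by omega)).1 hmem)
        have := (hiff c hc _ (by omega)).1 hmem
        exact ⟨hc, by omega⟩
      · rintro ⟨hc, hle⟩
        have := (ht c hc).1
        exact (hiff c hc _ (by omega)).2 (by omega)
    rw [this]

end PrefixTable

end OLA

namespace OLA

/-! ### Instances -/

namespace WeightedGraph

variable {n : ℕ} (I : WeightedGraph n)

open Classical in
/-- The weight of the edge between two vertices, and `0` if there is none. -/
noncomputable def finWt (u v : Fin n) : ℤ :=
  if h : I.graph.Adj u v then
    (I.weight ⟨s(u, v), (SimpleGraph.mem_edgeSet I.graph).mpr h⟩ : ℤ) else 0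

/-- `finWt` with natural numbers as vertices. -/
noncomputable def wt (u v : ℕ) : ℤ :=
  if h : u < n ∧ v < n then I.finWt ⟨u, h.1⟩ ⟨v, h.2⟩ else 0

lemma finWt_symm (u v : Fin n) : I.finWt u v = I.finWt v u := by
  unfold finWt
  by_cases h : I.graph.Adj u v
  · rw [dif_pos h, dif_pos h.symm]
    congr 2
    exact Subtype.ext Sym2.eq_swap
  · rw [dif_neg h, dif_neg fun h' => h h'.symm]

lemma wt_symm (u v : ℕ) : I.wt u v = I.wt v u := by
  unfold wt
  by_cases h : u < n ∧ v < n
  · rw [dif_pos h, dif_pos h.symm, finWt_symm]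
  · rw [dif_neg h, dif_neg fun h' => h h'.symm]

lemma finWt_nonneg (u v : Fin n) : 0 ≤ I.finWt u v := by
  unfold finWt; split_ifs <;> simp

lemma wt_nonneg (u v : ℕ) : 0 ≤ I.wt u v := by
  unfold wt; split_ifs
  · exact I.finWt_nonneg _ _
  · exact le_rfl

lemma wt_val (u v : Fin n) : I.wt u v = I.finWt u v := by simp [wt]

lemma finWt_le (u v : Fin n) : I.finWt u v ≤ 2 ^ I.inputSize := by
  classical
  unfold finWt
  split_ifs with h
  · set e : I.graph.edgeSet := ⟨s(u, v), (SimpleGraph.mem_edgeSet I.graph).mpr h⟩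
    have h1 : I.weight e < 2 ^ Nat.size (I.weight e) := Nat.lt_size_self _
    have h2 : Nat.size (I.weight e) ≤ I.inputSize := by
      unfold inputSize
      have h3 := Finset.single_le_sum (f := fun e => 1 + Nat.size (I.weight e))
        (fun _ _ => Nat.zero_le _) (Finset.mem_univ e)
      omega
    have h3 : I.weight e ≤ 2 ^ I.inputSize :=
      h1.le.trans (Nat.pow_le_pow_right (by norm_num) h2)
    exact_mod_cast h3
  · positivity

lemma n_le_inputSize : n ≤ I.inputSize := Nat.le_add_right _ _

/-- There are n² terms, each at most 2^size, and n ≤ 2^size. -/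
lemma sum_wt_le : ∑ u ∈ Finset.range n, ∑ v ∈ Finset.range n, I.wt u v ≤
    2 ^ (3 * I.inputSize) := by
  have h1 : ∀ u ∈ Finset.range n, ∀ v ∈ Finset.range n, I.wt u v ≤ 2 ^ I.inputSize := by
    intro u hu v hv
    have hu := Finset.mem_range.1 hu
    have hv := Finset.mem_range.1 hv
    exact (I.wt_val ⟨u, hu⟩ ⟨v, hv⟩).trans_le (I.finWt_le _ _)
  have h2 : (n : ℤ) ≤ 2 ^ I.inputSize := by
    have : n ≤ 2 ^ I.inputSize := I.n_le_inputSize.trans Nat.lt_two_pow_self.le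
    exact_mod_cast this
  calc _ ≤ ∑ u ∈ Finset.range n, ∑ v ∈ Finset.range n, (2 : ℤ) ^ I.inputSize :=
        Finset.sum_le_sum fun u hu => Finset.sum_le_sum fun v hv => h1 u hu v hv
    _ = n * (n * 2 ^ I.inputSize) := by simp
    _ ≤ 2 ^ I.inputSize * (2 ^ I.inputSize * 2 ^ I.inputSize) := by gcongr
    _ = _ := by rw [← pow_add, ← pow_add]; congr 1; ring

/-- The cut is a set of unordered edges. Orienting each edge from its earlier to its later end gives
a bijection with the ordered pairs that contribute on the right. The instances are arguments so that
the lemma fits the classical ones in the definition of the cost. -/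
lemma sum_cut (π : VertexOrdering n) (i : ℕ) [Fintype I.graph.edgeSet]
    [DecidablePred fun e : I.graph.edgeSet => e ∈ I.cut π (i + 1)] :
    ((∑ e : I.graph.edgeSet with e ∈ I.cut π (i + 1), I.weight e : ℕ) : ℤ) =
      ∑ u, ∑ v, I.finWt u v * (if (π u : ℕ) ≤ i then 1 else 0) *
        (1 - if (π v : ℕ) ≤ i then 1 else 0) := by
  classical
  have h1 : ∀ u v : Fin n, I.finWt u v * (if (π u : ℕ) ≤ i then 1 else 0) *
        (1 - if (π v : ℕ) ≤ i then 1 else 0) =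
      if I.graph.Adj u v ∧ (π u : ℕ) ≤ i ∧ i < π v then I.finWt u v else 0 := by
    intro u v
    by_cases h : I.graph.Adj u v
    · simp only [h, true_and]
      split_ifs <;> omega
    · have : I.finWt u v = 0 := by simp [finWt, h]
      simp [this]
  simp only [h1]
  rw [← Fintype.sum_prod_type' (f := fun u v =>
      if I.graph.Adj u v ∧ (π u : ℕ) ≤ i ∧ i < π v then I.finWt u v else 0),
    ← Finset.sum_filter]
  push_cast
  symm
  refine Finset.sum_bij (fun (p : Fin n × Fin n) hp => (⟨s(p.1, p.2),
    (SimpleGraph.mem_edgeSet I.graph).mpr (Finset.mem_filter.1 hp).2.1⟩ : I.graph.edgeSet))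
    ?_ ?_ ?_ ?_
  · intro p hp
    have h2 := (Finset.mem_filter.1 hp).2
    refine Finset.mem_filter.2 ⟨Finset.mem_univ _, p.2, p.1, Sym2.eq_swap, ?_, ?_⟩
    · simp only [VertexOrdering.pos]; omega
    · simp only [VertexOrdering.pos]; omega
  · intro p hp q hq h
    have h2 := (Finset.mem_filter.1 hp).2
    have h3 := (Finset.mem_filter.1 hq).2
    have h4 : s(p.1, p.2) = s(q.1, q.2) := congrArg Subtype.val h
    rcases Sym2.eq_iff.1 h4 with ⟨h5, h6⟩ | ⟨h5, h6⟩
    · exact Prod.ext h5 h6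
    · rw [h5, h6] at h2; omega
  · intro e he
    obtain ⟨u, v, h2, h3, h4⟩ := (Finset.mem_filter.1 he).2
    have hadj : I.graph.Adj v u := by
      have := e.2
      rw [h2, SimpleGraph.mem_edgeSet] at this
      exact this.symm
    simp only [VertexOrdering.pos] at h3 h4
    refine ⟨(v, u), Finset.mem_filter.2 ⟨Finset.mem_univ _, hadj, by simp only; omega,
      by simp only; omega⟩, ?_⟩
    exact Subtype.ext (by rw [h2]; exact Sym2.eq_swap)
  · intro p hp
    have h2 := (Finset.mem_filter.1 hp).2
    simp only [finWt]
    rw [dif_pos h2.1]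

/-- Positions are shifted from 1, …, n to 0, …, n - 1, and `ordCost` has one more cut, that of the
whole vertex set, which is empty. -/
lemma cost_eq (π : VertexOrdering n) (f : ℕ → ℕ) (hf : ∀ u : Fin n, f u = π u) :
    (I.cost π : ℤ) = ordCost n I.wt f := by
  have hcut : ∀ i, cutVal n I.wt (fun u => if f u ≤ i then 1 else 0) =
      ∑ u, ∑ v, I.finWt u v * (if (π u : ℕ) ≤ i then 1 else 0) *
        (1 - if (π v : ℕ) ≤ i then 1 else 0) := by
    intro i
    unfold cutVal
    rw [Finset.sum_range]
    refine Finset.sum_congr rfl fun u _ => ?_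
    rw [Finset.sum_range]
    refine Finset.sum_congr rfl fun v _ => ?_
    simp only [wt_val, hf]
  unfold cost ordCost
  rcases Nat.eq_zero_or_pos n with hn | hn
  · subst hn; simp
  obtain ⟨m, rfl⟩ : ∃ m, n = m + 1 := ⟨n - 1, by omega⟩
  rw [Finset.sum_range_succ]
  have hlast : cutVal (m + 1) I.wt (fun u => if f u ≤ m then 1 else 0) = 0 := by
    rw [hcut]
    refine Finset.sum_eq_zero fun u _ => Finset.sum_eq_zero fun v _ => ?_
    rw [if_pos (show (π v : ℕ) ≤ m by have := (π v).2; omega)]; simp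
  rw [hlast, add_zero, show m + 1 - 1 = m from rfl,
    show Finset.Icc 1 m = Finset.Ico 1 (m + 1) by
      ext; simp only [Finset.mem_Icc, Finset.mem_Ico]; omega,
    Finset.sum_Ico_eq_sum_range, Nat.cast_sum]
  refine Finset.sum_congr rfl fun i _ => ?_
  rw [hcut, add_comm 1 i]
  classical exact sum_cut I π i

end WeightedGraph

lemma matrixArray_apply {n : ℕ} (A : Fin n → Fin n → ℤ) (u v : Fin n) :
    matrixArray A ((n : ℤ) * u + v) = A u v := by
  unfold matrixArray
  have key : ∀ u' v' : Fin n, ((n : ℤ) * u + v = (n : ℤ) * u' + v') ↔ u = u' ∧ v = v' := by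
    intro u' v'
    constructor
    · intro h
      have h' : n * (u : ℕ) + v = n * u' + v' := by exact_mod_cast h
      have hn : 0 < n := u.pos
      have h1 : (n * (u : ℕ) + v) / n = u := by
        rw [Nat.mul_add_div hn, Nat.div_eq_of_lt v.2, add_zero]
      have h2 : (n * (u' : ℕ) + v') / n = u' := by
        rw [Nat.mul_add_div hn, Nat.div_eq_of_lt v'.2, add_zero]
      have h3 : (u : ℕ) = u' := by rw [← h1, ← h2, h']
      exact ⟨Fin.ext h3, Fin.ext (by rw [h3] at h'; omega)⟩
    · rintro ⟨rfl, rfl⟩; rfl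
  simp only [key, ite_and]
  simp

lemma abs_matrixArray_le {n : ℕ} (A : Fin n → Fin n → ℤ) (z B : ℤ) (hB : 0 ≤ B)
    (hA : ∀ u v, |A u v| ≤ B) : |matrixArray A z| ≤ B := by
  by_cases h : ∃ u v : Fin n, z = (n : ℤ) * u + v
  · obtain ⟨u, v, rfl⟩ := h
    rw [matrixArray_apply]; exact hA u v
  · have : matrixArray A z = 0 := by
      unfold matrixArray
      refine Finset.sum_eq_zero fun u _ => Finset.sum_eq_zero fun v _ => if_neg fun h' => ?_
      exact h ⟨u, v, h'⟩
    rw [this]; simpa using hB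

namespace WeightedGraph

variable {n : ℕ} (I : WeightedGraph n)

lemma initState_weight {u v : ℕ} (hu : u < n) (hv : v < n) :
    I.initState.arr 1 ((n : ℤ) * u + v) = I.wt u v := by
  have h := I.wt_val ⟨u, hu⟩ ⟨v, hv⟩
  simp only at h
  rw [h]
  exact matrixArray_apply (fun u v => I.finWt u v) ⟨u, hu⟩ ⟨v, hv⟩

lemma initState_bounded {M L : ℕ} (hn : n ≤ L) (hM : 2 ^ I.inputSize ≤ M) :
    I.initState.Bounded M L := by
  have hM' : (2 : ℤ) ^ I.inputSize ≤ M := by exact_mod_cast hM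
  have hM1 : (1 : ℤ) ≤ M := (one_le_pow₀ (by norm_num)).trans hM'
  refine ⟨fun x => ?_, fun a i => ?_⟩
  · by_cases hx : x = 0
    · subst hx
      simp [initState, limit]; exact_mod_cast hn
    · simp [initState, hx]
  · simp only [initState]
    split_ifs
    · refine abs_matrixArray_le _ _ _ (by linarith) fun u v => ?_
      split_ifs
      · simpa using hM1
      · simp
    · refine abs_matrixArray_le (fun u v => I.finWt u v) _ _ (by linarith) fun u v => ?_
      rw [abs_of_nonneg (I.finWt_nonneg u v)]
      exact (I.finWt_le u v).trans hM'
    · simp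

end WeightedGraph

end OLA

namespace OLA

/-! ### Terms of the algorithm -/

/-- The digit of `x` at position `i`; array `3` holds the powers of two. -/
def digitT (x i : Term) : Term := x / .read 3 i % 2

/-- The weight of the edge between the two innermost bound variables. -/
def weightT : Term := .read 1 (.var 0 * .bvar 1 + .bvar 0)

/-- The number of nonzero digits of `x` among the first `m`, where variable `1` holds `m`. -/
def popcountT (x : Term) : Term := .sum 1 (digitT x (.bvar 0))

/-- The weight of the cut given by the mask `x`, with the coordinates of the vertices in
array `p`. -/
def cutT (x : Term) (p : ℕ) : Term :=
  .sum 0 (.sum 0 (weightT * digitT x (.read p (.bvar 1)) * (1 - digitT x (.read p (.bvar 0)))))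

/-- The sum of the squares of the blocks of the two innermost bound variables. -/
def blocksT (q : ℕ) : Term :=
  .read q (.bvar 1) / .var 1 * (.read q (.bvar 1) / .var 1) +
    .read q (.bvar 0) / .var 1 * (.read q (.bvar 0) / .var 1)

/-- The part of the cut `x` between blocks with `lo ≤ blocksT ≤ hi`. -/
def partCutT (x : Term) (q lo hi : ℕ) : Term :=
  .sum 0 (.sum 0 (weightT * (Term.leq (.const lo) (blocksT q) * Term.leq (blocksT q) (.const hi)) *
    digitT x (.read q (.bvar 1)) * (1 - digitT x (.read q (.bvar 0)))))

/-- The weights between blocks with `lo ≤ blocks ≤ hi`. -/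
def partWt (w : ℕ → ℕ → ℤ) (m : ℕ) (q : ℕ → ℕ) (lo hi : ℕ) (u v : ℕ) : ℤ :=
  w u v * if lo ≤ q u / m * (q u / m) + q v / m * (q v / m) ∧
    q u / m * (q u / m) + q v / m * (q v / m) ≤ hi then 1 else 0

/-- The entry at `e` of a fixed table of `k` entries. -/
def lookupT (f : ℕ → ℤ) : ℕ → Term → Term
  | 0, _ => 0
  | k + 1, e => lookupT f k e + .const (f k) * e.eq (.const k)

lemma eval_lookupT (f : ℕ → ℤ) (s : State) (e : Term) (ρ : List ℤ) (i : ℕ)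
    (h : e.eval s ρ = i) (k : ℕ) : (lookupT f k e).eval s ρ = if i < k then f i else 0 := by
  induction k with
  | zero => simp [lookupT]
  | succ k ih =>
    simp only [lookupT, Term.eval_add, Term.eval_mul, Term.eval_eq, Term.eval_const, ih, h,
      ieq, Nat.cast_inj]
    split_ifs <;> first | omega | simp_all

/-- The memory contains the instance and the constants of the algorithm. -/
structure Ctx (n m Q R : ℕ) (W : ℤ → ℤ) (s : State) : Prop where
  var_zero : s.var 0 = n
  var_one : s.var 1 = m
  var_two : s.var 2 = Q
  var_three : s.var 3 = R
  arr_one : s.arr 1 = W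
  arr_three : ∀ i ≤ 3 * m, s.arr 3 (i : ℤ) = 2 ^ i

section
variable {n m Q R : ℕ} {W : ℤ → ℤ} {s : State} {w : ℕ → ℕ → ℤ}

lemma Ctx.congr {s' : State} (h : Ctx n m Q R W s) (h0 : s'.var 0 = s.var 0)
    (h1 : s'.var 1 = s.var 1) (h2 : s'.var 2 = s.var 2) (h3 : s'.var 3 = s.var 3)
    (h4 : s'.arr 1 = s.arr 1) (h5 : s'.arr 3 = s.arr 3) : Ctx n m Q R W s' :=
  ⟨h0.trans h.1, h1.trans h.2, h2.trans h.3, h3.trans h.4, h4.trans h.5,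
    fun i hi => by rw [h5]; exact h.6 i hi⟩

lemma Ctx.frame {s' : State} {c : Cmd} (h : Ctx n m Q R W s) (hc : c.Frame s s')
    (hk : c.KeepsVar 0 ∧ c.KeepsVar 1 ∧ c.KeepsVar 2 ∧ c.KeepsVar 3 ∧ c.KeepsArr 1 ∧
      c.KeepsArr 3) : Ctx n m Q R W s' :=
  h.congr (hc.1 _ hk.1) (hc.1 _ hk.2.1) (hc.1 _ hk.2.2.1) (hc.1 _ hk.2.2.2.1)
    (hc.2 _ hk.2.2.2.2.1) (hc.2 _ hk.2.2.2.2.2)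

lemma eval_digitT (hs : Ctx n m Q R W s) {x i : Term} {ρ : List ℤ} {x' i' : ℕ}
    (hx : x.eval s ρ = x') (hi : i.eval s ρ = i') (hi' : i' ≤ 3 * m) :
    (digitT x i).eval s ρ = digit x' i' := by
  simp only [digitT, Term.eval_mod, Term.eval_div, Term.eval_read, Term.eval_two, hx, hi,
    hs.arr_three i' hi']
  exact digit_eq x' i'

lemma eval_popcountT (hs : Ctx n m Q R W s) {x : Term} {ρ : List ℤ} {x' : ℕ}
    (hx : ∀ ρ, x.eval s ρ = x') : (popcountT x).eval s ρ = popcount m x' := by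
  simp only [popcountT, Term.eval_sum]
  rw [show s.var ((1 : Fin 4) : ℕ) = m from hs.var_one, Int.toNat_natCast]
  refine Finset.sum_congr rfl fun i hi => ?_
  have := Finset.mem_range.1 hi
  exact eval_digitT hs (hx _) rfl (by omega)

lemma eval_cutT (hs : Ctx n m Q R W s) (hW : ∀ u < n, ∀ v < n, W ((n : ℤ) * u + v) = w u v)
    {x : Term} {p : ℕ} {ρ : List ℤ} {x' : ℕ} {f : ℕ → ℕ} (hx : ∀ ρ, x.eval s ρ = x')
    (hp : ∀ u < n, s.arr p (u : ℤ) = f u) (hf : ∀ u < n, f u ≤ 3 * m) :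
    (cutT x p).eval s ρ = cutVal n w fun u => digit x' (f u) := by
  simp only [cutT, Term.eval_sum, cutVal]
  rw [show s.var ((0 : Fin 4) : ℕ) = n from hs.var_zero, Int.toNat_natCast]
  refine Finset.sum_congr rfl fun u hu => Finset.sum_congr rfl fun v hv => ?_
  have hu := Finset.mem_range.1 hu
  have hv := Finset.mem_range.1 hv
  simp only [Term.eval_mul, Term.eval_sub, Term.eval_one]
  rw [eval_digitT hs (hx _) (show (Term.read p (.bvar 1)).eval s ((v : ℤ) :: (u : ℤ) :: ρ) = _ from hp u hu) (hf u hu),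
    eval_digitT hs (hx _) (show (Term.read p (.bvar 0)).eval s ((v : ℤ) :: (u : ℤ) :: ρ) = _ from hp v hv) (hf v hv)]
  congr 2
  simp only [weightT, Term.eval_read, Term.eval_add, Term.eval_mul, Term.eval_var, Term.eval_bvar,
    hs.var_zero, hs.arr_one]
  exact hW u hu v hv

lemma eval_blocksT (hs : Ctx n m Q R W s) {q u v : ℕ} {ρ : List ℤ} {f : ℕ → ℕ}
    (hu : s.arr q (u : ℤ) = f u) (hv : s.arr q (v : ℤ) = f v) :
    (blocksT q).eval s ((v : ℤ) :: (u : ℤ) :: ρ) =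
      ((f u / m * (f u / m) + f v / m * (f v / m) : ℕ) : ℤ) := by
  have e1 : (Term.read q (.bvar 1)).eval s ((v : ℤ) :: (u : ℤ) :: ρ) = f u := hu
  have e0 : (Term.read q (.bvar 0)).eval s ((v : ℤ) :: (u : ℤ) :: ρ) = f v := hv
  simp only [blocksT, Term.eval_add, Term.eval_mul, Term.eval_div, Term.eval_var, e1, e0,
    hs.var_one]
  push_cast; rfl

lemma eval_partCutT (hs : Ctx n m Q R W s) (hW : ∀ u < n, ∀ v < n, W ((n : ℤ) * u + v) = w u v)
    {x : Term} {q lo hi : ℕ} {ρ : List ℤ} {x' : ℕ} {f : ℕ → ℕ} (hx : ∀ ρ, x.eval s ρ = x')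
    (hq : ∀ u < n, s.arr q (u : ℤ) = f u) (hf : ∀ u < n, f u ≤ 3 * m) :
    (partCutT x q lo hi).eval s ρ =
      cutVal n (partWt w m f lo hi) fun u => digit x' (f u) := by
  simp only [partCutT, Term.eval_sum, cutVal]
  rw [show s.var ((0 : Fin 4) : ℕ) = n from hs.var_zero, Int.toNat_natCast]
  refine Finset.sum_congr rfl fun u hu => Finset.sum_congr rfl fun v hv => ?_
  have hu := Finset.mem_range.1 hu
  have hv := Finset.mem_range.1 hv
  simp only [Term.eval_mul, Term.eval_sub, Term.eval_one]
  rw [eval_digitT hs (hx _) (show (Term.read q (.bvar 1)).eval s ((v : ℤ) :: (u : ℤ) :: ρ) = _ from hq u hu) (hf u hu),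
    eval_digitT hs (hx _) (show (Term.read q (.bvar 0)).eval s ((v : ℤ) :: (u : ℤ) :: ρ) = _ from hq v hv) (hf v hv)]
  congr 2
  simp only [weightT, Term.eval_read, Term.eval_add, Term.eval_mul, Term.eval_var, Term.eval_bvar,
    hs.var_zero, hs.arr_one, Term.eval_leq, Term.eval_const,
    eval_blocksT hs (hq u hu) (hq v hv)]
  rw [partWt]
  congr 1
  · exact hW u hu v hv
  · simp only [ile]
    norm_cast
    split_ifs <;> omega

end

lemma partWt_nonneg {w : ℕ → ℕ → ℤ} (hw : ∀ u v, 0 ≤ w u v) (m : ℕ) (q : ℕ → ℕ) (lo hi u v : ℕ) :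
    0 ≤ partWt w m q lo hi u v := by
  unfold partWt; split_ifs
  · simpa using hw u v
  · simp

/-- The mask composed of three blocks of `m` digits. -/
def mask3 (m x y z : ℕ) : ℕ := x + 2 ^ m * y + 2 ^ (2 * m) * z

/-- The block z is on top and needs no bound. -/
lemma digit_mask3 {m x y z : ℕ} (hx : x < 2 ^ m) (hy : y < 2 ^ m) (i : ℕ) :
    digit (mask3 m x y z) i = if i < m then digit x i else
      if i < 2 * m then digit y (i - m) else digit z (i - 2 * m) := by
  have h : mask3 m x y z = x + 2 ^ m * (y + 2 ^ m * z) := by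
    unfold mask3; rw [two_mul, pow_add]; ring
  rw [h, digit_add_mul hx, digit_add_mul hy]
  split_ifs <;> first | omega | rfl | (congr 1; omega)

/-- The cut splits into parts that depend on two of the three blocks each. -/
lemma cutVal_mask3 {n m x y z : ℕ} (w : ℕ → ℕ → ℤ) {q : ℕ → ℕ} (hq : ∀ u < n, q u < 3 * m)
    (hx : x < 2 ^ m) (hy : y < 2 ^ m) :
    cutVal n w (fun u => digit (mask3 m x y z) (q u)) =
      cutVal n (partWt w m q 0 2) (fun u => digit (mask3 m x y 0) (q u)) +
      cutVal n (partWt w m q 5 8) (fun u => digit (mask3 m 0 y z) (q u)) +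
      cutVal n (partWt w m q 3 4) (fun u => digit (mask3 m x 0 z) (q u)) := by
  have hpos : 0 < 2 ^ m := by positivity
  have hblock : ∀ u < n, 0 < m ∧ ((q u / m = 0 ∧ q u < m) ∨ (q u / m = 1 ∧ m ≤ q u ∧ q u < 2 * m) ∨
      (q u / m = 2 ∧ 2 * m ≤ q u)) := by
    intro u hu
    have h1 := hq u hu
    have hm : 0 < m := by omega
    refine ⟨hm, ?_⟩
    rcases lt_or_ge (q u) m with h | h
    · exact Or.inl ⟨Nat.div_eq_of_lt h, h⟩
    · rcases lt_or_ge (q u) (2 * m) with h' | h'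
      · exact Or.inr (Or.inl ⟨Nat.div_eq_of_lt_le (by omega) (by omega), h, h'⟩)
      · exact Or.inr (Or.inr ⟨Nat.div_eq_of_lt_le (by omega) (by omega), h'⟩)
  unfold cutVal
  rw [← Finset.sum_add_distrib, ← Finset.sum_add_distrib]
  refine Finset.sum_congr rfl fun u hu => ?_
  rw [← Finset.sum_add_distrib, ← Finset.sum_add_distrib]
  refine Finset.sum_congr rfl fun v hv => ?_
  obtain ⟨hm, h1⟩ := hblock u (Finset.mem_range.1 hu)
  obtain ⟨-, h2⟩ := hblock v (Finset.mem_range.1 hv)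
  -- The number a² + b² determines the unordered pair of blocks a, b in {0, 1, 2}. The values 0, 1,
  -- 2 come from pairs within the first two blocks, 4 from the first and the third, and 5, 8 from
  -- the second and the third or the third alone. So the ranges 0–2, 5–8 and 3–4 cover every pair
  -- exactly once, and each part ignores the third mask.
  simp only [digit_mask3 hx hy, digit_mask3 hx hpos, digit_mask3 hpos hy, partWt]
  rcases h1 with ⟨h1, h1'⟩ | ⟨h1, h1', h1''⟩ | ⟨h1, h1'⟩ <;>
    rcases h2 with ⟨h2, h2'⟩ | ⟨h2, h2', h2''⟩ | ⟨h2, h2'⟩ <;>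
    simp only [h1, h2] <;> norm_num <;>
    simp only [show ∀ a b : ℕ, (a < b) = ¬ (b ≤ a) by simp, *] <;> norm_num <;>
    (try split_ifs) <;> first | rfl | omega

end OLA

namespace OLA

infixr:67 " ;; " => Cmd.seq

/-! ### Listing the masks with a given number of digits -/

/-- Lists in array `6` the masks of `m` digits of which as many are nonzero as variable `9` says,
and counts them in variable `14`. -/
def listCmd : Cmd :=
  .assign 14 0 ;; .loop 4 (.read 3 (.var 1)) (.ite ((popcountT (.var 4)).eq (.var 9))
    (.write 6 (.var 14) (.var 4) ;; .assign 14 (.var 14 + 1)) .skip)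

/-- The number of masks of `m` digits with `k` nonzero digits. -/
def maskCount (m k : ℕ) : ℕ := ((Finset.range (2 ^ m)).filter fun x => popcount m x = k).card

lemma maskCount_le (m k : ℕ) : maskCount m k ≤ 2 ^ m :=
  (Finset.card_filter_le _ _).trans (by simp)

/-- Completeness of the list is needed to find a solution if there is one; soundness is needed for
the size of the set that is found. -/
lemma listCmd_spec {n m Q R k M L : ℕ} {W : ℤ → ℤ} {s : State} (hs : Ctx n m Q R W s)
    (hk : s.var 9 = k) (hM : 2 ^ m ≤ M) :
    listCmd.Spec M L s (1 + (1 + 2 ^ m * (1 + 3))) fun s' =>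
      s'.var 14 = maskCount m k ∧
      (∀ j < maskCount m k, ∃ x < 2 ^ m, popcount m x = k ∧ s'.arr 6 (j : ℤ) = x) ∧
      ∀ x < 2 ^ m, popcount m x = k → ∃ j < maskCount m k, s'.arr 6 (j : ℤ) = x := by
  refine .seq (.assign (by simp) ?_)
  set s₁ := s.setVar 14 ((0 : Term).eval s []) with hs₁
  have hc₁ : Ctx n m Q R W s₁ := hs.congr rfl rfl rfl rfl rfl rfl
  have hk₁ : s₁.var 9 = k := hk
  have h14 : s₁.var 14 = 0 := State.setVar_var_self _ _ _
  set c : ℕ → ℕ := fun i => ((Finset.range i).filter fun x => popcount m x = k).card with hcdef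
  have hcle : ∀ i, c i ≤ i := fun i => (Finset.card_filter_le _ _).trans (by simp)
  refine .loop (m := 2 ^ m) (k := 1 + (1 + 1)) ?_ ?_ (fun i s' => s'.var 14 = c i ∧
      (∀ j < c i, ∃ x < i, popcount m x = k ∧ s'.arr 6 (j : ℤ) = x) ∧
      ∀ x < i, popcount m x = k → ∃ j < c i, s'.arr 6 (j : ℤ) = x) ?_ ?_
  · simp only [Term.eval_read, Term.eval_var]
    rw [hc₁.var_one, hc₁.arr_three m (by omega)]; norm_cast
  · simp only [limit]; norm_num; omega
  · refine ⟨by simpa [c] using h14, ?_, ?_⟩ <;> simp [c]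
  · rintro i hi s' hfr ⟨h1, h2, h3⟩
    have hctx : Ctx n m Q R W (s'.setVar 4 i) :=
      (hc₁.frame hfr (by simp [Cmd.KeepsVar, Cmd.KeepsArr])).congr rfl rfl rfl rfl rfl rfl
    have hk' : (s'.setVar 4 i).var 9 = k := (hfr.1 9 (by simp [Cmd.KeepsVar])).trans hk₁
    have hpop : (popcountT (.var 4)).eval (s'.setVar 4 i) [] = popcount m i :=
      eval_popcountT hctx fun _ => State.setVar_var_self _ _ _
    have hsucc : c (i + 1) = if popcount m i = k then c i + 1 else c i := by
      simp only [c, Finset.range_add_one, Finset.filter_insert]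
      split_ifs
      · rw [Finset.card_insert_of_notMem (by simp)]
      · rfl
    have hciM : (c i : ℤ) + 1 ≤ M := by have := hcle i; exact_mod_cast (by omega : c i + 1 ≤ M)
    have hv4 : (s'.setVar 4 i).var 4 = i := State.setVar_var_self _ _ _
    have hv14 : (s'.setVar 4 i).var 14 = c i := h1
    refine .ite (fun hne => .seq (.write ?_ (.assign ?_ ?_))) (fun heq => ?_)
    · simp only [Term.eval_var, hv4]
      rw [abs_of_nonneg (by positivity)]; exact_mod_cast (by omega : i ≤ M)
    · simp only [Term.eval_add, Term.eval_var, Term.eval_one]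
      rw [show ((s'.setVar 4 i).setArr 6 _ _).var 14 = c i from h1,
        abs_of_nonneg (by positivity)]
      simpa [limit] using hciM
    · have hpk : popcount m i = k := by
        rw [Term.eval_eq, hpop, Term.eval_var, hk'] at hne
        exact ieq_ne_zero.1 hne
      simp only [Term.eval_add, Term.eval_var, Term.eval_one, hv4, hv14]
      rw [if_pos hpk] at hsucc
      have harr : ∀ z : ℤ, (((s'.setVar 4 i).setArr 6 (c i : ℤ) i).setVar 14
          (((s'.setVar 4 i).setArr 6 (c i : ℤ) i).var 14 + 1)).arr 6 z =
          if z = c i then (i : ℤ) else s'.arr 6 z := by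
        intro z
        simp [State.setVar, State.setArr, Function.update_apply]
      refine ⟨?_, ?_, ?_⟩
      · rw [State.setVar_var_self, show ((s'.setVar 4 i).setArr 6 _ _).var 14 = c i from h1, hsucc]
        push_cast; ring
      · intro j hj
        rw [harr]
        rw [hsucc] at hj
        rcases Nat.lt_succ_iff_lt_or_eq.1 hj with h | rfl
        · obtain ⟨x, hx, hx', hx''⟩ := h2 j h
          refine ⟨x, by omega, hx', ?_⟩
          rw [if_neg (by exact_mod_cast h.ne)]; exact hx''
        · exact ⟨i, by omega, hpk, by simp⟩
      · intro x hx hxk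
        rw [hsucc]
        rcases Nat.lt_succ_iff_lt_or_eq.1 hx with h | rfl
        · obtain ⟨j, hj, hj'⟩ := h3 x h hxk
          refine ⟨j, by omega, ?_⟩
          rw [harr, if_neg (by exact_mod_cast hj.ne)]; exact hj'
        · exact ⟨c x, by omega, by rw [harr]; simp⟩
    · have hpk : popcount m i ≠ k := by
        rw [Term.eval_eq, hpop, Term.eval_var, hk'] at heq
        exact fun hcon => ieq_ne_zero.2 hcon heq
      rw [if_neg hpk] at hsucc
      refine (Cmd.Spec.skip ?_ : Cmd.skip.Spec M L _ 1 _).mono (by omega) (fun _ _ h => h)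
      rw [hsucc]
      refine ⟨h1, fun j hj => ?_, fun x hx hxk => ?_⟩
      · obtain ⟨x, hx, hx'⟩ := h2 j hj
        exact ⟨x, by omega, hx'⟩
      · rcases Nat.lt_succ_iff_lt_or_eq.1 hx with h | rfl
        · exact h3 x h hxk
        · exact absurd hxk hpk

/-! ### The dimension of the matrices -/

/-- Computes in variables `15`, `16` and `17` the powers `N ^ κ`, `κ` and `R ^ κ` for the least `κ`
such that `N ^ κ` is at least the contents of variable `14`. -/
def dimCmd (N R : ℕ) : Cmd :=
  .assign 15 1 ;; .assign 16 0 ;; .assign 17 1 ;;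
    .loop 4 (.var 1) (.ite ((Term.var 15).lt (.var 14))
      (.assign 15 (.var 15 * .const N) ;; .assign 16 (.var 16 + 1) ;;
        .assign 17 (.var 17 * .const R)) .skip)

/-- Since c ≤ 2^m ≤ N^m, m rounds are enough. The minimality of κ is recorded for the running time:
the padded dimension exceeds c by a factor below N, unless κ = 0. -/
lemma dimCmd_spec {n m Q R c M L : ℕ} {W : ℤ → ℤ} {s : State} (hs : Ctx n m Q R W s) (N R' : ℕ)
    (hN : 2 ≤ N) (hNR : N ≤ R') (hc : s.var 14 = c) (hcm : c ≤ 2 ^ m) (hM : R' ^ m ≤ M)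
    (hmM : m ≤ M) :
    (dimCmd N R').Spec M L s (1 + (1 + (1 + (1 + m * (1 + 4))))) fun s' =>
      ∃ κ ≤ m, s'.var 15 = (N ^ κ : ℕ) ∧ s'.var 16 = κ ∧ s'.var 17 = (R' ^ κ : ℕ) ∧
        c ≤ N ^ κ ∧ (κ = 0 ∨ N ^ (κ - 1) < c) := by
  have hM1 : 1 ≤ M := le_trans (Nat.one_le_pow _ _ (by omega)) hM
  have hlim : ∀ z : ℤ, 0 ≤ z → z ≤ M → |z| ≤ M := fun z h0 h1 => by rwa [abs_of_nonneg h0]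
  refine .seq (.assign (by simpa [limit] using hM1) (.seq (.assign (by simp)
    (.seq (.assign (by simpa [limit] using hM1) ?_)))))
  simp only [Term.eval_one, Term.eval_zero]
  set s₁ := ((s.setVar 15 1).setVar 16 0).setVar 17 1 with hs₁
  have hc₁ : Ctx n m Q R W s₁ := hs.congr rfl rfl rfl rfl rfl rfl
  refine (Cmd.Spec.loop (m := m) (k := 1 + (1 + (1 + 1))) (by simp [hc₁.var_one])
    (by simp [limit]; omega)
    (fun i s' => ∃ κ ≤ i, s'.var 15 = (N ^ κ : ℕ) ∧ s'.var 16 = κ ∧ s'.var 17 = (R' ^ κ : ℕ) ∧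
      (κ = i ∨ c ≤ N ^ κ) ∧ (κ = 0 ∨ N ^ (κ - 1) < c)) ?_ ?_).mono le_rfl ?_
  · exact ⟨0, le_rfl, by simp [hs₁, State.setVar], by simp [hs₁, State.setVar],
      by simp [hs₁, State.setVar], Or.inl rfl, Or.inl rfl⟩
  · rintro i hi s' hfr ⟨κ, hκ, h15, h16, h17, h1, h2⟩
    have h14 : s'.var 14 = c := (hfr.1 14 (by simp [Cmd.KeepsVar])).trans hc
    have hpowM : R' ^ (κ + 1) ≤ M := (Nat.pow_le_pow_right (by omega) (by omega)).trans hM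
    have hpowN : N ^ (κ + 1) ≤ M := (Nat.pow_le_pow_left hNR _).trans hpowM
    have hκM : κ + 1 ≤ M := by omega
    refine .ite (fun hne => ?_) (fun heq => ?_)
    · have hlt : N ^ κ < c := by
        simp only [Term.eval_lt, Term.eval_var] at hne
        rw [show (s'.setVar 4 i).var 15 = _ from h15, show (s'.setVar 4 i).var 14 = _ from h14]
          at hne
        exact_mod_cast ilt_ne_zero.1 hne
      have e15 : (Term.var 15 * .const N).eval (s'.setVar 4 i) [] = (N ^ (κ + 1) : ℕ) := by
        simp only [Term.eval_mul, Term.eval_var, Term.eval_const]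
        rw [show (s'.setVar 4 i).var 15 = _ from h15, pow_succ]; push_cast; ring
      refine .seq (.assign ?_ (.seq (.assign ?_ (.assign ?_ ?_))))
      · rw [e15]; exact hlim _ (by positivity) (by exact_mod_cast hpowN)
      · simp only [Term.eval_add, Term.eval_var, Term.eval_one]
        rw [show ((s'.setVar 4 i).setVar 15 _).var 16 = _ from h16]
        exact hlim _ (by positivity) (by exact_mod_cast hκM)
      · simp only [Term.eval_mul, Term.eval_var, Term.eval_const]
        rw [show (((s'.setVar 4 i).setVar 15 _).setVar 16 _).var 17 = _ from h17]
        refine hlim _ (by positivity) ?_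
        rw [pow_succ] at hpowM
        exact_mod_cast hpowM
      · refine ⟨κ + 1, by omega, ?_, ?_, ?_, ?_, Or.inr (by simpa using hlt)⟩
        · rw [State.setVar_var_of_ne _ _ (by norm_num), State.setVar_var_of_ne _ _ (by norm_num),
            State.setVar_var_self, e15]
        · rw [State.setVar_var_of_ne _ _ (by norm_num), State.setVar_var_self]
          simp only [Term.eval_add, Term.eval_var, Term.eval_one]
          rw [show ((s'.setVar 4 i).setVar 15 _).var 16 = _ from h16]; push_cast; ring
        · rw [State.setVar_var_self]
          simp only [Term.eval_mul, Term.eval_var, Term.eval_const]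
          rw [show (((s'.setVar 4 i).setVar 15 _).setVar 16 _).var 17 = _ from h17, pow_succ]
          push_cast; ring
        · left
          rcases h1 with h | h
          · omega
          · omega
    · have hle : c ≤ N ^ κ := by
        simp only [Term.eval_lt, Term.eval_var] at heq
        rw [show (s'.setVar 4 i).var 15 = _ from h15, show (s'.setVar 4 i).var 14 = _ from h14]
          at heq
        by_contra hcon
        exact ilt_ne_zero.2 (by exact_mod_cast (by omega : N ^ κ < c)) heq
      refine (Cmd.Spec.skip ?_ : Cmd.skip.Spec M L _ 1 _).mono (by omega) (fun _ _ h => h)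
      exact ⟨κ, by omega, h15, h16, h17, Or.inr hle, h2⟩
  · rintro s' - ⟨κ, hκ, h15, h16, h17, h1, h2⟩
    refine ⟨κ, hκ, h15, h16, h17, ?_, h2⟩
    rcases h1 with rfl | h
    · exact hcm.trans (Nat.pow_le_pow_left hN _)
    · exact h

end OLA

namespace OLA

/-! ### Matrix multiplication by levels -/

lemma flat_lt {t i j T D : ℕ} (ht : t < T) (hi : i < D) (hj : j < D) :
    (t * D + i) * D + j < T * D * D := by
  have h1 : t * D + i + 1 ≤ T * D := by
    calc t * D + i + 1 ≤ (t + 1) * D := by rw [Nat.succ_mul]; omega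
      _ ≤ _ := Nat.mul_le_mul_right _ ht
  calc (t * D + i) * D + j < (t * D + i + 1) * D := by rw [Nat.succ_mul]; omega
    _ ≤ _ := Nat.mul_le_mul_right _ h1

lemma add_mul_div_of_lt {a b D : ℕ} (h : b < D) : (a * D + b) / D = a := by
  rw [mul_comm, Nat.mul_add_div (by omega), Nat.div_eq_of_lt h, add_zero]

lemma add_mul_mod_of_lt {a b D : ℕ} (h : b < D) : (a * D + b) % D = b := by
  rw [mul_comm, Nat.mul_add_mod, Nat.mod_eq_of_lt h]

lemma mul_add_lt_mul {a b N D : ℕ} (ha : a < N) (hb : b < D) : a * D + b < N * D := by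
  calc a * D + b < (a + 1) * D := by rw [Nat.succ_mul]; omega
    _ ≤ _ := Nat.mul_le_mul_right _ ha

namespace BilinearScheme

variable (S : BilinearScheme)

/-- The number of entries on a level. -/
def levelSize (κ l : ℕ) : ℕ := S.R ^ l * S.N ^ (κ - l) * S.N ^ (κ - l)

/-- The linear combinations of the entries of one factor on the levels, in row order. -/
def up (κ : ℕ) (f : ℕ → ℕ → ℤ) (X : ℕ → ℤ) : ℕ → ℕ → ℤ
  | 0, z => X z
  | l + 1, z => ∑ x ∈ Finset.range (S.N * S.N), f (z / S.N ^ (κ - l - 1) / S.N ^ (κ - l - 1) % S.R) x *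
      up κ f X l ((z / S.N ^ (κ - l - 1) / S.N ^ (κ - l - 1) / S.R * (S.N ^ (κ - l - 1) * S.N) +
        (x / S.N * S.N ^ (κ - l - 1) + z / S.N ^ (κ - l - 1) % S.N ^ (κ - l - 1))) *
          (S.N ^ (κ - l - 1) * S.N) + (x % S.N * S.N ^ (κ - l - 1) + z % S.N ^ (κ - l - 1)))

/-- The entries of the products on the levels, in row order; `d` counts from the last level. -/
def down (F : ℕ → ℤ) : ℕ → ℕ → ℤ
  | 0, z => F z
  | d + 1, z => ∑ t ∈ Finset.range S.R, S.c t (z / (S.N ^ d * S.N) % (S.N ^ d * S.N) / S.N ^ d * S.N +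
        z % (S.N ^ d * S.N) / S.N ^ d) *
      down F d (((z / (S.N ^ d * S.N) / (S.N ^ d * S.N) * S.R + t) * S.N ^ d +
        z / (S.N ^ d * S.N) % (S.N ^ d * S.N) % S.N ^ d) * S.N ^ d + z % (S.N ^ d * S.N) % S.N ^ d)

lemma N_pos : 0 < S.N := by have := S.two_le; omega

lemma R_pos : 0 < S.R := lt_of_lt_of_le (Nat.mul_pos S.N_pos S.N_pos) S.sq_le

/-- By N² ≤ R the number of entries does not decrease from level to level. Hence each level l can be
stored in the segment of length R^κ that begins at l·R^κ. -/
lemma levelSize_le {κ l : ℕ} (h : l ≤ κ) : S.levelSize κ l ≤ S.R ^ κ := by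
  rw [levelSize, mul_assoc, ← mul_pow]
  calc _ ≤ S.R ^ l * S.R ^ (κ - l) := Nat.mul_le_mul_left _ (Nat.pow_le_pow_left S.sq_le _)
    _ = _ := by rw [← pow_add]; congr 1; omega

/-- This is `BilinearScheme.levels`, with entry (i, j) of matrix t on level l stored at index (t·D +
i)·D + j for D = N^(κ-l). The quotients and remainders in `up` and `down` decode such indices. -/
lemma down_up (κ : ℕ) (A B : ℕ → ℤ) {i k : ℕ} (hi : i < S.N ^ κ) (hk : k < S.N ^ κ) :
    S.down (fun z => S.up κ S.a A κ z * S.up κ S.b B κ z) κ (i * S.N ^ κ + k) =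
      S.scale ^ κ * ∑ j ∈ Finset.range (S.N ^ κ), A (i * S.N ^ κ + j) * B (j * S.N ^ κ + k) := by
  have hup : ∀ (f : ℕ → ℕ → ℤ) (X : ℕ → ℤ), ∀ l < κ, ∀ t < S.R ^ l, ∀ t' < S.R,
      ∀ i < S.N ^ (κ - l - 1), ∀ j < S.N ^ (κ - l - 1),
      S.up κ f X (l + 1) (((t * S.R + t') * S.N ^ (κ - (l + 1)) + i) * S.N ^ (κ - (l + 1)) + j) =
      ∑ x ∈ Finset.range (S.N * S.N), f t' x * S.up κ f X l ((t * S.N ^ (κ - l) +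
        ((x / S.N) * S.N ^ (κ - l - 1) + i)) * S.N ^ (κ - l) +
        ((x % S.N) * S.N ^ (κ - l - 1) + j)) := by
    intro f X l hl t ht t' ht' i hi j hj
    have e : κ - (l + 1) = κ - l - 1 := by omega
    have e2 : S.N ^ (κ - l) = S.N ^ (κ - l - 1) * S.N := by rw [← pow_succ]; congr 1; omega
    rw [e, e2, up, add_mul_div_of_lt hj, add_mul_mod_of_lt hj, add_mul_div_of_lt hi,
      add_mul_mod_of_lt hi, add_mul_div_of_lt ht', add_mul_mod_of_lt ht']
  have h := S.levels κ (fun l t i j => S.up κ S.a A l ((t * S.N ^ (κ - l) + i) * S.N ^ (κ - l) + j))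
    (fun l t i j => S.up κ S.b B l ((t * S.N ^ (κ - l) + i) * S.N ^ (κ - l) + j))
    (fun l t i j => S.down (fun z => S.up κ S.a A κ z * S.up κ S.b B κ z) (κ - l)
      ((t * S.N ^ (κ - l) + i) * S.N ^ (κ - l) + j)) (hup S.a A) (hup S.b B)
    (fun t _ => by simp [down]) ?_ κ 0 (by omega) 0 (by simp) i hi k hk
  · simpa [up] using h
  · intro l hl t ht p hp q hq i hi j hj
    obtain ⟨d, rfl⟩ : ∃ d, κ = l + 1 + d := ⟨κ - (l + 1), by omega⟩
    have e1 : l + 1 + d - l = d + 1 := by omega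
    have e2 : l + 1 + d - (l + 1) = d := by omega
    have e3 : l + 1 + d - l - 1 = d := by omega
    rw [e3] at hi hj
    simp only [e1, e2, Nat.add_sub_cancel]
    have hpi : p * S.N ^ d + i < S.N ^ d * S.N := by
      rw [mul_comm (S.N ^ d)]; exact mul_add_lt_mul hp hi
    have hqj : q * S.N ^ d + j < S.N ^ d * S.N := by
      rw [mul_comm (S.N ^ d)]; exact mul_add_lt_mul hq hj
    rw [down, pow_succ, add_mul_div_of_lt hqj, add_mul_mod_of_lt hqj, add_mul_div_of_lt hpi,
      add_mul_mod_of_lt hpi, add_mul_div_of_lt hi, add_mul_mod_of_lt hi, add_mul_div_of_lt hj,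
      add_mul_mod_of_lt hj]

/-- Each level forms sums of N² terms with coefficients at most Z. -/
lemma abs_up_le (κ : ℕ) {f : ℕ → ℕ → ℤ} {X : ℕ → ℤ} {Z : ℕ} (hf : ∀ t x, |f t x| ≤ Z)
    (hX : ∀ z, |X z| ≤ 1) : ∀ l z, |S.up κ f X l z| ≤ ((S.N * S.N * Z) ^ l : ℕ) := by
  intro l
  induction l with
  | zero => simpa [up] using hX
  | succ l ih =>
    intro z
    rw [up]
    refine (Finset.abs_sum_le_sum_abs _ _).trans ?_
    calc _ ≤ ∑ _x ∈ Finset.range (S.N * S.N), (Z : ℤ) * ((S.N * S.N * Z) ^ l : ℕ) := by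
          refine Finset.sum_le_sum fun x _ => ?_
          rw [abs_mul]
          exact mul_le_mul (hf _ _) (ih _) (abs_nonneg _) (by positivity)
      _ = _ := by
          rw [Finset.sum_const, Finset.card_range, nsmul_eq_mul, pow_succ]; push_cast; ring

lemma abs_down_le {F : ℕ → ℤ} {Y : ℕ} (hF : ∀ z, |F z| ≤ Y) :
    ∀ d z, |S.down F d z| ≤ ((S.R * S.coefBound) ^ d * Y : ℕ) := by
  intro d
  induction d with
  | zero => simpa [down] using hF
  | succ d ih =>
    intro z
    rw [down]
    refine (Finset.abs_sum_le_sum_abs _ _).trans ?_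
    calc _ ≤ ∑ _x ∈ Finset.range S.R, (S.coefBound : ℤ) *
          ((S.R * S.coefBound) ^ d * Y : ℕ) := by
          refine Finset.sum_le_sum fun x _ => ?_
          rw [abs_mul]
          exact mul_le_mul (S.abs_c_le _ _) (ih _) (abs_nonneg _) (by positivity)
      _ = _ := by
          rw [Finset.sum_const, Finset.card_range, nsmul_eq_mul, pow_succ]; push_cast; ring

/-- A bound for all numbers in the multiplication of matrices. -/
def magnitude : ℕ := S.R * (S.coefBound + 1)

lemma up_magnitude (κ : ℕ) {f : ℕ → ℕ → ℤ} {X : ℕ → ℤ} (hf : ∀ t x, |f t x| ≤ S.coefBound)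
    (hX : ∀ z, |X z| ≤ 1) {l : ℕ} (hl : l ≤ κ) (z : ℕ) :
    |S.up κ f X l z| ≤ (S.magnitude ^ κ : ℕ) := by
  refine (S.abs_up_le κ hf hX l z).trans ?_
  have h : S.N * S.N * S.coefBound ≤ S.magnitude :=
    Nat.mul_le_mul S.sq_le (Nat.le_succ _)
  have h1 : 1 ≤ S.magnitude := Nat.mul_pos S.R_pos (Nat.succ_pos _)
  exact_mod_cast (Nat.pow_le_pow_left h l).trans (Nat.pow_le_pow_right h1 hl)

/-- Two factors `magnitude ^ κ` come from the two factors of the products on the last level, and a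
third one from the levels on the way back. -/
lemma down_magnitude (κ : ℕ) {A B : ℕ → ℤ} (hA : ∀ z, |A z| ≤ 1) (hB : ∀ z, |B z| ≤ 1)
    {d : ℕ} (hd : d ≤ κ) (z : ℕ) :
    |S.down (fun z => S.up κ S.a A κ z * S.up κ S.b B κ z) d z| ≤ (S.magnitude ^ (3 * κ) : ℕ) := by
  have hF : ∀ z, |S.up κ S.a A κ z * S.up κ S.b B κ z| ≤
      (S.magnitude ^ κ * S.magnitude ^ κ : ℕ) := by
    intro z
    rw [abs_mul]; push_cast
    exact_mod_cast mul_le_mul (S.up_magnitude κ S.abs_a_le hA le_rfl z)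
      (S.up_magnitude κ S.abs_b_le hB le_rfl z) (abs_nonneg _) (by positivity)
  refine (S.abs_down_le hF d z).trans ?_
  have h : S.R * S.coefBound ≤ S.magnitude := Nat.mul_le_mul_left _ (Nat.le_succ _)
  have h1 : 1 ≤ S.magnitude := Nat.mul_pos S.R_pos (Nat.succ_pos _)
  have h2 := (Nat.pow_le_pow_left h d).trans (Nat.pow_le_pow_right h1 hd)
  have h3 : S.magnitude ^ (3 * κ) = S.magnitude ^ κ * (S.magnitude ^ κ * S.magnitude ^ κ) := by
    rw [← pow_add, ← pow_add]; congr 1; ring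
  rw [h3]
  exact_mod_cast Nat.mul_le_mul_right _ h2

/-- The table of the coefficients of the linear combinations. -/
def table (f : ℕ → ℕ → ℤ) (y : ℕ) : ℤ := f (y / (S.N * S.N)) (y % (S.N * S.N))

/-- The coefficients `f` as a term. -/
def coefT (f : ℕ → ℕ → ℤ) (t x : Term) : Term :=
  lookupT (S.table f) (S.R * (S.N * S.N)) (t * .const (S.N * S.N : ℕ) + x)

lemma eval_coefT {s : State} {ρ : List ℤ} (f : ℕ → ℕ → ℤ) {t x : Term} {t' x' : ℕ}
    (ht : t.eval s ρ = t') (hx : x.eval s ρ = x') (ht' : t' < S.R) (hx' : x' < S.N * S.N) :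
    (S.coefT f t x).eval s ρ = f t' x' := by
  rw [coefT, eval_lookupT _ _ _ _ (t' * (S.N * S.N) + x'), if_pos (mul_add_lt_mul ht' hx'), table,
    add_mul_div_of_lt hx', add_mul_mod_of_lt hx']
  simp only [Term.eval_add, Term.eval_mul, Term.eval_const, ht, hx]
  push_cast; ring

/-- Computes the next level in array `a`; variables `15`, `16` and `17` hold `N ^ κ`, `κ` and
`R ^ κ`. -/
def upCmd (a : ℕ) (f : ℕ → ℕ → ℤ) : Cmd :=
  .assign 19 (.var 15) ;; .assign 20 1 ;; .loop 18 (.var 16)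
    (.assign 19 (.var 19 / .const S.N) ;; .assign 20 (.var 20 * .var 3) ;;
      .loop 4 (.var 20 * .var 19 * .var 19) (.write a ((.var 18 + 1) * .var 17 + .var 4)
        (.sum 2 (S.coefT f (.var 4 / .var 19 / .var 19 % .var 3) (.bvar 0) *
          .read a (.var 18 * .var 17 +
            ((.var 4 / .var 19 / .var 19 / .var 3 * (.var 19 * .const S.N) +
              (.bvar 0 / .const S.N * .var 19 + .var 4 / .var 19 % .var 19)) *
              (.var 19 * .const S.N) +
              (.bvar 0 % .const S.N * .var 19 + .var 4 % .var 19)))))))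

/-- Computes the products on the last level. -/
def prodCmd : Cmd :=
  .loop 4 (.var 17) (.write 9 (.var 16 * .var 17 + .var 4)
    (.read 7 (.var 16 * .var 17 + .var 4) * .read 8 (.var 16 * .var 17 + .var 4)))

/-- Computes the products on all levels from those on the last level. -/
def downCmd : Cmd :=
  .loop 18 (.var 16)
    (.assign 19 (.var 19 * .const S.N) ;; .assign 20 (.var 20 / .var 3) ;;
      .loop 4 (.var 20 * .var 19 * .var 19)
        (.write 9 ((.var 16 - 1 - .var 18) * .var 17 + .var 4)
        (.sum 3 (S.coefT S.c (.bvar 0) (.var 4 / .var 19 % .var 19 / (.var 19 / .const S.N) *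
            .const S.N + .var 4 % .var 19 / (.var 19 / .const S.N)) *
          .read 9 ((.var 16 - .var 18) * .var 17 +
            (((.var 4 / .var 19 / .var 19 * .var 3 + .bvar 0) * (.var 19 / .const S.N) +
              .var 4 / .var 19 % .var 19 % (.var 19 / .const S.N)) * (.var 19 / .const S.N) +
              .var 4 % .var 19 % (.var 19 / .const S.N)))))))

variable {S} {n m κ M L : ℕ} {W : ℤ → ℤ} {s : State}

/-- The memory holds the size of the matrices. -/
structure Dim (S : BilinearScheme) (κ : ℕ) (s : State) : Prop where
  var_15 : s.var 15 = (S.N ^ κ : ℕ)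
  var_16 : s.var 16 = κ
  var_17 : s.var 17 = (S.R ^ κ : ℕ)

lemma Dim.congr {s' : State} (h : Dim S κ s) (h0 : s'.var 15 = s.var 15)
    (h1 : s'.var 16 = s.var 16) (h2 : s'.var 17 = s.var 17) : Dim S κ s' :=
  ⟨h0.trans h.1, h1.trans h.2, h2.trans h.3⟩

/-- After i rounds the levels up to i are stored. Level 0 has to survive, because the original
matrices are consulted again after the product is known. -/
lemma upCmd_spec {a : ℕ} {f : ℕ → ℕ → ℤ} {X : ℕ → ℤ} (ha : a = 7 ∨ a = 8)
    (hs : Ctx n m (S.N * S.N) S.R W s) (hd : Dim S κ s)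
    (hf : ∀ t x, |f t x| ≤ S.coefBound) (hX : ∀ z, |X z| ≤ 1)
    (hXs : ∀ z < S.N ^ κ * S.N ^ κ, s.arr a (z : ℤ) = X z)
    (hM : S.magnitude ^ (3 * κ) ≤ M) (hκM : κ ≤ M) :
    (S.upCmd a f).Spec M L s (3 + κ * (4 + 2 * S.R ^ κ)) fun s' =>
      s'.var 19 = 1 ∧ s'.var 20 = (S.R ^ κ : ℕ) ∧
      (∀ z < S.N ^ κ * S.N ^ κ, s'.arr a (z : ℤ) = X z) ∧
      ∀ z < S.R ^ κ, s'.arr a ((κ * S.R ^ κ + z : ℕ) : ℤ) = S.up κ f X κ z := by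
  have hR := S.R_pos
  have hN := S.N_pos
  have hmag : 1 ≤ S.magnitude := Nat.mul_pos S.R_pos (Nat.succ_pos _)
  have hmagκ : S.magnitude ^ κ ≤ M :=
    (Nat.pow_le_pow_right hmag (by omega)).trans hM
  have hRM : S.R ^ κ ≤ M := (Nat.pow_le_pow_left (Nat.le_mul_of_pos_right _ (by omega)) _).trans hmagκ
  have hNR : S.N ≤ S.R := (Nat.le_mul_of_pos_right _ hN).trans S.sq_le
  have hNM : S.N ^ κ ≤ M := (Nat.pow_le_pow_left hNR _).trans hRM
  have hM1 : 1 ≤ M := le_trans (Nat.one_le_pow _ _ hR) hRM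
  have hlim : ∀ z : ℕ, z ≤ M → |(z : ℤ)| ≤ M := fun z h1 => by
    rw [abs_of_nonneg (by positivity)]; exact_mod_cast h1
  refine (Cmd.Spec.seq (k₁ := 1) (.assign ?_ (.seq (k₁ := 1) (.assign ?_ ?_)))).mono
    (by rw [show 4 + 2 * S.R ^ κ = 1 + (1 + (1 + (1 + S.R ^ κ * (1 + 1)))) by ring]; omega :
      1 + (1 + (1 + κ * (1 + (1 + (1 + (1 + S.R ^ κ * (1 + 1))))))) ≤ _)
    (fun _ _ h => h)
  · rw [Term.eval_var, hd.var_15]; exact hlim _ hNM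
  · simpa [limit] using hM1
  simp only [Term.eval_var, Term.eval_one, hd.var_15]
  set s₁ := (s.setVar 19 ((S.N ^ κ : ℕ) : ℤ)).setVar 20 1 with hs₁
  have hc₁ : Ctx n m (S.N * S.N) S.R W s₁ := hs.congr rfl rfl rfl rfl rfl rfl
  have hd₁ : Dim S κ s₁ := hd.congr rfl rfl rfl
  refine (Cmd.Spec.loop (m := κ) (by simp [hd₁.var_16]) (by simp [limit]; omega)
    (fun i s' => s'.var 19 = (S.N ^ (κ - i) : ℕ) ∧ s'.var 20 = (S.R ^ i : ℕ) ∧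
      ∀ l ≤ i, ∀ z < S.levelSize κ l, s'.arr a ((l * S.R ^ κ + z : ℕ) : ℤ) = S.up κ f X l z)
      ?_ ?_).mono le_rfl ?_
  · refine ⟨by simp [hs₁, State.setVar], by simp [hs₁, State.setVar], ?_⟩
    intro l hl z hz
    obtain rfl : l = 0 := by omega
    have := hXs z (by simpa [levelSize] using hz)
    simpa [up, hs₁, State.setVar] using this
  · rintro l hl s' hfr ⟨h19, h20, hlev⟩
    have hc' : Ctx n m (S.N * S.N) S.R W (s'.setVar 18 l) :=
      (hc₁.frame hfr (by rcases ha with rfl | rfl <;> simp [Cmd.KeepsVar, Cmd.KeepsArr])).congr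
        rfl rfl rfl rfl rfl rfl
    have hd' : Dim S κ (s'.setVar 18 l) :=
      hd₁.congr (hfr.1 _ (by simp [Cmd.KeepsVar])) (hfr.1 _ (by simp [Cmd.KeepsVar]))
        (hfr.1 _ (by simp [Cmd.KeepsVar]))
    set D := S.N ^ (κ - l - 1) with hD
    have hDpos : 0 < D := Nat.pow_pos hN
    have hD' : S.N ^ (κ - l) = D * S.N := by rw [hD, ← pow_succ]; congr 1; omega
    have e19 : (Term.var 19 / .const S.N).eval (s'.setVar 18 l) [] = (D : ℕ) := by
      simp only [Term.eval_div, Term.eval_var, Term.eval_const]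
      rw [show (s'.setVar 18 l).var 19 = _ from h19, hD']
      norm_cast
      rw [Nat.mul_div_cancel _ hN]
    have hDM : D ≤ M := (Nat.pow_le_pow_right hN (by omega)).trans hNM
    have hRlM : S.R ^ (l + 1) ≤ M := (Nat.pow_le_pow_right hR (by omega)).trans hRM
    refine .seq (.assign (by rw [e19]; exact hlim _ hDM) ?_)
    rw [e19]
    have e20 : (Term.var 20 * .var 3).eval ((s'.setVar 18 l).setVar 19 (D : ℕ)) [] =
        (S.R ^ (l + 1) : ℕ) := by
      simp only [Term.eval_mul, Term.eval_var]
      rw [show ((s'.setVar 18 l).setVar 19 _).var 20 = _ from h20,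
        show ((s'.setVar 18 l).setVar 19 _).var 3 = _ from hc'.var_three, pow_succ]
      norm_cast
    refine .seq (.assign (by rw [e20]; exact hlim _ hRlM) ?_)
    rw [e20]
    set s₂ := ((s'.setVar 18 l).setVar 19 (D : ℕ)).setVar 20 (S.R ^ (l + 1) : ℕ) with hs₂
    have hsz : S.levelSize κ (l + 1) = S.R ^ (l + 1) * D * D := by
      rw [levelSize, hD]; rfl
    have hszle : S.levelSize κ (l + 1) ≤ S.R ^ κ := S.levelSize_le (by omega)
    have h182 : s₂.var 18 = l := by simp [hs₂, State.setVar]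
    have h192 : s₂.var 19 = D := by simp [hs₂, State.setVar]
    have h202 : s₂.var 20 = (S.R ^ (l + 1) : ℕ) := by simp [hs₂, State.setVar]
    have hc₂ : Ctx n m (S.N * S.N) S.R W s₂ := hc'.congr rfl rfl rfl rfl rfl rfl
    have hd₂ : Dim S κ s₂ := hd'.congr rfl rfl rfl
    have harr₂ : s₂.arr a = s'.arr a := rfl
    refine (Cmd.Spec.fill (m := S.levelSize κ (l + 1)) ?_ (by simp [limit]; omega)
      (fun z => (((l + 1) * S.R ^ κ + z : ℕ) : ℤ)) (fun z => S.up κ f X (l + 1) z) ?_ ?_ ?_).mono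
      (by gcongr) ?_
    · simp only [Term.eval_mul, Term.eval_var, h202, h192, hsz]; norm_cast
    · intro i _ j _ hij; have := Int.natCast_inj.1 hij; omega
    · intro i _
      exact (S.up_magnitude κ hf hX (by omega) i).trans (by exact_mod_cast hmagκ)
    · intro z hz s₃ hv ha3 h4 hdone hkeep
      have h18 : s₃.var 18 = l := (hv 18 (by norm_num)).trans h182
      have h19 : s₃.var 19 = D := (hv 19 (by norm_num)).trans h192
      have h17 : s₃.var 17 = (S.R ^ κ : ℕ) := (hv 17 (by norm_num)).trans hd₂.var_17
      have h3 : s₃.var 3 = S.R := (hv 3 (by norm_num)).trans hc₂.var_three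
      have h2 : s₃.var 2 = (S.N * S.N : ℕ) := (hv 2 (by norm_num)).trans hc₂.var_two
      refine ⟨by simp [h18, h17, h4], ?_⟩
      rw [Term.eval_sum, show s₃.var ((2 : Fin 4) : ℕ) = _ from h2, Int.toNat_natCast, up]
      refine Finset.sum_congr rfl fun x hx => ?_
      have hx := Finset.mem_range.1 hx
      rw [Term.eval_mul, S.eval_coefT f (t' := z / D / D % S.R) (x' := x) (by
        simp only [Term.eval_mod, Term.eval_div, Term.eval_var, h4, h19, h3]; norm_cast) (by simp)
        (Nat.mod_lt _ hR) hx]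
      congr 1
      -- The address that is read belongs to the previous level, where the invariant gives its
      -- contents.
      have hlt : (z / D / D / S.R * (D * S.N) + (x / S.N * D + z / D % D)) * (D * S.N) +
          (x % S.N * D + z % D) < S.levelSize κ l := by
        rw [levelSize, hD']
        refine flat_lt ?_ ?_ ?_
        · rw [Nat.div_div_eq_div_mul, Nat.div_div_eq_div_mul]
          refine Nat.div_lt_of_lt_mul ?_
          rw [hsz, pow_succ] at hz
          linarith
        · rw [mul_comm D]
          exact mul_add_lt_mul (Nat.div_lt_of_lt_mul hx) (Nat.mod_lt _ hDpos)
        · rw [mul_comm D]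
          exact mul_add_lt_mul (Nat.mod_lt _ hN) (Nat.mod_lt _ hDpos)
      rw [← hlev l le_rfl _ hlt, ← harr₂, ← hkeep]
      · simp only [Term.eval_read, Term.eval_mod, Term.eval_div, Term.eval_mul, Term.eval_add,
          Term.eval_var, Term.eval_const, Term.eval_bvar, List.getD_cons_zero, h4, h19, h3, h18,
          h17]
        push_cast
        rfl
      -- Level l ends before the address (l + 1)·R^κ at which the writes of this round begin.
      · intro j _ hj
        have := Int.natCast_inj.1 hj
        have h5 := S.levelSize_le hl.le
        rw [Nat.succ_mul] at this
        omega
    · rintro s₃ hfr₃ ⟨hnew, hold⟩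
      refine ⟨?_, ?_, ?_⟩
      · rw [hfr₃.1 19 (by simp [Cmd.KeepsVar]), h192, hD]; congr 2
      · rw [hfr₃.1 20 (by simp [Cmd.KeepsVar]), h202]
      · intro l' hl' z hz
        rcases Nat.le_succ_iff.1 hl' with h | rfl
        · rw [hold, harr₂]
          · exact hlev l' h z hz
          · intro j _ hj
            have := Int.natCast_inj.1 hj
            have h5 := S.levelSize_le (h.trans hl.le)
            have h6 := Nat.mul_le_mul_right (S.R ^ κ) h
            rw [Nat.succ_mul] at this
            omega
        · exact hnew z hz
  · rintro s' - ⟨h19, h20, hlev⟩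
    refine ⟨by simpa using h19, h20, fun z hz => ?_, fun z hz => ?_⟩
    · have := hlev 0 (by omega) z (by simpa [levelSize] using hz)
      simpa [up] using this
    · exact hlev κ le_rfl z (by simpa [levelSize] using hz)

/-- Variables 19 and 20 are taken over from the last execution of `upCmd`, where they end as N^0 and
R^κ. They are now changed in the opposite direction, one level per round. -/
lemma downCmd_spec {A B : ℕ → ℤ} (hs : Ctx n m (S.N * S.N) S.R W s) (hd : Dim S κ s)
    (hA : ∀ z, |A z| ≤ 1) (hB : ∀ z, |B z| ≤ 1) (h19 : s.var 19 = 1)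
    (h20 : s.var 20 = (S.R ^ κ : ℕ))
    (h9 : ∀ z < S.R ^ κ, s.arr 9 ((κ * S.R ^ κ + z : ℕ) : ℤ) = S.up κ S.a A κ z * S.up κ S.b B κ z)
    (hM : S.magnitude ^ (3 * κ) ≤ M) (hκM : κ ≤ M) :
    S.downCmd.Spec M L s (1 + κ * (4 + 2 * S.R ^ κ)) fun s' =>
      ∀ i < S.N ^ κ, ∀ k < S.N ^ κ, s'.arr 9 ((i * S.N ^ κ + k : ℕ) : ℤ) =
        S.scale ^ κ * ∑ j ∈ Finset.range (S.N ^ κ), A (i * S.N ^ κ + j) * B (j * S.N ^ κ + k) := by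
  have hR := S.R_pos
  have hN := S.N_pos
  have hmag : 1 ≤ S.magnitude := Nat.mul_pos S.R_pos (Nat.succ_pos _)
  have hmagκ : S.magnitude ^ κ ≤ M :=
    (Nat.pow_le_pow_right hmag (by omega)).trans hM
  have hRM : S.R ^ κ ≤ M := (Nat.pow_le_pow_left (Nat.le_mul_of_pos_right _ (by omega)) _).trans hmagκ
  have hNR : S.N ≤ S.R := (Nat.le_mul_of_pos_right _ hN).trans S.sq_le
  have hNM : S.N ^ κ ≤ M := (Nat.pow_le_pow_left hNR _).trans hRM
  have hlim : ∀ z : ℕ, z ≤ M → |(z : ℤ)| ≤ M := fun z h1 => by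
    rw [abs_of_nonneg (by positivity)]; exact_mod_cast h1
  set G : ℕ → ℕ → ℤ := S.down (fun z => S.up κ S.a A κ z * S.up κ S.b B κ z) with hG
  refine (Cmd.Spec.loop (k := 1 + (1 + (1 + S.R ^ κ * (1 + 1)))) (m := κ) (by simp [hd.var_16])
    (by simp [limit]; omega)
    (fun d s' => s'.var 19 = (S.N ^ d : ℕ) ∧ s'.var 20 = (S.R ^ (κ - d) : ℕ) ∧
      ∀ z < S.levelSize κ (κ - d), s'.arr 9 (((κ - d) * S.R ^ κ + z : ℕ) : ℤ) = G d z)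
      ?_ ?_).mono (by
        rw [show 4 + 2 * S.R ^ κ = 1 + (1 + (1 + (1 + S.R ^ κ * (1 + 1)))) by ring]) ?_
  · refine ⟨by simpa using h19, by simpa using h20, ?_⟩
    intro z hz
    exact h9 z (by simpa [levelSize] using hz)
  · rintro d hdκ s' hfr ⟨g19, g20, hlev⟩
    have hc' : Ctx n m (S.N * S.N) S.R W (s'.setVar 18 d) :=
      (hs.frame hfr (by simp [Cmd.KeepsVar, Cmd.KeepsArr])).congr rfl rfl rfl rfl rfl rfl
    have hd' : Dim S κ (s'.setVar 18 d) :=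
      hd.congr (hfr.1 _ (by simp [Cmd.KeepsVar])) (hfr.1 _ (by simp [Cmd.KeepsVar]))
        (hfr.1 _ (by simp [Cmd.KeepsVar]))
    obtain ⟨l, rfl⟩ : ∃ l, κ = l + 1 + d := ⟨κ - (d + 1), by omega⟩
    have e1 : l + 1 + d - d = l + 1 := by omega
    have e2 : l + 1 + d - (d + 1) = l := by omega
    rw [e1] at g20 hlev
    rw [e2]
    set D := S.N ^ d with hD
    set RK := S.R ^ (l + 1 + d) with hRK
    have hDpos : 0 < D := Nat.pow_pos hN
    have hD' : S.N ^ (d + 1) = D * S.N := by rw [hD, ← pow_succ]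
    have e19 : (Term.var 19 * .const S.N).eval (s'.setVar 18 d) [] = (D * S.N : ℕ) := by
      simp only [Term.eval_mul, Term.eval_var, Term.eval_const]
      rw [show (s'.setVar 18 d).var 19 = _ from g19]
      norm_cast
    have hDM : D * S.N ≤ M := by
      rw [← hD']; exact (Nat.pow_le_pow_right hN (by omega)).trans hNM
    have hRlM : S.R ^ l ≤ M := (Nat.pow_le_pow_right hR (by omega)).trans hRM
    refine .seq (.assign (by rw [e19]; exact hlim _ hDM) ?_)
    rw [e19]
    have e20 : (Term.var 20 / .var 3).eval ((s'.setVar 18 d).setVar 19 (D * S.N : ℕ)) [] =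
        (S.R ^ l : ℕ) := by
      simp only [Term.eval_div, Term.eval_var]
      rw [show ((s'.setVar 18 d).setVar 19 _).var 20 = _ from g20,
        show ((s'.setVar 18 d).setVar 19 _).var 3 = _ from hc'.var_three, pow_succ]
      norm_cast
      rw [Nat.mul_div_cancel _ hR]
    refine .seq (.assign (by rw [e20]; exact hlim _ hRlM) ?_)
    rw [e20]
    set s₂ := ((s'.setVar 18 d).setVar 19 (D * S.N : ℕ)).setVar 20 (S.R ^ l : ℕ) with hs₂
    have hsz : S.levelSize (l + 1 + d) l = S.R ^ l * (D * S.N) * (D * S.N) := by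
      rw [levelSize, show l + 1 + d - l = d + 1 by omega, hD']
    have hsz' : S.levelSize (l + 1 + d) (l + 1) = S.R ^ (l + 1) * D * D := by
      rw [levelSize, show l + 1 + d - (l + 1) = d by omega]
    have hszle : S.levelSize (l + 1 + d) l ≤ RK := S.levelSize_le (by omega)
    have h182 : s₂.var 18 = d := by simp [hs₂, State.setVar]
    have h192 : s₂.var 19 = (D * S.N : ℕ) := by simp [hs₂, State.setVar]
    have h202 : s₂.var 20 = (S.R ^ l : ℕ) := by simp [hs₂, State.setVar]
    have hc₂ : Ctx n m (S.N * S.N) S.R W s₂ := hc'.congr rfl rfl rfl rfl rfl rfl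
    have hd₂ : Dim S (l + 1 + d) s₂ := hd'.congr rfl rfl rfl
    have harr₂ : s₂.arr 9 = s'.arr 9 := rfl
    refine (Cmd.Spec.fill (m := S.levelSize (l + 1 + d) l) ?_ (by simp [limit]; omega)
      (fun z => ((l * RK + z : ℕ) : ℤ)) (fun z => G (d + 1) z) ?_ ?_ ?_).mono
      (by gcongr) ?_
    · simp only [Term.eval_mul, Term.eval_var, h202, h192, hsz]; norm_cast
    · intro i _ j _ hij; have := Int.natCast_inj.1 hij; omega
    · intro i _
      exact (S.down_magnitude (l + 1 + d) hA hB (by omega) i).trans (by exact_mod_cast hM)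
    · intro z hz s₃ hv ha3 h4 hdone hkeep
      have h18 : s₃.var 18 = d := (hv 18 (by norm_num)).trans h182
      have h19 : s₃.var 19 = (D * S.N : ℕ) := (hv 19 (by norm_num)).trans h192
      have h17 : s₃.var 17 = RK := (hv 17 (by norm_num)).trans hd₂.var_17
      have h16 : s₃.var 16 = (l + 1 + d : ℕ) := (hv 16 (by norm_num)).trans hd₂.var_16
      have h3 : s₃.var 3 = S.R := (hv 3 (by norm_num)).trans hc₂.var_three
      refine ⟨by simp [h18, h17, h16, h4]; left; ring, ?_⟩
      rw [Term.eval_sum, show s₃.var ((3 : Fin 4) : ℕ) = _ from h3, Int.toNat_natCast, hG, down]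
      refine Finset.sum_congr rfl fun x hx => ?_
      have hx := Finset.mem_range.1 hx
      have hDD : 0 < D * S.N := Nat.mul_pos hDpos hN
      have hdivN : D * S.N / S.N = D := Nat.mul_div_cancel _ hN
      have hp : z / (D * S.N) % (D * S.N) / D < S.N := Nat.div_lt_of_lt_mul (Nat.mod_lt _ hDD)
      have hq : z % (D * S.N) / D < S.N := Nat.div_lt_of_lt_mul (Nat.mod_lt _ hDD)
      have hdivZ : ((D * S.N : ℕ) : ℤ) / (S.N : ℤ) = D := by
        rw [← Int.natCast_div, hdivN]
      rw [Term.eval_mul, S.eval_coefT S.c (t' := x)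
        (x' := z / (D * S.N) % (D * S.N) / D * S.N + z % (D * S.N) / D) (by simp) (by
        simp only [Term.eval_mod, Term.eval_div, Term.eval_add, Term.eval_mul, Term.eval_var,
          Term.eval_const, h4, h19, hdivZ]; norm_cast) hx (mul_add_lt_mul hp hq)]
      congr 1
      have hlt : ((z / (D * S.N) / (D * S.N) * S.R + x) * D + z / (D * S.N) % (D * S.N) % D) * D +
          z % (D * S.N) % D < S.levelSize (l + 1 + d) (l + 1) := by
        rw [hsz']
        refine flat_lt ?_ (Nat.mod_lt _ hDpos) (Nat.mod_lt _ hDpos)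
        rw [pow_succ]
        refine mul_add_lt_mul ?_ hx
        rw [Nat.div_div_eq_div_mul]
        refine Nat.div_lt_of_lt_mul ?_
        rw [hsz] at hz
        linarith
      rw [← hG, ← hlev _ hlt, ← harr₂, ← hkeep]
      · simp only [Term.eval_read, Term.eval_mod, Term.eval_div, Term.eval_mul, Term.eval_add,
          Term.eval_sub, Term.eval_var, Term.eval_const, Term.eval_bvar, List.getD_cons_zero, h4,
          h19, h3, h18, h17, h16, hdivZ]
        congr 1
        push_cast
        ring
      -- The entries that are read start at (l + 1)·R^κ, beyond everything written in this round.
      · intro j hj hj'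
        have := Int.natCast_inj.1 hj'
        rw [Nat.succ_mul] at this
        omega
    · rintro s₃ hfr₃ ⟨hnew, hold⟩
      refine ⟨?_, ?_, hnew⟩
      · rw [hfr₃.1 19 (by simp [Cmd.KeepsVar]), h192, hD']
      · rw [hfr₃.1 20 (by simp [Cmd.KeepsVar]), h202]
  · rintro s' - ⟨h19, h20, hlev⟩ i hi k hk
    rw [← S.down_up κ A B hi hk]
    have := hlev (i * S.N ^ κ + k) (by
      rw [Nat.sub_self, levelSize, pow_zero, one_mul]; exact mul_add_lt_mul hi hk)
    simpa using this

lemma prodCmd_spec {U V : ℕ → ℤ} (hd : Dim S κ s)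
    (h7 : ∀ z < S.R ^ κ, s.arr 7 ((κ * S.R ^ κ + z : ℕ) : ℤ) = U z)
    (h8 : ∀ z < S.R ^ κ, s.arr 8 ((κ * S.R ^ κ + z : ℕ) : ℤ) = V z)
    (hUV : ∀ z, |U z * V z| ≤ M) (hRM : S.R ^ κ ≤ M) :
    prodCmd.Spec M L s (1 + 2 * S.R ^ κ) fun s' =>
      ∀ z < S.R ^ κ, s'.arr 9 ((κ * S.R ^ κ + z : ℕ) : ℤ) = U z * V z := by
  refine (Cmd.Spec.fill (m := S.R ^ κ) (by rw [Term.eval_var, hd.var_17, Int.toNat_natCast])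
    (by simp [limit]; omega)
    (fun z => ((κ * S.R ^ κ + z : ℕ) : ℤ)) (fun z => U z * V z) ?_ (fun i _ => hUV i) ?_).mono
    (by omega) (fun _ _ h => h.1)
  · intro i _ j _ hij; have := Int.natCast_inj.1 hij; omega
  · intro z hz s' hv ha h4 _ _
    have e : (Term.var 16 * .var 17 + .var 4).eval s' [] = ((κ * S.R ^ κ + z : ℕ) : ℤ) := by
      simp only [Term.eval_add, Term.eval_mul, Term.eval_var, h4, hv 16 (by norm_num),
        hv 17 (by norm_num), hd.var_16, hd.var_17]
      push_cast; ring
    refine ⟨e, ?_⟩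
    rw [Term.eval_mul, Term.eval_read, Term.eval_read, e, ha 7 (by norm_num), ha 8 (by norm_num),
      h7 z hz, h8 z hz]

variable (S) in
/-- Multiplies the matrices in arrays `7` and `8`; a multiple of the product is left in
array `9`. -/
def mulCmd : Cmd := S.upCmd 7 S.a ;; S.upCmd 8 S.b ;; prodCmd ;; S.downCmd

/-- That arrays 7 and 8 still begin with the factors is part of the result: `findCmd` uses them to
recover the middle mask. -/
lemma mulCmd_spec {A B : ℕ → ℤ} (hs : Ctx n m (S.N * S.N) S.R W s) (hd : Dim S κ s)
    (hA : ∀ z, |A z| ≤ 1) (hB : ∀ z, |B z| ≤ 1)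
    (hAs : ∀ z < S.N ^ κ * S.N ^ κ, s.arr 7 (z : ℤ) = A z)
    (hBs : ∀ z < S.N ^ κ * S.N ^ κ, s.arr 8 (z : ℤ) = B z)
    (hM : S.magnitude ^ (3 * κ) ≤ M) (hκM : κ ≤ M) :
    S.mulCmd.Spec M L s (20 * ((κ + 1) * S.R ^ κ)) fun s' =>
      (∀ z < S.N ^ κ * S.N ^ κ, s'.arr 7 (z : ℤ) = A z) ∧
      (∀ z < S.N ^ κ * S.N ^ κ, s'.arr 8 (z : ℤ) = B z) ∧
      ∀ i < S.N ^ κ, ∀ k < S.N ^ κ, s'.arr 9 ((i * S.N ^ κ + k : ℕ) : ℤ) =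
        S.scale ^ κ * ∑ j ∈ Finset.range (S.N ^ κ), A (i * S.N ^ κ + j) * B (j * S.N ^ κ + k) := by
  have hR := S.R_pos
  have hmag : 1 ≤ S.magnitude := Nat.mul_pos S.R_pos (Nat.succ_pos _)
  have hRM : S.R ^ κ ≤ M := (Nat.pow_le_pow_left (Nat.le_mul_of_pos_right _ (by omega)) _).trans
    ((Nat.pow_le_pow_right hmag (by omega)).trans hM)
  have hsteps : (3 + κ * (4 + 2 * S.R ^ κ)) + ((3 + κ * (4 + 2 * S.R ^ κ)) +
      ((1 + 2 * S.R ^ κ) + (1 + κ * (4 + 2 * S.R ^ κ)))) ≤ 20 * ((κ + 1) * S.R ^ κ) := by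
    have h1 : 1 ≤ S.R ^ κ := Nat.one_le_pow _ _ hR
    have h2 : κ * 1 ≤ κ * S.R ^ κ := Nat.mul_le_mul_left _ h1
    nlinarith
  refine (Cmd.Spec.seq' (upCmd_spec (Or.inl rfl) hs hd S.abs_a_le hA hAs hM hκM) ?_).mono hsteps
    (fun _ _ h => h)
  rintro s₁ hfr₁ ⟨-, -, h71, h7u⟩
  have hs₁ := hs.frame hfr₁ (by simp [upCmd, Cmd.KeepsVar, Cmd.KeepsArr])
  have hd₁ : Dim S κ s₁ := hd.congr (hfr₁.1 _ (by simp [upCmd, Cmd.KeepsVar]))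
    (hfr₁.1 _ (by simp [upCmd, Cmd.KeepsVar])) (hfr₁.1 _ (by simp [upCmd, Cmd.KeepsVar]))
  refine Cmd.Spec.seq' (upCmd_spec (Or.inr rfl) hs₁ hd₁ S.abs_b_le hB (fun z hz => by
    rw [hfr₁.2 8 (by simp [upCmd, Cmd.KeepsArr])]; exact hBs z hz) hM hκM) ?_
  rintro s₂ hfr₂ ⟨h19, h20, h82, h8u⟩
  have hs₂ := hs₁.frame hfr₂ (by simp [upCmd, Cmd.KeepsVar, Cmd.KeepsArr])
  have hd₂ : Dim S κ s₂ := hd₁.congr (hfr₂.1 _ (by simp [upCmd, Cmd.KeepsVar]))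
    (hfr₂.1 _ (by simp [upCmd, Cmd.KeepsVar])) (hfr₂.1 _ (by simp [upCmd, Cmd.KeepsVar]))
  have h72 : s₂.arr 7 = s₁.arr 7 := hfr₂.2 7 (by simp [upCmd, Cmd.KeepsArr])
  refine Cmd.Spec.seq' (prodCmd_spec hd₂ (by rw [h72]; exact h7u) h8u (fun z => ?_) hRM) ?_
  · have := S.down_magnitude κ hA hB (Nat.zero_le κ) z
    rw [down] at this
    exact this.trans (by exact_mod_cast hM)
  rintro s₃ hfr₃ h9
  have hs₃ := hs₂.frame hfr₃ (by simp [prodCmd, Cmd.KeepsVar, Cmd.KeepsArr])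
  have hd₃ : Dim S κ s₃ := hd₂.congr (hfr₃.1 _ (by simp [prodCmd, Cmd.KeepsVar]))
    (hfr₃.1 _ (by simp [prodCmd, Cmd.KeepsVar])) (hfr₃.1 _ (by simp [prodCmd, Cmd.KeepsVar]))
  refine (downCmd_spec hs₃ hd₃ hA hB ((hfr₃.1 _ (by simp [prodCmd, Cmd.KeepsVar])).trans h19)
    ((hfr₃.1 _ (by simp [prodCmd, Cmd.KeepsVar])).trans h20) h9 hM hκM).mono le_rfl ?_
  intro s₄ hfr₄ h
  have h7 : s₄.arr 7 = s₁.arr 7 := (hfr₄.2 7 (by simp [downCmd, Cmd.KeepsArr])).trans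
    ((hfr₃.2 7 (by simp [prodCmd, Cmd.KeepsArr])).trans h72)
  have h8 : s₄.arr 8 = s₂.arr 8 := (hfr₄.2 8 (by simp [downCmd, Cmd.KeepsArr])).trans
    (hfr₃.2 8 (by simp [prodCmd, Cmd.KeepsArr]))
  rw [h7, h8]
  exact ⟨h71, h82, h⟩

end BilinearScheme

end OLA

namespace OLA

/-! ### Positions of the vertices for a pair of windows -/

/-- Two successive shifts. -/
def place (m r r' e : ℕ) : ℕ := shift m m r' (shift m 0 r e)

lemma place_lt {m r r' e : ℕ} (hr : r ≤ 2 * m) (hr' : r' ≤ m) (he : e < 3 * m) :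
    place m r r' e < 3 * m := by
  unfold place
  refine shift_lt (by omega) (shift_lt (by omega) he)

/-- A shift as a term. -/
def shiftT (b r e : Term) : Term :=
  e + b.leq e * e.lt (b + r) * .var 1 - (b + r).leq e * e.lt (b + r + .var 1) * r

lemma eval_shiftT {s : State} {ρ : List ℤ} {b r e : Term} {m b' r' e' : ℕ} (hm : s.var 1 = m)
    (hb : b.eval s ρ = b') (hr : r.eval s ρ = r') (he : e.eval s ρ = e') :
    (shiftT b r e).eval s ρ = shift m b' r' e' := by
  simp only [shiftT, Term.eval_add, Term.eval_sub, Term.eval_mul, Term.eval_leq, Term.eval_lt,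
    Term.eval_var, hm, hb, hr, he, ile, ilt, shift]
  split_ifs <;> simp only [mul_zero, zero_mul, one_mul] <;> omega

/-- Writes the positions of the vertices to array `5`. -/
def placeCmd : Cmd :=
  .loop 4 (.var 0) (.write 5 (.var 4) (shiftT (.var 1) (.var 8) (shiftT 0 (.var 7) (.var 4))))

lemma placeCmd_spec {n m Q R r r' M L : ℕ} {W : ℤ → ℤ} {s : State} (hs : Ctx n m Q R W s)
    (h7 : s.var 7 = r) (h8 : s.var 8 = r') (hr : r ≤ 2 * m) (hr' : r' ≤ m) (hn : n ≤ 3 * m)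
    (hM : 3 * m ≤ M) :
    placeCmd.Spec M L s (1 + 2 * n) fun s' => ∀ u < n, s'.arr 5 (u : ℤ) = place m r r' u := by
  refine (Cmd.Spec.fill (m := n) (by rw [Term.eval_var, hs.var_zero, Int.toNat_natCast])
    (by simp [limit]; omega) (fun i => (i : ℤ)) (fun i => (place m r r' i : ℤ)) ?_ ?_ ?_).mono
    (by omega) (fun _ _ h => h.1)
  · intro i _ j _ hij; exact_mod_cast hij
  · intro i hi
    rw [abs_of_nonneg (by positivity)]
    have := place_lt hr hr' (by omega : i < 3 * m)
    exact_mod_cast (by omega : place m r r' i ≤ M)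
  · intro i hi s' hv _ h4 _ _
    refine ⟨h4, ?_⟩
    have h1 : s'.var 1 = m := (hv 1 (by norm_num)).trans hs.var_one
    exact eval_shiftT h1 h1 ((hv 8 (by norm_num)).trans h8)
      (eval_shiftT (b' := 0) h1 rfl ((hv 7 (by norm_num)).trans h7) h4)

/-! ### The tables of a guess -/

/-- The composition of three masks as a term. -/
def mask3T (x y z : Term) : Term := x + .read 3 (.var 1) * y + .read 3 (2 * .var 1) * z

/-- The threshold with number `i`: a multiple of an edge weight. -/
def thr (W : ℤ → ℤ) (J i : ℕ) : ℤ := W ((i / J : ℕ) : ℤ) * ((i % J : ℕ) : ℤ)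

/-- The threshold whose number is in variable `i`. -/
def thrT (i : ℕ) : Term := .read 1 (.var i / .var 30) * (.var i % .var 30)

/-- Whether the pair of masks numbered by variable `4` obeys a threshold. -/
def condT (K : ℕ) (x : Term) (lo hi i : ℕ) : Term :=
  Term.lt (.var 4 / .var 15) (.var 14) * Term.lt (.var 4 % .var 15) (.var 14) *
    Term.leq (.const K * partCutT x 5 lo hi) (thrT i)

/-- The values of `condT`. -/
def entry (n m K c D : ℕ) (w : ℕ → ℕ → ℤ) (q X : ℕ → ℕ) (comb : ℕ → ℕ → ℕ) (lo hi : ℕ) (θ : ℤ)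
    (z : ℕ) : ℤ :=
  if z / D < c ∧ z % D < c ∧ K * cutVal n (partWt w m q lo hi)
    (fun u => digit (comb (X (z / D)) (X (z % D))) (q u)) ≤ θ then 1 else 0

lemma abs_entry_le (n m K c D : ℕ) (w : ℕ → ℕ → ℤ) (q X : ℕ → ℕ) (comb : ℕ → ℕ → ℕ) (lo hi : ℕ)
    (θ : ℤ) (z : ℕ) : |entry n m K c D w q X comb lo hi θ z| ≤ 1 := by
  unfold entry; split_ifs <;> simp

/-- The memory contains a list `X` of `c` masks, positions `q` and the numbers of thresholds. -/
structure Guess (S : BilinearScheme) (n m κ c J : ℕ) (W : ℤ → ℤ) (q X : ℕ → ℕ) (i₀ i₁ i₂ : ℕ)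
    (s : State) : Prop where
  ctx : Ctx n m (S.N * S.N) S.R W s
  dim : BilinearScheme.Dim S κ s
  var_10 : s.var 10 = i₀
  var_11 : s.var 11 = i₁
  var_12 : s.var 12 = i₂
  var_14 : s.var 14 = c
  var_30 : s.var 30 = J
  arr_5 : ∀ u < n, s.arr 5 (u : ℤ) = q u
  arr_6 : ∀ j < c, s.arr 6 (j : ℤ) = X j

section

variable {S : BilinearScheme} {n m κ c J : ℕ} {W : ℤ → ℤ} {q X : ℕ → ℕ} {i₀ i₁ i₂ : ℕ} {s : State}
  {w : ℕ → ℕ → ℤ} {M L K : ℕ}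

/-- The command changes nothing that `Guess` refers to. -/
def Cmd.KeepsGuess (C : Cmd) : Prop :=
  (∀ y ∈ [0, 1, 2, 3, 10, 11, 12, 14, 15, 16, 17, 30], C.KeepsVar y) ∧
    ∀ b ∈ [1, 3, 5, 6], C.KeepsArr b

lemma Guess.frame {s' : State} {C : Cmd} (h : Guess S n m κ c J W q X i₀ i₁ i₂ s)
    (hC : C.Frame s s') (hk : C.KeepsGuess) : Guess S n m κ c J W q X i₀ i₁ i₂ s' := by
  have hv : ∀ y ∈ [0, 1, 2, 3, 10, 11, 12, 14, 15, 16, 17, 30], s'.var y = s.var y :=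
    fun y hy => hC.1 y (hk.1 y hy)
  have ha : ∀ b ∈ [1, 3, 5, 6], s'.arr b = s.arr b := fun y hy => hC.2 y (hk.2 y hy)
  exact ⟨h.ctx.congr (hv _ (by simp)) (hv _ (by simp)) (hv _ (by simp)) (hv _ (by simp))
    (ha _ (by simp)) (ha _ (by simp)), h.dim.congr (hv _ (by simp)) (hv _ (by simp))
    (hv _ (by simp)), (hv _ (by simp)).trans h.var_10, (hv _ (by simp)).trans h.var_11,
    (hv _ (by simp)).trans h.var_12, (hv _ (by simp)).trans h.var_14,
    (hv _ (by simp)).trans h.var_30, by rw [ha 5 (by simp)]; exact h.arr_5,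
    by rw [ha 6 (by simp)]; exact h.arr_6⟩

lemma Guess.congr {s' : State} (h : Guess S n m κ c J W q X i₀ i₁ i₂ s)
    (hv : ∀ y ∈ [0, 1, 2, 3, 10, 11, 12, 14, 15, 16, 17, 30], s'.var y = s.var y)
    (ha : ∀ b ∈ [1, 3, 5, 6], s'.arr b = s.arr b) : Guess S n m κ c J W q X i₀ i₁ i₂ s' :=
  ⟨h.ctx.congr (hv _ (by simp)) (hv _ (by simp)) (hv _ (by simp)) (hv _ (by simp))
    (ha _ (by simp)) (ha _ (by simp)), h.dim.congr (hv _ (by simp)) (hv _ (by simp))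
    (hv _ (by simp)), (hv _ (by simp)).trans h.var_10, (hv _ (by simp)).trans h.var_11,
    (hv _ (by simp)).trans h.var_12, (hv _ (by simp)).trans h.var_14,
    (hv _ (by simp)).trans h.var_30, by rw [ha 5 (by simp)]; exact h.arr_5,
    by rw [ha 6 (by simp)]; exact h.arr_6⟩

lemma eval_mask3T (hs : Ctx n m (S.N * S.N) S.R W s) {ρ : List ℤ} {x y z : Term} {x' y' z' : ℕ}
    (hx : x.eval s ρ = x') (hy : y.eval s ρ = y') (hz : z.eval s ρ = z') :
    (mask3T x y z).eval s ρ = mask3 m x' y' z' := by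
  have h1 := hs.arr_three m (by omega)
  have h2 := hs.arr_three (2 * m) (by omega)
  push_cast at h2
  simp only [mask3T, Term.eval_add, Term.eval_mul, Term.eval_read, Term.eval_var, Term.eval_two,
    hs.var_one, hx, hy, hz, h1, h2, mask3]
  push_cast; ring

lemma eval_thrT {i i' J : ℕ} (h1 : s.arr 1 = W) (h30 : s.var 30 = J) (hi : s.var i = i')
    (ρ : List ℤ) : (thrT i).eval s ρ = thr W J i' := by
  simp only [thrT, Term.eval_mul, Term.eval_read, Term.eval_div, Term.eval_mod, Term.eval_var, h1,
    h30, hi, thr]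
  norm_cast

/-- The first two factors vanish for the indices that pad the matrices beyond the list. Therefore x
has to be evaluated correctly for listed masks only. -/
lemma eval_condT (h : Guess S n m κ c J W q X i₀ i₁ i₂ s)
    (hW : ∀ u < n, ∀ v < n, W ((n : ℤ) * u + v) = w u v) (hq : ∀ u < n, q u ≤ 3 * m)
    {x : Term} {comb : ℕ → ℕ → ℕ} {lo hi i i' z : ℕ} (h4 : s.var 4 = z) (hi' : s.var i = i')
    (hx : z / S.N ^ κ < c → z % S.N ^ κ < c → ∀ ρ,
      x.eval s ρ = comb (X (z / S.N ^ κ)) (X (z % S.N ^ κ))) :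
    (condT K x lo hi i).eval s [] =
      entry n m K c (S.N ^ κ) w q X comb lo hi (thr W J i') z := by
  have e1 : (Term.var 4 / .var 15).eval s [] = ((z / S.N ^ κ : ℕ) : ℤ) := by
    simp only [Term.eval_div, Term.eval_var, h4, h.dim.var_15]; norm_cast
  have e2 : (Term.var 4 % .var 15).eval s [] = ((z % S.N ^ κ : ℕ) : ℤ) := by
    simp only [Term.eval_mod, Term.eval_var, h4, h.dim.var_15]; norm_cast
  rw [condT, Term.eval_mul, Term.eval_mul, Term.eval_lt, Term.eval_lt, e1, e2, Term.eval_var,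
    h.var_14, entry]
  simp only [ilt, Nat.cast_lt]
  by_cases h1 : z / S.N ^ κ < c
  · by_cases h2 : z % S.N ^ κ < c
    · rw [if_pos h1, if_pos h2, one_mul, one_mul, Term.eval_leq, Term.eval_mul,
        eval_partCutT h.ctx hW (hx h1 h2) h.arr_5 hq,
        eval_thrT h.ctx.arr_one h.var_30 hi', Term.eval_const, ile]
      simp only [h1, h2, true_and]
    · simp [h2]
  · simp [h1]

/-- Writes a table of the values of `condT` to array `a`. -/
def tableCmd (a K : ℕ) (x : Term) (lo hi i : ℕ) : Cmd :=
  .loop 4 (.var 15 * .var 15) (.write a (.var 4) (condT K x lo hi i))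

/-- The first mask of the pair numbered by variable `4`. -/
def fstT : Term := .read 6 (.var 4 / .var 15)

/-- The second mask of the pair numbered by variable `4`. -/
def sndT : Term := .read 6 (.var 4 % .var 15)

lemma eval_fstT (h : Guess S n m κ c J W q X i₀ i₁ i₂ s) {z : ℕ} (h4 : s.var 4 = z)
    (hz : z / S.N ^ κ < c) (ρ : List ℤ) : fstT.eval s ρ = X (z / S.N ^ κ) := by
  rw [← h.arr_6 _ hz]
  simp only [fstT, Term.eval_read, Term.eval_div, Term.eval_var, h4, h.dim.var_15]; norm_cast

lemma eval_sndT (h : Guess S n m κ c J W q X i₀ i₁ i₂ s) {z : ℕ} (h4 : s.var 4 = z)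
    (hz : z % S.N ^ κ < c) (ρ : List ℤ) : sndT.eval s ρ = X (z % S.N ^ κ) := by
  rw [← h.arr_6 _ hz]
  simp only [sndT, Term.eval_read, Term.eval_mod, Term.eval_var, h4, h.dim.var_15]; norm_cast

lemma tableCmd_spec (h : Guess S n m κ c J W q X i₀ i₁ i₂ s)
    (hW : ∀ u < n, ∀ v < n, W ((n : ℤ) * u + v) = w u v) (hq : ∀ u < n, q u ≤ 3 * m)
    {a : ℕ} (ha : a = 7 ∨ a = 8) {x : Term} {comb : ℕ → ℕ → ℕ} {lo hi i i' : ℕ} (hi4 : i ≠ 4)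
    (hi' : s.var i = i') (hM : S.R ^ κ ≤ M)
    (hx : ∀ z s', Guess S n m κ c J W q X i₀ i₁ i₂ s' → s'.var 4 = (z : ℕ) → z / S.N ^ κ < c →
      z % S.N ^ κ < c → ∀ ρ, x.eval s' ρ = comb (X (z / S.N ^ κ)) (X (z % S.N ^ κ))) :
    (tableCmd a K x lo hi i).Spec M L s (1 + 2 * S.R ^ κ) fun s' =>
      ∀ z < S.N ^ κ * S.N ^ κ, s'.arr a (z : ℤ) =
        entry n m K c (S.N ^ κ) w q X comb lo hi (thr W J i') z := by
  have hsq : S.N ^ κ * S.N ^ κ ≤ S.R ^ κ := by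
    rw [← mul_pow]; exact Nat.pow_le_pow_left S.sq_le _
  have hM1 : 1 ≤ M := le_trans (Nat.one_le_pow _ _ S.R_pos) hM
  refine (Cmd.Spec.fill (m := S.N ^ κ * S.N ^ κ) ?_
    (by simp [limit]; omega) (fun i => (i : ℤ))
    (fun z => entry n m K c (S.N ^ κ) w q X comb lo hi (thr W J i') z) ?_ ?_ ?_).mono
    (by omega) (fun _ _ h => h.1)
  · simp only [Term.eval_mul, Term.eval_var, h.dim.var_15]; norm_cast
  · intro i _ j _ hij; exact_mod_cast hij
  · intro i _; exact (abs_entry_le _ _ _ _ _ _ _ _ _ _ _ _ _).trans (by exact_mod_cast hM1)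
  · intro z hz s' hv ha' h4 _ _
    refine ⟨h4, ?_⟩
    have hg : Guess S n m κ c J W q X i₀ i₁ i₂ s' := h.congr
      (fun y hy => hv y (by rintro rfl; simp at hy))
      (fun b hb => ha' b (by rintro rfl; rcases ha with rfl | rfl <;> simp at hb))
    exact eval_condT hg hW hq h4 ((hv i hi4).trans hi') (hx z s' hg h4)

/-! ### Searching the product -/

/-- Searches for three masks that obey the thresholds; the outcome is in variables `21`
and `22`. -/
def findCmd (K : ℕ) : Cmd :=
  .assign 21 (0 - 1) ;;
  .loop 4 (.var 15 * .var 15) (.ite (Term.lt 0 (.read 9 (.var 4)) *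
    condT K (mask3T fstT 0 sndT) 3 4 12) (.assign 21 (.var 4)) .skip) ;;
  .assign 22 (0 - 1) ;;
  .loop 4 (.var 14) (.ite (Term.leq 0 (.var 21) * .read 7 (.var 21 / .var 15 * .var 15 + .var 4) *
    .read 8 (.var 4 * .var 15 + .var 21 % .var 15)) (.assign 22 (.var 4)) .skip)

/-- A positive entry of the product at (x, z) means that some y is joined to both; together with the
third condition this is a triangle. One pair (x, z) is selected first, and y is searched only for
it, which avoids a search over all triples. -/
lemma findCmd_spec (h : Guess S n m κ c J W q X i₀ i₁ i₂ s)
    (hW : ∀ u < n, ∀ v < n, W ((n : ℤ) * u + v) = w u v) (hq : ∀ u < n, q u ≤ 3 * m)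
    (hcD : c ≤ S.N ^ κ) (hM : S.R ^ κ ≤ M) {A B E : ℕ → ℤ}
    (hA : A = entry n m K c (S.N ^ κ) w q X (fun x y => mask3 m x y 0) 0 2 (thr W J i₀))
    (hB : B = entry n m K c (S.N ^ κ) w q X (fun y z => mask3 m 0 y z) 5 8 (thr W J i₁))
    (hE : E = entry n m K c (S.N ^ κ) w q X (fun x z => mask3 m x 0 z) 3 4 (thr W J i₂))
    (h7 : ∀ z < S.N ^ κ * S.N ^ κ, s.arr 7 (z : ℤ) = A z)
    (h8 : ∀ z < S.N ^ κ * S.N ^ κ, s.arr 8 (z : ℤ) = B z)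
    (h9 : ∀ i < S.N ^ κ, ∀ k < S.N ^ κ, s.arr 9 ((i * S.N ^ κ + k : ℕ) : ℤ) =
        S.scale ^ κ * ∑ j ∈ Finset.range (S.N ^ κ), A (i * S.N ^ κ + j) * B (j * S.N ^ κ + k)) :
    (findCmd K).Spec M L s (4 + 6 * S.R ^ κ) fun s' =>
      (s'.var 22 = -1 ∧ ∀ i < c, ∀ j < c, ∀ k < c, A (i * S.N ^ κ + j) = 1 →
        B (j * S.N ^ κ + k) = 1 → E (i * S.N ^ κ + k) = 1 → False) ∨
      ∃ i < c, ∃ j < c, ∃ k < c, A (i * S.N ^ κ + j) = 1 ∧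
        B (j * S.N ^ κ + k) = 1 ∧ E (i * S.N ^ κ + k) = 1 ∧
        s'.var 21 = (i * S.N ^ κ + k : ℕ) ∧ s'.var 22 = j := by
  set D := S.N ^ κ with hD
  have hDpos : 0 < D := Nat.pow_pos S.N_pos
  have hsq : D * D ≤ S.R ^ κ := by
    rw [hD, ← mul_pow]; exact Nat.pow_le_pow_left S.sq_le _
  have hDle : D ≤ D * D := Nat.le_mul_of_pos_left _ hDpos
  have hM1 : 1 ≤ M := le_trans (Nat.one_le_pow _ _ S.R_pos) hM
  have hA01 : ∀ z, A z = 0 ∨ A z = 1 := by intro z; rw [hA, entry]; split_ifs <;> simp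
  have hB01 : ∀ z, B z = 0 ∨ B z = 1 := by intro z; rw [hB, entry]; split_ifs <;> simp
  have hE01 : ∀ z, E z = 0 ∨ E z = 1 := by intro z; rw [hE, entry]; split_ifs <;> simp
  have hAc : ∀ z, A z = 1 → z % D < c := by
    intro z hz; rw [hA, entry] at hz; by_contra hcon; simp [hcon] at hz
  have hEc : ∀ z, E z = 1 → z / D < c ∧ z % D < c := by
    intro z hz; rw [hE, entry] at hz
    by_contra hcon
    rw [if_neg (fun h => hcon ⟨h.1, h.2.1⟩)] at hz
    exact zero_ne_one hz
  have hneg : |((0 : Term) - 1).eval s []| ≤ (M : ℤ) := by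
    simp; exact_mod_cast hM1
  set P : ℕ → ℕ → Prop := fun z j => A (z / D * D + j) = 1 ∧ B (j * D + z % D) = 1 with hP
  -- All summands are 0 or 1 and the scaling factor is positive, so the entry is positive exactly if
  -- some summand is 1.
  have hpos : ∀ z, z < D * D → (0 < s.arr 9 (z : ℤ) ↔ ∃ j < D, P z j) := by
    intro z hz
    have h1 : z / D < D := Nat.div_lt_of_lt_mul hz
    have h2 := h9 (z / D) h1 (z % D) (Nat.mod_lt _ hDpos)
    rw [Nat.div_add_mod'] at h2
    rw [h2]
    have hnn : ∀ j ∈ Finset.range D, 0 ≤ A (z / D * D + j) * B (j * D + z % D) := by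
      intro j _
      rcases hA01 (z / D * D + j) with e | e <;> rcases hB01 (j * D + z % D) with e' | e' <;>
        rw [e, e'] <;> norm_num
    rw [mul_pos_iff_of_pos_left (pow_pos S.scale_pos κ), Finset.sum_pos_iff_of_nonneg hnn]
    simp only [Finset.mem_range]
    refine exists_congr fun j => and_congr_right fun _ => ?_
    rcases hA01 (z / D * D + j) with e | e <;> rcases hB01 (j * D + z % D) with e' | e' <;>
      simp [hP, e, e']
  refine (Cmd.Spec.seq (k₁ := 1) (.assign (by simpa [limit] using hneg) ?_)).mono
    (by omega : 1 + ((1 + D * D * 3) + (1 + (1 + c * 3))) ≤ _) (fun _ _ h => h)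
  set s₁ := s.setVar 21 (((0 : Term) - 1).eval s []) with hs₁
  have hg₁ : Guess S n m κ c J W q X i₀ i₁ i₂ s₁ := h.congr
    (fun y hy => State.setVar_var_of_ne _ _ (by rintro rfl; simp at hy)) (fun _ _ => rfl)
  refine Cmd.Spec.seq' (Cmd.Spec.search (m := D * D) (by norm_num) ?_ (by simp [limit]; omega)
    (by simp [limit]; omega) (fun z => (∃ j < D, P z j) ∧ E z = 1)
    (State.setVar_var_self _ _ _) ?_) ?_
  · simp only [Term.eval_mul, Term.eval_var, hg₁.dim.var_15]; norm_cast
  · intro z hz s' hv ha h4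
    have hg' : Guess S n m κ c J W q X i₀ i₁ i₂ s' := hg₁.congr
      (fun y hy => hv y (by rintro rfl; simp at hy) (by rintro rfl; simp at hy))
      (fun _ _ => by rw [ha])
    rw [Term.eval_mul, eval_condT hg' hW hq h4 hg'.var_12
      (comb := fun x z => mask3 m x 0 z) (fun h1 h2 ρ => eval_mask3T (y' := 0) hg'.ctx
        (eval_fstT hg' h4 h1 ρ) rfl (eval_sndT hg' h4 h2 ρ)), ← hD, ← hE, Term.eval_lt,
        Term.eval_read, Term.eval_var, h4, Term.eval_zero, ha, mul_ne_zero_iff, ilt_ne_zero]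
    rw [show s₁.arr 9 (z : ℤ) = s.arr 9 (z : ℤ) from rfl, hpos z hz]
    refine and_congr_right fun _ => ?_
    rcases hE01 z with e | e <;> simp [e]
  rintro s₂ hfr₂ hout
  have hg₂ : Guess S n m κ c J W q X i₀ i₁ i₂ s₂ :=
    hg₁.frame hfr₂ (by simp [Cmd.KeepsGuess, Cmd.KeepsVar, Cmd.KeepsArr])
  have harr₂ : s₂.arr = s.arr := by
    funext b; exact hfr₂.2 b ⟨trivial, trivial⟩
  refine .seq (.assign (by simpa [limit] using hneg) ?_)
  set s₃ := s₂.setVar 22 (((0 : Term) - 1).eval s₂ []) with hs₃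
  have hg₃ : Guess S n m κ c J W q X i₀ i₁ i₂ s₃ := hg₂.congr
    (fun y hy => State.setVar_var_of_ne _ _ (by rintro rfl; simp at hy)) (fun _ _ => rfl)
  have h22 : s₃.var 22 = -1 := State.setVar_var_self _ _ _
  have h21 : s₃.var 21 = s₂.var 21 := rfl
  have harr₃ : s₃.arr = s.arr := harr₂
  rcases hout with ⟨hm1, hno⟩ | ⟨z, hz, ⟨⟨j₀, hj₀, hPj⟩, hEz⟩, hz21⟩
  -- If no pair was found, variable 21 is -1. The factor testing 0 ≤ variable 21 then makes the
  -- second search fail, whatever is read at the meaningless addresses.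
  · refine (Cmd.Spec.search (m := c) (by norm_num)
      (by rw [Term.eval_var, hg₃.var_14, Int.toNat_natCast]) (by simp [limit]; omega)
      (by simp [limit]; omega) (fun _ => False) h22 ?_).mono le_rfl ?_
    · intro i hi s' hv ha h4
      rw [Term.eval_mul, Term.eval_mul, Term.eval_leq, Term.eval_var, hv 21 (by norm_num)
        (by norm_num), h21, hm1]
      simp [ile]
    · rintro s' - (⟨h1, -⟩ | ⟨_, _, h1, _⟩)
      · refine Or.inl ⟨h1, fun i hi j hj k hk ha hb he => ?_⟩
        have hk' : k < D := by omega
        refine hno (i * D + k) (mul_add_lt_mul (by omega) hk') ⟨⟨j, by omega, ?_, ?_⟩, he⟩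
        · rwa [add_mul_div_of_lt hk']
        · rwa [add_mul_mod_of_lt hk']
      · exact h1.elim
  · have hzD : z / D < D := Nat.div_lt_of_lt_mul hz
    -- The product ranges over padded indices too, but entries equal to 1 have listed indices.
    have hj₀c : j₀ < c := by
      have := hAc _ hPj.1; rwa [add_mul_mod_of_lt hj₀] at this
    refine (Cmd.Spec.search (m := c) (by norm_num)
      (by rw [Term.eval_var, hg₃.var_14, Int.toNat_natCast]) (by simp [limit]; omega)
      (by simp [limit]; omega) (fun j => P z j) h22 ?_).mono le_rfl ?_
    · intro j hj s' hv ha h4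
      have h21' : s'.var 21 = z := (hv 21 (by norm_num) (by norm_num)).trans (h21.trans hz21)
      have h15' : s'.var 15 = D := (hv 15 (by norm_num) (by norm_num)).trans hg₃.dim.var_15
      have e1 : (Term.read 7 (.var 21 / .var 15 * .var 15 + .var 4)).eval s' [] =
          A (z / D * D + j) := by
        rw [← h7 _ (mul_add_lt_mul hzD (by omega))]
        simp only [Term.eval_read, Term.eval_div, Term.eval_add, Term.eval_mul, Term.eval_var,
          h21', h15', h4, ha, harr₃]
        norm_cast
      have e2 : (Term.read 8 (.var 4 * .var 15 + .var 21 % .var 15)).eval s' [] =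
          B (j * D + z % D) := by
        rw [← h8 _ (mul_add_lt_mul (by omega) (Nat.mod_lt _ hDpos))]
        simp only [Term.eval_read, Term.eval_mod, Term.eval_add, Term.eval_mul, Term.eval_var,
          h21', h15', h4, ha, harr₃]
        norm_cast
      rw [Term.eval_mul, Term.eval_mul, e1, e2, Term.eval_leq, Term.eval_var, h21']
      rcases hA01 (z / D * D + j) with e | e <;> rcases hB01 (j * D + z % D) with e' | e' <;>
        simp [hP, e, e', ile]
    · rintro s' hfr' (⟨-, h1⟩ | ⟨j, hj, hPj', h22'⟩)
      · exact absurd hPj (h1 j₀ hj₀c)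
      · obtain ⟨hz1, hz2⟩ := hEc z hEz
        refine Or.inr ⟨z / D, hz1, j, hj, z % D, hz2, hPj'.1, hPj'.2, ?_, ?_, h22'⟩
        · rwa [Nat.div_add_mod']
        · rw [hfr'.1 21 (by simp [Cmd.KeepsVar]), h21, hz21, Nat.div_add_mod']

end

end OLA

namespace OLA

/-! ### Sizes of composed sets -/

lemma sum_shift (χ : ℕ → ℤ) {m b r t : ℕ} (ht : b + r + m ≤ t) :
    ∑ e ∈ Finset.range t, χ (shift m b r e) = ∑ e ∈ Finset.range t, χ e := by
  have h := sum_unshift (fun e => χ (shift m b r e)) ht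
  simp only [shift_unshift] at h
  exact h.symm

/-- The placement is a permutation of the 3m positions, so the digits of the three blocks are only
counted in another order. -/
lemma sum_digit_place {m x y z r r' : ℕ} {k : ℤ} (hx : x < 2 ^ m) (hy : y < 2 ^ m)
    (hxk : popcount m x = k) (hyk : popcount m y = k) (hzk : popcount m z = k)
    (hr : r ≤ 2 * m) (hr' : r' ≤ m) :
    ∑ u ∈ Finset.range (3 * m), digit (mask3 m x y z) (place m r r' u) = 3 * k := by
  have h1 := sum_shift (fun e => digit (mask3 m x y z) (shift m m r' e)) (m := m) (b := 0) (r := r)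
    (t := 3 * m) (by omega)
  have h2 := sum_shift (fun e => digit (mask3 m x y z) e) (m := m) (b := m) (r := r')
    (t := 3 * m) (by omega)
  unfold place
  rw [h1, h2, show 3 * m = m + m + m by ring, Finset.sum_range_add, Finset.sum_range_add]
  have e1 : ∑ i ∈ Finset.range m, digit (mask3 m x y z) i = popcount m x :=
    Finset.sum_congr rfl fun i hi => by
      rw [digit_mask3 hx hy, if_pos (Finset.mem_range.1 hi)]
  have e2 : ∑ i ∈ Finset.range m, digit (mask3 m x y z) (m + i) = popcount m y :=
    Finset.sum_congr rfl fun i hi => by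
      have := Finset.mem_range.1 hi
      rw [digit_mask3 hx hy, if_neg (by omega), if_pos (by omega)]; congr 1; omega
  have e3 : ∑ i ∈ Finset.range m, digit (mask3 m x y z) (m + m + i) = popcount m z :=
    Finset.sum_congr rfl fun i hi => by
      have := Finset.mem_range.1 hi
      rw [digit_mask3 hx hy, if_neg (by omega), if_neg (by omega)]; congr 1; omega
  rw [e1, e2, e3, hxk, hyk, hzk]; ring

/-- Used to discard the 3m - n dummy positions: they change the size of a set by at most their
number. -/
lemma sum_range_le_add {χ : ℕ → ℤ} (h0 : ∀ i, 0 ≤ χ i) (h1 : ∀ i, χ i ≤ 1) {n t : ℕ} (h : n ≤ t) :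
    ∑ i ∈ Finset.range n, χ i ≤ ∑ i ∈ Finset.range t, χ i ∧
      ∑ i ∈ Finset.range t, χ i ≤ ∑ i ∈ Finset.range n, χ i + (t - n) := by
  obtain ⟨d, rfl⟩ := Nat.exists_eq_add_of_le h
  rw [Finset.sum_range_add]
  have h2 : ∑ i ∈ Finset.range d, χ (n + i) ≤ ∑ _i ∈ Finset.range d, 1 :=
    Finset.sum_le_sum fun i _ => h1 _
  have h3 : 0 ≤ ∑ i ∈ Finset.range d, χ (n + i) := Finset.sum_nonneg fun i _ => h0 _
  simp at h2
  push_cast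
  constructor <;> linarith

/-! ### Testing a candidate -/

/-- Array `11` holds the best set found so far and variable `13` its cut. -/
def Best (A₁ A₂ n : ℕ) (w : ℕ → ℕ → ℤ) (s : State) : Prop :=
  ∃ b : ℕ → ℤ, (∀ v < n, s.arr 11 (v : ℤ) = b v) ∧ (∀ v, b v = 0 ∨ b v = 1) ∧
    (((∀ v, b v = 0) ∧
        s.var 13 = 2 * ∑ u ∈ Finset.range n, ∑ v ∈ Finset.range n, w u v + 1) ∨
      ((A₁ * n : ℤ) ≤ A₂ * ∑ v ∈ Finset.range n, b v ∧
        (A₁ * n : ℤ) ≤ A₂ * (n - ∑ v ∈ Finset.range n, b v) ∧ s.var 13 = cutVal n w b))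

lemma Best.congr {A₁ A₂ n : ℕ} {w : ℕ → ℕ → ℤ} {s s' : State} (h : Best A₁ A₂ n w s)
    (h1 : s'.arr 11 = s.arr 11) (h2 : s'.var 13 = s.var 13) : Best A₁ A₂ n w s' := by
  unfold Best; rw [h1, h2]; exact h

/-- Tests the set composed of the masks that were found. -/
def candCmd (A₁ A₂ : ℕ) : Cmd :=
  .loop 4 (.var 0) (.write 10 (.var 4) (digitT (mask3T (.read 6 (.var 21 / .var 15))
    (.read 6 (.var 22)) (.read 6 (.var 21 % .var 15))) (.read 5 (.var 4)))) ;;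
  .assign 23 (.sum 0 (.read 10 (.bvar 0))) ;;
  .assign 24 (.sum 0 (.sum 0 (weightT * .read 10 (.bvar 1) * (1 - .read 10 (.bvar 0))))) ;;
  .ite (Term.leq (.const A₁ * .var 0) (.const A₂ * .var 23) *
      Term.leq (.const A₁ * .var 0) (.const A₂ * (.var 0 - .var 23)) *
      Term.lt (.var 24) (.var 13))
    (.assign 13 (.var 24) ;; .loop 4 (.var 0) (.write 11 (.var 4) (.read 10 (.var 4)))) .skip

section

variable {S : BilinearScheme} {n m κ c J : ℕ} {W : ℤ → ℤ} {q X : ℕ → ℕ} {i₀ i₁ i₂ : ℕ} {s : State}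
  {w : ℕ → ℕ → ℤ} {M L K A₁ A₂ : ℕ}

/-- A candidate replaces the best set only if its true size is acceptable and its cut is smaller.
Hence variable 13 never increases, and it ends at or below the cut of every acceptable candidate. -/
lemma candCmd_spec (h : Guess S n m κ c J W q X i₀ i₁ i₂ s)
    (hW : ∀ u < n, ∀ v < n, W ((n : ℤ) * u + v) = w u v) (hw : ∀ u v, 0 ≤ w u v)
    (hq : ∀ u < n, q u ≤ 3 * m) (hcD : c ≤ S.N ^ κ)
    {i j k : ℕ} (hi : i < c) (hj : j < c) (hk : k < c) (h21 : s.var 21 = (i * S.N ^ κ + k : ℕ))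
    (h22 : s.var 22 = j) (hbest : Best A₁ A₂ n w s) (hnM : n ≤ M) (hM1 : 1 ≤ M)
    (hwM : ∑ u ∈ Finset.range n, ∑ v ∈ Finset.range n, w u v ≤ M) {b : ℕ → ℤ}
    (hb : b = fun u => digit (mask3 m (X i) (X j) (X k)) (q u)) :
    (candCmd A₁ A₂).Spec M L s (6 + 4 * n) fun s' =>
      Best A₁ A₂ n w s' ∧ s'.var 13 ≤ s.var 13 ∧
      ((A₁ * n : ℤ) ≤ A₂ * ∑ v ∈ Finset.range n, b v →
        (A₁ * n : ℤ) ≤ A₂ * (n - ∑ v ∈ Finset.range n, b v) → s'.var 13 ≤ cutVal n w b) := by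
  have b01 : ∀ v, b v = 0 ∨ b v = 1 := by
    intro v; rw [hb]; simp only [digit]; split_ifs <;> simp
  have b0 : ∀ v, 0 ≤ b v := fun v => by rcases b01 v with e | e <;> rw [e]; norm_num
  have b1 : ∀ v, b v ≤ 1 := fun v => by rcases b01 v with e | e <;> rw [e]; norm_num
  have hkD : k < S.N ^ κ := by omega
  refine (Cmd.Spec.seq' (Cmd.Spec.fill (m := n)
    (by rw [Term.eval_var, h.ctx.var_zero, Int.toNat_natCast])
    (by simp [limit]; omega) (fun i => (i : ℤ)) b ?_ ?_ ?_) ?_).mono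
    (by omega : (1 + n * (1 + 1)) + (1 + (1 + (1 + (1 + (1 + n * (1 + 1)))))) ≤ _) (fun _ _ h => h)
  · intro i _ j _ hij; exact_mod_cast hij
  · intro i hi
    rcases b01 i with e | e <;> rw [e] <;> simp
    exact hM1
  · intro v hv s' hvar ha h4 _ _
    refine ⟨h4, ?_⟩
    have hg : Guess S n m κ c J W q X i₀ i₁ i₂ s' := h.congr
      (fun y hy => hvar y (by rintro rfl; simp at hy))
      (fun b hb => ha b (by rintro rfl; simp at hb))
    have g21 := (hvar 21 (by norm_num)).trans h21
    have g22 := (hvar 22 (by norm_num)).trans h22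
    have e1 : (Term.read 6 (.var 21 / .var 15)).eval s' [] = X i := by
      rw [← hg.arr_6 _ hi]
      simp only [Term.eval_read, Term.eval_div, Term.eval_var, g21, hg.dim.var_15]
      rw [← Int.natCast_div, add_mul_div_of_lt hkD]
    have e2 : (Term.read 6 (.var 22)).eval s' [] = X j := by
      rw [← hg.arr_6 _ hj]; simp only [Term.eval_read, Term.eval_var, g22]
    have e3 : (Term.read 6 (.var 21 % .var 15)).eval s' [] = X k := by
      rw [← hg.arr_6 _ hk]
      simp only [Term.eval_read, Term.eval_mod, Term.eval_var, g21, hg.dim.var_15]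
      rw [← Int.natCast_mod, add_mul_mod_of_lt hkD]
    rw [eval_digitT hg.ctx (eval_mask3T hg.ctx e1 e2 e3)
      (show (Term.read 5 (.var 4)).eval s' [] = q v by
        rw [Term.eval_read, Term.eval_var, h4, hg.arr_5 v hv]) (hq v hv), hb]
  rintro s₁ hfr₁ ⟨h10, -⟩
  have hg₁ : Guess S n m κ c J W q X i₀ i₁ i₂ s₁ :=
    h.frame hfr₁ (by simp [Cmd.KeepsGuess, Cmd.KeepsVar, Cmd.KeepsArr])
  have esum : (Term.sum 0 (.read 10 (.bvar 0))).eval s₁ [] = ∑ v ∈ Finset.range n, b v := by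
    rw [Term.eval_sum, show s₁.var ((0 : Fin 4) : ℕ) = n from hg₁.ctx.var_zero, Int.toNat_natCast]
    exact Finset.sum_congr rfl fun v hv => h10 v (Finset.mem_range.1 hv)
  have hsum0 : 0 ≤ ∑ v ∈ Finset.range n, b v := Finset.sum_nonneg fun v _ => b0 v
  have hsum1 : ∑ v ∈ Finset.range n, b v ≤ n := by
    have := Finset.sum_le_sum (s := Finset.range n) fun v _ => b1 v
    simpa using this
  refine .seq (.assign ?_ ?_)
  · rw [esum, abs_of_nonneg hsum0]
    exact hsum1.trans (by simpa [limit] using hnM)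
  rw [esum]
  set s₂ := s₁.setVar 23 (∑ v ∈ Finset.range n, b v) with hs₂
  have hg₂ : Guess S n m κ c J W q X i₀ i₁ i₂ s₂ := hg₁.congr
    (fun y hy => State.setVar_var_of_ne _ _ (by rintro rfl; simp at hy)) (fun _ _ => rfl)
  have ecut : (Term.sum 0 (.sum 0 (weightT * .read 10 (.bvar 1) *
      (1 - .read 10 (.bvar 0))))).eval s₂ [] = cutVal n w b := by
    simp only [Term.eval_sum]
    rw [show s₂.var ((0 : Fin 4) : ℕ) = n from hg₂.ctx.var_zero, Int.toNat_natCast]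
    refine Finset.sum_congr rfl fun u hu => Finset.sum_congr rfl fun v hv => ?_
    have hu := Finset.mem_range.1 hu
    have hv := Finset.mem_range.1 hv
    have e10 : s₂.arr 10 = s₁.arr 10 := rfl
    simp only [Term.eval_mul, Term.eval_sub, Term.eval_one, Term.eval_read, Term.eval_bvar,
      List.getD_cons_zero, List.getD_cons_succ, e10, h10 u hu, h10 v hv, weightT, Term.eval_add,
      Term.eval_var, hg₂.ctx.var_zero, hg₂.ctx.arr_one, hW u hu v hv]
  have hcut0 : 0 ≤ cutVal n w b := cutVal_nonneg hw b0 b1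
  have hcutM : cutVal n w b ≤ M := (cutVal_le_sum hw b0 b1).trans hwM
  refine .seq (.assign ?_ ?_)
  · rw [ecut, abs_of_nonneg hcut0]
    exact hcutM.trans (by simp [limit])
  rw [ecut]
  set s₃ := s₂.setVar 24 (cutVal n w b) with hs₃
  have hg₃ : Guess S n m κ c J W q X i₀ i₁ i₂ s₃ := hg₂.congr
    (fun y hy => State.setVar_var_of_ne _ _ (by rintro rfl; simp at hy)) (fun _ _ => rfl)
  have v23 : s₃.var 23 = ∑ v ∈ Finset.range n, b v := by simp [hs₃, hs₂, State.setVar]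
  have v24 : s₃.var 24 = cutVal n w b := by simp [hs₃, State.setVar]
  have v13 : s₃.var 13 = s.var 13 := hfr₁.1 13 (by simp [Cmd.KeepsVar])
  have a11 : s₃.arr 11 = s.arr 11 := hfr₁.2 11 (by simp [Cmd.KeepsArr])
  have a10 : s₃.arr 10 = s₁.arr 10 := rfl
  have hcond : (Term.leq (.const A₁ * .var 0) (.const A₂ * .var 23) *
      Term.leq (.const A₁ * .var 0) (.const A₂ * (.var 0 - .var 23)) *
      Term.lt (.var 24) (.var 13)).eval s₃ [] ≠ 0 ↔
      (A₁ * n : ℤ) ≤ A₂ * ∑ v ∈ Finset.range n, b v ∧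
      (A₁ * n : ℤ) ≤ A₂ * (n - ∑ v ∈ Finset.range n, b v) ∧ cutVal n w b < s.var 13 := by
    simp only [Term.eval_mul, Term.eval_leq, Term.eval_lt, Term.eval_const, Term.eval_var,
      Term.eval_sub, v23, v24, v13, hg₃.ctx.var_zero, mul_ne_zero_iff, ile_ne_zero, ilt_ne_zero,
      and_assoc]
  refine .ite (fun hne => ?_) (fun heq => ?_)
  · obtain ⟨hc1, hc2, hc3⟩ := hcond.1 hne
    refine .seq (.assign ?_ ?_)
    · rw [Term.eval_var, v24, abs_of_nonneg hcut0]; exact hcutM.trans (by simp [limit])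
    rw [Term.eval_var, v24]
    set s₄ := s₃.setVar 13 (cutVal n w b) with hs₄
    have a10' : s₄.arr 10 = s₁.arr 10 := rfl
    refine (Cmd.Spec.fill (m := n)
      (by rw [Term.eval_var, show s₄.var 0 = n from hg₃.ctx.var_zero, Int.toNat_natCast])
      (by simp [limit]; omega) (fun i => (i : ℤ)) b ?_ ?_ ?_).mono le_rfl ?_
    · intro i _ j _ hij; exact_mod_cast hij
    · intro i hi
      rcases b01 i with e | e <;> rw [e] <;> simp
      exact hM1
    · intro v hv s' hvar ha h4 _ _
      refine ⟨h4, ?_⟩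
      rw [Term.eval_read, Term.eval_var, h4, ha 10 (by norm_num), a10', h10 v hv]
    · rintro s₅ hfr₅ ⟨h11, -⟩
      have g13 : s₅.var 13 = cutVal n w b :=
        (hfr₅.1 13 (by simp [Cmd.KeepsVar])).trans (State.setVar_var_self _ _ _)
      exact ⟨⟨b, h11, b01, Or.inr ⟨hc1, hc2, g13⟩⟩, by rw [g13]; exact hc3.le,
        fun _ _ => g13.le⟩
  · refine (Cmd.Spec.skip ?_ : Cmd.skip.Spec M L _ 1 _).mono (by omega) (fun _ _ h => h)
    refine ⟨hbest.congr a11 v13, v13.le, fun hc1 hc2 => ?_⟩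
    rw [v13]
    by_contra hcon
    exact hcond.2 ⟨hc1, hc2, not_le.1 hcon⟩ heq

end

end OLA

namespace OLA

/-! ### One guess -/

/-- Tests all sets composed of three masks for given windows, number of digits and thresholds. -/
def bodyCmd (S : BilinearScheme) (K A₁ A₂ : ℕ) : Cmd :=
  placeCmd ;; listCmd ;; dimCmd S.N S.R ;;
  tableCmd 7 K (mask3T fstT sndT 0) 0 2 10 ;; tableCmd 8 K (mask3T 0 fstT sndT) 5 8 11 ;;
  S.mulCmd ;; findCmd K ;; .ite (Term.leq 0 (.var 22)) (candCmd A₁ A₂) .skip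

/-- The conditions on the instance and on the bound for all numbers. -/
structure Bounds (S : BilinearScheme) (n m M : ℕ) (w : ℕ → ℕ → ℤ) (W : ℤ → ℤ) : Prop where
  weight : ∀ u < n, ∀ v < n, W ((n : ℤ) * u + v) = w u v
  nonneg : ∀ u v, 0 ≤ w u v
  le : n ≤ 3 * m
  three_mul_le : 3 * m ≤ M
  magnitude_le : S.magnitude ^ (3 * m) ≤ M
  sum_le : 2 * ∑ u ∈ Finset.range n, ∑ v ∈ Finset.range n, w u v + 1 ≤ M

/-- There are three masks that obey the thresholds. -/
def Solvable (K n m : ℕ) (w : ℕ → ℕ → ℤ) (W : ℤ → ℤ) (J r r' k i₀ i₁ i₂ : ℕ) : Prop :=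
  ∃ x < 2 ^ m, ∃ y < 2 ^ m, ∃ z < 2 ^ m,
    popcount m x = k ∧ popcount m y = k ∧ popcount m z = k ∧
    K * cutVal n (partWt w m (place m r r') 0 2)
      (fun u => digit (mask3 m x y 0) (place m r r' u)) ≤ thr W J i₀ ∧
    K * cutVal n (partWt w m (place m r r') 5 8)
      (fun u => digit (mask3 m 0 y z) (place m r r' u)) ≤ thr W J i₁ ∧
    K * cutVal n (partWt w m (place m r r') 3 4)
      (fun u => digit (mask3 m x 0 z) (place m r r' u)) ≤ thr W J i₂

section

variable {S : BilinearScheme} {n m J : ℕ} {W : ℤ → ℤ} {s : State}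
  {w : ℕ → ℕ → ℤ} {M L K A₁ A₂ : ℕ}

lemma entry_eq_one {c D : ℕ} {q X : ℕ → ℕ} {comb : ℕ → ℕ → ℕ} {lo hi i j : ℕ} {θ : ℤ}
    (hj : j < D) : entry n m K c D w q X comb lo hi θ (i * D + j) = 1 ↔
      i < c ∧ j < c ∧ K * cutVal n (partWt w m q lo hi)
        (fun u => digit (comb (X i) (X j)) (q u)) ≤ θ := by
  rw [entry, add_mul_div_of_lt hj, add_mul_mod_of_lt hj]
  split_ifs with h <;> simp [h]

/-- The triple that is found need not be the one promised by `Solvable`. Any triple that obeys the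
three thresholds has K times its cut at most their sum, and this is all that is claimed. -/
lemma bodyCmd_spec {r r' k i₀ i₁ i₂ Y : ℕ} (hb : Bounds S n m M w W)
    (hs : Ctx n m (S.N * S.N) S.R W s) (h7 : s.var 7 = r) (h8 : s.var 8 = r') (h9 : s.var 9 = k)
    (h10 : s.var 10 = i₀) (h11 : s.var 11 = i₁) (h12 : s.var 12 = i₂) (h30 : s.var 30 = J)
    (hr : r ≤ 2 * m) (hr' : r' ≤ m) (hbest : Best A₁ A₂ n w s)
    (hY : ∀ κ ≤ m, (κ = 0 ∨ S.N ^ (κ - 1) < maskCount m k) → S.R ^ κ ≤ Y) :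
    (bodyCmd S K A₁ A₂).Spec M L s (40 * (m + 1) * (Y + 2 ^ m + n + 1)) fun s' =>
      Best A₁ A₂ n w s' ∧ s'.var 13 ≤ s.var 13 ∧
      (Solvable K n m w W J r r' k i₀ i₁ i₂ → (A₁ * n + A₂ * (3 * m) : ℤ) ≤ A₂ * (3 * k + n) →
        (A₁ * n + A₂ * (3 * k) : ℤ) ≤ A₂ * n →
        K * s'.var 13 ≤ thr W J i₀ + thr W J i₁ + thr W J i₂) := by
  have hRpos := S.R_pos
  have hmag : 1 ≤ S.magnitude := Nat.mul_pos S.R_pos (Nat.succ_pos _)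
  have hRm : S.R ^ m ≤ M := (Nat.pow_le_pow_left (Nat.le_mul_of_pos_right _ (by omega)) _).trans
    ((Nat.pow_le_pow_right hmag (by omega)).trans hb.magnitude_le)
  have hR2 : 2 ≤ S.R := S.two_le.trans ((Nat.le_mul_of_pos_right _ S.N_pos).trans S.sq_le)
  have h2m : 2 ^ m ≤ M := (Nat.pow_le_pow_left hR2 _).trans hRm
  have hM1 : 1 ≤ M := le_trans Nat.one_le_two_pow h2m
  have hNR : S.N ≤ S.R := (Nat.le_mul_of_pos_right _ S.N_pos).trans S.sq_le
  have hmM : m ≤ M := by have := hb.three_mul_le; omega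
  have hnM : n ≤ M := hb.le.trans hb.three_mul_le
  have hY1 : 1 ≤ Y := by simpa using hY 0 (Nat.zero_le _) (Or.inl rfl)
  have hsteps : (1 + 2 * n) + ((1 + (1 + 2 ^ m * (1 + 3))) + ((1 + (1 + (1 + (1 + m * (1 + 4))))) +
      ((1 + 2 * Y) + ((1 + 2 * Y) + (20 * ((m + 1) * Y) + ((4 + 6 * Y) + (1 + (6 + 4 * n)))))))) ≤
      40 * (m + 1) * (Y + 2 ^ m + n + 1) := by
    have h2 : 1 ≤ 2 ^ m := Nat.one_le_two_pow
    have e : 40 * (m + 1) * (Y + 2 ^ m + n + 1) = 40 * (m * Y) + 40 * (m * (2 ^ m)) +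
      40 * (m * n) + 40 * m + 40 * Y + 40 * 2 ^ m + 40 * n + 40 := by ring
    rw [e, show 20 * ((m + 1) * Y) = 20 * (m * Y) + 20 * Y by ring]
    have := Nat.zero_le (m * Y)
    have := Nat.zero_le (m * 2 ^ m)
    have := Nat.zero_le (m * n)
    omega
  refine Cmd.Spec.mono (Cmd.Spec.seq' (placeCmd_spec hs h7 h8 hr hr' hb.le hb.three_mul_le) ?_)
    hsteps (fun _ _ h => h)
  rintro s₁ hfr₁ hplace
  have hs₁ : Ctx n m (S.N * S.N) S.R W s₁ :=
    hs.frame hfr₁ (by simp [placeCmd, Cmd.KeepsVar, Cmd.KeepsArr])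
  refine Cmd.Spec.seq' (listCmd_spec hs₁
    ((hfr₁.1 9 (by simp [placeCmd, Cmd.KeepsVar])).trans h9) h2m) ?_
  rintro s₂ hfr₂ ⟨h14, hlist, hall⟩
  have hs₂ : Ctx n m (S.N * S.N) S.R W s₂ :=
    hs₁.frame hfr₂ (by simp [listCmd, Cmd.KeepsVar, Cmd.KeepsArr])
  set c := maskCount m k with hc
  refine Cmd.Spec.seq' (dimCmd_spec hs₂ S.N S.R S.two_le hNR h14 (maskCount_le m k) hRm hmM) ?_
  rintro s₃ hfr₃ ⟨κ, hκ, h15, h16, h17, hcD, hκc⟩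
  have hs₃ : Ctx n m (S.N * S.N) S.R W s₃ :=
    hs₂.frame hfr₃ (by simp [dimCmd, Cmd.KeepsVar, Cmd.KeepsArr])
  have keep : ∀ y ∈ [10, 11, 12, 13, 30], s₃.var y = s.var y := by
    intro y hy
    simp only [List.mem_cons, List.not_mem_nil, or_false] at hy
    rw [hfr₃.1 y (by rcases hy with rfl | rfl | rfl | rfl | rfl <;> simp [dimCmd, Cmd.KeepsVar]),
      hfr₂.1 y (by rcases hy with rfl | rfl | rfl | rfl | rfl <;> simp [listCmd, Cmd.KeepsVar]),
      hfr₁.1 y (by rcases hy with rfl | rfl | rfl | rfl | rfl <;> simp [placeCmd, Cmd.KeepsVar])]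
  have a11 : s₃.arr 11 = s.arr 11 := by
    rw [hfr₃.2 11 (by simp [dimCmd, Cmd.KeepsArr]), hfr₂.2 11 (by simp [listCmd, Cmd.KeepsArr]),
      hfr₁.2 11 (by simp [placeCmd, Cmd.KeepsArr])]
  have a5 : s₃.arr 5 = s₁.arr 5 := by
    rw [hfr₃.2 5 (by simp [dimCmd, Cmd.KeepsArr]), hfr₂.2 5 (by simp [listCmd, Cmd.KeepsArr])]
  have a6 : s₃.arr 6 = s₂.arr 6 := hfr₃.2 6 (by simp [dimCmd, Cmd.KeepsArr])
  set X : ℕ → ℕ := fun j => (s₂.arr 6 (j : ℤ)).toNat with hX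
  have hXspec : ∀ j < c, s₂.arr 6 (j : ℤ) = X j ∧ X j < 2 ^ m ∧ popcount m (X j) = k := by
    intro j hj
    obtain ⟨x, hx, hxk, hxj⟩ := hlist j hj
    have : X j = x := by simp [hX, hxj]
    rw [this]; exact ⟨hxj, hx, hxk⟩
  set q : ℕ → ℕ := place m r r' with hq
  have hqlt : ∀ u < n, q u < 3 * m := fun u hu => place_lt hr hr' (hu.trans_le hb.le)
  have hqle : ∀ u < n, q u ≤ 3 * m := fun u hu => (hqlt u hu).le
  have hg₃ : Guess S n m κ c J W q X i₀ i₁ i₂ s₃ :=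
    ⟨hs₃, ⟨h15, h16, h17⟩, (keep 10 (by simp)).trans h10, (keep 11 (by simp)).trans h11,
      (keep 12 (by simp)).trans h12, (hfr₃.1 14 (by simp [dimCmd, Cmd.KeepsVar])).trans h14,
      (keep 30 (by simp)).trans h30, by rw [a5]; exact hplace,
      by rw [a6]; exact fun j hj => (hXspec j hj).1⟩
  have hRY : S.R ^ κ ≤ Y := hY κ hκ hκc
  have hRM : S.R ^ κ ≤ M := (Nat.pow_le_pow_right hRpos hκ).trans hRm
  set D := S.N ^ κ with hD
  refine Cmd.Spec.seq' ((tableCmd_spec hg₃ hb.weight hqle (Or.inl rfl) (by norm_num : 10 ≠ 4)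
    hg₃.var_10 hRM (comb := fun x y => mask3 m x y 0) fun z s' hg' h4 h1 h2 ρ =>
      eval_mask3T (z' := 0) hg'.ctx (eval_fstT hg' h4 h1 ρ) (eval_sndT hg' h4 h2 ρ) rfl).mono
    (by omega) (fun _ _ h => h)) ?_
  rintro s₄ hfr₄ hA₄
  have hg₄ := hg₃.frame hfr₄ (by simp [tableCmd, Cmd.KeepsGuess, Cmd.KeepsVar, Cmd.KeepsArr])
  refine Cmd.Spec.seq' ((tableCmd_spec hg₄ hb.weight hqle (Or.inr rfl) (by norm_num : 11 ≠ 4)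
    hg₄.var_11 hRM (comb := fun y z => mask3 m 0 y z) fun z s' hg' h4 h1 h2 ρ =>
      eval_mask3T (x' := 0) hg'.ctx rfl (eval_fstT hg' h4 h1 ρ) (eval_sndT hg' h4 h2 ρ)).mono
    (by omega) (fun _ _ h => h)) ?_
  rintro s₅ hfr₅ hB₅
  have hg₅ := hg₄.frame hfr₅ (by simp [tableCmd, Cmd.KeepsGuess, Cmd.KeepsVar, Cmd.KeepsArr])
  rw [← hfr₅.2 7 (by simp [tableCmd, Cmd.KeepsArr])] at hA₄
  set EA := entry n m K c D w q X (fun x y => mask3 m x y 0) 0 2 (thr W J i₀) with hEA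
  set EB := entry n m K c D w q X (fun y z => mask3 m 0 y z) 5 8 (thr W J i₁) with hEB
  set EE := entry n m K c D w q X (fun x z => mask3 m x 0 z) 3 4 (thr W J i₂) with hEE
  refine Cmd.Spec.seq' ((BilinearScheme.mulCmd_spec hg₅.ctx hg₅.dim
    (fun z => abs_entry_le _ _ _ _ _ _ _ _ _ _ _ _ z)
    (fun z => abs_entry_le _ _ _ _ _ _ _ _ _ _ _ _ z) hA₄ hB₅
    ((Nat.pow_le_pow_right hmag (by omega)).trans hb.magnitude_le) (by omega)).mono
    (by gcongr) (fun _ _ h => h)) ?_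
  rintro s₆ hfr₆ ⟨hA₆, hB₆, hC₆⟩
  have hg₆ := hg₅.frame hfr₆ (by
    simp [BilinearScheme.mulCmd, BilinearScheme.upCmd, BilinearScheme.prodCmd,
      BilinearScheme.downCmd, Cmd.KeepsGuess, Cmd.KeepsVar, Cmd.KeepsArr])
  refine Cmd.Spec.seq' ((findCmd_spec hg₆ hb.weight hqle hcD hRM hEA hEB hEE hA₆ hB₆ hC₆).mono
    (by omega) (fun _ _ h => h)) ?_
  rintro s₇ hfr₇ hout
  have hg₇ := hg₆.frame hfr₇ (by
    simp [findCmd, Cmd.KeepsGuess, Cmd.KeepsVar, Cmd.KeepsArr])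
  have v13 : s₇.var 13 = s.var 13 := by
    rw [hfr₇.1 13 (by simp [findCmd, Cmd.KeepsVar]), hfr₆.1 13 (by
      simp [BilinearScheme.mulCmd, BilinearScheme.upCmd, BilinearScheme.prodCmd,
        BilinearScheme.downCmd, Cmd.KeepsVar]), hfr₅.1 13 (by simp [tableCmd, Cmd.KeepsVar]),
      hfr₄.1 13 (by simp [tableCmd, Cmd.KeepsVar]), keep 13 (by simp)]
  have a11' : s₇.arr 11 = s.arr 11 := by
    rw [hfr₇.2 11 (by simp [findCmd, Cmd.KeepsArr]), hfr₆.2 11 (by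
      simp [BilinearScheme.mulCmd, BilinearScheme.upCmd, BilinearScheme.prodCmd,
        BilinearScheme.downCmd, Cmd.KeepsArr]), hfr₅.2 11 (by simp [tableCmd, Cmd.KeepsArr]),
      hfr₄.2 11 (by simp [tableCmd, Cmd.KeepsArr]), a11]
  have hbest₇ : Best A₁ A₂ n w s₇ := hbest.congr a11' v13
  -- In the first case no triangle exists, which contradicts solvability because the list of masks
  -- is complete.
  rcases hout with ⟨h22, hno⟩ | ⟨i, hi, j, hj, k', hk', ha, hb', he, h21, h22⟩
  · refine .ite (fun hne => ?_) (fun _ => ?_)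
    · rw [Term.eval_leq, Term.eval_var, h22, Term.eval_zero] at hne
      exact absurd (ile_ne_zero.1 hne) (by norm_num)
    · refine (Cmd.Spec.skip ?_ : Cmd.skip.Spec M L _ 1 _).mono (by omega) (fun _ _ h => h)
      refine ⟨hbest₇, v13.le, fun hsol _ _ => ?_⟩
      obtain ⟨x, hx, y, hy, z, hz, hxk, hyk, hzk, h1, h2, h3⟩ := hsol
      obtain ⟨i, hi, hxi⟩ := hall x hx hxk
      obtain ⟨j, hj, hyj⟩ := hall y hy hyk
      obtain ⟨l, hl, hzl⟩ := hall z hz hzk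
      have ei : X i = x := by simp [hX, hxi]
      have ej : X j = y := by simp [hX, hyj]
      have el : X l = z := by simp [hX, hzl]
      refine absurd (hno i hi j hj l hl ?_ ?_ ?_) id
      · rw [hEA, entry_eq_one (by omega), ei, ej]; exact ⟨hi, hj, h1⟩
      · rw [hEB, entry_eq_one (by omega), ej, el]; exact ⟨hj, hl, h2⟩
      · rw [hEE, entry_eq_one (by omega), ei, el]; exact ⟨hi, hl, h3⟩
  · refine .ite (fun _ => ?_) (fun heq => ?_)
    · refine (candCmd_spec (b := fun u => digit (mask3 m (X i) (X j) (X k')) (q u)) hg₇ hb.weight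
        hb.nonneg hqle hcD hi hj hk' h21 h22 hbest₇ hnM hM1 (by
          have h1 := hb.sum_le
          have h2 : 0 ≤ ∑ u ∈ Finset.range n, ∑ v ∈ Finset.range n, w u v :=
            Finset.sum_nonneg fun u _ => Finset.sum_nonneg fun v _ => hb.nonneg u v
          linarith)
        rfl).mono le_rfl ?_
      rintro s₈ - ⟨hbest₈, h13, hcand⟩
      refine ⟨hbest₈, h13.trans v13.le, fun _ hlo hhi => ?_⟩
      obtain ⟨-, hXi, hXik⟩ := hXspec i hi
      obtain ⟨-, hXj, hXjk⟩ := hXspec j hj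
      obtain ⟨-, hXk, hXkk⟩ := hXspec k' hk'
      -- Including dummy positions the set has exactly 3k elements, so its true size lies between 3k
      -- - (3m - n) and 3k. The two inequalities in the conclusion make both ends acceptable.
      have hsum := sum_digit_place (z := X k') hXi hXj hXik hXjk hXkk hr hr'
      obtain ⟨hle1, hle2⟩ := sum_range_le_add
        (χ := fun u => digit (mask3 m (X i) (X j) (X k')) (q u))
        (fun _ => digit_nonneg _ _) (fun _ => digit_le_one _ _) hb.le
      rw [hsum] at hle1 hle2
      push_cast at hle2
      have hA2 : (0 : ℤ) ≤ A₂ := by positivity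
      have m1 := mul_le_mul_of_nonneg_left hle1 hA2
      have m2 := mul_le_mul_of_nonneg_left hle2 hA2
      have hcut := hcand (by linarith) (by linarith)
      rw [cutVal_mask3 w hqlt hXi hXj] at hcut
      have p1 := ((entry_eq_one (by omega)).1 ha).2.2
      have p2 := ((entry_eq_one (by omega)).1 hb').2.2
      have p3 := ((entry_eq_one (by omega)).1 he).2.2
      have hK : (0 : ℤ) ≤ K := by positivity
      have := mul_le_mul_of_nonneg_left hcut hK
      linarith
    · rw [Term.eval_leq, Term.eval_var, h22, Term.eval_zero] at heq
      exact absurd (by positivity) (fun h => ile_ne_zero.2 h heq)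

/-! ### All guesses -/

/-- The digit of `g` with number `i` in base `B`. -/
def baseDigit (B g i : ℕ) : ℕ := g / B ^ i % B

/-- A power of variable `29`. -/
def powT : ℕ → Term
  | 0 => 1
  | i + 1 => powT i * .var 29

/-- The digit with number `i` of variable `5` in base variable `29`. -/
def baseDigitT (i : ℕ) : Term := .var 5 / powT i % .var 29

lemma eval_baseDigitT {g B : ℕ} (h5 : s.var 5 = g) (h29 : s.var 29 = B) (i : ℕ) :
    (baseDigitT i).eval s [] = baseDigit B g i := by
  have h : (powT i).eval s [] = (B ^ i : ℕ) := by
    induction i with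
    | zero => simp [powT]
    | succ i ih =>
      rw [powT, Term.eval_mul, ih, Term.eval_var, h29, pow_succ]; norm_cast
  simp only [baseDigitT, Term.eval_mod, Term.eval_div, Term.eval_var, h5, h29, h, baseDigit]
  norm_cast

/-- Decodes a guess. -/
def decodeCmd : Cmd :=
  .assign 7 (baseDigitT 0 % (2 * .var 1 + 1)) ;; .assign 8 (baseDigitT 1 % (.var 1 + 1)) ;;
  .assign 9 (baseDigitT 2) ;; .assign 10 (baseDigitT 3) ;; .assign 11 (baseDigitT 4) ;;
  .assign 12 (baseDigitT 5)

lemma Cmd.Spec.assign_val {x : ℕ} {e : Term} {v : ℤ} (hv : e.eval s [] = v)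
    (hb : |v| ≤ limit M L x) : (Cmd.assign x e).Spec M L s 1 fun s' => s'.var x = v :=
  .assign (by rwa [hv]) (by rw [State.setVar_var_self, hv])

/-- The first two digits are reduced so that every guess describes legitimate windows; thus the loop
over all guesses needs no test for this. -/
lemma decodeCmd_spec {g B : ℕ} (h1 : s.var 1 = m) (h5 : s.var 5 = g) (h29 : s.var 29 = B)
    (hB : 0 < B) (hBM : B ≤ M) : decodeCmd.Spec M L s 6 fun s' =>
      s'.var 7 = (baseDigit B g 0 % (2 * m + 1) : ℕ) ∧ s'.var 8 = (baseDigit B g 1 % (m + 1) : ℕ) ∧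
      s'.var 9 = baseDigit B g 2 ∧ s'.var 10 = baseDigit B g 3 ∧ s'.var 11 = baseDigit B g 4 ∧
      s'.var 12 = baseDigit B g 5 := by
  have hdig : ∀ i, baseDigit B g i ≤ M := fun i => (Nat.mod_lt _ hB).le.trans hBM
  have hlim : ∀ z x : ℕ, 4 ≤ x → z ≤ M → |(z : ℤ)| ≤ limit M L x := fun z x hx h1 => by
    rw [abs_of_nonneg (by positivity), limit, if_neg (by omega)]; exact_mod_cast h1
  have e7 : (baseDigitT 0 % (2 * .var 1 + 1)).eval s [] =
      ((baseDigit B g 0 % (2 * m + 1) : ℕ) : ℤ) := by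
    simp only [Term.eval_mod, Term.eval_add, Term.eval_mul, Term.eval_two, Term.eval_one,
      Term.eval_var, eval_baseDigitT h5 h29, h1]; norm_cast
  refine (Cmd.Spec.seq' (.assign_val e7 (hlim _ _ (by norm_num) ((Nat.mod_le _ _).trans (hdig _))))
    ?_).mono (by norm_num : 1 + (1 + (1 + (1 + (1 + 1)))) ≤ 6) (fun _ _ h => h)
  rintro s₁ f₁ g7
  have h1₁ := (f₁.1 1 (by simp [Cmd.KeepsVar])).trans h1
  have h5₁ := (f₁.1 5 (by simp [Cmd.KeepsVar])).trans h5
  have h29₁ := (f₁.1 29 (by simp [Cmd.KeepsVar])).trans h29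
  have e8 : (baseDigitT 1 % (.var 1 + 1)).eval s₁ [] =
      ((baseDigit B g 1 % (m + 1) : ℕ) : ℤ) := by
    simp only [Term.eval_mod, Term.eval_add, Term.eval_one, Term.eval_var,
      eval_baseDigitT h5₁ h29₁, h1₁]; norm_cast
  refine .seq' (.assign_val e8 (hlim _ _ (by norm_num) ((Nat.mod_le _ _).trans (hdig _)))) ?_
  rintro s₂ f₂ g8
  have h5₂ := (f₂.1 5 (by simp [Cmd.KeepsVar])).trans h5₁
  have h29₂ := (f₂.1 29 (by simp [Cmd.KeepsVar])).trans h29₁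
  refine .seq' (.assign_val (eval_baseDigitT h5₂ h29₂ 2) (hlim _ _ (by norm_num) (hdig _))) ?_
  rintro s₃ f₃ g9
  have h5₃ := (f₃.1 5 (by simp [Cmd.KeepsVar])).trans h5₂
  have h29₃ := (f₃.1 29 (by simp [Cmd.KeepsVar])).trans h29₂
  refine .seq' (.assign_val (eval_baseDigitT h5₃ h29₃ 3) (hlim _ _ (by norm_num) (hdig _))) ?_
  rintro s₄ f₄ g10
  have h5₄ := (f₄.1 5 (by simp [Cmd.KeepsVar])).trans h5₃
  have h29₄ := (f₄.1 29 (by simp [Cmd.KeepsVar])).trans h29₃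
  refine .seq' (.assign_val (eval_baseDigitT h5₄ h29₄ 4) (hlim _ _ (by norm_num) (hdig _))) ?_
  rintro s₅ f₅ g11
  have h5₅ := (f₅.1 5 (by simp [Cmd.KeepsVar])).trans h5₄
  have h29₅ := (f₅.1 29 (by simp [Cmd.KeepsVar])).trans h29₄
  refine (Cmd.Spec.assign_val (eval_baseDigitT h5₅ h29₅ 5)
    (hlim _ _ (by norm_num) (hdig _))).mono le_rfl ?_
  rintro s₆ f₆ g12
  simp only [Cmd.Frame, Cmd.KeepsVar] at f₂ f₃ f₄ f₅ f₆
  refine ⟨?_, ?_, ?_, ?_, ?_, g12⟩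
  · rw [f₆.1 7 (by norm_num), f₅.1 7 (by norm_num), f₄.1 7 (by norm_num), f₃.1 7 (by norm_num),
      f₂.1 7 (by norm_num), g7]
  · rw [f₆.1 8 (by norm_num), f₅.1 8 (by norm_num), f₄.1 8 (by norm_num), f₃.1 8 (by norm_num), g8]
  · rw [f₆.1 9 (by norm_num), f₅.1 9 (by norm_num), f₄.1 9 (by norm_num), g9]
  · rw [f₆.1 10 (by norm_num), f₅.1 10 (by norm_num), g10]
  · rw [f₆.1 11 (by norm_num), g11]

/-- Decodes a guess and tests it. -/
def guessCmd (S : BilinearScheme) (K A B A₁ A₂ : ℕ) : Cmd :=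
  decodeCmd ;;
  .ite (Term.leq (.const A * .var 9) (.const B * .var 1)) (bodyCmd S K A₁ A₂) .skip

/-- The guess `g` leads to a set of suitable size. -/
def Promising (K A B A₁ A₂ n m : ℕ) (w : ℕ → ℕ → ℤ) (W : ℤ → ℤ) (J Bs g : ℕ) : Prop :=
  A * baseDigit Bs g 2 ≤ B * m ∧
  (A₁ * n + A₂ * (3 * m) : ℤ) ≤ A₂ * (3 * baseDigit Bs g 2 + n) ∧
  (A₁ * n + A₂ * (3 * baseDigit Bs g 2) : ℤ) ≤ A₂ * n ∧
  Solvable K n m w W J (baseDigit Bs g 0 % (2 * m + 1)) (baseDigit Bs g 1 % (m + 1))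
    (baseDigit Bs g 2) (baseDigit Bs g 3) (baseDigit Bs g 4) (baseDigit Bs g 5)

/-- The matrices are built only if k passes the test A·k ≤ B·m. This is what keeps the list of masks
short enough for the time bound. -/
lemma guessCmd_spec {A B Bs g Y : ℕ} (hb : Bounds S n m M w W)
    (hs : Ctx n m (S.N * S.N) S.R W s) (h5 : s.var 5 = g) (h29 : s.var 29 = Bs)
    (h30 : s.var 30 = J) (hbest : Best A₁ A₂ n w s) (hBs : 0 < Bs) (hBsM : Bs ≤ M)
    (hY : ∀ k κ, A * k ≤ B * m → κ ≤ m → (κ = 0 ∨ S.N ^ (κ - 1) < maskCount m k) → S.R ^ κ ≤ Y) :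
    (guessCmd S K A B A₁ A₂).Spec M L s (50 * (m + 1) * (Y + 2 ^ m + n + 1)) fun s' =>
      Best A₁ A₂ n w s' ∧ s'.var 13 ≤ s.var 13 ∧
      (Promising K A B A₁ A₂ n m w W J Bs g →
        K * s'.var 13 ≤ thr W J (baseDigit Bs g 3) + thr W J (baseDigit Bs g 4) +
          thr W J (baseDigit Bs g 5)) := by
  have h1 : 1 ≤ (m + 1) * (Y + 2 ^ m + n + 1) := Nat.mul_pos (Nat.succ_pos _) (Nat.succ_pos _)
  refine Cmd.Spec.mono (Cmd.Spec.seq' (decodeCmd_spec hs.var_one h5 h29 hBs hBsM) ?_)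
    (by rw [mul_assoc, mul_assoc]; omega :
      6 + (1 + 40 * (m + 1) * (Y + 2 ^ m + n + 1)) ≤ _) (fun _ _ h => h)
  rintro s₁ hfr ⟨h7, h8, h9, h10, h11, h12⟩
  have hc₁ : Ctx n m (S.N * S.N) S.R W s₁ :=
    hs.frame hfr (by simp [decodeCmd, Cmd.KeepsVar, Cmd.KeepsArr])
  have v13 : s₁.var 13 = s.var 13 := hfr.1 13 (by simp [decodeCmd, Cmd.KeepsVar])
  have v30 : s₁.var 30 = J := (hfr.1 30 (by simp [decodeCmd, Cmd.KeepsVar])).trans h30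
  have hbest₁ : Best A₁ A₂ n w s₁ :=
    hbest.congr (hfr.2 11 (by simp [decodeCmd, Cmd.KeepsArr])) v13
  have hcond : (Term.leq (.const A * .var 9) (.const B * .var 1)).eval s₁ [] ≠ 0 ↔
      A * baseDigit Bs g 2 ≤ B * m := by
    simp only [Term.eval_leq, Term.eval_mul, Term.eval_const, Term.eval_var, h9, hc₁.var_one,
      ile_ne_zero]
    norm_cast
  refine .ite (fun hne => ?_) (fun heq => ?_)
  · have hk := hcond.1 hne
    refine (bodyCmd_spec (Y := Y) hb hc₁ h7 h8 h9 h10 h11 h12 v30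
      (Nat.lt_succ_iff.1 (Nat.mod_lt _ (by omega))) (Nat.lt_succ_iff.1 (Nat.mod_lt _ (by omega)))
      hbest₁ (fun κ hκ h => hY _ κ hk hκ h)).mono le_rfl ?_
    rintro s' - ⟨h1, h2, h3⟩
    exact ⟨h1, h2.trans v13.le, fun hp => h3 hp.2.2.2 hp.2.1 hp.2.2.1⟩
  · refine (Cmd.Spec.skip ?_ : Cmd.skip.Spec M L _ 1 _).mono ?_ (fun _ _ h => h)
    · exact ⟨hbest₁, v13.le, fun hp => absurd heq (hcond.2 hp.1)⟩
    · rw [mul_assoc]; omega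

/-- Tests all guesses. -/
def searchCmd (S : BilinearScheme) (K A B A₁ A₂ : ℕ) : Cmd :=
  .loop 5 (powT 6) (guessCmd S K A B A₁ A₂)

lemma guessCmd_keepsVar (S : BilinearScheme) (K A B A₁ A₂ : ℕ) :
    ∀ y ∈ [0, 1, 2, 3, 29, 30], (guessCmd S K A B A₁ A₂).KeepsVar y := by
  simp [guessCmd, decodeCmd, bodyCmd, placeCmd, listCmd, dimCmd, tableCmd, findCmd, candCmd,
    BilinearScheme.mulCmd, BilinearScheme.upCmd, BilinearScheme.prodCmd, BilinearScheme.downCmd,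
    Cmd.KeepsVar]

lemma guessCmd_keepsArr (S : BilinearScheme) (K A B A₁ A₂ : ℕ) :
    ∀ b ∈ [1, 3], (guessCmd S K A B A₁ A₂).KeepsArr b := by
  simp [guessCmd, decodeCmd, bodyCmd, placeCmd, listCmd, dimCmd, tableCmd, findCmd, candCmd,
    BilinearScheme.mulCmd, BilinearScheme.upCmd, BilinearScheme.prodCmd, BilinearScheme.downCmd,
    Cmd.KeepsArr]

/-- Since variable 13 never increases, the bound that a promising guess establishes persists through
the later guesses. -/
lemma searchCmd_spec {A B Bs Y : ℕ} (hb : Bounds S n m M w W)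
    (hs : Ctx n m (S.N * S.N) S.R W s) (h29 : s.var 29 = Bs)
    (h30 : s.var 30 = J) (hbest : Best A₁ A₂ n w s) (hBs : 0 < Bs) (hBsM : Bs ^ 6 ≤ M)
    (hY : ∀ k κ, A * k ≤ B * m → κ ≤ m → (κ = 0 ∨ S.N ^ (κ - 1) < maskCount m k) → S.R ^ κ ≤ Y) :
    (searchCmd S K A B A₁ A₂).Spec M L s
      (1 + Bs ^ 6 * (1 + 50 * (m + 1) * (Y + 2 ^ m + n + 1))) fun s' =>
      Best A₁ A₂ n w s' ∧ ∀ g < Bs ^ 6, Promising K A B A₁ A₂ n m w W J Bs g →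
        K * s'.var 13 ≤ thr W J (baseDigit Bs g 3) + thr W J (baseDigit Bs g 4) +
          thr W J (baseDigit Bs g 5) := by
  refine Cmd.Spec.loop (m := Bs ^ 6) ?_ (by simp [limit]; omega)
    (fun i s' => Best A₁ A₂ n w s' ∧ ∀ g < i, Promising K A B A₁ A₂ n m w W J Bs g →
        K * s'.var 13 ≤ thr W J (baseDigit Bs g 3) + thr W J (baseDigit Bs g 4) +
          thr W J (baseDigit Bs g 5)) ⟨hbest, by simp⟩ ?_
  · simp only [powT, Term.eval_mul, Term.eval_one, Term.eval_var, h29]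
    norm_cast
  · rintro g hg s' hfr ⟨hbest', hall⟩
    have hkv : ∀ y ∈ [0, 1, 2, 3, 29, 30], s'.var y = s.var y := fun y hy =>
      hfr.1 y ⟨by rintro rfl; simp at hy, guessCmd_keepsVar S K A B A₁ A₂ y hy⟩
    have hka : ∀ b ∈ [1, 3], s'.arr b = s.arr b := fun b hb =>
      hfr.2 b (guessCmd_keepsArr S K A B A₁ A₂ b hb)
    have hc : Ctx n m (S.N * S.N) S.R W (s'.setVar 5 g) :=
      hs.congr (hkv 0 (by simp)) (hkv 1 (by simp)) (hkv 2 (by simp)) (hkv 3 (by simp))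
        (hka 1 (by simp)) (hka 3 (by simp))
    refine (guessCmd_spec (Y := Y) hb hc (State.setVar_var_self _ _ _)
      ((hkv 29 (by simp)).trans h29) ((hkv 30 (by simp)).trans h30)
      (hbest'.congr rfl rfl) hBs ((Nat.le_self_pow (by norm_num) _).trans hBsM) hY).mono le_rfl ?_
    rintro s'' - ⟨h1, h2, h3⟩
    refine ⟨h1, fun g' hg' hp => ?_⟩
    rcases Nat.lt_succ_iff_lt_or_eq.1 hg' with h | rfl
    · have h4 := hall g' h hp
      have hK : (0 : ℤ) ≤ K := by positivity
      have := mul_le_mul_of_nonneg_left h2 hK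
      exact this.trans h4
    · exact h3 hp

end

end OLA

namespace OLA

/-! ### Initialization -/

/-- Computes the constants of the search. -/
def initCmd (S : BilinearScheme) (K : ℕ) : Cmd :=
  .assign 1 ((.var 0 + .const 4) / .const 3) ;; .assign 2 (.const (S.N * S.N : ℕ)) ;;
  .assign 3 (.const S.R) ;; .write 3 0 1 ;;
  .loop 4 (.const 3 * .var 1) (.write 3 (.var 4 + 1) (.read 3 (.var 4) * 2)) ;;
  .assign 30 (.const K * (.var 0 * .var 0) + 1) ;;
  .assign 29 (.var 0 * .var 0 * .var 30 + .const 3 * .var 1 + 1) ;;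
  .assign 13 (2 * .sum 0 (.sum 0 weightT) + 1)

section

variable {S : BilinearScheme} {n m J : ℕ} {W : ℤ → ℤ} {s : State}
  {w : ℕ → ℕ → ℤ} {M L K A₁ A₂ : ℕ}

lemma initCmd_spec (hb : Bounds S n m M w W) (hm : m = (n + 4) / 3) (h0 : s.var 0 = n)
    (h1 : s.arr 1 = W) (h11 : ∀ z, s.arr 11 z = 0) (hmL : m ≤ L) (hNL : S.N * S.N ≤ L)
    (hRL : S.R ≤ L) (hJ : J = K * (n * n) + 1) {Bs : ℕ} (hBs : Bs = n * n * J + 3 * m + 1)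
    (hBsM : Bs ≤ M) (hJM : J ≤ M) :
    (initCmd S K).Spec M L s (10 + 6 * m) fun s' =>
      Ctx n m (S.N * S.N) S.R W s' ∧ s'.var 29 = Bs ∧ s'.var 30 = J ∧ Best A₁ A₂ n w s' := by
  have hmag : 1 ≤ S.magnitude := Nat.mul_pos S.R_pos (Nat.succ_pos _)
  have hlimM : ∀ z x : ℕ, 4 ≤ x → z ≤ M → |(z : ℤ)| ≤ limit M L x := fun z x hx h1 => by
    rw [abs_of_nonneg (by positivity), limit, if_neg (by omega)]; exact_mod_cast h1
  have hlimL : ∀ z x : ℕ, x < 4 → z ≤ L → |(z : ℤ)| ≤ limit M L x := fun z x hx h1 => by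
    rw [abs_of_nonneg (by positivity), limit, if_pos (by omega)]; exact_mod_cast h1
  have hpow : ∀ i ≤ 3 * m, 2 ^ i ≤ M := by
    intro i hi
    have h2 : 2 ≤ S.magnitude := by
      have h3 : 2 ≤ S.R := S.two_le.trans ((Nat.le_mul_of_pos_right _ S.N_pos).trans S.sq_le)
      exact h3.trans (Nat.le_mul_of_pos_right _ (Nat.succ_pos _))
    exact (Nat.pow_le_pow_left h2 i).trans ((Nat.pow_le_pow_right hmag hi).trans hb.magnitude_le)
  have hM1 : 1 ≤ M := hpow 0 (Nat.zero_le _)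
  refine Cmd.Spec.mono (Cmd.Spec.seq' (.assign_val (v := (m : ℕ)) ?_ (hlimL _ _ (by norm_num) hmL))
    ?_) (by omega : 1 + (1 + (1 + (1 + ((1 + (3 * m) * (1 + 1)) + (1 + (1 + 1)))))) ≤ _)
    (fun _ _ h => h)
  · simp only [Term.eval_div, Term.eval_add, Term.eval_var, Term.eval_const, h0, hm]; norm_cast
  rintro s₁ f₁ g1
  refine .seq' (.assign_val (v := (S.N * S.N : ℕ)) rfl (hlimL _ _ (by norm_num) hNL)) ?_
  rintro s₂ f₂ g2
  refine .seq' (.assign_val (v := (S.R : ℕ)) rfl (hlimL _ _ (by norm_num) hRL)) ?_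
  rintro s₃ f₃ g3
  refine .seq' (Q' := fun s' => s'.arr 3 0 = 1) (.write (by simpa using hM1) (by
    simp [State.setArr])) ?_
  rintro s₄ f₄ g4
  simp only [Cmd.Frame, Cmd.KeepsVar, Cmd.KeepsArr] at f₁ f₂ f₃ f₄
  have v0 : s₄.var 0 = n := by
    rw [f₄.1 0 trivial, f₃.1 0 (by norm_num), f₂.1 0 (by norm_num), f₁.1 0 (by norm_num), h0]
  have v1 : s₄.var 1 = m := by
    rw [f₄.1 1 trivial, f₃.1 1 (by norm_num), f₂.1 1 (by norm_num), g1]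
  have v2 : s₄.var 2 = (S.N * S.N : ℕ) := by rw [f₄.1 2 trivial, f₃.1 2 (by norm_num), g2]
  have v3 : s₄.var 3 = S.R := by rw [f₄.1 3 trivial, g3]
  have a1 : s₄.arr 1 = W := by
    rw [f₄.2 1 (by norm_num), f₃.2 1 trivial, f₂.2 1 trivial, f₁.2 1 trivial, h1]
  have a11 : s₄.arr 11 = s.arr 11 := by
    rw [f₄.2 11 (by norm_num), f₃.2 11 trivial, f₂.2 11 trivial, f₁.2 11 trivial]
  refine .seq' (Cmd.Spec.fill (m := 3 * m) ?_ (by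
      have := hb.three_mul_le; simp [limit]; omega) (fun i => ((i + 1 : ℕ) : ℤ))
    (fun i => ((2 ^ (i + 1) : ℕ) : ℤ)) ?_ ?_ ?_) ?_
  · simp only [Term.eval_mul, Term.eval_var, Term.eval_const, v1]; norm_cast
  · intro i _ j _ hij; have := Int.natCast_inj.1 hij; omega
  · intro i hi
    rw [abs_of_nonneg (by positivity)]; exact_mod_cast hpow (i + 1) (by omega)
  · intro i hi s' hv ha h4 hdone hkeep
    refine ⟨by simp [h4], ?_⟩
    have hi3 : s'.arr 3 (i : ℤ) = (2 ^ i : ℕ) := by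
      rcases i with _ | i
      · have := hkeep 0 (by simp)
        simp only [Nat.cast_zero, pow_zero, Nat.cast_one] at this ⊢
        rw [this, g4]
      · exact hdone i (by omega)
    rw [Term.eval_mul, Term.eval_read, Term.eval_var, h4, hi3, Term.eval_two, pow_succ]
    norm_cast
  rintro s₅ f₅ ⟨hfill, hkeep⟩
  simp only [Cmd.Frame, Cmd.KeepsVar, Cmd.KeepsArr] at f₅
  have w0 : s₅.var 0 = n := (f₅.1 0 (by norm_num)).trans v0
  have w1 : s₅.var 1 = m := (f₅.1 1 (by norm_num)).trans v1
  have p3 : ∀ i ≤ 3 * m, s₅.arr 3 (i : ℤ) = 2 ^ i := by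
    intro i hi
    rcases i with _ | i
    · have := hkeep 0 (fun i _ => by positivity)
      simp only [Nat.cast_zero, pow_zero] at this ⊢
      rw [this, g4]
    · rw [hfill i (by omega)]; norm_cast
  have hc₅ : Ctx n m (S.N * S.N) S.R W s₅ :=
    ⟨w0, w1, (f₅.1 2 (by norm_num)).trans v2, (f₅.1 3 (by norm_num)).trans v3,
      (f₅.2 1 (by norm_num)).trans a1, p3⟩
  refine .seq' (.assign_val (v := (J : ℕ)) ?_ (hlimM _ _ (by norm_num) hJM)) ?_
  · simp only [Term.eval_mul, Term.eval_add, Term.eval_var, Term.eval_const, Term.eval_one, w0, hJ]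
    norm_cast
  rintro s₆ f₆ g6
  have hc₆ := hc₅.frame f₆ (by simp [Cmd.KeepsVar, Cmd.KeepsArr])
  refine .seq' (.assign_val (v := (Bs : ℕ)) ?_ (hlimM _ _ (by norm_num) hBsM)) ?_
  · simp only [Term.eval_mul, Term.eval_add, Term.eval_var, Term.eval_const, Term.eval_one,
      hc₆.var_zero, hc₆.var_one, g6, hBs]
    norm_cast
  rintro s₇ f₇ g7
  have hc₇ := hc₆.frame f₇ (by simp [Cmd.KeepsVar, Cmd.KeepsArr])
  have esum : (2 * Term.sum 0 (.sum 0 weightT) + 1).eval s₇ [] =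
      2 * ∑ u ∈ Finset.range n, ∑ v ∈ Finset.range n, w u v + 1 := by
    rw [Term.eval_add, Term.eval_mul, Term.eval_two, Term.eval_sum, show s₇.var ((0 : Fin 4) : ℕ) = n from hc₇.var_zero,
      Int.toNat_natCast, Term.eval_one]
    congr 2
    refine Finset.sum_congr rfl fun u hu => ?_
    rw [Term.eval_sum, show s₇.var ((0 : Fin 4) : ℕ) = n from hc₇.var_zero, Int.toNat_natCast]
    refine Finset.sum_congr rfl fun v hv => ?_
    simp only [weightT, Term.eval_read, Term.eval_add, Term.eval_mul, Term.eval_var,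
      Term.eval_bvar, List.getD_cons_zero, List.getD_cons_succ, hc₇.var_zero, hc₇.arr_one]
    exact hb.weight u (Finset.mem_range.1 hu) v (Finset.mem_range.1 hv)
  refine (Cmd.Spec.assign_val esum ?_).mono le_rfl ?_
  · have h2 : 0 ≤ ∑ u ∈ Finset.range n, ∑ v ∈ Finset.range n, w u v :=
      Finset.sum_nonneg fun u _ => Finset.sum_nonneg fun v _ => hb.nonneg u v
    rw [abs_of_nonneg (by linarith)]
    simpa [limit] using hb.sum_le
  rintro s₈ f₈ g8
  simp only [Cmd.Frame, Cmd.KeepsVar, Cmd.KeepsArr] at f₆ f₇ f₈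
  refine ⟨hc₇.congr (f₈.1 0 (by norm_num)) (f₈.1 1 (by norm_num)) (f₈.1 2 (by norm_num))
    (f₈.1 3 (by norm_num)) (f₈.2 1 trivial) (f₈.2 3 trivial), (f₈.1 29 (by norm_num)).trans g7,
    (f₈.1 30 (by norm_num)).trans ((f₇.1 30 (by norm_num)).trans g6), fun _ => 0, fun v _ => ?_,
    fun _ => Or.inl rfl, Or.inl ⟨fun _ => rfl, g8⟩⟩
  rw [f₈.2 11 trivial, f₇.2 11 trivial, f₆.2 11 trivial, f₅.2 11 (by norm_num), a11, h11]

/-! ### The right guess -/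

/-- Let p be the largest term and G the sum, so that p ≤ G ≤ n²·p. The multiple p·j with j = ⌈KG/p⌉
lies between KG and KG + p ≤ (K+1)G, and j ≤ K·n². As p is an entry of W, the number of possible
thresholds is polynomial whatever the size of the weights. -/
lemma exists_threshold {P : ℕ → ℕ → ℤ} {w : ℕ → ℕ → ℤ}
    (hW : ∀ u < n, ∀ v < n, W ((n : ℤ) * u + v) = w u v)
    (hP : ∀ u v, P u v = 0 ∨ P u v = w u v) (hP0 : ∀ u v, 0 ≤ P u v)
    (hJ : J = K * (n * n) + 1) :
    ∃ i, i < n * n * J + 1 ∧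
      K * ∑ u ∈ Finset.range n, ∑ v ∈ Finset.range n, P u v ≤ thr W J i ∧
      thr W J i ≤ (K + 1) * ∑ u ∈ Finset.range n, ∑ v ∈ Finset.range n, P u v := by
  rw [← Finset.sum_product' (f := P)]
  set T := Finset.range n ×ˢ Finset.range n with hT
  have hnn : 0 ≤ ∑ x ∈ T, P x.1 x.2 := Finset.sum_nonneg fun x _ => hP0 _ _
  rcases hnn.eq_or_lt with h0 | hpos
  · refine ⟨0, by omega, ?_⟩
    rw [← h0]; simp [thr]
  have hne : T.Nonempty := by
    by_contra hcon
    rw [Finset.not_nonempty_iff_eq_empty.1 hcon] at hpos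
    simp at hpos
  obtain ⟨⟨u, v⟩, huv, hmax⟩ := Finset.exists_max_image T (fun x => P x.1 x.2) hne
  obtain ⟨hu, hv⟩ := Finset.mem_product.1 huv
  have hu := Finset.mem_range.1 hu
  have hv := Finset.mem_range.1 hv
  set G := ∑ x ∈ T, P x.1 x.2 with hG
  have hle : P u v ≤ G := Finset.single_le_sum (f := fun x => P x.1 x.2) (fun x _ => hP0 _ _) huv
  have hGle : G ≤ (n * n : ℕ) * P u v := by
    calc G ≤ ∑ _x ∈ T, P u v := Finset.sum_le_sum fun x hx => hmax x hx
      _ = _ := by rw [Finset.sum_const, hT, Finset.card_product, Finset.card_range, nsmul_eq_mul]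
  have hPpos : 0 < P u v := by
    by_contra hcon
    have : P u v = 0 := le_antisymm (not_lt.1 hcon) (hP0 _ _)
    rw [this] at hGle; simp at hGle; omega
  have hPw : P u v = w u v := (hP u v).resolve_left hPpos.ne'
  set p := P u v with hp
  have hK : (0 : ℤ) ≤ K := by positivity
  -- The ceiling of K·G/p.
  obtain ⟨j, hj⟩ : ∃ j : ℕ, (j : ℤ) = (K * G + p - 1) / p :=
    ⟨((K * G + p - 1) / p).toNat, Int.toNat_of_nonneg (Int.ediv_nonneg (by nlinarith) hPpos.le)⟩
  have h1 : K * G ≤ p * j := by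
    have := Int.lt_ediv_add_one_mul_self (K * G + p - 1) hPpos
    rw [hj]; nlinarith
  have h2 : p * j ≤ K * G + p - 1 := by rw [hj]; exact Int.mul_ediv_self_le hPpos.ne'
  have hjJ : j < J := by
    have h3 : p * j < p * (J : ℤ) := by
      have : (J : ℤ) = K * (n * n : ℕ) + 1 := by rw [hJ]; push_cast; ring
      rw [this]
      have := mul_le_mul_of_nonneg_left hGle hK
      nlinarith
    exact_mod_cast lt_of_mul_lt_mul_left h3 hPpos.le
  have hthr : thr W J ((n * u + v) * J + j) = p * j := by
    rw [thr, add_mul_div_of_lt hjJ, add_mul_mod_of_lt hjJ, hPw, ← hW u hu v hv]; push_cast; rfl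
  refine ⟨(n * u + v) * J + j, ?_, ?_, ?_⟩
  · have : n * u + v < n * n := by rw [mul_comm n u]; exact mul_add_lt_mul hu hv
    exact (mul_add_lt_mul this hjJ).trans (Nat.lt_succ_self _)
  · rw [hthr]; exact h1
  · rw [hthr]; linarith

lemma exists_baseDigits {B : ℕ} (d : ℕ → ℕ) (hd : ∀ i, d i < B) :
    ∀ l, ∃ g < B ^ l, ∀ i < l, baseDigit B g i = d i := by
  -- The offset o lets the induction peel off the lowest digit.
  suffices h : ∀ l o, ∃ g < B ^ l, ∀ i < l, baseDigit B g i = d (o + i) by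
    intro l; simpa using h l 0
  have hB : 0 < B := (Nat.zero_le _).trans_lt (hd 0)
  intro l
  induction l with
  | zero => intro o; exact ⟨0, by simp, by simp⟩
  | succ l ih =>
    intro o
    obtain ⟨g, hg, hgd⟩ := ih (o + 1)
    refine ⟨g * B + d o, ?_, ?_⟩
    · rw [pow_succ]; exact mul_add_lt_mul hg (hd o)
    · intro i hi
      rcases i with _ | i
      · rw [baseDigit, pow_zero, Nat.div_one, add_mul_mod_of_lt (hd o), add_zero]
      · rw [baseDigit, pow_succ', ← Nat.div_div_eq_div_mul, add_mul_div_of_lt (hd o)]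
        have := hgd i (by omega)
        rw [baseDigit] at this
        rw [this]; congr 1; omega

/-- The set b is padded to a multiple of three, balanced over the blocks by two window shifts, and
its three partial cuts are rounded up to thresholds. The rounding loses a factor of at most (K+1)/K
in each part, hence also in the sum. -/
lemma exists_guess {A B k t Bs : ℕ} (hW : ∀ u < n, ∀ v < n, W ((n : ℤ) * u + v) = w u v)
    (hw : ∀ u v, 0 ≤ w u v) {b : ℕ → ℤ} (hb : ∀ u, b u = 0 ∨ b u = 1)
    (ht : ∑ u ∈ Finset.range n, b u = t) (htk : t ≤ 3 * k) (hkt : 3 * k ≤ t + 2)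
    (hm : n + 2 ≤ 3 * m) (hJ : J = K * (n * n) + 1) (hBs : Bs = n * n * J + 3 * m + 1)
    (h1 : A * k ≤ B * m) (h2 : (A₁ * n + A₂ * (3 * m) : ℤ) ≤ A₂ * (3 * k + n))
    (h3 : (A₁ * n + A₂ * (3 * k) : ℤ) ≤ A₂ * n) :
    ∃ g < Bs ^ 6, Promising K A B A₁ A₂ n m w W J Bs g ∧
      thr W J (baseDigit Bs g 3) + thr W J (baseDigit Bs g 4) + thr W J (baseDigit Bs g 5) ≤
        (K + 1) * cutVal n w b := by
  have b0 : ∀ v, 0 ≤ b v := fun v => by rcases hb v with e | e <;> rw [e]; norm_num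
  have b1 : ∀ v, b v ≤ 1 := fun v => by rcases hb v with e | e <;> rw [e]; norm_num
  have htn : t ≤ n := by
    have := Finset.sum_le_sum (s := Finset.range n) fun v _ => b1 v
    rw [ht] at this
    simpa using this
  -- At most two dummy elements are added; there is room for them because n + 2 ≤ 3m.
  set χ : ℕ → ℤ := fun e => if e < n then b e else if e < n + (3 * k - t) then 1 else 0 with hχ
  have χ01 : ∀ i, 0 ≤ χ i ∧ χ i ≤ 1 := by
    intro i; simp only [hχ]; split_ifs
    exacts [⟨b0 i, b1 i⟩, by norm_num, by norm_num]
  have hsum : ∑ i ∈ Finset.range (3 * m), χ i = (3 * k : ℕ) := by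
    obtain ⟨d, hd⟩ := Nat.exists_eq_add_of_le (show n + (3 * k - t) ≤ 3 * m by omega)
    rw [hd, Finset.sum_range_add, Finset.sum_range_add]
    have e1 : ∑ i ∈ Finset.range n, χ i = t := by
      rw [← ht]
      exact Finset.sum_congr rfl fun i hi => by simp [hχ, Finset.mem_range.1 hi]
    have e2 : ∑ i ∈ Finset.range (3 * k - t), χ (n + i) = (3 * k - t : ℕ) := by
      rw [Finset.sum_congr rfl (g := fun _ => 1)]
      · simp
      · intro i hi; simp [hχ, Finset.mem_range.1 hi]
    have e3 : ∑ i ∈ Finset.range d, χ (n + (3 * k - t) + i) = 0 := by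
      refine Finset.sum_eq_zero fun i _ => ?_
      simp only [hχ]; rw [if_neg (by omega), if_neg (by omega)]
    rw [e1, e2, e3]; omega
  obtain ⟨r, r', hr, hr', ψ, ψ0, ψ1, hψ, hblock⟩ :=
    exists_balanced χ (fun i => (χ01 i).1) (fun i => (χ01 i).2) m k hsum
  have ψ01 : ∀ i, ψ i = 0 ∨ ψ i = 1 := fun i => by have := ψ0 i; have := ψ1 i; omega
  have hmask : ∀ j, ∃ x < 2 ^ m, ∀ i < m, digit x i = ψ (j * m + i) := by
    intro j
    refine ⟨mask ((Finset.range m).filter fun i => ψ (j * m + i) = 1),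
      mask_lt (Finset.filter_subset _ _), fun i hi => ?_⟩
    rw [digit_mask]
    rcases ψ01 (j * m + i) with e | e <;> simp [e, hi]
  obtain ⟨x, hx, hxd⟩ := hmask 0
  obtain ⟨y, hy, hyd⟩ := hmask 1
  obtain ⟨z, hz, hzd⟩ := hmask 2
  have hpop : ∀ (j x : ℕ), j < 3 → (∀ i < m, digit x i = ψ (j * m + i)) → popcount m x = k := by
    intro j x hj hx
    rw [← hblock j hj]
    exact Finset.sum_congr rfl fun i hi => hx i (Finset.mem_range.1 hi)
  have hq : ∀ u < n, place m r r' u < 3 * m := fun u hu => place_lt hr hr' (by omega)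
  have hdig : ∀ e < 3 * m, digit (mask3 m x y z) e = ψ e := by
    intro e he
    rw [digit_mask3 hx hy]
    split_ifs with c1 c2
    · rw [hxd e c1]; congr 1; omega
    · rw [hyd _ (by omega)]; congr 1; omega
    · rw [hzd _ (by omega)]; congr 1; omega
  have hcut : cutVal n w b = cutVal n w (fun u => digit (mask3 m x y z) (place m r r' u)) := by
    refine cutVal_congr fun u hu => ?_
    rw [hdig _ (hq u hu), place, hψ u]; simp [hχ, hu]
  rw [cutVal_mask3 w hq hx hy] at hcut
  have key : ∀ lo hi X, ∃ i, i < n * n * J + 1 ∧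
      K * cutVal n (partWt w m (place m r r') lo hi) (fun u => digit X (place m r r' u)) ≤
        thr W J i ∧ thr W J i ≤ (K + 1) * cutVal n (partWt w m (place m r r') lo hi)
          (fun u => digit X (place m r r' u)) := by
    intro lo hi X
    refine exists_threshold (w := w) hW (fun u v => ?_) (fun u v => ?_) hJ
    · simp only [partWt, digit]; split_ifs <;> simp
    · exact mul_nonneg (mul_nonneg (partWt_nonneg hw _ _ _ _ _ _) (digit_nonneg _ _))
        (by linarith [digit_le_one X (place m r r' v)])
  obtain ⟨i₀, hi₀, l₀, u₀⟩ := key 0 2 (mask3 m x y 0)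
  obtain ⟨i₁, hi₁, l₁, u₁⟩ := key 5 8 (mask3 m 0 y z)
  obtain ⟨i₂, hi₂, l₂, u₂⟩ := key 3 4 (mask3 m x 0 z)
  have hA : k ≤ m := by
    have := hpop 0 x (by norm_num) hxd
    have h4 : popcount m x ≤ m := by
      have := Finset.sum_le_sum (s := Finset.range m) fun i _ => digit_le_one x i
      simpa [popcount] using this
    omega
  set d : ℕ → ℕ := fun i => match i with
    | 0 => r | 1 => r' | 2 => k | 3 => i₀ | 4 => i₁ | 5 => i₂ | _ => 0 with hd
  -- The base exceeds the range of each of the six digits: the windows r ≤ 2m and r' ≤ m, the size k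
  -- ≤ m, and the three threshold numbers up to n²·J.
  obtain ⟨g, hg, hgd⟩ := exists_baseDigits (B := Bs) d (by
    intro i; rw [hBs]; simp only [hd]; split <;> omega) 6
  have d0 : baseDigit Bs g 0 = r := hgd 0 (by norm_num)
  have d1 : baseDigit Bs g 1 = r' := hgd 1 (by norm_num)
  have d2 : baseDigit Bs g 2 = k := hgd 2 (by norm_num)
  have d3 : baseDigit Bs g 3 = i₀ := hgd 3 (by norm_num)
  have d4 : baseDigit Bs g 4 = i₁ := hgd 4 (by norm_num)
  have d5 : baseDigit Bs g 5 = i₂ := hgd 5 (by norm_num)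
  refine ⟨g, hg, ?_, ?_⟩
  · rw [Promising, d0, d1, d2, d3, d4, d5, Nat.mod_eq_of_lt (by omega), Nat.mod_eq_of_lt (by omega)]
    exact ⟨h1, h2, h3, x, hx, y, hy, z, hz, hpop 0 x (by norm_num) hxd, hpop 1 y (by norm_num) hyd,
      hpop 2 z (by norm_num) hzd, l₀, l₁, l₂⟩
  · rw [d3, d4, d5, hcut]; linarith

end

end OLA

namespace OLA

/-! ### The minimization over the last element -/

/-- The candidates for the last element of the set with mask `T`. -/
def candidate (s T v : ℕ) : ℤ := digit T v * ile ((if 2 ^ s ≤ T then s else 0 : ℕ)) v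

/-- The least candidate for which the table entry of the remaining set is minimal. -/
def argmin (n s : ℕ) (F : ℤ → ℤ) (T : ℕ) : ℤ :=
  ∑ v ∈ Finset.range n, (v : ℤ) * candidate s T v * ile (∑ v' ∈ Finset.range n, candidate s T v' *
    ilt (F ((T : ℤ) - 2 ^ v') * n + v') (F ((T : ℤ) - 2 ^ v) * n + v)) 0

lemma candidate_eq (s T v : ℕ) :
    candidate s T v = if T.testBit v ∧ (2 ^ s ≤ T → s ≤ v) then 1 else 0 := by
  unfold candidate digit ile
  by_cases h1 : T.testBit v <;> by_cases h2 : 2 ^ s ≤ T <;> by_cases h3 : s ≤ v <;>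
    simp [h1, h2, h3]

/-- The key F·n + v is injective for v < n, since v is its remainder modulo n. So exactly one
candidate has no candidate with smaller key, and the sum over v reduces to this candidate. Comparing
keys compares values of F first. -/
lemma argmin_spec {n s T : ℕ} (F : ℤ → ℤ) (h : ∃ v < n, candidate s T v = 1) :
    ∃ v < n, argmin n s F T = v ∧ candidate s T v = 1 ∧
      ∀ v' < n, candidate s T v' = 1 → F ((T : ℤ) - 2 ^ v) ≤ F ((T : ℤ) - 2 ^ v') := by
  set C := (Finset.range n).filter fun v => candidate s T v = 1 with hC
  set key : ℕ → ℤ := fun v => F ((T : ℤ) - 2 ^ v) * n + v with hkey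
  have hCne : C.Nonempty := by
    obtain ⟨v, hv, hv'⟩ := h
    exact ⟨v, by rw [hC, Finset.mem_filter, Finset.mem_range]; exact ⟨hv, hv'⟩⟩
  have hc01 : ∀ v, candidate s T v = 0 ∨ candidate s T v = 1 := by
    intro v; rw [candidate_eq]; split_ifs <;> simp
  have hmemC : ∀ v, v ∈ C ↔ v < n ∧ candidate s T v = 1 := by
    intro v; rw [hC, Finset.mem_filter, Finset.mem_range]
  have hinj : ∀ u < n, ∀ v < n, key u = key v → u = v := by
    intro u hu v hv huv
    have h1 : key u % n = u := by
      simp only [hkey]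
      rw [add_comm, Int.add_mul_emod_self_right]
      exact Int.emod_eq_of_lt (by positivity) (by exact_mod_cast hu)
    have h2 : key v % n = v := by
      simp only [hkey]
      rw [add_comm, Int.add_mul_emod_self_right]
      exact Int.emod_eq_of_lt (by positivity) (by exact_mod_cast hv)
    rw [huv, h2] at h1
    exact_mod_cast h1.symm
  obtain ⟨v₀, hv₀, hmin⟩ := Finset.exists_min_image C key hCne
  obtain ⟨hv₀n, hv₀c⟩ := (hmemC v₀).1 hv₀
  have hinner : ∀ v, (∑ v' ∈ Finset.range n, candidate s T v' * ilt (key v') (key v) ≤ 0) ↔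
      ∀ v' ∈ C, key v ≤ key v' := by
    intro v
    have hnn : ∀ v' ∈ Finset.range n, 0 ≤ candidate s T v' * ilt (key v') (key v) := by
      intro v' _
      rcases hc01 v' with e | e <;> rw [e] <;> simp only [ilt] <;> split_ifs <;> norm_num
    constructor
    · intro hle v' hv'
      obtain ⟨h1, h2⟩ := (hmemC v').1 hv'
      have h3 := (Finset.single_le_sum hnn (Finset.mem_range.2 h1)).trans hle
      rw [h2, one_mul] at h3
      by_contra hcon
      simp [ilt, not_le.1 hcon] at h3
    · intro hall
      refine (Finset.sum_eq_zero fun v' hv' => ?_).le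
      rcases hc01 v' with e | e
      · rw [e, zero_mul]
      · have := hall v' ((hmemC v').2 ⟨Finset.mem_range.1 hv', e⟩)
        rw [ilt, if_neg (not_lt.2 this), mul_zero]
  refine ⟨v₀, hv₀n, ?_, hv₀c, ?_⟩
  · unfold argmin
    rw [Finset.sum_eq_single v₀]
    · rw [hv₀c, mul_one, ile, if_pos ((hinner v₀).2 hmin), mul_one]
    · intro v hv hne
      rcases hc01 v with e | e
      · rw [e]; ring
      · rw [ile, if_neg, mul_zero]
        intro hle
        have h1 := (hinner v).1 hle v₀ hv₀
        have h2 := hmin v ((hmemC v).2 ⟨Finset.mem_range.1 hv, e⟩)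
        exact hne (hinj v (Finset.mem_range.1 hv) v₀ hv₀n (le_antisymm h1 h2))
    · intro hcon; exact absurd (Finset.mem_range.2 hv₀n) hcon
  · intro v' hv' hc'
    have h1 := hmin v' ((hmemC v').2 ⟨hv', hc'⟩)
    by_contra hcon
    have h2 : F ((T : ℤ) - 2 ^ v') + 1 ≤ F ((T : ℤ) - 2 ^ v₀) := by linarith [not_le.1 hcon]
    have h3 := mul_le_mul_of_nonneg_right h2 (by positivity : (0 : ℤ) ≤ n)
    simp only [hkey] at h1
    have h4 : (v' : ℤ) < n := by exact_mod_cast hv'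
    have h5 : (0 : ℤ) ≤ v₀ := by positivity
    linarith

/-- Only entries at T - 2^v are read, so writing at T or above has no effect. -/
lemma argmin_congr {n s T : ℕ} {F F' : ℤ → ℤ} (h : ∀ z : ℤ, z < T → F z = F' z) :
    argmin n s F T = argmin n s F' T := by
  have h' : ∀ v : ℕ, F ((T : ℤ) - 2 ^ v) = F' ((T : ℤ) - 2 ^ v) := fun v =>
    h _ (by have : (0 : ℤ) < 2 ^ v := by positivity
            linarith)
  unfold argmin; simp only [h']

/-! ### The sets in the table -/

/-- The masks of the sets in the table: first those of the nonempty sets of numbers below `s`, and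
then those of the sets with all numbers below `s`. -/
def setAt (s j : ℕ) : ℕ := j + 1 + (if 2 ^ s - 1 < j + 1 then (2 ^ s - 1) * (j + 1 - (2 ^ s - 1)) else 0)

lemma setAt_pos (s j : ℕ) : 0 < setAt s j := by unfold setAt; omega

lemma setAt_lt {s j j' : ℕ} (h : j < j') : setAt s j < setAt s j' := by
  unfold setAt
  split_ifs with h1 h2
  · have := Nat.mul_le_mul_left (2 ^ s - 1) (show j + 1 - (2 ^ s - 1) ≤ j' + 1 - (2 ^ s - 1) by omega)
    omega
  · omega
  · omega
  · omega

lemma setAt_lt_pow {n s j : ℕ} (hs : s ≤ n) (hj : j < 2 ^ s + 2 ^ (n - s) - 2) :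
    setAt s j < 2 ^ n := by
  have e : 2 ^ n = 2 ^ s * 2 ^ (n - s) := by rw [← pow_add]; congr 1; omega
  have h1 : 1 ≤ 2 ^ s := Nat.one_le_two_pow
  have h2 : 1 ≤ 2 ^ (n - s) := Nat.one_le_two_pow
  unfold setAt
  split_ifs with h
  · obtain ⟨i, hi⟩ : ∃ i, j + 1 = 2 ^ s - 1 + i := ⟨j + 1 - (2 ^ s - 1), by omega⟩
    have e2 : j + 1 - (2 ^ s - 1) = i := by omega
    have h3 : i + 1 ≤ 2 ^ (n - s) := by omega
    have h4 := Nat.mul_le_mul_left (2 ^ s) h3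
    rw [e2, e]
    obtain ⟨E, hE⟩ : ∃ E, 2 ^ s = E + 1 := ⟨2 ^ s - 1, by omega⟩
    rw [hE] at h4 hi ⊢
    rw [Nat.add_sub_cancel] at hi ⊢
    nlinarith
  · have := Nat.mul_le_mul_left (2 ^ s) h2
    omega

/-- A mask of a set that contains all numbers below s has the form 2^s·i + (2^s - 1), and j + 1 =
2^s - 1 + i enumerates these after the masks below 2^s. -/
lemma exists_setAt {n s : ℕ} {A : Finset ℕ} (hA : A ⊆ Finset.range n) (hne : A.Nonempty)
    (h : A ⊆ Finset.range s ∨ Finset.range s ⊆ A) :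
    ∃ j < 2 ^ s + 2 ^ (n - s) - 2, setAt s j = mask A := by
  have h1 : 1 ≤ 2 ^ s := Nat.one_le_two_pow
  have h2 : 1 ≤ 2 ^ (n - s) := Nat.one_le_two_pow
  have hpos : 0 < mask A := by
    obtain ⟨v, hv⟩ := hne
    have := mask_erase hv
    have : 0 < 2 ^ v := by positivity
    omega
  by_cases hlt : mask A < 2 ^ s
  · refine ⟨mask A - 1, by omega, ?_⟩
    unfold setAt; rw [if_neg (by omega)]; omega
  · have hsub : Finset.range s ⊆ A := h.resolve_left fun h' => hlt (mask_lt h')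
    have hmod : mask A % 2 ^ s = 2 ^ s - 1 := by
      refine Nat.eq_of_testBit_eq fun i => ?_
      rw [Nat.testBit_mod_two_pow, Nat.testBit_two_pow_sub_one, testBit_mask]
      by_cases hi : i < s
      · simp [hi, hsub (Finset.mem_range.2 hi)]
      · simp [hi]
    set i := mask A / 2 ^ s with hi
    have hdiv : 2 ^ s * i + (2 ^ s - 1) = mask A := by rw [← hmod, hi]; exact Nat.div_add_mod _ _
    have hi1 : 1 ≤ i := by
      rw [hi, Nat.one_le_div_iff (by positivity)]; omega
    have hsn : s ≤ n := by
      by_contra hcon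
      have : n ∈ A := hsub (Finset.mem_range.2 (by omega))
      have := Finset.mem_range.1 (hA this); omega
    have hi2 : i < 2 ^ (n - s) := by
      have h3 := mask_lt hA
      have e : 2 ^ n = 2 ^ s * 2 ^ (n - s) := by rw [← pow_add]; congr 1; omega
      rw [hi]; exact Nat.div_lt_of_lt_mul (by rw [← e]; exact h3)
    refine ⟨2 ^ s - 1 + i - 1, by omega, ?_⟩
    unfold setAt
    rw [if_pos (by omega), show 2 ^ s - 1 + i - 1 + 1 = 2 ^ s - 1 + i by omega,
      Nat.add_sub_cancel_left, ← hdiv]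
    obtain ⟨E, hE⟩ : ∃ E, 2 ^ s = E + 1 := ⟨2 ^ s - 1, by omega⟩
    rw [hE, Nat.add_sub_cancel]; ring

/-- A set consists of numbers below s exactly if its mask is less than 2^s, which is the comparison
in `candidate`. Removing v from the set subtracts 2^v from the mask. -/
lemma prefixTable_of_equations {n s : ℕ} (hs : s ≤ n) {cut : ℕ → ℤ} {F : ℤ → ℤ} (h0 : F 0 = 0)
    (h : ∀ j < 2 ^ s + 2 ^ (n - s) - 2, F (setAt s j) = cut (setAt s j) +
      F ((setAt s j : ℤ) - 2 ^ (argmin n s F (setAt s j)).toNat)) :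
    PrefixTable n s cut (fun T => F T) (fun T => (argmin n s F T).toNat) := by
  refine ⟨hs, by simpa using h0, ?_⟩
  intro A hA hor hne
  obtain ⟨j, hj, hjA⟩ := exists_setAt hA hne hor
  have hsub : A ⊆ Finset.range s ↔ ¬ 2 ^ s ≤ mask A := by
    refine ⟨fun h' => by have := mask_lt h'; omega, fun h' v hv => ?_⟩
    rw [Finset.mem_range]
    by_contra hcon
    have h1 := mask_erase hv
    have h2 := Nat.pow_le_pow_right (show 0 < 2 by norm_num) (not_lt.1 hcon)
    omega
  have hcand : ∀ v, candidate s (mask A) v = 1 ↔ v ∈ A ∧ (¬ A ⊆ Finset.range s → s ≤ v) := by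
    intro v
    rw [candidate_eq, testBit_mask, hsub, not_not]
    simp
  have hex : ∃ v < n, candidate s (mask A) v = 1 := by
    by_cases hsA : A ⊆ Finset.range s
    · obtain ⟨v, hv⟩ := hne
      exact ⟨v, Finset.mem_range.1 (hA hv), (hcand v).2 ⟨hv, fun h' => absurd hsA h'⟩⟩
    · obtain ⟨v, hv, hv'⟩ := Finset.not_subset.1 hsA
      rw [Finset.mem_range, not_lt] at hv'
      exact ⟨v, Finset.mem_range.1 (hA hv), (hcand v).2 ⟨hv, fun _ => hv'⟩⟩
  obtain ⟨v, hv, hval, hvc, hmin⟩ := argmin_spec F hex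
  have hlast : (argmin n s F (mask A)).toNat = v := by rw [hval, Int.toNat_natCast]
  have herase : ∀ v ∈ A, ((mask (A.erase v) : ℕ) : ℤ) = (mask A : ℤ) - 2 ^ v := by
    intro v hv
    rw [← mask_erase hv]; push_cast; ring
  obtain ⟨hvA, hvs⟩ := (hcand v).1 hvc
  simp only [hlast]
  refine ⟨hvA, hvs, ?_, fun v' hv' hs' => ?_⟩
  · have := h j hj
    rw [hjA, hlast] at this
    rw [this, herase v hvA]
  · rw [herase v hvA, herase v' hv']
    exact hmin v' (Finset.mem_range.1 (hA hv')) ((hcand v').2 ⟨hv', hs'⟩)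

/-! ### The dynamic program -/

/-- `candidate` as a term. -/
def candidateT (v : Term) : Term :=
  digitT (.var 27) v * Term.leq (Term.leq (.read 3 (.var 25)) (.var 27) * .var 25) v

/-- The quantity that is minimized, as a term. -/
def entryT (v : Term) : Term := .read 13 (.var 27 - .read 3 v) * .var 0 + v

/-- `argmin` as a term. -/
def argminT : Term :=
  .sum 0 (.bvar 0 * candidateT (.bvar 0) * Term.leq (.sum 0 (candidateT (.bvar 0) *
    Term.lt (entryT (.bvar 0)) (entryT (.bvar 1)))) 0)

section

variable {n m Q R z M L : ℕ} {W : ℤ → ℤ} {s : State} {w : ℕ → ℕ → ℤ} {p : ℕ → ℕ}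

lemma eval_argminT {T : ℕ} (hs : Ctx n m Q R W s) (hn : n ≤ 3 * m) (h25 : s.var 25 = z)
    (hz : z ≤ n) (h27 : s.var 27 = T) (ρ : List ℤ) :
    argminT.eval s ρ = argmin n z (s.arr 13) T := by
  have hcand : ∀ (v : ℕ) (e : Term) (ρ : List ℤ), v < n → e.eval s ρ = v →
      (candidateT e).eval s ρ = candidate z T v := by
    intro v e ρ hv he
    rw [candidateT, Term.eval_mul,
      eval_digitT hs (show (Term.var 27).eval s ρ = T from h27) he (by omega)]
    simp only [Term.eval_leq, Term.eval_mul, Term.eval_read, Term.eval_var, h25, h27, he,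
      hs.arr_three z (by omega), candidate]
    congr 2
    simp only [ile]
    norm_cast
    split_ifs <;> simp
  have hent : ∀ (v : ℕ) (e : Term) (ρ : List ℤ), v < n → e.eval s ρ = v →
      (entryT e).eval s ρ = s.arr 13 ((T : ℤ) - 2 ^ v) * n + v := by
    intro v e ρ hv he
    simp only [entryT, Term.eval_add, Term.eval_mul, Term.eval_read, Term.eval_sub, Term.eval_var,
      h27, he, hs.var_zero, hs.arr_three v (by omega)]
  rw [argminT, Term.eval_sum, show s.var ((0 : Fin 4) : ℕ) = n from hs.var_zero, Int.toNat_natCast]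
  refine Finset.sum_congr rfl fun v hv => ?_
  have hv := Finset.mem_range.1 hv
  rw [Term.eval_mul, Term.eval_mul, Term.eval_leq, hcand v _ _ hv rfl, Term.eval_sum,
    show s.var ((0 : Fin 4) : ℕ) = n from hs.var_zero, Int.toNat_natCast, Term.eval_zero]
  congr 2
  refine Finset.sum_congr rfl fun v' hv' => ?_
  have hv' := Finset.mem_range.1 hv'
  rw [Term.eval_mul, Term.eval_lt, hcand v' _ _ hv' rfl, hent v' _ _ hv' rfl, hent v _ _ hv rfl]

/-- Fills the table in array `13`. -/
def tableauCmd : Cmd :=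
  .loop 4 (.read 3 (.var 25) + .read 3 (.var 0 - .var 25) - 2)
    (.assign 27 (.var 4 + 1 + Term.lt (.var 26) (.var 4 + 1) * (.var 26 * (.var 4 + 1 - .var 26))) ;;
      .assign 28 argminT ;;
      .write 13 (.var 27) (cutT (.var 27) 12 + .read 13 (.var 27 - .read 3 (.var 28))))

/-- The memory contains the positions of the vertices for the dynamic program. -/
structure Placed (n m z : ℕ) (p : ℕ → ℕ) (s : State) : Prop where
  le : z ≤ n
  le_three_mul : n ≤ 3 * m
  var_25 : s.var 25 = z
  arr_12 : ∀ v < n, s.arr 12 (v : ℤ) = p v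
  lt : ∀ v < n, p v < n

lemma Placed.congr {s' : State} (h : Placed n m z p s) (h1 : s'.var 25 = s.var 25)
    (h2 : s'.arr 12 = s.arr 12) : Placed n m z p s' :=
  ⟨h.1, h.2, h1.trans h.3, by rw [h2]; exact h.4, h.5⟩

lemma tableauCmd_spec (hs : Ctx n m Q R W s) (hp : Placed n m z p s)
    (hW : ∀ u < n, ∀ v < n, W ((n : ℤ) * u + v) = w u v) (hw : ∀ u v, 0 ≤ w u v)
    (h26 : s.var 26 = (2 ^ z - 1 : ℕ)) (h13 : ∀ i, s.arr 13 i = 0)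
    (hM : 2 ^ n ≤ M) (hnM : n ≤ M) {B : ℕ}
    (hB : ∑ u ∈ Finset.range n, ∑ v ∈ Finset.range n, w u v ≤ B)
    (hBM : 2 ^ (n + 1) * B ≤ M) :
    tableauCmd.Spec M L s (1 + (2 ^ z + 2 ^ (n - z)) * 4) fun s' =>
      PrefixTable n z (fun T => cutVal n w fun u => digit T (p u)) (fun T => s'.arr 13 T)
        (fun T => (argmin n z (s'.arr 13) T).toNat) := by
  have hzn := hp.le
  have hn3 := hp.le_three_mul
  have h1 : 1 ≤ 2 ^ z := Nat.one_le_two_pow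
  have h2 : 1 ≤ 2 ^ (n - z) := Nat.one_le_two_pow
  have h3 : 2 ^ z ≤ 2 ^ n := Nat.pow_le_pow_right (by norm_num) hzn
  have h4 : 2 ^ (n - z) ≤ 2 ^ n := Nat.pow_le_pow_right (by norm_num) (Nat.sub_le _ _)
  set J := 2 ^ z + 2 ^ (n - z) - 2 with hJ
  have hJn : J ≤ 2 ^ (n + 1) := by rw [pow_succ]; omega
  -- The loop counter has to obey the bound M. If both exponents are positive, x + y ≤ xy for x, y ≥
  -- 2 gives it; otherwise one of the powers is 1.
  have hJM : J ≤ M + 1 := by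
    rcases Nat.eq_zero_or_pos (n - z) with e | e
    · have : 2 ^ (n - z) = 1 := by rw [e, pow_zero]
      omega
    · rcases Nat.eq_zero_or_pos z with e' | e'
      · have : 2 ^ z = 1 := by rw [e', pow_zero]
        omega
      · have e3 : 2 ^ n = 2 ^ z * 2 ^ (n - z) := by rw [← pow_add]; congr 1; omega
        have h5 : 2 ≤ 2 ^ z := Nat.le_self_pow (by omega) 2
        have h6 : 2 ≤ 2 ^ (n - z) := Nat.le_self_pow (by omega) 2
        have : 2 ^ z + 2 ^ (n - z) ≤ 2 ^ z * 2 ^ (n - z) := by nlinarith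
        omega
  have hcut0 : ∀ T, 0 ≤ cutVal n w fun u => digit T (p u) := fun T =>
    cutVal_nonneg hw (fun _ => digit_nonneg _ _) (fun _ => digit_le_one _ _)
  have hcutB : ∀ T, (cutVal n w fun u => digit T (p u)) ≤ B := fun T =>
    (cutVal_le_sum hw (fun _ => digit_nonneg _ _) (fun _ => digit_le_one _ _)).trans hB
  refine (Cmd.Spec.loop (m := J) (k := 1 + (1 + 1)) ?_ (by simp [limit]; omega)
    -- Only the crude bound i·B is maintained after i rounds, since each round adds at most one cut
    -- to an entry. Unwritten entries are 0, which provides the value of the empty set at index 0.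
    (fun i s' => (∀ t, 0 ≤ s'.arr 13 t ∧ s'.arr 13 t ≤ (i * B : ℕ)) ∧
      (∀ t, (∀ j < i, t ≠ (setAt z j : ℤ)) → s'.arr 13 t = 0) ∧
      ∀ j < i, s'.arr 13 (setAt z j) = (cutVal n w fun u => digit (setAt z j) (p u)) +
        s'.arr 13 ((setAt z j : ℤ) - 2 ^ (argmin n z (s'.arr 13) (setAt z j)).toNat))
    ⟨fun t => by simp [h13], fun t _ => h13 t, by simp⟩ ?_).mono ?_ ?_
  · simp only [Term.eval_sub, Term.eval_add, Term.eval_read, Term.eval_var, Term.eval_two,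
      hp.var_25, hs.var_zero]
    rw [← Nat.cast_sub hzn, hs.arr_three z (by omega), hs.arr_three (n - z) (by omega)]
    rw [show (2 : ℤ) ^ z + 2 ^ (n - z) - 2 = (J : ℕ) by
      rw [hJ, Nat.cast_sub (by omega)]; push_cast; ring, Int.toNat_natCast]
  · rintro i hi s' hfr ⟨hbd, hzero, heqs⟩
    have hc' : Ctx n m Q R W (s'.setVar 4 i) :=
      (hs.frame hfr (by simp [Cmd.KeepsVar, Cmd.KeepsArr])).congr rfl rfl rfl rfl rfl rfl
    have hp' : Placed n m z p (s'.setVar 4 i) :=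
      hp.congr (hfr.1 25 (by simp [Cmd.KeepsVar])) (hfr.2 12 (by simp [Cmd.KeepsArr]))
    have h26' : (s'.setVar 4 i).var 26 = (2 ^ z - 1 : ℕ) :=
      (hfr.1 26 (by simp [Cmd.KeepsVar])).trans h26
    have hTlt : setAt z i < 2 ^ n := setAt_lt_pow hzn hi
    set T := setAt z i with hT
    refine .seq' (Cmd.Spec.assign_val (v := (T : ℕ)) ?_ ?_) ?_
    · simp only [Term.eval_add, Term.eval_mul, Term.eval_sub, Term.eval_lt, Term.eval_var,
        Term.eval_one, State.setVar_var_self, h26', ilt, hT, setAt]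
      generalize 2 ^ z - 1 = E
      split_ifs with c1 c2 c2
      · rw [Nat.cast_add, Nat.cast_mul, Nat.cast_sub c2.le]; push_cast; ring
      · exact absurd (by exact_mod_cast c1) c2
      · exact absurd (by exact_mod_cast c2) c1
      · push_cast; ring
    · rw [abs_of_nonneg (by positivity), limit, if_neg (by norm_num)]
      exact_mod_cast hTlt.le.trans hM
    rintro s₁ f₁ g27
    have hc₁ : Ctx n m Q R W s₁ := hc'.frame f₁ (by simp [Cmd.KeepsVar, Cmd.KeepsArr])
    have hp₁ : Placed n m z p s₁ := hp'.congr (f₁.1 25 (by simp [Cmd.KeepsVar]))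
      (f₁.2 12 (by simp [Cmd.KeepsArr]))
    have a13 : s₁.arr 13 = s'.arr 13 := f₁.2 13 (by simp [Cmd.KeepsArr])
    have eam := eval_argminT hc₁ hn3 hp₁.var_25 hzn g27 []
    -- The mask is not 0, so it has a nonzero digit; if it is at least 2^z, it has one at position z
    -- or higher.
    have hex : ∃ v < n, candidate z T v = 1 := by
      obtain ⟨A, hA⟩ := exists_mask_eq T
      have hTA : ∀ v, T.testBit v → v < n := by
        intro v hv
        by_contra hcon
        rw [Nat.testBit_lt_two_pow (hTlt.trans_le (Nat.pow_le_pow_right (by norm_num)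
          (not_lt.1 hcon)))] at hv
        exact Bool.false_ne_true hv
      by_cases hlt : 2 ^ z ≤ T
      · obtain ⟨v, hv, hv'⟩ := Nat.exists_ge_and_testBit_of_ge_two_pow hlt
        exact ⟨v, hTA v hv', by rw [candidate_eq, if_pos ⟨hv', fun _ => hv⟩]⟩
      · obtain ⟨v, hv⟩ := Nat.exists_testBit_of_ne_zero (setAt_pos z i).ne'
        exact ⟨v, hTA v hv, by rw [candidate_eq, if_pos ⟨hv, fun h => absurd h hlt⟩]⟩
    obtain ⟨v, hv, hval, -, -⟩ := argmin_spec (s₁.arr 13) hex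
    rw [hval] at eam
    refine .seq' (Cmd.Spec.assign_val (v := (v : ℤ)) eam ?_) ?_
    · rw [abs_of_nonneg (by positivity), limit, if_neg (by norm_num)]
      exact_mod_cast hv.le.trans hnM
    rintro s₂ f₂ g28
    have hc₂ : Ctx n m Q R W s₂ := hc₁.frame f₂ (by simp [Cmd.KeepsVar, Cmd.KeepsArr])
    have hp₂ : Placed n m z p s₂ := hp₁.congr (f₂.1 25 (by simp [Cmd.KeepsVar]))
      (f₂.2 12 (by simp [Cmd.KeepsArr]))
    have b13 : s₂.arr 13 = s'.arr 13 := (f₂.2 13 (by simp [Cmd.KeepsArr])).trans a13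
    have g27' : s₂.var 27 = T := (f₂.1 27 (by simp [Cmd.KeepsVar])).trans g27
    have eval2 : (cutT (.var 27) 12 + .read 13 (.var 27 - .read 3 (.var 28))).eval s₂ [] =
        (cutVal n w fun u => digit T (p u)) + s'.arr 13 ((T : ℤ) - 2 ^ v) := by
      rw [Term.eval_add, eval_cutT (x' := T) hc₂ hW (fun ρ => show (Term.var 27).eval s₂ ρ = T from g27') hp₂.arr_12
        (fun u hu => (hp₂.lt u hu).le.trans hn3)]
      simp only [Term.eval_read, Term.eval_sub, Term.eval_var, g27', g28, b13,
        hc₂.arr_three v (by omega)]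
    rw [a13] at hval
    have hnew0 := add_nonneg (hcut0 T) (hbd ((T : ℤ) - 2 ^ v)).1
    have hnewB : (cutVal n w fun u => digit T (p u)) + s'.arr 13 ((T : ℤ) - 2 ^ v) ≤
        ((i + 1) * B : ℕ) := by
      have := hcutB T
      have := (hbd ((T : ℤ) - 2 ^ v)).2
      push_cast at this ⊢
      linarith
    refine .write ?_ ?_
    · rw [eval2, abs_of_nonneg hnew0]
      refine hnewB.trans ?_
      exact_mod_cast (Nat.mul_le_mul_right B (show i + 1 ≤ 2 ^ (n + 1) by omega)).trans hBM
    · rw [eval2, Term.eval_var, g27']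
      set val := (cutVal n w fun u => digit T (p u)) + s'.arr 13 ((T : ℤ) - 2 ^ v) with hvaldef
      have harr : ∀ t, (s₂.setArr 13 (T : ℤ) val).arr 13 t = if t = T then val else s'.arr 13 t := by
        intro t; simp [State.setArr, Function.update_apply, b13]
      -- The masks are enumerated in increasing order, so the new entry lies above all earlier ones
      -- and leaves their equations intact.
      have hlow : ∀ t : ℤ, t < T → (s₂.setArr 13 (T : ℤ) val).arr 13 t = s'.arr 13 t :=
        fun t ht => by rw [harr, if_neg ht.ne]
      have hpow : ∀ (T' : ℕ) (k : ℕ), (T' : ℤ) ≤ T → (T' : ℤ) - 2 ^ k < T := fun T' k h => by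
        have : (0 : ℤ) < 2 ^ k := by positivity
        linarith
      refine ⟨fun t => ?_, fun t ht => ?_, fun j hj => ?_⟩
      · rw [harr]
        split_ifs
        · exact ⟨hnew0, hnewB⟩
        · refine ⟨(hbd t).1, (hbd t).2.trans ?_⟩
          exact_mod_cast Nat.mul_le_mul_right B (Nat.le_succ i)
      · rw [harr, if_neg (ht i (Nat.lt_succ_self i))]
        exact hzero t fun j hj => ht j (by omega)
      · rcases Nat.lt_succ_iff_lt_or_eq.1 hj with h | rfl
        · have hjT : (setAt z j : ℤ) < T := by exact_mod_cast setAt_lt h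
          rw [hlow _ hjT, hlow _ (hpow _ _ hjT.le), argmin_congr fun t ht =>
            hlow t (ht.trans hjT)]
          exact heqs j h
        · rw [harr, if_pos rfl, hlow _ (hpow _ _ le_rfl), argmin_congr fun t ht => hlow t ht, hval,
            Int.toNat_natCast]
  · have : J ≤ 2 ^ z + 2 ^ (n - z) := Nat.sub_le _ _
    have := Nat.mul_le_mul_right 4 this
    omega
  · rintro s' - ⟨-, hzero, heqs⟩
    refine prefixTable_of_equations hzn (hzero 0 fun j _ h => ?_) heqs
    have := setAt_pos z j
    have : (0 : ℤ) < setAt z j := by exact_mod_cast this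
    omega

end

end OLA

namespace OLA

/-! ### The best ordering with a given initial set -/

/-- The vertices outside of the set in array `11` come last. -/
def keyT (e : Term) : Term := (1 - .read 11 e) * .var 0 + e

/-- Computes the positions of the vertices for the dynamic program. -/
def sortCmd : Cmd :=
  .assign 25 (.sum 0 (.read 11 (.bvar 0))) ;; .assign 26 (.read 3 (.var 25) - 1) ;;
  .loop 4 (.var 0) (.write 12 (.var 4) (.sum 0 (Term.lt (keyT (.bvar 0)) (keyT (.var 4)))))

/-- Reads off an ordering from the table. -/
def traceCmd : Cmd :=
  .assign 27 (.read 3 (.var 0) - 1) ;;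
  .loop 4 (.var 0) (.assign 28 argminT ;; .write 14 (.var 28) (.var 0 - .var 4) ;;
    .assign 27 (.var 27 - .read 3 (.var 28))) ;;
  .loop 4 (.var 0) (.write 2 (.var 4) (.read 14 (.read 12 (.var 4))))

/-- Computes the best ordering that begins with the set in array `11`. -/
def arrangeCmd : Cmd := sortCmd ;; tableauCmd ;; traceCmd

/-- The key that puts the vertices of `A` first. -/
def firstKey (n : ℕ) (A : Finset ℕ) (v : ℕ) : ℕ := (if v ∈ A then 0 else n) + v

lemma firstKey_injOn (n : ℕ) (A : Finset ℕ) : Set.InjOn (firstKey n A) (Set.Iio n) := by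
  intro u hu v hv h
  have hu : u < n := hu
  have hv : v < n := hv
  simp only [firstKey] at h
  split_ifs at h <;> omega

lemma exists_preimage {n : ℕ} {f : ℕ → ℕ} (hf : ∀ u < n, f u < n) (hinj : Set.InjOn f (Set.Iio n)) :
    ∀ c < n, ∃ u < n, f u = c := by
  intro c hc
  have h1 : Finset.image f (Finset.range n) = Finset.range n := by
    refine Finset.eq_of_subset_of_card_le ?_ ?_
    · intro x hx
      obtain ⟨u, hu, rfl⟩ := Finset.mem_image.1 hx
      exact Finset.mem_range.2 (hf u (Finset.mem_range.1 hu))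
    · rw [Finset.card_image_of_injOn (fun u hu v hv => hinj (by simpa using hu) (by simpa using hv))]
  have h2 : c ∈ Finset.image f (Finset.range n) := by rw [h1]; exact Finset.mem_range.2 hc
  obtain ⟨u, hu, rfl⟩ := Finset.mem_image.1 h2
  exact ⟨u, Finset.mem_range.1 hu, rfl⟩

/-- The value of a full table in terms of orderings. -/
lemma sum_cut_eq_ordCost {n : ℕ} {w : ℕ → ℕ → ℤ} {p : ℕ → ℕ} (hp : ∀ v < n, p v < n)
    (g : ℕ → ℕ) : ∑ j ∈ Finset.range n, (cutVal n w fun u =>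
      digit (mask ((Finset.range n).filter fun c => g c ≤ j)) (p u)) =
      ordCost n w fun u => g (p u) := by
  refine Finset.sum_congr rfl fun j _ => cutVal_congr fun u hu => ?_
  rw [digit_mask]; simp [hp u hu]

section

variable {n m Q R z M L : ℕ} {W : ℤ → ℤ} {s : State} {w : ℕ → ℕ → ℤ} {p : ℕ → ℕ}

lemma sortCmd_spec (hs : Ctx n m Q R W s) (hn : n ≤ 3 * m) {b : ℕ → ℤ} {A : Finset ℕ}
    (hA : A = (Finset.range n).filter fun v => b v = 1)
    (h11 : ∀ v < n, s.arr 11 (v : ℤ) = b v) (hb : ∀ v, b v = 0 ∨ b v = 1) (hnM : n ≤ M)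
    (hM : 2 ^ n ≤ M) :
    sortCmd.Spec M L s (3 + 2 * n) fun s' => Placed n m A.card (rank n (firstKey n A)) s' ∧
      s'.var 26 = (2 ^ A.card - 1 : ℕ) := by
  have hcard : A.card ≤ n := by
    rw [hA]; exact (Finset.card_filter_le _ _).trans (by simp)
  have hbA : ∀ v < n, b v = if v ∈ A then 1 else 0 := by
    intro v hv
    rcases hb v with e | e <;> simp [hA, hv, e]
  refine (Cmd.Spec.seq' (.assign_val (v := (A.card : ℕ)) ?_ ?_) ?_).mono
    (by omega : 1 + (1 + (1 + n * (1 + 1))) ≤ _) (fun _ _ h => h)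
  · rw [Term.eval_sum, show s.var ((0 : Fin 4) : ℕ) = n from hs.var_zero, Int.toNat_natCast]
    rw [Finset.sum_congr rfl (g := fun v => if v ∈ A then 1 else 0) fun v hv => by
      have hv := Finset.mem_range.1 hv
      rw [← hbA v hv, ← h11 v hv]; rfl]
    rw [← Finset.sum_filter, Finset.sum_const, nsmul_eq_mul, mul_one]
    congr 2
    ext v
    rw [Finset.mem_filter, hA, Finset.mem_filter, and_iff_right_iff_imp]; exact fun h => h.1
  · rw [abs_of_nonneg (by positivity), limit, if_neg (by norm_num)]; exact_mod_cast hcard.trans hnM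
  rintro s₁ f₁ g25
  have hs₁ := hs.frame f₁ (by simp [Cmd.KeepsVar, Cmd.KeepsArr])
  have h1 : 1 ≤ 2 ^ A.card := Nat.one_le_two_pow
  refine .seq' (.assign_val (v := ((2 ^ A.card - 1 : ℕ) : ℤ)) ?_ ?_) ?_
  · simp only [Term.eval_sub, Term.eval_read, Term.eval_var, Term.eval_one, g25,
      hs₁.arr_three _ (show A.card ≤ 3 * m by omega)]
    rw [Nat.cast_sub h1]; push_cast; rfl
  · rw [abs_of_nonneg (by positivity), limit, if_neg (by norm_num)]
    have := Nat.pow_le_pow_right (show 0 < 2 by norm_num) hcard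
    exact_mod_cast (by omega : 2 ^ A.card - 1 ≤ M)
  rintro s₂ f₂ g26
  have hs₂ := hs₁.frame f₂ (by simp [Cmd.KeepsVar, Cmd.KeepsArr])
  have a11 : s₂.arr 11 = s.arr 11 :=
    (f₂.2 11 (by simp [Cmd.KeepsArr])).trans (f₁.2 11 (by simp [Cmd.KeepsArr]))
  have g25' : s₂.var 25 = A.card := (f₂.1 25 (by simp [Cmd.KeepsVar])).trans g25
  have hrank : ∀ v < n, rank n (firstKey n A) v < n := fun v hv => rank_lt hv
  refine (Cmd.Spec.fill (m := n) (by rw [Term.eval_var, hs₂.var_zero, Int.toNat_natCast])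
    (by simp [limit]; omega) (fun i => (i : ℤ)) (fun i => (rank n (firstKey n A) i : ℤ)) ?_ ?_
    ?_).mono le_rfl ?_
  · intro i _ j _ hij; exact_mod_cast hij
  · intro i hi
    rw [abs_of_nonneg (by positivity)]; exact_mod_cast (hrank i hi).le.trans hnM
  · intro i hi s' hv ha h4 _ _
    refine ⟨h4, ?_⟩
    have v0 : s'.var 0 = n := (hv 0 (by norm_num)).trans hs₂.var_zero
    have hkey : ∀ (e : Term) (ρ : List ℤ) (v : ℕ), v < n → e.eval s' ρ = v →
        (keyT e).eval s' ρ = firstKey n A v := by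
      intro e ρ v hv he
      simp only [keyT, Term.eval_add, Term.eval_mul, Term.eval_sub, Term.eval_one, Term.eval_read,
        Term.eval_var, he, v0, ha 11 (by norm_num), a11, h11 v hv, hbA v hv, firstKey]
      split_ifs <;> simp
    rw [Term.eval_sum, show s'.var ((0 : Fin 4) : ℕ) = n from v0, Int.toNat_natCast, rank,
      Finset.card_filter]
    push_cast
    refine Finset.sum_congr rfl fun u hu => ?_
    rw [Term.eval_lt, hkey _ _ u (Finset.mem_range.1 hu) rfl, hkey (.var 4) _ i hi h4, ilt]
    norm_cast
  · rintro s₃ f₃ ⟨h12, -⟩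
    exact ⟨⟨hcard, hn, (f₃.1 25 (by simp [Cmd.KeepsVar])).trans g25', h12, hrank⟩,
      (f₃.1 26 (by simp [Cmd.KeepsVar])).trans g26⟩

/-- Round i removes the last element of the remaining set and records its position n - i, counted
from 1. The last loop translates coordinates back to vertices through p. -/
lemma traceCmd_spec (hs : Ctx n m Q R W s) (hp : Placed n m z p s) {cut : ℕ → ℤ}
    (ht : PrefixTable n z cut (fun T => s.arr 13 T) fun T => (argmin n z (s.arr 13) T).toNat)
    (hnM : n ≤ M) (hM : 2 ^ n ≤ M) :
    traceCmd.Spec M L s (3 + 6 * n) fun s' => ∃ g : ℕ → ℕ, (∀ c < n, g c < n) ∧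
      Set.InjOn g (Set.Iio n) ∧ (∀ v < n, s'.arr 2 (v : ℤ) = (g (p v) + 1 : ℕ)) ∧
      s.arr 13 (mask (Finset.range n)) =
        ∑ j ∈ Finset.range n, cut (mask ((Finset.range n).filter fun c => g c ≤ j)) := by
  have hn3 := hp.le_three_mul
  have hlim : ∀ z : ℕ, z ≤ M → |(z : ℤ)| ≤ M := fun z h1 => by
    rw [abs_of_nonneg (by positivity)]; exact_mod_cast h1
  set last : ℕ → ℕ := fun T => (argmin n z (s.arr 13) T).toNat with hlast
  set rem := PrefixTable.remaining n last with hrem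
  have hmaskM : ∀ i ≤ n, mask (rem i) ≤ M := fun i hi =>
    (mask_lt (ht.remaining_spec i hi).1).le.trans hM
  refine (Cmd.Spec.seq' (.assign_val (v := (mask (rem 0) : ℕ)) ?_ ?_) ?_).mono
    (by omega : 1 + ((1 + n * (1 + (1 + (1 + 1)))) + (1 + n * (1 + 1))) ≤ _) (fun _ _ h => h)
  · rw [Term.eval_sub, Term.eval_read, Term.eval_var, hs.var_zero, hs.arr_three n (by omega),
      Term.eval_one]
    rw [hrem, PrefixTable.remaining, mask_range, Nat.cast_sub Nat.one_le_two_pow]; push_cast; rfl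
  · rw [limit, if_neg (by norm_num)]; exact hlim _ (hmaskM 0 (Nat.zero_le _))
  rintro s₁ f₁ g27
  have hs₁ := hs.frame f₁ (by simp [Cmd.KeepsVar, Cmd.KeepsArr])
  have hp₁ := hp.congr (f₁.1 25 (by simp [Cmd.KeepsVar])) (f₁.2 12 (by simp [Cmd.KeepsArr]))
  have a13 : s₁.arr 13 = s.arr 13 := f₁.2 13 (by simp [Cmd.KeepsArr])
  refine .seq' (Cmd.Spec.loop (m := n) (by rw [Term.eval_var, hs₁.var_zero, Int.toNat_natCast])
    (by simp [limit]; omega)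
    (fun i s' => s'.var 27 = (mask (rem i) : ℕ) ∧
      ∀ j < i, s'.arr 14 (last (mask (rem j)) : ℤ) = (n - j : ℕ)) ⟨g27, by simp⟩ ?_) ?_
  · rintro i hi s' hfr ⟨h27, hdone⟩
    have hc' : Ctx n m Q R W (s'.setVar 4 i) :=
      (hs₁.frame hfr (by simp [Cmd.KeepsVar, Cmd.KeepsArr])).congr rfl rfl rfl rfl rfl rfl
    have hp' : Placed n m z p (s'.setVar 4 i) :=
      hp₁.congr (hfr.1 25 (by simp [Cmd.KeepsVar])) (hfr.2 12 (by simp [Cmd.KeepsArr]))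
    have b13 : (s'.setVar 4 i).arr 13 = s.arr 13 := (hfr.2 13 (by simp [Cmd.KeepsArr])).trans a13
    have h27' : (s'.setVar 4 i).var 27 = (mask (rem i) : ℕ) := h27
    have eam := eval_argminT hc' hn3 hp'.var_25 hp.le h27' []
    rw [b13] at eam
    obtain ⟨r1, r2, r3⟩ := ht.remaining_spec i hi.le
    have hvmem := ht.last_mem hi
    have hex : 0 ≤ argmin n z (s.arr 13) (mask (rem i)) := by
      refine Finset.sum_nonneg fun v _ => mul_nonneg (mul_nonneg (by positivity) ?_) ?_
      · rw [candidate_eq]; split_ifs <;> norm_num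
      · unfold ile; split_ifs <;> norm_num
    set v := last (mask (rem i)) with hv
    have hvn : v < n := Finset.mem_range.1 (r1 hvmem)
    have eam' : argminT.eval (s'.setVar 4 i) [] = (v : ℕ) := by
      rw [eam, hv, hlast, Int.toNat_of_nonneg hex]
    refine .seq' (.assign_val eam' ?_) ?_
    · rw [limit, if_neg (by norm_num)]; exact hlim _ (hvn.le.trans hnM)
    rintro s₂ f₂ g28
    have hc₂ := hc'.frame f₂ (by simp [Cmd.KeepsVar, Cmd.KeepsArr])
    have g4 : s₂.var 4 = i :=
      (f₂.1 4 (by simp [Cmd.KeepsVar])).trans (State.setVar_var_self _ _ _)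
    have g27' : s₂.var 27 = (mask (rem i) : ℕ) := (f₂.1 27 (by simp [Cmd.KeepsVar])).trans h27
    have a14 : s₂.arr 14 = s'.arr 14 := f₂.2 14 (by simp [Cmd.KeepsArr])
    have eval2 : (Term.var 0 - .var 4).eval s₂ [] = (n - i : ℕ) := by
      rw [Term.eval_sub, Term.eval_var, Term.eval_var, hc₂.var_zero, g4, Nat.cast_sub hi.le]
    refine .seq (.write ?_ ?_)
    · rw [eval2]; exact hlim _ ((Nat.sub_le _ _).trans hnM)
    rw [eval2, Term.eval_var, g28]
    set s₃ := s₂.setArr 14 (v : ℤ) ((n - i : ℕ) : ℤ) with hs₃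
    have harr : ∀ t, s₃.arr 14 t = if t = v then ((n - i : ℕ) : ℤ) else s'.arr 14 t := by
      intro t; simp [hs₃, State.setArr, Function.update_apply, a14]
    have eval3 : (Term.var 27 - .read 3 (.var 28)).eval s₃ [] = (mask (rem (i + 1)) : ℕ) := by
      have h3 : s₃.arr 3 (v : ℤ) = 2 ^ v := hc₂.arr_three v (by omega)
      have hm := mask_erase hvmem
      rw [Term.eval_sub, Term.eval_read, Term.eval_var, Term.eval_var,
        show s₃.var 28 = v from g28, show s₃.var 27 = _ from g27', h3]
      have e : rem (i + 1) = (rem i).erase v := rfl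
      rw [e]
      have hm' : (mask ((rem i).erase v) : ℤ) + 2 ^ v = mask (rem i) := by exact_mod_cast hm
      linarith
    refine (Cmd.Spec.assign_val eval3 ?_).mono le_rfl ?_
    · rw [limit, if_neg (by norm_num)]; exact hlim _ (hmaskM _ hi)
    rintro s₄ f₄ h27₄
    refine ⟨h27₄, fun j hj => ?_⟩
    rw [f₄.2 14 (by simp [Cmd.KeepsArr]), harr]
    -- An element removed earlier is not in the present set, so no position is overwritten.
    rcases Nat.lt_succ_iff_lt_or_eq.1 hj with h | rfl
    · rw [if_neg]
      · exact hdone j h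
      · intro hcon
        have hcon : last (mask (rem j)) = v := by exact_mod_cast hcon
        have h5 : v ∈ rem (j + 1) := PrefixTable.remaining_anti last (Nat.succ_le_of_lt h) hvmem
        have h6 : v ∉ rem (j + 1) := by
          rw [← hcon]; exact Finset.notMem_erase _ _
        exact h6 h5
    · rw [if_pos rfl]
  rintro s₂ f₂ ⟨-, h14⟩
  have hs₂ := hs₁.frame f₂ (by simp [Cmd.KeepsVar, Cmd.KeepsArr])
  have hp₂ := hp₁.congr (f₂.1 25 (by simp [Cmd.KeepsVar])) (f₂.2 12 (by simp [Cmd.KeepsArr]))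
  obtain ⟨g, hg, hinj, hgl, hval⟩ := ht.exists_ordering
  refine (Cmd.Spec.fill (m := n) (by rw [Term.eval_var, hs₂.var_zero, Int.toNat_natCast])
    (by simp [limit]; omega) (fun i => (i : ℤ)) (fun v => ((g (p v) + 1 : ℕ) : ℤ)) ?_ ?_ ?_).mono
    le_rfl ?_
  · intro i _ j _ hij; exact_mod_cast hij
  · intro v hv
    exact hlim _ ((Nat.succ_le_of_lt (hg _ (hp.lt v hv))).trans hnM)
  · intro v hv s' hvar ha h4 _ _
    refine ⟨h4, ?_⟩
    have hpv := hp.lt v hv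
    have hgv := hg _ hpv
    have e1 := h14 (n - 1 - g (p v)) (by omega)
    rw [hrem, hgl _ hpv] at e1
    rw [Term.eval_read, Term.eval_read, Term.eval_var, h4, ha 12 (by norm_num),
      ha 14 (by norm_num), hp₂.arr_12 v hv, e1]
    congr 1; omega
  · rintro s₃ - ⟨h2, -⟩
    exact ⟨g, hg, hinj, h2, hval⟩

/-- The table covers the orderings that begin with A, and `exists_rearrangement` compares those with
all others. -/
lemma arrangeCmd_spec (hs : Ctx n m Q R W s) (hn : n ≤ 3 * m)
    (hW : ∀ u < n, ∀ v < n, W ((n : ℤ) * u + v) = w u v) (hw : ∀ u v, 0 ≤ w u v)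
    (hsymm : ∀ u v, w u v = w v u) {b : ℕ → ℤ} {A : Finset ℕ}
    (hA : A = (Finset.range n).filter fun v => b v = 1)
    (h11 : ∀ v < n, s.arr 11 (v : ℤ) = b v) (hb : ∀ v, b v = 0 ∨ b v = 1)
    (h13 : ∀ i, s.arr 13 i = 0) (hM : 2 ^ n ≤ M) (hnM : n ≤ M) {B : ℕ}
    (hB : ∑ u ∈ Finset.range n, ∑ v ∈ Finset.range n, w u v ≤ B)
    (hBM : 2 ^ (n + 1) * B ≤ M) :
    arrangeCmd.Spec M L s (7 + 8 * n + (2 ^ A.card + 2 ^ (n - A.card)) * 4) fun s' =>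
      ∃ f : ℕ → ℕ, (∀ v < n, f v < n) ∧ Set.InjOn f (Set.Iio n) ∧
        (∀ v < n, s'.arr 2 (v : ℤ) = (f v + 1 : ℕ)) ∧
        ∀ f' : ℕ → ℕ, (∀ v < n, f' v < n) → Set.InjOn f' (Set.Iio n) →
          2 * ordCost n w f ≤ 2 * ordCost n w f' + n * cutVal n w b := by
  set p := rank n (firstKey n A) with hp
  refine (Cmd.Spec.seq' (sortCmd_spec hs hn hA h11 hb hnM hM) ?_).mono
    (by omega : (3 + 2 * n) + ((1 + (2 ^ A.card + 2 ^ (n - A.card)) * 4) + (3 + 6 * n)) ≤ _)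
    (fun _ _ h => h)
  rintro s₁ f₁ ⟨hp₁, h26⟩
  have hs₁ := hs.frame f₁ (by simp [sortCmd, Cmd.KeepsVar, Cmd.KeepsArr])
  refine Cmd.Spec.seq' (tableauCmd_spec hs₁ hp₁ hW hw h26 (by
    rw [f₁.2 13 (by simp [sortCmd, Cmd.KeepsArr])]; exact h13) hM hnM hB hBM) ?_
  rintro s₂ f₂ htab
  have hs₂ := hs₁.frame f₂ (by simp [tableauCmd, Cmd.KeepsVar, Cmd.KeepsArr])
  have hp₂ := hp₁.congr (f₂.1 25 (by simp [tableauCmd, Cmd.KeepsVar]))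
    (f₂.2 12 (by simp [tableauCmd, Cmd.KeepsArr]))
  refine (traceCmd_spec hs₂ hp₂ htab hnM hM).mono le_rfl ?_
  rintro s₃ - ⟨g, hg, hginj, hout, hval⟩
  have hplt : ∀ v < n, p v < n := fun v hv => rank_lt hv
  have hpinj : Set.InjOn p (Set.Iio n) := rank_injOn (firstKey_injOn n A)
  refine ⟨fun v => g (p v), fun v hv => hg _ (hplt v hv), ?_, hout, ?_⟩
  · intro u hu v hv huv
    exact hpinj hu hv (hginj (hplt u hu) (hplt v hv) huv)
  · intro f' hf' hinj'
    have hAsub : A ⊆ Finset.range n := by rw [hA]; exact Finset.filter_subset _ _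
    obtain ⟨g', hg', hginj', hgA, hcost⟩ := exists_rearrangement hw hsymm hf' hinj' A hAsub
    have hpA : ∀ u < n, p u < A.card ↔ u ∈ A := fun u hu =>
      rank_lt_card_iff A hAsub (fun u v h1 h2 h3 h4 => by simp [firstKey, h1, h2]; omega) hu
    choose! inv hinv hpinv using exists_preimage hplt hpinj
    have hinvp : ∀ u < n, inv (p u) = u := fun u hu =>
      hpinj (hinv _ (hplt u hu)) hu (hpinv _ (hplt u hu))
    -- The table works with coordinates in which A occupies the first places, so the rearranged
    -- competitor is transported along the inverse of p.
    have hchain := htab.le_chain (fun c => g' (inv c)) (fun c hc => hg' _ (hinv c hc))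
      (fun c hc d hd hcd => by
        have := hginj' (hinv c hc) (hinv d hd) hcd
        rw [← hpinv c hc, ← hpinv d hd, this])
      (fun c hc => by rw [hgA _ (hinv c hc), ← hpA _ (hinv c hc), hpinv c hc])
    rw [sum_cut_eq_ordCost hplt] at hchain hval
    have e1 : ordCost n w (fun u => g' (inv (p u))) = ordCost n w g' :=
      ordCost_congr fun u hu => by rw [hinvp u hu]
    rw [e1] at hchain
    have e2 : cutVal n w (fun u => if u ∈ A then 1 else 0) = cutVal n w b :=
      cutVal_congr fun u hu => by rcases hb u with e | e <;> simp [hA, hu, e]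
    rw [e2] at hcost
    rw [hval] at hchain
    linarith

end

end OLA

namespace OLA

/-! ### The algorithm -/

/-- The algorithm. Instances with fewer than `n₀` vertices are solved exactly. -/
def fullCmd (S : BilinearScheme) (K A B A₁ A₂ n₀ : ℕ) : Cmd :=
  initCmd S K ;; .ite (Term.leq (.const n₀) (.var 0)) (searchCmd S K A B A₁ A₂) .skip ;; arrangeCmd

/-- The sizes `t` of sets, padded to `3 * k`, that the search covers. -/
structure Admissible (A B A₁ A₂ n m t k : ℕ) : Prop where
  le : t ≤ 3 * k
  le_add : 3 * k ≤ t + 2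
  mul_le : A * k ≤ B * m
  lower : A₁ * n + A₂ * (3 * m) ≤ A₂ * (3 * k + n)
  upper : A₁ * n + A₂ * (3 * k) ≤ A₂ * n

/-- The size `a` of a set is acceptable. -/
def Acceptable (A₁ A₂ n a : ℕ) : Prop := a ≤ n ∧ A₁ * n ≤ A₂ * a ∧ A₁ * n ≤ A₂ * (n - a)

section

variable {S : BilinearScheme} {n m J : ℕ} {W : ℤ → ℤ} {s : State}
  {w : ℕ → ℕ → ℤ} {M L K A B A₁ A₂ : ℕ}

/-- For n < n₀ the search is skipped and the set stays empty; its cut is 0 and the dynamic program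
is then exact. For larger n the number of table entries is controlled because the search succeeds
whenever some size is admissible. -/
lemma fullCmd_spec {n₀ Bs Y Z : ℕ} (hb : Bounds S n m M w W) (hsymm : ∀ u v, w u v = w v u)
    (hm : m = (n + 4) / 3) (h0 : s.var 0 = n) (h1 : s.arr 1 = W) (h11 : ∀ z, s.arr 11 z = 0)
    (h13 : ∀ z, s.arr 13 z = 0) (hmL : m ≤ L) (hNL : S.N * S.N ≤ L) (hRL : S.R ≤ L) (hK : 1 ≤ K)
    (hJ : J = K * (n * n) + 1) (hBs : Bs = n * n * J + 3 * m + 1) (hBsM : Bs ^ 6 ≤ M)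
    (hY : ∀ k κ, A * k ≤ B * m → κ ≤ m → (κ = 0 ∨ S.N ^ (κ - 1) < maskCount m k) → S.R ^ κ ≤ Y)
    (hZ : ∀ a, (Acceptable A₁ A₂ n a ∨ a = 0 ∧
      (n₀ ≤ n → ∀ t ≤ n, ∀ k, ¬ Admissible A B A₁ A₂ n m t k)) →
      2 ^ a + 2 ^ (n - a) ≤ Z) {C : ℕ}
    (hC : ∑ u ∈ Finset.range n, ∑ v ∈ Finset.range n, w u v ≤ C) (hCM : 2 ^ (n + 1) * C ≤ M) :
    (fullCmd S K A B A₁ A₂ n₀).Spec M L s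
      ((10 + 6 * m) + ((1 + (1 + Bs ^ 6 * (1 + 50 * (m + 1) * (Y + 2 ^ m + n + 1)))) +
        (7 + 8 * n + Z * 4))) fun s' =>
      ∃ f : ℕ → ℕ, (∀ v < n, f v < n) ∧ Set.InjOn f (Set.Iio n) ∧
        (∀ v < n, s'.arr 2 (v : ℤ) = (f v + 1 : ℕ)) ∧ ∃ b : ℕ → ℤ, (∀ v, b v = 0 ∨ b v = 1) ∧
        (∀ f' : ℕ → ℕ, (∀ v < n, f' v < n) → Set.InjOn f' (Set.Iio n) →
          2 * ordCost n w f ≤ 2 * ordCost n w f' + n * cutVal n w b) ∧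
        (n < n₀ → cutVal n w b = 0) ∧ (n₀ ≤ n → ∀ c : ℕ → ℤ, (∀ v, c v = 0 ∨ c v = 1) →
          ∀ t k : ℕ, ∑ v ∈ Finset.range n, c v = t → Admissible A B A₁ A₂ n m t k → K * cutVal n w b ≤ (K + 1) * cutVal n w c) := by
  have hBs0 : 0 < Bs := by omega
  have hBsM' : Bs ≤ M := (Nat.le_self_pow (by norm_num) _).trans hBsM
  have hJBs : J ≤ M := by
    rcases Nat.eq_zero_or_pos n with h | h
    · have : 1 ≤ M := hBs0.trans_le hBsM'
      rw [hJ, h]; simpa using this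
    · have : J ≤ n * n * J := Nat.le_mul_of_pos_left _ (Nat.mul_pos h h)
      omega
  have hnM : n ≤ M := hb.le.trans hb.three_mul_le
  have hmag : 2 ≤ S.magnitude := by
    have h3 : 2 ≤ S.R := S.two_le.trans ((Nat.le_mul_of_pos_right _ S.N_pos).trans S.sq_le)
    exact h3.trans (Nat.le_mul_of_pos_right _ (Nat.succ_pos _))
  have h2nM : 2 ^ n ≤ M := (Nat.pow_le_pow_left hmag n).trans
    ((Nat.pow_le_pow_right (by omega) hb.le).trans hb.magnitude_le)
  refine Cmd.Spec.seq' (initCmd_spec (A₁ := A₁) (A₂ := A₂) hb hm h0 h1 h11 hmL hNL hRL hJ hBs hBsM'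
    hJBs) ?_
  rintro s₁ f₁ ⟨hs₁, h29, h30, hbest₁⟩
  have hkv : ∀ y ∈ [0, 1, 2, 3, 29, 30], (searchCmd S K A B A₁ A₂).KeepsVar y := fun y hy =>
    ⟨by rintro rfl; simp at hy, guessCmd_keepsVar S K A B A₁ A₂ y hy⟩
  have hka : ∀ y ∈ [1, 3], (searchCmd S K A B A₁ A₂).KeepsArr y :=
    guessCmd_keepsArr S K A B A₁ A₂
  have hcond : (Term.leq (.const n₀) (.var 0)).eval s₁ [] ≠ 0 ↔ n₀ ≤ n := by
    rw [Term.eval_leq, Term.eval_const, Term.eval_var, hs₁.var_zero, ile_ne_zero, Nat.cast_le]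
  refine Cmd.Spec.seq' (Q' := fun s' => Best A₁ A₂ n w s' ∧ (n < n₀ → s'.arr 11 = s₁.arr 11) ∧
    (n₀ ≤ n → ∀ g < Bs ^ 6, Promising K A B A₁ A₂ n m w W J Bs g →
      K * s'.var 13 ≤ thr W J (baseDigit Bs g 3) + thr W J (baseDigit Bs g 4) +
        thr W J (baseDigit Bs g 5))) (.ite (fun hne => ?_) (fun heq => ?_)) ?_
  · refine (searchCmd_spec hb hs₁ h29 h30 hbest₁ hBs0 hBsM hY).mono le_rfl ?_
    rintro s' - ⟨h, h'⟩
    exact ⟨h, fun hlt => absurd (hcond.1 hne) (not_le.2 hlt), fun _ => h'⟩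
  · refine (Cmd.Spec.skip ?_ : Cmd.skip.Spec M L _ 1 _).mono (by omega) (fun _ _ h => h)
    exact ⟨hbest₁, fun _ => rfl, fun hle => absurd heq (hcond.2 hle)⟩
  rintro s₂ f₂ ⟨⟨b, hb11, hb01, hbest⟩, hsmall, hall⟩
  have hs₂ : Ctx n m (S.N * S.N) S.R W s₂ :=
    hs₁.frame f₂ ⟨⟨hkv 0 (by simp), trivial⟩, ⟨hkv 1 (by simp), trivial⟩,
      ⟨hkv 2 (by simp), trivial⟩, ⟨hkv 3 (by simp), trivial⟩, ⟨hka 1 (by simp), trivial⟩,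
      ⟨hka 3 (by simp), trivial⟩⟩
  have g13 : ∀ z, s₂.arr 13 z = 0 := by
    intro z
    rw [f₂.2 13 (by
      simp [searchCmd, guessCmd, decodeCmd, bodyCmd, placeCmd, listCmd, dimCmd, tableCmd, findCmd,
        candCmd, BilinearScheme.mulCmd, BilinearScheme.upCmd, BilinearScheme.prodCmd,
        BilinearScheme.downCmd, Cmd.KeepsArr]), f₁.2 13 (by simp [initCmd, Cmd.KeepsArr]), h13]
  have hbz : n < n₀ → ∀ v < n, b v = 0 := by
    intro hlt v hv
    rw [← hb11 v hv, hsmall hlt, f₁.2 11 (by simp [initCmd, Cmd.KeepsArr]), h11]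
  set D := (Finset.range n).filter fun v => b v = 1 with hD
  have hDsum : ∑ v ∈ Finset.range n, b v = D.card := by
    rw [hD, Finset.card_filter]
    push_cast
    exact Finset.sum_congr rfl fun v _ => by rcases hb01 v with e | e <;> simp [e]
  have hDn : D.card ≤ n := (Finset.card_filter_le _ _).trans (by simp)
  have hcov : n₀ ≤ n → ∀ c : ℕ → ℤ, (∀ v, c v = 0 ∨ c v = 1) → ∀ t k : ℕ,
      ∑ v ∈ Finset.range n, c v = t → Admissible A B A₁ A₂ n m t k →
      K * s₂.var 13 ≤ (K + 1) * cutVal n w c := by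
    intro hn₀ c hc t k hct had
    obtain ⟨g, hg, hprom, hle⟩ := exists_guess (K := K) hb.weight hb.nonneg hc hct had.le had.le_add
      (by omega) hJ hBs had.mul_le (by exact_mod_cast had.lower) (by exact_mod_cast had.upper)
    exact (hall hn₀ g hg hprom).trans hle
  have hw0 : 0 ≤ ∑ u ∈ Finset.range n, ∑ v ∈ Finset.range n, w u v :=
    Finset.sum_nonneg fun u _ => Finset.sum_nonneg fun v _ => hb.nonneg u v
  have hK0 : (1 : ℤ) ≤ K := by exact_mod_cast hK
  have c0 : ∀ {c : ℕ → ℤ}, (∀ v, c v = 0 ∨ c v = 1) → ∀ v, 0 ≤ c v := fun hc v => by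
    rcases hc v with e | e <;> rw [e]; norm_num
  have c1 : ∀ {c : ℕ → ℤ}, (∀ v, c v = 0 ∨ c v = 1) → ∀ v, c v ≤ 1 := fun hc v => by
    rcases hc v with e | e <;> rw [e]; norm_num
  have hfinal : n₀ ≤ n → ∀ c : ℕ → ℤ, (∀ v, c v = 0 ∨ c v = 1) → ∀ t k : ℕ,
      ∑ v ∈ Finset.range n, c v = t → Admissible A B A₁ A₂ n m t k →
      K * cutVal n w b ≤ (K + 1) * cutVal n w c := by
    intro hn₀ c hc t k hct had
    rcases hbest with ⟨hz, -⟩ | ⟨-, -, h⟩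
    · have e : cutVal n w b = 0 := by unfold cutVal; simp [hz]
      rw [e, mul_zero]
      exact mul_nonneg (by positivity) (cutVal_nonneg hb.nonneg (c0 hc) (c1 hc))
    · rw [← h]; exact hcov hn₀ c hc t k hct had
  have hZD : 2 ^ D.card + 2 ^ (n - D.card) ≤ Z := by
    refine hZ _ ?_
    rcases hbest with ⟨hz, h⟩ | ⟨hlo, hhi, -⟩
    · refine Or.inr ⟨by rw [hD, Finset.filter_false_of_mem (fun v _ => by rw [hz]; norm_num),
        Finset.card_empty], fun hn₀ t ht k had => ?_⟩
      have hc01 : ∀ v : ℕ, (if v < t then (1 : ℤ) else 0) = 0 ∨ (if v < t then (1 : ℤ) else 0) = 1 :=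
        fun v => by split_ifs <;> simp
      -- If no set was stored, variable 13 still is 2Σ + 1, where Σ sums the weights over ordered
      -- pairs. Any set of an admissible size, here the first t vertices, would force K(2Σ + 1) ≤ (K
      -- + 1)Σ, which is false for K ≥ 1.
      have h5 := hcov hn₀ (fun v => if v < t then 1 else 0) hc01 t k (by
        obtain ⟨d, rfl⟩ := Nat.exists_eq_add_of_le ht
        rw [Finset.sum_range_add]
        simp only [add_lt_iff_neg_left, not_lt_zero, if_false, Finset.sum_const_zero, add_zero]
        rw [Finset.sum_congr rfl (g := fun _ => 1) fun i hi => if_pos (Finset.mem_range.1 hi)]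
        simp) had
      have h6 := cutVal_le_sum hb.nonneg (c0 hc01) (c1 hc01) (n := n)
      rw [h] at h5
      nlinarith
    · rw [hDsum] at hlo hhi
      refine Or.inl ⟨hDn, by exact_mod_cast hlo, ?_⟩
      zify [hDn]; exact hhi
  refine (arrangeCmd_spec hs₂ hb.le hb.weight hb.nonneg hsymm hD hb11 hb01 g13 h2nM hnM hC
    hCM).mono (by gcongr) ?_
  rintro s₃ - ⟨f, hf, hinj, hout, hopt⟩
  refine ⟨f, hf, hinj, hout, b, hb01, hopt, fun hlt => ?_, hfinal⟩
  unfold cutVal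
  exact Finset.sum_eq_zero fun u hu => Finset.sum_eq_zero fun v _ => by
    rw [hbz hlt u (Finset.mem_range.1 hu)]; ring

end

end OLA

namespace OLA

/-! ### Cuts of moderate size -/

lemma sum_prefix {n : ℕ} {g : ℕ → ℕ} (hg : ∀ u < n, g u < n) (hinj : Set.InjOn g (Set.Iio n))
    {i : ℕ} (hi : i < n) : ∑ u ∈ Finset.range n, (if g u ≤ i then (1 : ℤ) else 0) = i + 1 := by
  have h : ∑ u ∈ Finset.range n, (if g u ≤ i then (1 : ℤ) else 0) =
      ∑ c ∈ Finset.range n, if c ≤ i then 1 else 0 := by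
    refine Finset.sum_nbij g (fun u hu => Finset.mem_range.2 (hg u (Finset.mem_range.1 hu)))
      (fun u hu v hv => hinj (by simpa using hu) (by simpa using hv)) (fun c hc => ?_)
      fun _ _ => rfl
    obtain ⟨u, hu, rfl⟩ := exists_preimage hg hinj c (by simpa using hc)
    exact ⟨u, by simpa using hu, rfl⟩
  rw [h, ← Finset.sum_filter, show (Finset.range n).filter (· ≤ i) = Finset.range (i + 1) by
    ext c; simp only [Finset.mem_filter, Finset.mem_range]; omega]
  simp

/-- A lower bound for the cost of an ordering from the cuts of its prefixes and suffixes. -/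
lemma mul_le_ordCost {n : ℕ} {w : ℕ → ℕ → ℤ} (hw : ∀ u v, 0 ≤ w u v)
    (hsymm : ∀ u v, w u v = w v u) {g : ℕ → ℕ} (hg : ∀ u < n, g u < n)
    (hinj : Set.InjOn g (Set.Iio n)) {a e : ℕ} (hae : a ≤ e) (he : 2 * e < n) {P Q : ℤ} (hQ : 0 ≤ Q)
    (h : ∀ c : ℕ → ℤ, (∀ v, c v = 0 ∨ c v = 1) → ∀ t : ℕ, ∑ v ∈ Finset.range n, c v = t →
      a < t → t ≤ e → P ≤ Q * cutVal n w c) :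
    2 * ((e : ℤ) - a) * P ≤ Q * ordCost n w g := by
  set c : ℕ → ℕ → ℤ := fun i u => if g u ≤ i then 1 else 0 with hc
  have h01 : ∀ i v, c i v = 0 ∨ c i v = 1 := fun i v => by
    simp only [hc]; split_ifs <;> simp
  have hpre : ∀ i ∈ Finset.Ico a e, P ≤ Q * cutVal n w (c i) := by
    intro i hi
    rw [Finset.mem_Ico] at hi
    refine h _ (h01 i) (i + 1) ?_ (by omega) (by omega)
    rw [sum_prefix hg hinj (by omega)]; push_cast; ring
  -- The set of vertices after position i has n - 1 - i elements and the same cut as the prefix.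
  have hsuf : ∀ i ∈ Finset.Ico (n - 1 - e) (n - 1 - a), P ≤ Q * cutVal n w (c i) := by
    intro i hi
    rw [Finset.mem_Ico] at hi
    rw [← cutVal_compl hsymm]
    refine h _ (fun v => by rcases h01 i v with h | h <;> simp [h]) (n - 1 - i) ?_ (by omega)
      (by omega)
    rw [Finset.sum_sub_distrib, sum_prefix hg hinj (by omega)]
    simp; omega
  -- The condition 2e < n separates the short prefixes from those with a short complement, so both
  -- groups of cuts count.
  have hdisj : Disjoint (Finset.Ico a e) (Finset.Ico (n - 1 - e) (n - 1 - a)) := by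
    rw [Finset.disjoint_left]
    intro i hi hi'
    rw [Finset.mem_Ico] at hi hi'
    omega
  have hsub : Finset.Ico a e ∪ Finset.Ico (n - 1 - e) (n - 1 - a) ⊆ Finset.range n := by
    intro i hi
    rw [Finset.mem_union, Finset.mem_Ico, Finset.mem_Ico] at hi
    rw [Finset.mem_range]; omega
  have h0 : ∀ i ∈ Finset.range n, i ∉ Finset.Ico a e ∪ Finset.Ico (n - 1 - e) (n - 1 - a) →
      0 ≤ Q * cutVal n w (c i) := fun i _ _ =>
    mul_nonneg hQ (cutVal_nonneg hw (fun u => by rcases h01 i u with h | h <;> simp [h])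
      fun u => by rcases h01 i u with h | h <;> simp [h])
  have hsum := Finset.sum_le_sum_of_subset_of_nonneg hsub h0
  rw [Finset.sum_union hdisj, ← Finset.mul_sum (Finset.range n)] at hsum
  have h1 := Finset.card_nsmul_le_sum _ _ _ hpre
  have h2 := Finset.card_nsmul_le_sum _ _ _ hsuf
  rw [Nat.card_Ico, nsmul_eq_mul] at h1 h2
  rw [show n - 1 - a - (n - 1 - e) = e - a by omega] at h2
  rw [Nat.cast_sub hae] at h1 h2
  have h3 : 2 * ((e : ℤ) - a) * P = (e - a) * P + (e - a) * P := by ring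
  rw [h3]
  exact (add_le_add h1 h2).trans hsum

/-! ### The choice of the constants -/

/-- The constants of the algorithm for the parameter `α`. -/
structure Fits (α : ℝ) (q A₁ : ℕ) : Prop where
  large : 32 ≤ α * q
  le : α * q / 4 ≤ A₁
  le_add : (A₁ : ℝ) ≤ α * q / 4 + 1

lemma exists_fits {α : ℝ} (h0 : 0 < α) : ∃ q A₁ : ℕ, Fits α q A₁ := by
  obtain ⟨q, hq⟩ := exists_nat_ge (32 / α)
  refine ⟨q, ⌈α * q / 4⌉₊, ?_, Nat.le_ceil _, (Nat.ceil_lt_add_one (by positivity)).le⟩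
  rw [div_le_iff₀ h0] at hq
  linarith

section

variable {α : ℝ} {q A₁ n m : ℕ}

lemma Fits.le_q (h : Fits α q A₁) (h1 : α < 1) : 32 ≤ q := by
  have h2 : (0 : ℝ) ≤ q := Nat.cast_nonneg q
  have h3 := h.large
  have : (32 : ℝ) ≤ q := by nlinarith
  exact_mod_cast this

lemma Fits.four_mul_le (h : Fits α q A₁) (h1 : α < 1) : 4 * A₁ ≤ q + 4 := by
  have h2 : (0 : ℝ) ≤ q := Nat.cast_nonneg q
  have h3 := h.le_add
  have : 4 * (A₁ : ℝ) ≤ q + 4 := by nlinarith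
  exact_mod_cast this

/-- The summand 4 pays for the up to four dummy positions that a set may contain, and the summand 2
for rounding t up to a multiple of three. -/
lemma Fits.admissible (h : Fits α q A₁) (h1 : α < 1) (hm : m = (n + 4) / 3) {t : ℕ}
    (ht : A₁ * n / q + 4 < t) (ht' : t + 2 ≤ (q - 2) * n / (2 * q)) :
    Admissible (2 * q) (q - 2) A₁ q n m t ((t + 2) / 3) := by
  have hq := h.le_q h1
  have hA := h.four_mul_le h1
  have hk1 : t ≤ 3 * ((t + 2) / 3) := by omega
  have hk2 : 3 * ((t + 2) / 3) ≤ t + 2 := by omega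
  generalize (t + 2) / 3 = k at hk1 hk2 ⊢
  have hm1 : n + 2 ≤ 3 * m := by omega
  have hm2 : 3 * m ≤ n + 4 := by omega
  obtain ⟨B, rfl⟩ : ∃ B, q = B + 2 := ⟨q - 2, by omega⟩
  rw [Nat.add_sub_cancel] at ht' ⊢
  have e1 : A₁ * n + 4 * (B + 2) ≤ (B + 2) * t := by
    have h2 := Nat.lt_div_mul_add (a := A₁ * n) (show 0 < B + 2 by omega)
    have h3 : A₁ * n / (B + 2) + 5 ≤ t := ht
    nlinarith
  have e2 : (t + 2) * (2 * (B + 2)) ≤ B * n := (Nat.le_div_iff_mul_le (by omega)).1 ht'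
  refine ⟨hk1, hk2, ?_, ?_, ?_⟩ <;> nlinarith

/-- The sizes from about αn/4 to about (1/2 - 1/q)n are admissible. Twice their number is about (1 -
α/2 - O(1/q))n, and αq ≥ 32 together with n ≥ 10q makes this at least n(1 - α)(1 + 1/q). -/
lemma Fits.window (h : Fits α q A₁) (h0 : 0 < α) (h1 : α < 1) (hn : 10 * q ≤ n) :
    ∃ a e : ℕ, a < e ∧ 2 * e < n ∧ (n : ℝ) * (1 - α) * (q + 1) ≤ 2 * q * ((e : ℝ) - a) ∧
      ∀ t, a < t → t ≤ e → ∀ m, m = (n + 4) / 3 →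
        Admissible (2 * q) (q - 2) A₁ q n m t ((t + 2) / 3) := by
  have hq := h.le_q h1
  have hq' : (0 : ℝ) < q := by exact_mod_cast (by omega : 0 < q)
  obtain ⟨B, hB⟩ : ∃ B, q = B + 2 := ⟨q - 2, by omega⟩
  have hBr : (B : ℝ) = q - 2 := by rw [hB]; push_cast; ring
  set x := (q - 2) * n / (2 * q) with hx
  set a := A₁ * n / q with ha
  have hx1 : x * (2 * q) ≤ B * n := by
    rw [hx, show q - 2 = B by omega]; exact Nat.div_mul_le_self _ _
  have hx2 : B * n < x * (2 * q) + 2 * q := by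
    rw [hx, show q - 2 = B by omega]; exact Nat.lt_div_mul_add (by omega)
  have ha1 : a * q ≤ A₁ * n := Nat.div_mul_le_self _ _
  have hxr : ((q : ℝ) - 2) * n < x * (2 * q) + 2 * q := by rw [← hBr]; exact_mod_cast hx2
  have har : (a : ℝ) * q ≤ A₁ * n := by exact_mod_cast ha1
  have hnr : 10 * (q : ℝ) ≤ n := by exact_mod_cast hn
  have hn0 : (0 : ℝ) < n := by linarith
  have h2x : 2 ≤ x := by
    rw [hx, Nat.le_div_iff_mul_le (by omega)]
    obtain rfl := hB
    rw [Nat.add_sub_cancel]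
    nlinarith
  have hle := mul_le_mul_of_nonneg_right h.le_add hn0.le
  have hlarge := mul_le_mul_of_nonneg_right h.large hn0.le
  have key : (n : ℝ) * (1 - α) * (q + 1) ≤ 2 * q * (((x - 2 : ℕ) : ℝ) - (a + 4 : ℕ)) := by
    rw [Nat.cast_sub h2x]; push_cast
    nlinarith
  have hlt : a + 4 < x - 2 := by
    have h3 : 0 < (n : ℝ) * (1 - α) * (q + 1) := by
      have : 0 < 1 - α := by linarith
      positivity
    have h4 : 0 < ((x - 2 : ℕ) : ℝ) - (a + 4 : ℕ) := by
      by_contra hc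
      rw [not_lt] at hc
      nlinarith
    exact_mod_cast sub_pos.1 h4
  refine ⟨a + 4, x - 2, hlt, ?_, key, fun t ht ht' m hm => h.admissible h1 hm ht (by omega)⟩
  obtain rfl := hB
  have : 2 * x < n + 4 := by
    by_contra hc
    rw [not_lt] at hc
    nlinarith
  omega

/-- The approximation guarantee. -/
lemma Fits.approx (h : Fits α q A₁) (h0 : 0 < α) (h1 : α < 1) (hm : m = (n + 4) / 3)
    {w : ℕ → ℕ → ℤ} (hw : ∀ u v, 0 ≤ w u v) (hsymm : ∀ u v, w u v = w v u) {b : ℕ → ℤ}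
    (hb : ∀ v, b v = 0 ∨ b v = 1) (hsmall : n < 10 * q → cutVal n w b = 0)
    (hopt : 10 * q ≤ n → ∀ c : ℕ → ℤ, (∀ v, c v = 0 ∨ c v = 1) → ∀ t k : ℕ,
      ∑ v ∈ Finset.range n, c v = t → Admissible (2 * q) (q - 2) A₁ q n m t k →
        (q : ℕ) * cutVal n w b ≤ (q + 1) * cutVal n w c)
    {g : ℕ → ℕ} (hg : ∀ u < n, g u < n) (hinj : Set.InjOn g (Set.Iio n)) :
    (n : ℝ) * (1 - α) * cutVal n w b ≤ ordCost n w g := by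
  have hX : 0 ≤ cutVal n w b := cutVal_nonneg hw (fun u => by rcases hb u with h | h <;> simp [h])
    fun u => by rcases hb u with h | h <;> simp [h]
  rcases lt_or_ge n (10 * q) with hlt | hge
  · rw [hsmall hlt, Int.cast_zero, mul_zero]
    have : 0 ≤ ordCost n w g := Finset.sum_nonneg fun i _ =>
      cutVal_nonneg hw (fun u => by split_ifs <;> simp) fun u => by split_ifs <;> simp
    exact_mod_cast this
  · obtain ⟨a, e, hae, he, hsize, had⟩ := h.window h0 h1 hge
    -- All cuts of the optimal ordering in the window are at least q/(q+1) times the cut that was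
    -- found.
    have h2 := mul_le_ordCost hw hsymm hg hinj hae.le he (P := q * cutVal n w b) (Q := q + 1)
      (by positivity) fun c hc t hct hat hte => hopt hge c hc t _ hct (had t hat hte m hm)
    have h3 : 2 * ((e : ℝ) - a) * (q * (cutVal n w b : ℝ)) ≤ (q + 1) * (ordCost n w g : ℝ) := by
      exact_mod_cast h2
    have hXr : (0 : ℝ) ≤ cutVal n w b := by exact_mod_cast hX
    have h4 := mul_le_mul_of_nonneg_right hsize hXr
    have hq1 : (0 : ℝ) < q + 1 := by positivity
    refine le_of_mul_le_mul_left ?_ hq1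
    linarith

end

end OLA

namespace OLA

/-! ### Running times -/

section

variable {q A₁ n m : ℕ} {α : ℝ}

/-- The integer test 2q·k ≤ (q - 2)·m of the program says k ≤ (1/2 - 1/q)·m. -/
lemma maskCount_le_rpow {θ : ℝ} (hθ : ∀ m k : ℕ, (k : ℝ) ≤ (1 / 2 - 1 / q) * m →
    (((Finset.range (2 ^ m)).filter fun x => popcount m x = k).card : ℝ) ≤ 2 ^ (θ * m))
    (hq : 2 ≤ q) {k : ℕ} (hk : 2 * q * k ≤ (q - 2) * m) : (maskCount m k : ℝ) ≤ 2 ^ (θ * m) := by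
  refine hθ m k ?_
  have hq' : (0 : ℝ) < q := by exact_mod_cast (by omega : 0 < q)
  have h1 : 2 * (q : ℝ) * k ≤ (q - 2) * m := by
    have : ((2 * q * k : ℕ) : ℝ) ≤ ((q - 2) * m : ℕ) := by exact_mod_cast hk
    rw [Nat.cast_mul (q - 2), Nat.cast_sub hq] at this
    push_cast at this
    exact this
  rw [show (1 / 2 - 1 / (q : ℝ)) * m = ((q - 2) * m) / (2 * q) by field_simp,
    le_div_iff₀ (by positivity)]
  linarith

/-- The size of the recursive multiplication of matrices of dimension at most `c`. -/
lemma BilinearScheme.pow_le (S : BilinearScheme) {ω θ : ℝ} (hω : 0 ≤ ω) (hθ : 0 < θ)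
    (hS : (S.R : ℝ) ≤ (S.N : ℝ) ^ (ω / θ)) {κ c m : ℕ} (hc : (c : ℝ) ≤ 2 ^ (θ * m))
    (hκ : κ = 0 ∨ S.N ^ (κ - 1) < c) : (S.R : ℝ) ^ κ ≤ S.R * 2 ^ (ω * m) := by
  have hR : (1 : ℝ) ≤ S.R := by
    have h1 := S.two_le
    have h2 := S.sq_le
    have : 1 ≤ S.R := by nlinarith
    exact_mod_cast this
  have hone : (1 : ℝ) ≤ 2 ^ (ω * m) := Real.one_le_rpow (by norm_num) (by positivity)
  rcases κ with _ | κ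
  · rw [pow_zero]; exact one_le_mul_of_one_le_of_one_le hR hone
  rw [pow_succ, mul_comm]
  refine mul_le_mul_of_nonneg_left ?_ (by linarith)
  replace hκ : S.N ^ κ < c := by simpa using hκ
  have hN : (0 : ℝ) ≤ S.N := Nat.cast_nonneg _
  have hc' : (S.N : ℝ) ^ κ ≤ 2 ^ (θ * m) := le_trans (by exact_mod_cast hκ.le) hc
  -- After one level is split off at the cost of a factor R, minimality gives N^κ < c ≤ 2^(θm). The
  -- exponent ω/θ of the scheme cancels θ.
  calc (S.R : ℝ) ^ κ ≤ ((S.N : ℝ) ^ (ω / θ)) ^ κ := pow_le_pow_left₀ (by linarith) hS κ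
    _ = ((S.N : ℝ) ^ κ) ^ (ω / θ) := by
        rw [← Real.rpow_natCast, ← Real.rpow_mul hN, ← Real.rpow_natCast, ← Real.rpow_mul hN,
          mul_comm]
    _ ≤ (2 ^ (θ * m)) ^ (ω / θ) := Real.rpow_le_rpow (pow_nonneg hN κ) hc' (by positivity)
    _ = 2 ^ (ω * m) := by
        rw [← Real.rpow_mul (by norm_num)]; congr 1; field_simp

/-- Both the set and its complement contain at least A₁n/q ≥ αn/4 vertices, so each has at most (1 -
α/4)n. -/
lemma Acceptable.rpow_le (h : Fits α q A₁) (h1 : α < 1) {a : ℕ}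
    (ha : Acceptable A₁ q n a) : (2 : ℝ) ^ a + 2 ^ (n - a) ≤ 2 * 2 ^ ((1 - α / 4) * n) := by
  obtain ⟨hle, hlo, hhi⟩ := ha
  have hq : (0 : ℝ) < q := by have := h.le_q h1; exact_mod_cast (by omega : 0 < q)
  have key : ∀ a' b : ℕ, a' + b = n → A₁ * n ≤ q * b → (2 : ℝ) ^ a' ≤ 2 ^ ((1 - α / 4) * n) := by
    intro a' b hab hb
    rw [← Real.rpow_natCast]
    refine Real.rpow_le_rpow_of_exponent_le (by norm_num) ?_
    have h2 : (A₁ : ℝ) * n ≤ q * b := by exact_mod_cast hb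
    have h3 : (a' : ℝ) + b = n := by exact_mod_cast hab
    have h4 := mul_le_mul_of_nonneg_right h.le (Nat.cast_nonneg (α := ℝ) n)
    refine le_of_mul_le_mul_left ?_ hq
    have h5 : (q : ℝ) * a' = q * n - q * b := by rw [← h3]; ring
    rw [h5]; linarith
  have := key a (n - a) (by omega) hhi
  have := key (n - a) a (by omega) hlo
  linarith

/-- The bound for the dimensions of the loops in the final machine. -/
def BilinearScheme.indexBound (S : BilinearScheme) (n : ℕ) : ℕ := n + S.N * S.N + S.R + 4

/-- The number of guesses is the sixth power of this. -/
def guessBase (K n : ℕ) : ℕ := n * n * (K * (n * n) + 1) + 3 * ((n + 4) / 3) + 1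

/-- The bound for the bits of the numbers that occur. -/
def BilinearScheme.bitBound (S : BilinearScheme) (K n p : ℕ) : ℕ :=
  S.magnitude * (3 * ((n + 4) / 3)) + 6 * guessBase K n + S.indexBound n + n + 3 * p + 3

/-- The bound for the number of steps of the algorithm. -/
def stepBound (K n Y Z : ℕ) : ℕ :=
  (10 + 6 * ((n + 4) / 3)) + ((1 + (1 + guessBase K n ^ 6 *
    (1 + 50 * ((n + 4) / 3 + 1) * (Y + 2 ^ ((n + 4) / 3) + n + 1)))) + (7 + 8 * n + Z * 4))

lemma guessBase_le {K n u : ℕ} (hu : n + 1 ≤ u) : guessBase K n ≤ (K + 8) * u ^ 4 := by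
  have h1 : n * n * (K * (n * n) + 1) ≤ u * u * (K * (u * u) + 1) := by gcongr <;> omega
  have h2 : 1 ≤ u := by omega
  have h3 : u ≤ u ^ 4 := Nat.le_self_pow (by norm_num) _
  have h4 : u ^ 2 ≤ u ^ 4 := Nat.pow_le_pow_right h2 (by norm_num)
  have h5 : u * u * (K * (u * u) + 1) = K * u ^ 4 + u ^ 2 := by ring
  have h6 : (K + 8) * u ^ 4 = K * u ^ 4 + 8 * u ^ 4 := by ring
  unfold guessBase
  omega

lemma BilinearScheme.indexBound_le (S : BilinearScheme) {n u : ℕ} (hu : n + 1 ≤ u) :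
    S.indexBound n + 1 ≤ (S.N * S.N + S.R + 5) * u := by
  have h1 : S.N * S.N + S.R + 4 ≤ (S.N * S.N + S.R + 4) * u := Nat.le_mul_of_pos_right _ (by omega)
  unfold indexBound
  have : (S.N * S.N + S.R + 5) * u = (S.N * S.N + S.R + 4) * u + u := by ring
  omega

lemma BilinearScheme.bitBound_le (S : BilinearScheme) {K n p u : ℕ} (hu : u = p + 1) (hn : n ≤ p) :
    S.bitBound K n p + 1 ≤ (4 * S.magnitude + 6 * (K + 8) + (S.N * S.N + S.R + 5) + 8) * u ^ 4 := by
  have hnu : n + 1 ≤ u := by omega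
  have h1 := guessBase_le (K := K) hnu
  have h2 := S.indexBound_le hnu
  have h3 : u ≤ u ^ 4 := Nat.le_self_pow (by norm_num) _
  have h4 : S.magnitude * (3 * ((n + 4) / 3)) ≤ S.magnitude * (4 * u ^ 4) :=
    Nat.mul_le_mul_left _ (by omega)
  have h5 : (S.N * S.N + S.R + 5) * u ≤ (S.N * S.N + S.R + 5) * u ^ 4 := Nat.mul_le_mul_left _ h3
  unfold bitBound
  rw [add_mul, add_mul, add_mul]
  have e1 : 4 * S.magnitude * u ^ 4 = S.magnitude * (4 * u ^ 4) := by ring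
  have e2 : 6 * (K + 8) * u ^ 4 = 6 * ((K + 8) * u ^ 4) := by ring
  rw [e1, e2]
  omega

/-- The exponent 26 consists of 24 for the sixth power of the number base, 1 for the factor m + 1
and 1 for the additive term n. -/
lemma stepBound_le {K n Y Z u : ℕ} (hu : n + 1 ≤ u) {X E F : ℝ} (hX : 1 ≤ X)
    (hY : (Y : ℝ) + 2 ^ ((n + 4) / 3) ≤ E * X) (hE : 0 ≤ E) (hZ : (Z : ℝ) ≤ F * X) :
    (stepBound K n Y Z : ℝ) ≤ (39 + (K + 8) ^ 6 * (1 + 150 * (E + 1)) + 4 * F) * u ^ 26 * X := by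
  have hu1 : (1 : ℝ) ≤ u := by exact_mod_cast (by omega : 1 ≤ u)
  have hnu : (n : ℝ) + 1 ≤ u := by exact_mod_cast hu
  have hm : (((n + 4) / 3 : ℕ) : ℝ) ≤ 2 * u := by
    exact_mod_cast (by omega : (n + 4) / 3 ≤ 2 * u)
  have hB : (guessBase K n : ℝ) ≤ (K + 8) * u ^ 4 := by exact_mod_cast guessBase_le hu
  have hu26 : (u : ℝ) ≤ u ^ 26 := le_self_pow₀ hu1 (by norm_num)
  have hs : ∀ c : ℝ, 0 ≤ c → c ≤ c * u ^ 26 * X := fun c hc => by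
    have : 1 ≤ (u : ℝ) ^ 26 * X := one_le_mul_of_one_le_of_one_le (one_le_pow₀ hu1) hX
    rw [mul_assoc]; exact le_mul_of_one_le_right hc this
  have huX : (u : ℝ) ≤ u ^ 26 * X := hu26.trans (le_mul_of_one_le_right (by positivity) hX)
  have h1 : (Y : ℝ) + 2 ^ ((n + 4) / 3) + n + 1 ≤ (E + 1) * u * X := by
    have e1 : E * X ≤ E * X * u := le_mul_of_one_le_right (by positivity) hu1
    have e2 : (u : ℝ) ≤ u * X := le_mul_of_one_le_right (by positivity) hX
    nlinarith
  have h2 : 1 + 50 * ((((n + 4) / 3 : ℕ) : ℝ) + 1) * ((Y : ℝ) + 2 ^ ((n + 4) / 3) + n + 1) ≤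
      (1 + 150 * (E + 1)) * u ^ 2 * X := by
    have e1 : (1 : ℝ) ≤ u ^ 2 * X := one_le_mul_of_one_le_of_one_le (one_le_pow₀ hu1) hX
    have e2 : 50 * ((((n + 4) / 3 : ℕ) : ℝ) + 1) * ((Y : ℝ) + 2 ^ ((n + 4) / 3) + n + 1) ≤
        (50 * (3 * u)) * ((E + 1) * u * X) := by
      gcongr
      linarith
    calc _ ≤ u ^ 2 * X + (50 * (3 * u)) * ((E + 1) * u * X) := add_le_add e1 e2
      _ = _ := by ring
  have h3 : (guessBase K n : ℝ) ^ 6 * (1 + 50 * ((((n + 4) / 3 : ℕ) : ℝ) + 1) *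
      ((Y : ℝ) + 2 ^ ((n + 4) / 3) + n + 1)) ≤
      (K + 8) ^ 6 * (1 + 150 * (E + 1)) * u ^ 26 * X := by
    calc _ ≤ ((K + 8) * (u : ℝ) ^ 4) ^ 6 * ((1 + 150 * (E + 1)) * u ^ 2 * X) := by gcongr
      _ = _ := by ring
  have h4 : 4 * (Z : ℝ) ≤ 4 * F * u ^ 26 * X := by
    have e1 : (0 : ℝ) ≤ F * X := (Nat.cast_nonneg _).trans hZ
    have e2 : F * X ≤ F * X * u ^ 26 := le_mul_of_one_le_right e1 (one_le_pow₀ hu1)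
    nlinarith
  have h5 := hs 19 (by norm_num)
  unfold stepBound
  push_cast at h3 ⊢
  nlinarith

end

end OLA

/-! ### The compiled algorithm on an instance -/

namespace OLA

section

variable {n : ℕ}

lemma WeightedGraph.bounds (I : WeightedGraph n) (S : BilinearScheme) {m M : ℕ}
    (hm : m = (n + 4) / 3) (h3 : 3 * m ≤ M) (hmag : S.magnitude ^ (3 * m) ≤ M)
    (hsum : 2 * 2 ^ (3 * I.inputSize) + 1 ≤ M) :
    Bounds S n m M I.wt (I.initState.arr 1) where
  weight u hu v hv := I.initState_weight hu hv
  nonneg := I.wt_nonneg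
  le := by omega
  three_mul_le := h3
  magnitude_le := hmag
  sum_le := by
    have h1 := I.sum_wt_le
    have h2 : (2 : ℤ) * 2 ^ (3 * I.inputSize) + 1 ≤ M := by exact_mod_cast hsum
    linarith

/-- The ordering given by its positions as natural numbers. -/
lemma exists_ordering_eq {f : ℕ → ℕ} (hf : ∀ v < n, f v < n) (hinj : Set.InjOn f (Set.Iio n)) :
    ∃ π : VertexOrdering n, ∀ u : Fin n, f u = π u := by
  have h : Function.Injective fun u : Fin n => (⟨f u, hf u u.2⟩ : Fin n) := by
    intro u v huv
    exact Fin.ext (hinj u.2 v.2 (congrArg Fin.val huv))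
  exact ⟨Equiv.ofBijective _ (Finite.injective_iff_bijective.1 h), fun u => rfl⟩

/-- A run of the compiled algorithm. -/
lemma WeightedGraph.exists_run (I : WeightedGraph n) (S : BilinearScheme) {K A B A₁ A₂ n₀ Y Z : ℕ}
    (hK : 1 ≤ K)
    (hY : ∀ k κ, A * k ≤ B * ((n + 4) / 3) →
      (κ = 0 ∨ S.N ^ (κ - 1) < maskCount ((n + 4) / 3) k) → S.R ^ κ ≤ Y)
    (hZ : ∀ a, (Acceptable A₁ A₂ n a ∨ a = 0 ∧
      (n₀ ≤ n → ∀ t ≤ n, ∀ k, ¬ Admissible A B A₁ A₂ n ((n + 4) / 3) t k)) →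
      2 ^ a + 2 ^ (n - a) ≤ Z) :
    ∃ (t : ℕ) (s : State) (π : VertexOrdering n),
      Run ((fullCmd S K A B A₁ A₂ n₀).compile (fullCmd S K A B A₁ A₂ n₀).varBound) I.initState t s ∧
      s.Outputs π ∧
      t ≤ stepBound K n Y Z * ((fullCmd S K A B A₁ A₂ n₀).costConst *
        (S.bitBound K n I.inputSize + 1) ^ 2 *
        (S.indexBound n + 1) ^ (fullCmd S K A B A₁ A₂ n₀).depth) ∧
      ∃ b : ℕ → ℤ, (∀ v, b v = 0 ∨ b v = 1) ∧
        (∀ f' : ℕ → ℕ, (∀ v < n, f' v < n) → Set.InjOn f' (Set.Iio n) →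
          2 * (I.cost π : ℤ) ≤ 2 * ordCost n I.wt f' + n * cutVal n I.wt b) ∧
        (n < n₀ → cutVal n I.wt b = 0) ∧
        (n₀ ≤ n → ∀ c : ℕ → ℤ, (∀ v, c v = 0 ∨ c v = 1) → ∀ t k : ℕ,
          ∑ v ∈ Finset.range n, c v = t → Admissible A B A₁ A₂ n ((n + 4) / 3) t k →
          K * cutVal n I.wt b ≤ (K + 1) * cutVal n I.wt c) := by
  obtain ⟨m, hm⟩ : ∃ m, m = (n + 4) / 3 := ⟨_, rfl⟩
  rw [← hm] at hY hZ
  -- All stored numbers are bounded by M = 2^β. The summands of β correspond to the separate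
  -- requirements: matrix entries, guesses, loop ranges, and table entries.
  set β := S.bitBound K n I.inputSize with hβ
  have hβe : β = S.magnitude * (3 * m) + 6 * guessBase K n + S.indexBound n + n +
      3 * I.inputSize + 3 := by rw [hβ, hm]; rfl
  have hnp := I.n_le_inputSize
  have hpow : ∀ {x e : ℕ}, x ≤ 2 ^ e → e ≤ β → x ≤ 2 ^ β := fun h h' =>
    h.trans (Nat.pow_le_pow_right (by norm_num) h')
  have hself : ∀ {x : ℕ}, x ≤ β → x ≤ 2 ^ β := fun h => hpow Nat.lt_two_pow_self.le h
  have hL : S.indexBound n = n + S.N * S.N + S.R + 4 := rfl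
  have hG : 3 * m + 1 ≤ guessBase K n := by rw [hm]; unfold guessBase; omega
  have hp : Params (2 ^ β) (S.indexBound n) β := ⟨by omega, hself (by omega), le_rfl⟩
  have hmag : S.magnitude ^ (3 * m) ≤ 2 ^ β := by
    refine hpow (e := S.magnitude * (3 * m)) ?_ (by omega)
    rw [pow_mul 2]
    exact Nat.pow_le_pow_left Nat.lt_two_pow_self.le _
  have hB6 : guessBase K n ^ 6 ≤ 2 ^ β := by
    refine hpow (e := guessBase K n * 6) ?_ (by omega)
    rw [pow_mul 2]
    exact Nat.pow_le_pow_left Nat.lt_two_pow_self.le _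
  have hsum : 2 * 2 ^ (3 * I.inputSize) + 1 ≤ 2 ^ β := by
    refine hpow (e := 3 * I.inputSize + 2) ?_ (by omega)
    have : 1 ≤ 2 ^ (3 * I.inputSize) := Nat.one_le_two_pow
    rw [pow_add]; omega
  have hCM : 2 ^ (n + 1) * 2 ^ (3 * I.inputSize) ≤ 2 ^ β := by
    rw [← pow_add]
    exact Nat.pow_le_pow_right (by norm_num) (by omega)
  have hspec := fullCmd_spec (s := I.initState) (A := A) (B := B) (A₁ := A₁) (A₂ := A₂) (n₀ := n₀)
    (L := S.indexBound n) (I.bounds S hm (hself (by omega)) hmag hsum) I.wt_symm hm rfl rfl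
    (fun _ => rfl) (fun _ => rfl) (by omega) (by omega) (by omega) hK rfl
    (show guessBase K n = _ by rw [hm]; rfl) hB6 (fun k κ hk _ hκ => hY k κ hk hκ) hZ
    (C := 2 ^ (3 * I.inputSize)) (by exact_mod_cast I.sum_wt_le) hCM
  obtain ⟨hok, hsteps, f, hf, hinj, hout, b, hb01, hopt, hsmall, hall⟩ := hspec
  obtain ⟨t, s', hrun, hagree, -, -, ht⟩ := Cmd.run_compile hp (fullCmd S K A B A₁ A₂ n₀) le_rfl _
    I.initState I.initState le_rfl
    (I.initState_bounded (by omega) (Nat.pow_le_pow_right (by norm_num) (by omega))) hok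
    ⟨fun _ _ => rfl, rfl⟩
  obtain ⟨π, hπ⟩ := exists_ordering_eq hf hinj
  refine ⟨t, s', π, hrun, fun v => ?_, ht.trans (Nat.mul_le_mul_right _ ?_), b, hb01, ?_, hsmall,
    by rw [← hm]; exact hall⟩
  · rw [hagree.2, hout v v.2, hπ]; rfl
  · unfold stepBound; rw [← hm]; exact hsteps
  · intro f' hf' hinj'
    rw [I.cost_eq π f hπ]
    exact hopt f' hf' hinj'

/-- The exponent is 26 from the number of steps, 8 from the square of a bit bound of degree 4, and D
from the nesting of sums. -/
lemma BilinearScheme.time_le (S : BilinearScheme) {K p Y Z t k D : ℕ} (hnp : n ≤ p) {X E F : ℝ}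
    (hX : 1 ≤ X) (hY : (Y : ℝ) + 2 ^ ((n + 4) / 3) ≤ E * X) (hE : 0 ≤ E) (hZ : (Z : ℝ) ≤ F * X)
    (hF : 0 ≤ F)
    (ht : t ≤ stepBound K n Y Z * (k * (S.bitBound K n p + 1) ^ 2 * (S.indexBound n + 1) ^ D)) :
    (t : ℝ) ≤ (39 + (K + 8) ^ 6 * (1 + 150 * (E + 1)) + 4 * F) *
      (k * (4 * S.magnitude + 6 * (K + 8) + (S.N * S.N + S.R + 5) + 8 : ℕ) ^ 2 *
        (S.N * S.N + S.R + 5 : ℕ) ^ D) * (1 + (p : ℝ)) ^ (34 + D) * X := by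
  obtain ⟨u, hu⟩ : ∃ u, u = p + 1 := ⟨_, rfl⟩
  have hur : 1 + (p : ℝ) = u := by rw [hu]; push_cast; ring
  have h1 := stepBound_le (K := K) (n := n) (u := u) (by omega) hX hY hE hZ
  have h2 := S.bitBound_le (K := K) hu hnp
  have h3 := S.indexBound_le (n := n) (u := u) (by omega)
  rw [hur]
  generalize 4 * S.magnitude + 6 * (K + 8) + (S.N * S.N + S.R + 5) + 8 = c₂ at h2 ⊢
  generalize S.N * S.N + S.R + 5 = c₃ at h3 ⊢
  calc (t : ℝ) ≤ stepBound K n Y Z * (k * ((S.bitBound K n p + 1 : ℕ) : ℝ) ^ 2 *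
        ((S.indexBound n + 1 : ℕ) : ℝ) ^ D) := by exact_mod_cast ht
    _ ≤ ((39 + (K + 8) ^ 6 * (1 + 150 * (E + 1)) + 4 * F) * u ^ 26 * X) *
        (k * ((c₂ * u ^ 4 : ℕ) : ℝ) ^ 2 * ((c₃ * u : ℕ) : ℝ) ^ D) := by gcongr
    _ = _ := by push_cast; rw [mul_pow, mul_pow, pow_add]; ring

end

end OLA

/-! ### Choice of the constants and conclusion -/

open OLA in
theorem mainTheorem11 (α : ℝ) (hα₀ : 0 < α) (hα₁ : α < 1) :
    ∃ (p : OLA.Program) (C : ℝ) (d : ℕ), ∀ (n : ℕ) (I : OLA.WeightedGraph n),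
      ∃ (t : ℕ) (s : OLA.State) (π : OLA.VertexOrdering n),
        OLA.Run p I.initState t s ∧ s.Outputs π ∧
        I.IsApproxOptimal (1 + 1 / (2 * (1 - α))) π ∧
        (t : ℝ) ≤ C * (1 + (I.inputSize : ℝ)) ^ d *
          ((2 : ℝ) ^ (OLA.matMulExponent * n / 3) + (2 : ℝ) ^ ((1 - α / 4) * n)) := by
  obtain ⟨q, A₁, hfit⟩ := exists_fits hα₀
  have hq := hfit.le_q hα₁
  have hq' : (0 : ℝ) < q := by exact_mod_cast (by omega : 0 < q)
  obtain ⟨θ, hθ0, hθ1, hθ⟩ := exists_entropy_bound (δ := 1 / 2 - 1 / q)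
    (by have : 0 < 1 / (q : ℝ) := by positivity
        linarith)
  have hω := two_le_matMulExponent
  set ω := matMulExponent
  -- This is where θ < 1 is used: ω/θ exceeds the infimum ω, so a finite scheme of that exponent
  -- exists. It depends on α only.
  obtain ⟨S, hS⟩ := exists_scheme (τ := ω / θ) (by
    rw [lt_div_iff₀ hθ0]; nlinarith)
  -- The accuracy K of the thresholds is q as well, and 10q is the size below which instances are
  -- solved exactly.
  set c := fullCmd S q (2 * q) (q - 2) A₁ q (10 * q)
  -- The factor 2^(4ω/3) stems from the rounding m ≤ (n + 4)/3.
  obtain ⟨E, hE⟩ : ∃ E : ℝ, E = (S.R + 1) * 2 ^ (ω * (4 / 3)) := ⟨_, rfl⟩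
  obtain ⟨F, hF⟩ : ∃ F : ℝ, F = 2 + (2 ^ (10 * q) + 1) := ⟨_, rfl⟩
  have hE0 : 0 ≤ E := by rw [hE]; positivity
  have hF0 : 0 ≤ F := by rw [hF]; positivity
  refine ⟨c.compile c.varBound, (39 + (q + 8) ^ 6 * (1 + 150 * (E + 1)) + 4 * F) *
    (c.costConst * (4 * S.magnitude + 6 * (q + 8) + (S.N * S.N + S.R + 5) + 8 : ℕ) ^ 2 *
      (S.N * S.N + S.R + 5 : ℕ) ^ c.depth), 34 + c.depth, fun n I => ?_⟩
  set X : ℝ := 2 ^ (ω * n / 3) + 2 ^ ((1 - α / 4) * n)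
  obtain ⟨m, hm⟩ : ∃ m, m = (n + 4) / 3 := ⟨_, rfl⟩
  have hX1 : (1 : ℝ) ≤ 2 ^ (ω * n / 3) := Real.one_le_rpow (by norm_num) (by positivity)
  have hX2 : (0 : ℝ) < 2 ^ ((1 - α / 4) * n) := by positivity
  have hX0 : 1 ≤ X := by linarith
  set Y := ⌊(S.R : ℝ) * 2 ^ (ω * m)⌋₊
  -- The second summand bounds the exact dynamic program on instances with fewer than 10q vertices.
  set Z := ⌊(2 : ℝ) * 2 ^ ((1 - α / 4) * n)⌋₊ + (2 ^ (10 * q) + 1) with hZdef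
  have hYX : (Y : ℝ) + 2 ^ ((n + 4) / 3) ≤ E * X := by
    have h1 : (Y : ℝ) ≤ S.R * 2 ^ (ω * m) := Nat.floor_le (by positivity)
    have h2 : (2 : ℝ) ^ ((n + 4) / 3) ≤ 2 ^ (ω * m) := by
      rw [← hm, ← Real.rpow_natCast]
      refine Real.rpow_le_rpow_of_exponent_le (by norm_num) ?_
      exact le_mul_of_one_le_left (Nat.cast_nonneg m) (by linarith)
    have h3 : (2 : ℝ) ^ (ω * m) ≤ 2 ^ (ω * (4 / 3)) * X := by
      have h4 : 3 * (m : ℝ) ≤ n + 4 := by exact_mod_cast (by omega : 3 * m ≤ n + 4)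
      calc (2 : ℝ) ^ (ω * m) ≤ 2 ^ (ω * (4 / 3) + ω * n / 3) := by
            refine Real.rpow_le_rpow_of_exponent_le (by norm_num) ?_
            nlinarith
        _ = 2 ^ (ω * (4 / 3)) * 2 ^ (ω * n / 3) := Real.rpow_add (by norm_num) _ _
        _ ≤ _ := by gcongr; linarith
    calc _ ≤ (S.R + 1 : ℝ) * 2 ^ (ω * m) := by linarith
      _ ≤ (S.R + 1 : ℝ) * (2 ^ (ω * (4 / 3)) * X) := by gcongr
      _ = _ := by rw [hE]; ring
  have hZX : (Z : ℝ) ≤ F * X := by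
    have h1 : ((⌊(2 : ℝ) * 2 ^ ((1 - α / 4) * n)⌋₊ : ℕ) : ℝ) ≤ 2 * 2 ^ ((1 - α / 4) * n) :=
      Nat.floor_le (by positivity)
    have h2 : (2 ^ (10 * q) + 1 : ℝ) ≤ (2 ^ (10 * q) + 1) * X :=
      le_mul_of_one_le_right (by positivity) hX0
    rw [hZdef, hF]
    push_cast
    linarith
  obtain ⟨t, s, π, hrun, hout, ht, b, hb01, hopt, hsmall, hall⟩ :=
    I.exists_run S (K := q) (A := 2 * q) (B := q - 2) (A₁ := A₁) (A₂ := q) (n₀ := 10 * q)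
      (Y := Y) (Z := Z) (by omega) (by
        intro k κ hk hκ
        rw [← hm] at hk hκ
        have := S.pow_le (by linarith) hθ0 hS (maskCount_le_rpow hθ (by omega) hk) hκ
        exact Nat.le_floor (by exact_mod_cast this)) (by
        rintro a (ha | ⟨rfl, hno⟩)
        · have h1 := ha.rpow_le hfit hα₁
          refine le_add_right (Nat.le_floor ?_)
          exact_mod_cast h1
        -- The empty set is left only for small n, since otherwise the window contains an admissible
        -- size.
        · have hlt : n < 10 * q := by
            by_contra hge
            rw [not_lt] at hge
            obtain ⟨a, e, hae, he, -, had⟩ := hfit.window hα₀ hα₁ hge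
            exact hno hge e (by omega) _ (had e hae le_rfl _ rfl)
          have : 2 ^ n ≤ 2 ^ (10 * q) := Nat.pow_le_pow_right (by norm_num) hlt.le
          simp only [pow_zero, Nat.sub_zero]
          omega)
  refine ⟨t, s, π, hrun, hout, fun σ => ?_, ?_⟩
  · set g : ℕ → ℕ := fun u => if h : u < n then σ ⟨u, h⟩ else 0 with hg
    have hgσ : ∀ u : Fin n, g u = σ u := fun u => by simp [hg]
    have hglt : ∀ u < n, g u < n := fun u hu => by rw [hgσ ⟨u, hu⟩]; exact (σ _).2
    have hginj : Set.InjOn g (Set.Iio n) := by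
      intro u hu v hv huv
      rw [hgσ ⟨u, hu⟩, hgσ ⟨v, hv⟩] at huv
      exact congrArg Fin.val (σ.injective (Fin.ext huv))
    have h1 := hfit.approx hα₀ hα₁ rfl I.wt_nonneg I.wt_symm hb01 hsmall hall hglt hginj
    have h2 := hopt g hglt hginj
    have h3 := I.cost_eq σ g hgσ
    rw [← h3] at h1 h2
    have h2' : 2 * (I.cost π : ℝ) ≤ 2 * I.cost σ + n * cutVal n I.wt b := by exact_mod_cast h2
    have h4 : 0 < 1 - α := by linarith
    rw [Int.cast_natCast] at h1
    -- Half of this quantity is the extra cost of putting the set first.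
    have h5 : (n : ℝ) * cutVal n I.wt b ≤ I.cost σ / (1 - α) := by
      rw [le_div_iff₀ h4]; linarith
    have h6 : (1 + 1 / (2 * (1 - α))) * (I.cost σ : ℝ) = I.cost σ + I.cost σ / (1 - α) / 2 := by
      field_simp
    rw [h6]; linarith
  · exact S.time_le I.n_le_inputSize hX0 hYX hE0 hZX hF0 ht
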